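/- **Setting.** Let $U\subset\mathbb R^d$ be open and connected with compact complement, $\mu_-\in(0,1)$, $\mu_+>0$, $T>0$. Let $F:[0,T]\to(0,\infty)$ be Lipschitz and let $Z$ be a finite set such that $F$ is monotone on each $[s,t]\subset[0,T]$ with $s<t$ and $(s,t)\cap Z=\emptyset$. For a continuous $v:\overline U\to[0,\infty)$ write $\Omega(v)=\{v>0\}$ and, for $x_0\in\partial\Omega(v)\cap U$, $$D_+v(x_0)=\{p: v(x)\le p\cdot(x-x_0)+o(|x-x_0|)\text{ for }x\in\overline{\Omega(v)}\},\qquad D_-v(x_0)=\{p: v(x)\ge p\cdot(x-x_0)-o(|x-x_0|)\}.$$ The conditions $|\nabla v|^2\ge Q$ and $|\nabla v|^2\le Q$ on $\partial\Omega(v)\cap U$ mean that $|p|^2\ge Q$ for all $p\in D_+v(x_0)$, respectively $|p|^2\le Q$ for all $p\in D_-v(x_0)$, for all $x_0\in\partial\Omega(v)\cap U$. Consider the local stability condition $$(S)\qquad \Delta v=0\ \text{in }\Omega(v)\cap U,\qquad 1-\mu_-\le|\nabla v|^2\le 1+\mu_+\ \text{on }\partial\Omega(v)\cap U .$$ A supersolution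 of $(S)$ is a continuous $v\ge0$ on $\overline U$ that is superharmonic in $\Omega(v)\cap U$ with $|\nabla v|^2\le1+\mu_+$ on $\partial\Omega(v)\cap U$; a subsolution is one that is subharmonic in $\Omega(v)\cap U$ with $|\nabla v|^2\ge 1-\mu_-$ on $\partial\Omega(v)\cap U$. **Obstacle solutions.** Let $u(t)\in C(\overline U)$, $u(t)\ge0$ for $t\in[0,T]$, with $u(0)$ bounded. Suppose that $u$ is an obstacle solution driven by $F$: $u(0)$ satisfies $(S)$; $u(t)=F(t)$ on $\partial U$ for all $t\in[0,T]$; and whenever $0\le s<t\le T$ and $(s,t)\cap Z=\emptyset$, $u(t)$ is the minimal supersolution of $(S)$ with boundary value $F(t)$ on $\partial U$ lying above $u(s)$ if $F$ is increasing on $[s,t]$, and the maximal subsolution of $(S)$ with boundary value $F(t)$ on $\partial U$ lying below $u(s)$ if $F$ is decreasing on $[s,t]$. Suppose also that $u$ is uniformly non-degenerate at its free boundary: there are $c,r_0>0$ such that $\sup_{B_r(x)}u(t)\ge cr$ for all $t\in[0,T]$, $x\in\partial\Omega(u(t))\cap U$ and $0<r\le r_0$ with $B_r(x)\subset U$. Let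 $u^*(t,x)=\limsup_{(s,y)\to(t,x)}u(s,y)$ and $u_*(t,x)=\liminf_{(s,y)\to(t,x)}u(s,y)$, with $(s,y)\in[0,T]\times\overline U$ ($(s,y)=(t,x)$ allowed). For a family $\Omega(t)$, $t\in[0,T]$, write $V(t_0,x_0;\Omega)>0$ (respectively $<0$) if there are $c>0$ and $0<r_0\le t_0$ with $\{x:|x-x_0|\le c(t_0-t)\}\subset\Omega(t)^{\complement}$ (respectively $\subset\Omega(t)$) for all $t_0-r_0\le t<t_0$. **Claim** (no star-shapedness is assumed). The function $u$ solves the local stability condition in the semicontinuous envelope sense: (a) $u$ is bounded on $[0,T]\times\overline U$, and $u(t)$ satisfies $(S)$ for every $t\in[0,T]$; (b) $|p|^2\ge 1-\mu_-$ for all $t_0\in[0,T]$, $x_0\in\partial\Omega(u^*(t_0))\cap U$ and $p\in D_+u^*(t_0)(x_0)$; and it solves the dynamic slope condition in the semicontinuous envelope sense: for all $t_0\in[0,T]$, (c) if $x_0\in\partial\Omega(u^*(t_0))\cap U$ and $V(t_0,x_0;\Omega(u^*))>0$, then $|p|^2\ge1+\mu_+$ for all $p\in D_+u^*(t_0)(x_0)$;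 (d) if $x_0\in\partial\Omega(u_*(t_0))\cap U$ and $V(t_0,x_0;\Omega(u_*))<0$, then $|p|^2\le1-\mu_-$ for all $p\in D_-u_*(t_0)(x_0)$. -/

import Mathlib

open Set Filter Topology MeasureTheory Metric

open scoped NNReal

noncomputable section

namespace Droplet

/-- Euclidean space `ℝ^d`. -/
abbrev Space (d : ℕ) := EuclideanSpace ℝ (Fin d)

variable {d : ℕ}

/-- The wet region `Ω(v) = {v > 0}` of a function `v` on `closure U`.  Functions on `closure U` are
represented by functions on the whole space whose values off `closure U` are never used. -/
def wet (U : Set (Space d)) (v : Space d → ℝ) : Set (Space d) :=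
  {x | x ∈ closure U ∧ 0 < v x}

/-- The free boundary `∂Ω(v) ∩ U`. -/
def freeBoundary (U : Set (Space d)) (v : Space d → ℝ) : Set (Space d) :=
  frontier (wet U v) ∩ U

/-- A continuous function is subharmonic in the open set `A` if it lies below its average over every
closed ball contained in `A`. -/
def SubharmonicIn (A : Set (Space d)) (v : Space d → ℝ) : Prop :=
  ContinuousOn v A ∧
    ∀ x : Space d, ∀ r : ℝ, 0 < r → closedBall x r ⊆ A → v x ≤ ⨍ y in closedBall x r, v y

/-- A continuous function is superharmonic in the open set `A` if it lies above its average over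
every closed ball contained in `A`. -/
def SuperharmonicIn (A : Set (Space d)) (v : Space d → ℝ) : Prop :=
  ContinuousOn v A ∧
    ∀ x : Space d, ∀ r : ℝ, 0 < r → closedBall x r ⊆ A → ⨍ y in closedBall x r, v y ≤ v x

/-- The superdifferential `D_+ v(x₀)`: the vectors `p` with `v(x) ≤ p · (x - x₀) + o(|x - x₀|)` for
`x` in the closure of `Ω(v)`. -/
def superDiff (U : Set (Space d)) (v : Space d → ℝ) (x₀ : Space d) : Set (Space d) :=
  {p | ∀ ε : ℝ, 0 < ε →
    ∀ᶠ x in 𝓝[closure (wet U v)] x₀, v x ≤ inner ℝ p (x - x₀) + ε * ‖x - x₀‖}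

/-- The subdifferential `D_- v(x₀)`: the vectors `p` with `v(x) ≥ p · (x - x₀) - o(|x - x₀|)`.  It is
only used at points `x₀` of the open set `U`. -/
def subDiff (v : Space d → ℝ) (x₀ : Space d) : Set (Space d) :=
  {p | ∀ ε : ℝ, 0 < ε → ∀ᶠ x in 𝓝 x₀, inner ℝ p (x - x₀) - ε * ‖x - x₀‖ ≤ v x}

/-- `|∇v|² ≥ Q` on the free boundary, in the viscosity sense. -/
def SlopeGE (U : Set (Space d)) (v : Space d → ℝ) (Q : ℝ) : Prop :=
  ∀ x ∈ freeBoundary U v, ∀ p ∈ superDiff U v x, Q ≤ ‖p‖ ^ 2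

/-- `|∇v|² ≤ Q` on the free boundary, in the viscosity sense. -/
def SlopeLE (U : Set (Space d)) (v : Space d → ℝ) (Q : ℝ) : Prop :=
  ∀ x ∈ freeBoundary U v, ∀ p ∈ subDiff v x, ‖p‖ ^ 2 ≤ Q

/-- `v` is a non-negative continuous function on `closure U`. -/
structure IsState (U : Set (Space d)) (v : Space d → ℝ) : Prop where
  continuousOn : ContinuousOn v (closure U)
  nonneg : ∀ x ∈ closure U, 0 ≤ v x

/-- Viscosity solution of the local stability condition: `Δv = 0` in `Ω(v) ∩ U` and
`1 - μ₋ ≤ |∇v|² ≤ 1 + μ₊` on `∂Ω(v) ∩ U`. -/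
structure IsStable (U : Set (Space d)) (μm μp : ℝ) (v : Space d → ℝ) : Prop where
  state : IsState U v
  harmonic : InnerProductSpace.HarmonicOnNhd v (wet U v ∩ U)
  slope_ge : SlopeGE U v (1 - μm)
  slope_le : SlopeLE U v (1 + μp)

/-- Viscosity supersolution of the local stability condition: `Δv ≤ 0` in `Ω(v) ∩ U` and
`|∇v|² ≤ 1 + μ₊` on `∂Ω(v) ∩ U`. -/
structure IsSupersolution (U : Set (Space d)) (μp : ℝ) (v : Space d → ℝ) : Prop where
  state : IsState U v
  superharmonic : SuperharmonicIn (wet U v ∩ U) v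
  slope_le : SlopeLE U v (1 + μp)

/-- Viscosity subsolution of the local stability condition: `Δv ≥ 0` in `Ω(v) ∩ U` and
`|∇v|² ≥ 1 - μ₋` on `∂Ω(v) ∩ U`. -/
structure IsSubsolution (U : Set (Space d)) (μm : ℝ) (v : Space d → ℝ) : Prop where
  state : IsState U v
  subharmonic : SubharmonicIn (wet U v ∩ U) v
  slope_ge : SlopeGE U v (1 - μm)

/-- The supersolutions with boundary value `f` on `∂U` that lie above `w`. -/
def SupersolutionAbove (U : Set (Space d)) (μp f : ℝ) (w v : Space d → ℝ) : Prop :=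
  IsSupersolution U μp v ∧ (∀ x ∈ frontier U, v x = f) ∧ ∀ x ∈ closure U, w x ≤ v x

/-- The subsolutions with boundary value `f` on `∂U` that lie below `w`. -/
def SubsolutionBelow (U : Set (Space d)) (μm f : ℝ) (w v : Space d → ℝ) : Prop :=
  IsSubsolution U μm v ∧ (∀ x ∈ frontier U, v x = f) ∧ ∀ x ∈ closure U, v x ≤ w x

/-- `v` is the minimal supersolution with boundary value `f` above `w`. -/
def IsMinimalSupersolution (U : Set (Space d)) (μp f : ℝ) (w v : Space d → ℝ) : Prop :=
  SupersolutionAbove U μp f w v ∧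
    ∀ v' : Space d → ℝ, SupersolutionAbove U μp f w v' → ∀ x ∈ closure U, v x ≤ v' x

/-- `v` is the maximal subsolution with boundary value `f` below `w`. -/
def IsMaximalSubsolution (U : Set (Space d)) (μm f : ℝ) (w v : Space d → ℝ) : Prop :=
  SubsolutionBelow U μm f w v ∧
    ∀ v' : Space d → ℝ, SubsolutionBelow U μm f w v' → ∀ x ∈ closure U, v' x ≤ v x

/-- Admissible forcing: positive, Lipschitz on `[0,T]`, changing monotonicity only on the finite set
`Z`. -/
structure IsForcing (T : ℝ) (Z : Set ℝ) (F : ℝ → ℝ) : Prop where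
  pos : ∀ t ∈ Icc 0 T, 0 < F t
  lipschitz : ∃ L : ℝ≥0, LipschitzOnWith L F (Icc 0 T)
  finite : Z.Finite
  monotone_or_antitone : ∀ s t : ℝ, 0 ≤ s → s < t → t ≤ T → Disjoint (Ioo s t) Z →
    MonotoneOn F (Icc s t) ∨ AntitoneOn F (Icc s t)

/-- Obstacle solution `u : [0,T] → C(closure U)` driven by `F`. -/
structure IsObstacleSolution (U : Set (Space d)) (μm μp T : ℝ) (Z : Set ℝ) (F : ℝ → ℝ)
    (u : ℝ → Space d → ℝ) : Prop where
  state : ∀ t ∈ Icc 0 T, IsState U (u t)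
  initial : IsStable U μm μp (u 0)
  dirichlet : ∀ t ∈ Icc 0 T, ∀ x ∈ frontier U, u t x = F t
  increasing : ∀ s t : ℝ, 0 ≤ s → s < t → t ≤ T → Disjoint (Ioo s t) Z →
    MonotoneOn F (Icc s t) → IsMinimalSupersolution U μp (F t) (u s) (u t)
  decreasing : ∀ s t : ℝ, 0 ≤ s → s < t → t ≤ T → Disjoint (Ioo s t) Z →
    AntitoneOn F (Icc s t) → IsMaximalSubsolution U μm (F t) (u s) (u t)

/-- Uniform non-degeneracy at the free boundary: `sup_{B_r(x)} u(t) ≥ c r` with constants that do not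
depend on the time `t`, the free boundary point `x` or the radius `r ≤ r₀`. -/
def UniformlyNondegenerate (U : Set (Space d)) (T : ℝ) (u : ℝ → Space d → ℝ) : Prop :=
  ∃ c > 0, ∃ r₀ > 0, ∀ t ∈ Icc 0 T, ∀ x ∈ freeBoundary U (u t), ∀ r : ℝ, 0 < r → r ≤ r₀ →
    ball x r ⊆ U → c * r ≤ sSup (u t '' ball x r)

/-- The upper semicontinuous envelope `u^*` on `[0,T] × closure U`. -/
def upperEnv (U : Set (Space d)) (T : ℝ) (u : ℝ → Space d → ℝ) (t : ℝ) (x : Space d) : ℝ :=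
  limsup (fun z : ℝ × Space d => u z.1 z.2) (𝓝[Icc 0 T ×ˢ closure U] (t, x))

/-- The lower semicontinuous envelope `u_*` on `[0,T] × closure U`. -/
def lowerEnv (U : Set (Space d)) (T : ℝ) (u : ℝ → Space d → ℝ) (t : ℝ) (x : Space d) : ℝ :=
  liminf (fun z : ℝ × Space d => u z.1 z.2) (𝓝[Icc 0 T ×ˢ closure U] (t, x))

/-- `V(t₀,x₀;Ω) > 0`: positive cone condition for a family of sets `Ω(t)`, `t ≥ 0`.  The backward
time window `[t₀ - r₀, t₀)` has to lie in the time domain. -/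
def PositiveVelocity (Ω : ℝ → Set (Space d)) (t₀ : ℝ) (x₀ : Space d) : Prop :=
  ∃ c > 0, ∃ r₀ > 0, r₀ ≤ t₀ ∧
    ∀ t ∈ Ico (t₀ - r₀) t₀, closedBall x₀ (c * (t₀ - t)) ⊆ (Ω t)ᶜ

/-- `V(t₀,x₀;Ω) < 0`: negative cone condition for a family of sets `Ω(t)`, `t ≥ 0`. -/
def NegativeVelocity (Ω : ℝ → Set (Space d)) (t₀ : ℝ) (x₀ : Space d) : Prop :=
  ∃ c > 0, ∃ r₀ > 0, r₀ ≤ t₀ ∧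
    ∀ t ∈ Ico (t₀ - r₀) t₀, closedBall x₀ (c * (t₀ - t)) ⊆ Ω t

/-- `u` is a viscosity solution of the local stability condition on `[0,T] × U` in the semicontinuous
envelope sense. -/
structure SolvesLocalStability (U : Set (Space d)) (μm μp T : ℝ) (u : ℝ → Space d → ℝ) : Prop where
  bounded : ∃ M : ℝ, ∀ t ∈ Icc 0 T, ∀ x ∈ closure U, |u t x| ≤ M
  stable : ∀ t ∈ Icc 0 T, IsStable U μm μp (u t)
  upper : ∀ t₀ ∈ Icc 0 T, ∀ x₀ ∈ freeBoundary U (upperEnv U T u t₀),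
    ∀ p ∈ superDiff U (upperEnv U T u t₀) x₀, 1 - μm ≤ ‖p‖ ^ 2

/-- `u` is a viscosity solution of the dynamic slope condition on `[0,T] × U` in the semicontinuous
envelope sense. -/
structure SolvesDynamicSlope (U : Set (Space d)) (μm μp T : ℝ) (u : ℝ → Space d → ℝ) : Prop where
  advancing : ∀ t₀ ∈ Icc 0 T, ∀ x₀ ∈ freeBoundary U (upperEnv U T u t₀),
    PositiveVelocity (fun t => wet U (upperEnv U T u t)) t₀ x₀ →
      ∀ p ∈ superDiff U (upperEnv U T u t₀) x₀, 1 + μp ≤ ‖p‖ ^ 2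
  receding : ∀ t₀ ∈ Icc 0 T, ∀ x₀ ∈ freeBoundary U (lowerEnv U T u t₀),
    NegativeVelocity (fun t => wet U (lowerEnv U T u t)) t₀ x₀ →
      ∀ p ∈ subDiff (lowerEnv U T u t₀) x₀, ‖p‖ ^ 2 ≤ 1 - μm

end Droplet

end

namespace Droplet

variable {d : ℕ}

/-! Minimality and maximality are exploited through local surgery. Inside a ball a supersolution may
be lowered to its minimum with a barrier (`IsSupersolution.glue_min`), a subsolution may be raised
to its maximum with one (`IsSubsolution.glue_max`), and either may be replaced by a harmonic
function. An extremal solution must already satisfy whatever such a competitor satisfies. Harmonic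
replacement gives Δu = 0 in the wet region, and barriers give the slope bound that extremality does
not contain by definition. This makes u(t) stable by induction over the finitely many points of Z
(`forcing_induction`).

Dynamic slope. In (c) the velocity cone gives a time s₀ < t₀, with no point of Z in between, at
which a whole ball around x₀ is dry. If some p in the superdifferential of u^*(t₀) were too small, a
slightly steeper quadratic, strictly superharmonic and negative at x₀, would lie above u^*(t₀) on a
small sphere, hence above u(s) there for s close to t₀. Comparison makes u vanish near (t₀, x₀):
first for s ≤ t₀, then, with u(t₀) as new dry obstacle, for s > t₀. This contradicts x₀ being a free
boundary point (`eventually_eq_zero_of_superDiff`). Statement (d) is the mirror image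
(`eventually_le_of_subDiff`).

Statement (b) is harder. If x₀ is a limit of wet points of u(t₀), then u ≤ u^* reduces it to the
stability of u(t₀). Otherwise u(t₀) vanishes near x₀, later times are handled as in (c), and earlier
times are trivial when F increases. When F decreases, the profiles v_n = u(s_n) with s_n increasing
to t₀ form a decreasing sequence of maximal subsolutions below one obstacle o. A contact argument
would suffice if the v_n vanished eventually wherever their infimum w vanishes locally. The
obstruction is the `hollow` set, where w vanishes locally but every v_n is positive.

The hollow set is empty (`IsRecedingSequence.hollow_eq_empty`). Let a ball of it touch its boundary
at a point y of {o > 0}. Non-degeneracy makes w grow on the far side of y with an asymptotic slope α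
> 0, and a Hopf argument transfers linear growth there to all v_n simultaneously
(`exists_linear_growth`). Now replace v_n harmonically in a small ball around y. Its boundary values
lie above a hinge of the form κ (e · (x - y) - δ r)⁺, and harmonic functions above such data have
normal slope of order log(1/δ) near the equator (`PolyApprox.le_norm_superDiff`). So the replacement
is steep enough at the remaining boundary zeros to be a subsolution, and maximality identifies it
with v_n. All v_n are then positive near y, and y is hollow. Hence the hollow set is relatively
closed in {o > 0}. The function equal to o on it and to v_n elsewhere is therefore an admissible
subsolution, so o ≤ v_n there for every n, which is incompatible with w = 0 < v_n ≤ o.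

The potential theory is developed from the maximum principle for functions lying below their
averages over small balls. Rotational averages give mean values, and harmonic polynomials solve the
Dirichlet problem on balls. -/

/-- `f` lies below its averages over all small balls centred at `x`. -/
def SubMeanAt (f : Space d → ℝ) (x : Space d) : Prop :=
  ∀ᶠ r in 𝓝[>] (0 : ℝ), f x ≤ ⨍ y in closedBall x r, f y

/-! ### Averages over balls and the maximum principle. -/

lemma volume_real_closedBall_pos (x : Space d) {r : ℝ} (hr : 0 < r) :
    0 < (volume : Measure (Space d)).real (closedBall x r) :=
  ENNReal.toReal_pos (measure_closedBall_pos _ _ hr).ne' measure_closedBall_lt_top.ne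

lemma le_setAverage_closedBall_iff {f : Space d → ℝ} {x : Space d} {r c : ℝ} (hr : 0 < r) :
    c ≤ ⨍ y in closedBall x r, f y ↔
      c * (volume : Measure (Space d)).real (closedBall x r) ≤ ∫ y in closedBall x r, f y := by
  rw [setAverage_eq, smul_eq_mul, ← div_eq_inv_mul, le_div_iff₀ (volume_real_closedBall_pos x hr)]

lemma lt_setAverage_closedBall_iff {f : Space d → ℝ} {x : Space d} {r c : ℝ} (hr : 0 < r) :
    c < ⨍ y in closedBall x r, f y ↔
      c * (volume : Measure (Space d)).real (closedBall x r) < ∫ y in closedBall x r, f y := by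
  rw [setAverage_eq, smul_eq_mul, ← div_eq_inv_mul, lt_div_iff₀ (volume_real_closedBall_pos x hr)]

lemma setAverage_closedBall_const (x : Space d) {r : ℝ} (hr : 0 < r) (c : ℝ) :
    ⨍ _ in closedBall x r, c = c :=
  setAverage_const (measure_closedBall_pos _ _ hr).ne' measure_closedBall_lt_top.ne c

lemma setAverage_closedBall_mono {f g : Space d → ℝ} {x : Space d} {r : ℝ}
    (hf : IntegrableOn f (closedBall x r)) (hg : IntegrableOn g (closedBall x r))
    (h : ∀ y ∈ closedBall x r, f y ≤ g y) :
    ⨍ y in closedBall x r, f y ≤ ⨍ y in closedBall x r, g y := by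
  rw [setAverage_eq, setAverage_eq, smul_eq_mul, smul_eq_mul]
  exact mul_le_mul_of_nonneg_left (setIntegral_mono_on hf hg measurableSet_closedBall h)
    (by positivity)

lemma setAverage_closedBall_add {f g : Space d → ℝ} {x : Space d} {r : ℝ}
    (hf : IntegrableOn f (closedBall x r)) (hg : IntegrableOn g (closedBall x r)) :
    ⨍ y in closedBall x r, (f y + g y) =
      (⨍ y in closedBall x r, f y) + ⨍ y in closedBall x r, g y := by
  simp only [setAverage_eq, smul_eq_mul]
  rw [integral_add hf hg, mul_add]

lemma setAverage_closedBall_sub {f g : Space d → ℝ} {x : Space d} {r : ℝ}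
    (hf : IntegrableOn f (closedBall x r)) (hg : IntegrableOn g (closedBall x r)) :
    ⨍ y in closedBall x r, (f y - g y) =
      (⨍ y in closedBall x r, f y) - ⨍ y in closedBall x r, g y := by
  simp only [setAverage_eq, smul_eq_mul]
  rw [integral_sub hf hg, mul_sub]

lemma setAverage_closedBall_neg (f : Space d → ℝ) (x : Space d) (r : ℝ) :
    ⨍ y in closedBall x r, -f y = -⨍ y in closedBall x r, f y :=
  average_neg (μ := volume.restrict (closedBall x r)) f

lemma setAverage_closedBall_const_mul (f : Space d → ℝ) (x : Space d) (r c : ℝ) :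
    ⨍ y in closedBall x r, c * f y = c * ⨍ y in closedBall x r, f y := by
  simp only [setAverage_eq, smul_eq_mul]
  rw [integral_const_mul]; ring

lemma setAverage_closedBall_congr {f g : Space d → ℝ} {x : Space d} {r : ℝ}
    (h : ∀ y ∈ closedBall x r, f y = g y) :
    ⨍ y in closedBall x r, f y = ⨍ y in closedBall x r, g y := by
  simp only [setAverage_eq]
  rw [setIntegral_congr_fun measurableSet_closedBall h]

lemma eventually_closedBall_subset {s : Set (Space d)} {x : Space d} (hs : s ∈ 𝓝 x) :
    ∀ᶠ r in 𝓝[>] (0 : ℝ), closedBall x r ⊆ s := by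
  obtain ⟨ε, hε, h⟩ := nhds_basis_closedBall.mem_iff.1 hs
  filter_upwards [Ioo_mem_nhdsGT hε] with r hr
  exact (closedBall_subset_closedBall hr.2.le).trans h

lemma _root_.ContinuousOn.integrableOn_closedBall {f : Space d → ℝ} {x : Space d} {r : ℝ}
    (hf : ContinuousOn f (closedBall x r)) : IntegrableOn f (closedBall x r) :=
  hf.integrableOn_compact (isCompact_closedBall x r)

lemma eventually_integrableOn_closedBall {f : Space d → ℝ} {s : Set (Space d)} {x : Space d}
    (hs : s ∈ 𝓝 x) (hf : ContinuousOn f s) :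
    ∀ᶠ r in 𝓝[>] (0 : ℝ), IntegrableOn f (closedBall x r) := by
  filter_upwards [eventually_closedBall_subset hs] with r hr
  exact (hf.mono hr).integrableOn_closedBall

lemma SubMeanAt.congr {f g : Space d → ℝ} {x : Space d} (hf : SubMeanAt f x) (h : f =ᶠ[𝓝 x] g) :
    SubMeanAt g x := by
  filter_upwards [hf, eventually_closedBall_subset h] with r hr hs
  rwa [← h.eq_of_nhds, ← setAverage_closedBall_congr hs]

lemma SubMeanAt.add {f g : Space d → ℝ} {x : Space d} (hf : SubMeanAt f x) (hg : SubMeanAt g x)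
    (hfi : ∀ᶠ r in 𝓝[>] (0 : ℝ), IntegrableOn f (closedBall x r))
    (hgi : ∀ᶠ r in 𝓝[>] (0 : ℝ), IntegrableOn g (closedBall x r)) :
    SubMeanAt (fun y => f y + g y) x := by
  filter_upwards [hf, hg, hfi, hgi] with r h1 h2 h3 h4
  rw [setAverage_closedBall_add h3 h4]
  exact add_le_add h1 h2

lemma subMeanAt_const (c : ℝ) (x : Space d) : SubMeanAt (fun _ => c) x := by
  filter_upwards [self_mem_nhdsWithin] with r hr
  rw [setAverage_closedBall_const x hr]

/-- A function touched from below at `x` by one with the sub-mean-value property has it as well. -/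
lemma SubMeanAt.of_le {f g : Space d → ℝ} {x : Space d} (hf : SubMeanAt f x) (hx : f x = g x)
    (hle : ∀ᶠ y in 𝓝 x, f y ≤ g y)
    (hfi : ∀ᶠ r in 𝓝[>] (0 : ℝ), IntegrableOn f (closedBall x r))
    (hgi : ∀ᶠ r in 𝓝[>] (0 : ℝ), IntegrableOn g (closedBall x r)) : SubMeanAt g x := by
  filter_upwards [hf, hfi, hgi, eventually_closedBall_subset hle] with r h1 h2 h3 h4
  rw [← hx]
  exact h1.trans (setAverage_closedBall_mono h2 h3 h4)

/-- Maximum principle for upper semicontinuous functions with the sub-mean-value property. -/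
theorem nonpos_of_subMeanAt (hd : 0 < d) {D : Set (Space d)} (hD : IsOpen D)
    (hb : Bornology.IsBounded D) {f : Space d → ℝ} (hf : UpperSemicontinuousOn f (closure D))
    (hs : ∀ x ∈ D, 0 < f x → SubMeanAt f x) (hfr : ∀ x ∈ frontier D, f x ≤ 0) :
    ∀ x ∈ closure D, f x ≤ 0 := by
  have : Nonempty (Fin d) := ⟨⟨0, hd⟩⟩
  by_contra! hcon
  obtain ⟨x₀, hx₀, hpos⟩ := hcon
  have hK : IsCompact (closure D) := hb.isCompact_closure
  obtain ⟨a, ha, hmax⟩ := UpperSemicontinuousOn.exists_isMaxOn ⟨x₀, hx₀⟩ hK hf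
  set M := f a with hM
  have hMpos : 0 < M := hpos.trans_le (hmax hx₀)
  -- Among the maximizers one farthest from the origin is chosen. Points of larger norm in a small
  -- ball around it are not maximizers, so the average over that ball drops strictly below `M`.
  have hS : IsCompact (closure D ∩ f ⁻¹' Ici M) := hf.isCompact_inter_preimage_Ici hK M
  obtain ⟨z, hz, hzmax⟩ := hS.exists_isMaxOn ⟨a, ha, le_refl M⟩ continuous_norm.continuousOn
  have hzM : f z = M := le_antisymm (hmax hz.1) hz.2
  have hzD : z ∈ D := by
    by_contra hzD
    have : z ∈ frontier D := by rw [hD.frontier_eq]; exact ⟨hz.1, hzD⟩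
    linarith [hfr z this]
  obtain ⟨r, ⟨hr1, hr2⟩, hr0⟩ := (((hs z hzD (hzM ▸ hMpos)).and
    (eventually_closedBall_subset (hD.mem_nhds hzD))).and self_mem_nhdsWithin).exists
  rw [hzM] at hr1
  have hle : ∀ y ∈ closedBall z r, f y ≤ M := fun y hy => hmax (subset_closure (hr2 hy))
  -- For a non-integrable function the average is 0 by convention, which the inequality `M ≤
  -- average` with `M > 0` rules out.
  have hint : IntegrableOn f (closedBall z r) := by
    by_contra hni
    rw [setAverage_eq, integral_undef hni, smul_zero] at hr1
    linarith
  rw [le_setAverage_closedBall_iff hr0] at hr1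
  have hintc : IntegrableOn (fun _ : Space d => M) (closedBall z r) :=
    continuousOn_const.integrableOn_closedBall
  have key : 0 < ∫ y in closedBall z r, (M - f y) := by
    rw [setIntegral_pos_iff_support_of_nonneg_ae]
    -- A step of length r/2 away from the origin: `z + w` shows that the part of the ball lying
    -- farther out than `z` is a non-empty open set.
    · obtain ⟨w, hw⟩ : ∃ w : Space d, ‖w‖ = r / 2 ∧ ‖z‖ < ‖z + w‖ := by
        by_cases hz0 : z = 0
        · obtain ⟨w, hw⟩ := exists_norm_eq (Space d) (half_pos hr0).le
          exact ⟨w, hw, by rw [hz0, zero_add, norm_zero, hw]; exact half_pos hr0⟩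
        · have hzn : 0 < ‖z‖ := norm_pos_iff.2 hz0
          refine ⟨(r / 2 / ‖z‖) • z, ?_, ?_⟩
          · rw [norm_smul, Real.norm_of_nonneg (by have : (0:ℝ) < r := hr0; positivity)]; field_simp
          · have : z + (r / 2 / ‖z‖) • z = (1 + r / 2 / ‖z‖) • z := by module
            have hr0' : 0 < r := hr0
            rw [this, norm_smul, Real.norm_of_nonneg (by positivity)]
            have : 0 < r / 2 / ‖z‖ := by positivity
            nlinarith
      have hopen : IsOpen (ball z r ∩ {y | ‖z‖ < ‖y‖}) :=
        isOpen_ball.inter (isOpen_lt continuous_const continuous_norm)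
      refine (hopen.measure_pos volume ⟨z + w, ?_, hw.2⟩).trans_le (measure_mono ?_)
      · have hr0' : 0 < r := hr0
        simp [hw.1, hr0']
      · rintro y ⟨hy1, hy2⟩
        refine ⟨?_, ball_subset_closedBall hy1⟩
        simp only [Function.mem_support]
        intro h0
        have hyS : y ∈ closure D ∩ f ⁻¹' Ici M :=
          ⟨subset_closure (hr2 (ball_subset_closedBall hy1)), by simp; linarith⟩
        exact absurd (show ‖y‖ ≤ ‖z‖ from hzmax hyS) (not_le.2 hy2)
    · filter_upwards [ae_restrict_mem measurableSet_closedBall] with y hy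
      simpa using hle y hy
    · exact hintc.sub hint
  rw [integral_sub hintc hint, setIntegral_const, smul_eq_mul] at key
  linarith

/-! ### Averages of functions of class `C²` -/

lemma setIntegral_closedBall_eq (f : Space d → ℝ) (x : Space d) (r : ℝ) :
    ∫ y in closedBall x r, f y = ∫ h in closedBall (0 : Space d) r, f (x + h) := by
  have := (measurePreserving_add_left (volume : Measure (Space d)) x).setIntegral_preimage_emb
    (measurableEmbedding_addLeft x) f (closedBall x r)
  rw [← this]
  congr 2
  ext h; simp

lemma setIntegral_closedBall_isometry (R : Space d ≃ₗᵢ[ℝ] Space d) (f : Space d → ℝ) (r : ℝ) :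
    ∫ h in closedBall (0 : Space d) r, f (R h) = ∫ h in closedBall (0 : Space d) r, f h := by
  have := R.measurePreserving.setIntegral_preimage_emb
    R.toHomeomorph.measurableEmbedding f (closedBall 0 r)
  rw [← this]
  congr 2
  ext h; simp

lemma setIntegral_closedBall_linear (L : Space d →L[ℝ] ℝ) (r : ℝ) :
    ∫ h in closedBall (0 : Space d) r, L h = 0 := by
  have := setIntegral_closedBall_isometry (LinearIsometryEquiv.neg ℝ) L r
  simp only [LinearIsometryEquiv.coe_neg, map_neg] at this
  rw [integral_neg] at this
  linarith

lemma inner_reflection_right (K : Submodule ℝ (Space d)) [K.HasOrthogonalProjection]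
    (x y : Space d) : inner ℝ (K.reflection x) y = inner ℝ x (K.reflection y) := by
  rw [← K.reflection.inner_map_map (K.reflection x) y, K.reflection_reflection]

/-- Second moments of a ball. Reflection in the hyperplane orthogonal to `e i` kills the mixed
moments, and the reflection exchanging `e i` and `e j` makes the pure ones equal, so only the trace
of `B` survives. -/
lemma setIntegral_closedBall_bilin (B : Space d →L[ℝ] Space d →L[ℝ] ℝ) (r : ℝ) :
    d * ∫ h in closedBall (0 : Space d) r, B h h =
      (∑ i, B (EuclideanSpace.basisFun (Fin d) ℝ i) (EuclideanSpace.basisFun (Fin d) ℝ i)) *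
        ∫ h in closedBall (0 : Space d) r, ‖h‖ ^ 2 := by
  set e := EuclideanSpace.basisFun (Fin d) ℝ with he
  set κ : Fin d → Fin d → ℝ := fun i j =>
    ∫ h in closedBall (0 : Space d) r, inner ℝ h (e i) * inner ℝ h (e j) with hκ
  have hint : ∀ i j, IntegrableOn (fun h : Space d => inner ℝ h (e i) * inner ℝ h (e j))
      (closedBall 0 r) := fun i j =>
    Continuous.continuousOn (by fun_prop) |>.integrableOn_closedBall
  have hoff : ∀ i j, i ≠ j → κ i j = 0 := by
    intro i j hij
    have := setIntegral_closedBall_isometry ((ℝ ∙ (e i))ᗮ.reflection)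
      (fun h => inner ℝ h (e i) * inner ℝ h (e j)) r
    have h2 : (ℝ ∙ (e i))ᗮ.reflection (e j) = e j := by
      apply Submodule.reflection_mem_subspace_eq_self
      rw [Submodule.mem_orthogonal_singleton_iff_inner_right]
      exact e.orthonormal.2 hij
    simp only [inner_reflection_right, h2, Submodule.reflection_orthogonalComplement_singleton_eq_neg,
      inner_neg_right, neg_mul] at this
    rw [integral_neg] at this
    simp only [hκ]
    linarith
  have hdiag : ∀ i j, κ i i = κ j j := by
    intro i j
    have := setIntegral_closedBall_isometry ((ℝ ∙ (e i - e j))ᗮ.reflection)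
      (fun h => inner ℝ h (e i) * inner ℝ h (e i)) r
    have h2 : (ℝ ∙ (e i - e j))ᗮ.reflection (e i) = e j := by
      apply Submodule.reflection_sub
      rw [e.orthonormal.1, e.orthonormal.1]
    simp only [inner_reflection_right, h2] at this
    exact this.symm
  have hB : ∀ h : Space d, B h h = ∑ i, ∑ j, inner ℝ h (e i) * inner ℝ h (e j) * B (e i) (e j) := by
    intro h
    have hh : h = ∑ i, inner ℝ (e i) h • e i := (e.sum_repr' h).symm
    have h0 : B h h = B (∑ i, inner ℝ (e i) h • e i) (∑ i, inner ℝ (e i) h • e i) := by rw [← hh]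
    rw [h0]
    simp only [map_sum, map_smul, sum_apply, smul_apply,
      smul_eq_mul, real_inner_comm h, Finset.mul_sum]
    rw [Finset.sum_comm]
    refine Finset.sum_congr rfl fun i _ => Finset.sum_congr rfl fun j _ => ?_
    ring
  have h1 : ∫ h in closedBall (0 : Space d) r, B h h = ∑ i, κ i i * B (e i) (e i) := by
    rw [show (fun h : Space d => B h h) = _ from funext hB]
    rw [integral_finsetSum _ fun i _ => integrable_finsetSum _ fun j _ => (hint i j).mul_const _]
    refine Finset.sum_congr rfl fun i _ => ?_
    rw [integral_finsetSum _ fun j _ => (hint i j).mul_const _]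
    rw [Finset.sum_eq_single i]
    · rw [integral_mul_const]
    · intro j _ hj
      rw [integral_mul_const]
      have : ∫ h in closedBall (0 : Space d) r, inner ℝ h (e i) * inner ℝ h (e j) = 0 :=
        hoff i j hj.symm
      rw [this, zero_mul]
    · simp
  have h2 : ∫ h in closedBall (0 : Space d) r, ‖h‖ ^ 2 = ∑ i, κ i i := by
    have : ∀ h : Space d, ‖h‖ ^ 2 = ∑ i, inner ℝ h (e i) * inner ℝ h (e i) := by
      intro h
      rw [← e.sum_sq_norm_inner_left h]
      simp [sq]
    simp_rw [this]
    rw [integral_finsetSum _ fun i _ => hint i i]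
  rw [h1, h2]
  rcases Nat.eq_zero_or_pos d with rfl | hd
  · simp
  · have i₀ : Fin d := ⟨0, hd⟩
    have e1 : ∑ i, κ i i * B (e i) (e i) = κ i₀ i₀ * ∑ i, B (e i) (e i) := by
      rw [Finset.mul_sum]; exact Finset.sum_congr rfl fun i _ => by rw [hdiag i i₀]
    have e2 : ∑ i, κ i i = d * κ i₀ i₀ := by
      rw [Finset.sum_congr rfl fun i _ => hdiag i i₀]; simp
    rw [e1, e2]; ring

open Laplacian in
lemma laplacian_eq_sum_fderiv (f : Space d → ℝ) (x : Space d) :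
    Δ f x = ∑ i, fderiv ℝ (fderiv ℝ f) x (EuclideanSpace.basisFun (Fin d) ℝ i)
      (EuclideanSpace.basisFun (Fin d) ℝ i) := by
  rw [InnerProductSpace.laplacian_eq_iteratedFDeriv_orthonormalBasis f
    (EuclideanSpace.basisFun (Fin d) ℝ)]
  simp [iteratedFDeriv_two_apply]

open Laplacian in
/-- A function with positive Laplacian at a point lies, near that point, strictly below its
averages over small balls. -/
theorem exists_lt_setAverage_of_laplacian_pos {f : Space d → ℝ} {x₀ : Space d}
    (hf : ContDiffAt ℝ 2 f x₀) (hΔ : 0 < Δ f x₀) :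
    ∃ ρ > 0, ∀ x ∈ ball x₀ ρ, ∀ r, 0 < r → r < ρ → f x < ⨍ y in closedBall x r, f y := by
  have hd : 0 < d := by
    rcases Nat.eq_zero_or_pos d with rfl | hd
    · simp [laplacian_eq_sum_fderiv] at hΔ
    · exact hd
  set A := fderiv ℝ (fderiv ℝ f) x₀ with hA
  -- The Hessian term contributes Δf(x₀)/(2d) times the integral of |h|², so a Taylor error of half
  -- this size still leaves a strict gain.
  set ε : ℝ := Δ f x₀ / (4 * d) with hε
  have hεpos : 0 < ε := by positivity
  -- Strict differentiability of the gradient at `x₀` lets the same Hessian `A` serve at every base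
  -- point `x` near `x₀`. This is what makes the radius uniform in `x`.
  have hD : HasStrictFDerivAt (fderiv ℝ f) A x₀ := by
    have h1 : ContDiffAt ℝ 1 (fderiv ℝ f) x₀ := hf.fderiv_right (by norm_num)
    exact h1.hasStrictFDerivAt' (h1.differentiableAt (by norm_num)).hasFDerivAt (by norm_num)
  have h1 : ∀ᶠ p in 𝓝 x₀ ×ˢ 𝓝 x₀,
      ‖fderiv ℝ f p.1 - fderiv ℝ f p.2 - A (p.1 - p.2)‖ ≤ ε * ‖p.1 - p.2‖ := by
    rw [← nhds_prod_eq]; exact hD.isLittleO.def hεpos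
  have h2 : ∀ᶠ y in 𝓝 x₀, ContDiffAt ℝ 2 f y := hf.eventually (by simp)
  obtain ⟨s, hs, t, ht, hst⟩ := mem_prod_iff.1 h1
  obtain ⟨ρ, hρ, hball⟩ := Metric.mem_nhds_iff.1 (inter_mem (inter_mem hs ht) h2)
  have hA2 : ∀ h k, A h k = A k h := by
    intro h k
    have := (hf.isSymmSndFDerivAt (by simp)) h k
    exact this
  refine ⟨ρ / 2, by positivity, fun x hx r hr hrρ => ?_⟩
  have hsub : ∀ h ∈ closedBall (0 : Space d) r, x + h ∈ ball x₀ ρ := by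
    intro h hh
    rw [mem_closedBall_zero_iff] at hh
    rw [mem_ball, dist_eq_norm] at hx ⊢
    calc ‖x + h - x₀‖ = ‖(x - x₀) + h‖ := by congr 1; abel
      _ ≤ ‖x - x₀‖ + ‖h‖ := norm_add_le _ _
      _ < ρ := by linarith
  have hx' : x ∈ ball x₀ ρ := by simpa using hsub 0 (by simp [hr.le])
  have taylor : ∀ h ∈ closedBall (0 : Space d) r,
      |f (x + h) - f x - fderiv ℝ f x h - A h h / 2| ≤ ε * ‖h‖ ^ 2 := by
    intro h hh
    -- The Taylor remainder is the increment of `G` from 0 to `h`, and the derivative of `G` is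
    -- bounded by `ε ‖h‖` on the ball of radius `‖h‖`.
    set G : Space d → ℝ := fun k => f (x + k) - fderiv ℝ f x k - A k k / 2 with hG
    have hderiv : ∀ k ∈ closedBall (0 : Space d) ‖h‖,
        HasFDerivWithinAt G (fderiv ℝ f (x + k) - fderiv ℝ f x - A k) (closedBall 0 ‖h‖) k := by
      intro k hk
      have hk' : x + k ∈ ball x₀ ρ := hsub k (closedBall_subset_closedBall
        (by simpa using hh) hk)
      have d1 : HasFDerivAt (fun k => f (x + k)) (fderiv ℝ f (x + k)) k := by
        have := ((hball hk').2.out.differentiableAt (by norm_num)).hasFDerivAt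
        exact this.comp k ((hasFDerivAt_id k).const_add x)
      have d2 : HasFDerivAt (fun k => A k k) (A k + A.flip k) k := by
        have := (A.hasFDerivAt (x := k)).clm_apply (hasFDerivAt_id k)
        refine this.congr_fderiv ?_
        ext v; simp
      have d3 := ((d1.sub (fderiv ℝ f x).hasFDerivAt).sub (d2.mul_const (2 : ℝ)⁻¹))
      refine HasFDerivAt.hasFDerivWithinAt ?_
      refine (d3.congr_fderiv ?_)
      ext v
      simp only [sub_apply, smul_apply,
        add_apply, ContinuousLinearMap.flip_apply, smul_eq_mul, hA2 v k]
      ring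
    have hbound : ∀ k ∈ closedBall (0 : Space d) ‖h‖,
        ‖fderiv ℝ f (x + k) - fderiv ℝ f x - A k‖ ≤ ε * ‖h‖ := by
      intro k hk
      have hk' : x + k ∈ ball x₀ ρ := hsub k (closedBall_subset_closedBall
        (by simpa using hh) hk)
      have := hst (show (x + k, x) ∈ s ×ˢ t from ⟨(hball hk').1.1, (hball hx').1.2⟩)
      simp only [mem_ofPred_eq, add_sub_cancel_left] at this
      exact this.trans (mul_le_mul_of_nonneg_left (mem_closedBall_zero_iff.1 hk) hεpos.le)
    have := (convex_closedBall (0 : Space d) ‖h‖).norm_image_sub_le_of_norm_hasFDerivWithin_le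
      hderiv hbound
      (mem_closedBall_self (norm_nonneg h)) (mem_closedBall_zero_iff.2 le_rfl)
    simp only [hG, Real.norm_eq_abs, add_zero, map_zero, sub_zero, zero_div] at this
    rw [show f (x + h) - f x - fderiv ℝ f x h - A h h / 2 =
      f (x + h) - fderiv ℝ f x h - A h h / 2 - f x by ring]
    calc _ ≤ _ := this
      _ = _ := by ring
  have hcont : ContinuousOn (fun h => f (x + h)) (closedBall (0 : Space d) r) := by
    intro h hh
    have h3 := (hball (hsub h hh)).2.out.continuousAt
    exact (ContinuousAt.comp (f := fun h => x + h) h3 (by fun_prop)).continuousWithinAt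
  rw [lt_setAverage_closedBall_iff hr, setIntegral_closedBall_eq]
  have hlow : ∫ h in closedBall (0 : Space d) r,
      (f x + fderiv ℝ f x h + A h h / 2 - ε * ‖h‖ ^ 2) ≤
      ∫ h in closedBall (0 : Space d) r, f (x + h) := by
    refine setIntegral_mono_on (Continuous.continuousOn (by fun_prop)).integrableOn_closedBall
      hcont.integrableOn_closedBall measurableSet_closedBall fun h hh => ?_
    have := neg_le_of_abs_le (taylor h hh)
    linarith
  refine lt_of_lt_of_le ?_ hlow
  have i1 : IntegrableOn (fun _ : Space d => f x) (closedBall 0 r) :=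
    continuousOn_const.integrableOn_closedBall
  have i2 : IntegrableOn (fun h : Space d => fderiv ℝ f x h) (closedBall 0 r) :=
    (Continuous.continuousOn (by fun_prop)).integrableOn_closedBall
  have i3 : IntegrableOn (fun h : Space d => A h h / 2) (closedBall 0 r) :=
    (Continuous.continuousOn (by fun_prop)).integrableOn_closedBall
  have i4 : IntegrableOn (fun h : Space d => ε * ‖h‖ ^ 2) (closedBall 0 r) :=
    (Continuous.continuousOn (by fun_prop)).integrableOn_closedBall
  have i12 : IntegrableOn (fun h : Space d => f x + fderiv ℝ f x h) (closedBall 0 r) := i1.add i2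
  have i123 : IntegrableOn (fun h : Space d => f x + fderiv ℝ f x h + A h h / 2)
    (closedBall 0 r) := i12.add i3
  rw [integral_sub i123 i4, integral_add i12 i3, integral_add i1 i2, setIntegral_const, setIntegral_closedBall_linear, integral_div, integral_const_mul]
  have hb := setIntegral_closedBall_bilin A r
  rw [← laplacian_eq_sum_fderiv f x₀] at hb
  have hpos : 0 < ∫ h in closedBall (0 : Space d) r, ‖h‖ ^ 2 := by
    rw [setIntegral_pos_iff_support_of_nonneg_ae]
    · have hopen : IsOpen (ball (0 : Space d) r ∩ {y | 0 < ‖y‖}) :=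
        isOpen_ball.inter (isOpen_lt continuous_const continuous_norm)
      have : Nonempty (Fin d) := ⟨⟨0, hd⟩⟩
      obtain ⟨w, hw⟩ := exists_norm_eq (Space d) (half_pos hr).le
      refine (hopen.measure_pos volume ⟨w, ?_, ?_⟩).trans_le (measure_mono ?_)
      · simp [hw]; linarith
      · simp only [mem_ofPred_eq, hw]; linarith
      · rintro y ⟨hy1, hy2⟩
        refine ⟨?_, ball_subset_closedBall hy1⟩
        simp only [Function.mem_support, mem_ofPred_eq] at hy2 ⊢
        positivity
    · exact Eventually.of_forall fun y => by positivity
    · exact (Continuous.continuousOn (by fun_prop)).integrableOn_closedBall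
  set I := ∫ h in closedBall (0 : Space d) r, A h h
  set N := ∫ h in closedBall (0 : Space d) r, ‖h‖ ^ 2
  have hd' : (0 : ℝ) < d := by exact_mod_cast hd
  have hI : I = Δ f x₀ / d * N := by field_simp; linarith
  rw [hI, hε]
  have h9 : Δ f x₀ / d * N / 2 - Δ f x₀ / (4 * d) * N = Δ f x₀ / (4 * d) * N := by field_simp; ring
  have h10 : 0 < Δ f x₀ / (4 * d) * N := by positivity
  have hv : (volume : Measure (Space d)).real (closedBall x r) = volume.real (closedBall (0 : Space d) r) := by
    rw [measureReal_def, measureReal_def, Measure.addHaar_closedBall_center]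
  rw [hv, smul_eq_mul]
  linarith

/-! ### Calculus of gradients and Laplacians -/

open Laplacian in
/-- `f` is of class `C²` at `x`, with gradient `g` and Laplacian `l` there. -/
def HasLap (f : Space d → ℝ) (x g : Space d) (l : ℝ) : Prop :=
  ContDiffAt ℝ 2 f x ∧ (∀ v, fderiv ℝ f x v = inner ℝ g v) ∧ Δ f x = l

lemma HasLap.congr {f f' : Space d → ℝ} {x g g' : Space d} {l l' : ℝ} (h : HasLap f x g l)
    (hf : ∀ y, f y = f' y) (hg : g = g') (hl : l = l') : HasLap f' x g' l' := by
  obtain rfl : f = f' := funext hf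
  subst hg hl
  exact h

lemma hasLap_const (b : ℝ) (x : Space d) : HasLap (fun _ => b) x 0 0 :=
  ⟨contDiffAt_const, by simp, by simp⟩

lemma _root_.ContDiffAt.differentiableAt_fderiv_two {f : Space d → ℝ} {x : Space d}
    (h : ContDiffAt ℝ 2 f x) : DifferentiableAt ℝ (fderiv ℝ f) x :=
  (h.fderiv_right (m := 1) (by norm_num)).differentiableAt (by norm_num)

lemma HasLap.add {f₁ f₂ : Space d → ℝ} {x g₁ g₂ : Space d} {l₁ l₂ : ℝ} (h₁ : HasLap f₁ x g₁ l₁)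
    (h₂ : HasLap f₂ x g₂ l₂) : HasLap (fun y => f₁ y + f₂ y) x (g₁ + g₂) (l₁ + l₂) := by
  refine ⟨h₁.1.add h₂.1, fun v => ?_, ?_⟩
  · rw [fderiv_fun_add (h₁.1.differentiableAt (by norm_num)) (h₂.1.differentiableAt (by norm_num)),
      add_apply, h₁.2.1, h₂.2.1, inner_add_left]
  · rw [← h₁.2.2, ← h₂.2.2]
    exact h₁.1.laplacian_add h₂.1

lemma HasLap.mul {f₁ f₂ : Space d → ℝ} {x g₁ g₂ : Space d} {l₁ l₂ : ℝ} (h₁ : HasLap f₁ x g₁ l₁)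
    (h₂ : HasLap f₂ x g₂ l₂) : HasLap (fun y => f₁ y * f₂ y) x (f₁ x • g₂ + f₂ x • g₁)
      (f₁ x * l₂ + 2 * inner ℝ g₁ g₂ + f₂ x * l₁) := by
  have d₁ := h₁.1.differentiableAt (n := 2) (by norm_num)
  have d₂ := h₂.1.differentiableAt (n := 2) (by norm_num)
  refine ⟨h₁.1.mul h₂.1, fun v => ?_, ?_⟩
  · rw [fderiv_fun_mul d₁ d₂]
    simp [h₁.2.1, h₂.2.1, inner_add_left, real_inner_smul_left]
  · have hev : fderiv ℝ (fun y => f₁ y * f₂ y) =ᶠ[𝓝 x]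
        fun y => f₁ y • fderiv ℝ f₂ y + f₂ y • fderiv ℝ f₁ y := by
      filter_upwards [h₁.1.eventually (by simp), h₂.1.eventually (by simp)] with y hy₁ hy₂
      exact fderiv_fun_mul (hy₁.differentiableAt (by norm_num)) (hy₂.differentiableAt (by norm_num))
    have e₁ := h₁.1.differentiableAt_fderiv_two
    have e₂ := h₂.1.differentiableAt_fderiv_two
    have hD := (d₁.hasFDerivAt.smul e₂.hasFDerivAt).add (d₂.hasFDerivAt.smul e₁.hasFDerivAt)
    rw [laplacian_eq_sum_fderiv, hev.fderiv_eq]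
    have hD' : fderiv ℝ (fun y => f₁ y • fderiv ℝ f₂ y + f₂ y • fderiv ℝ f₁ y) x = _ := hD.fderiv
    rw [hD']
    rw [← h₁.2.2, ← h₂.2.2, laplacian_eq_sum_fderiv, laplacian_eq_sum_fderiv,
      ← (EuclideanSpace.basisFun (Fin d) ℝ).sum_inner_mul_inner g₁ g₂]
    simp only [add_apply, smul_apply, ContinuousLinearMap.smulRight_apply, h₁.2.1, h₂.2.1,
      smul_eq_mul, Finset.mul_sum]
    rw [← Finset.sum_add_distrib, ← Finset.sum_add_distrib]
    refine Finset.sum_congr rfl fun i _ => ?_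
    rw [real_inner_comm g₂]
    ring

lemma HasLap.comp {f : Space d → ℝ} {x g : Space d} {l : ℝ} (h : HasLap f x g l) {q q' : ℝ → ℝ}
    {q'' : ℝ} (hq : ∀ᶠ s in 𝓝 (f x), HasDerivAt q (q' s) s) (hq2 : HasDerivAt q' q'' (f x))
    (hqc : ContDiffAt ℝ 2 q (f x)) :
    HasLap (fun y => q (f y)) x (q' (f x) • g) (q' (f x) * l + q'' * ‖g‖ ^ 2) := by
  have d₁ := h.1.differentiableAt (n := 2) (by norm_num)
  have hev0 : ∀ᶠ y in 𝓝 x, HasDerivAt q (q' (f y)) (f y) := h.1.continuousAt.eventually hq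
  have hev : fderiv ℝ (fun y => q (f y)) =ᶠ[𝓝 x] fun y => q' (f y) • fderiv ℝ f y := by
    filter_upwards [h.1.eventually (by simp), hev0] with y hy hy'
    exact (hy'.comp_hasFDerivAt y (hy.differentiableAt (by norm_num)).hasFDerivAt).fderiv
  refine ⟨hqc.comp x h.1, fun v => ?_, ?_⟩
  · rw [hev.eq_of_nhds]
    simp [h.2.1, real_inner_smul_left]
  · rw [laplacian_eq_sum_fderiv, hev.fderiv_eq]
    have hD := (hq2.comp_hasFDerivAt x d₁.hasFDerivAt).smul h.1.differentiableAt_fderiv_two.hasFDerivAt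
    have hD' : fderiv ℝ (fun y => q' (f y) • fderiv ℝ f y) x = _ := hD.fderiv
    rw [hD', ← h.2.2, laplacian_eq_sum_fderiv, ← real_inner_self_eq_norm_sq,
      ← (EuclideanSpace.basisFun (Fin d) ℝ).sum_inner_mul_inner g g]
    simp only [add_apply, smul_apply, ContinuousLinearMap.smulRight_apply, h.2.1,
      smul_eq_mul, Finset.mul_sum, Function.comp]
    rw [← Finset.sum_add_distrib]
    refine Finset.sum_congr rfl fun i _ => ?_
    rw [real_inner_comm g]
    ring

lemma hasLap_inner (e x : Space d) : HasLap (fun y => inner ℝ e y) x e 0 := by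
  have h : ∀ y, HasFDerivAt (fun y : Space d => inner ℝ e y) (innerSL ℝ e : Space d →L[ℝ] ℝ) y :=
    fun y => (innerSL ℝ e : Space d →L[ℝ] ℝ).hasFDerivAt
  refine ⟨(innerSL ℝ e : Space d →L[ℝ] ℝ).contDiff.contDiffAt, fun v => ?_, ?_⟩
  · rw [(h x).fderiv]; rfl
  · rw [laplacian_eq_sum_fderiv, show fderiv ℝ (fun y : Space d => inner ℝ e y) =
      fun _ => innerSL ℝ e from funext fun y => (h y).fderiv]
    simp

lemma HasLap.const_mul {f : Space d → ℝ} {x g : Space d} {l : ℝ} (h : HasLap f x g l) (b : ℝ) :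
    HasLap (fun y => b * f y) x (b • g) (b * l) :=
  ((hasLap_const b x).mul h).congr (fun _ => rfl) (by simp) (by simp)

lemma HasLap.sum {ι : Type*} (s : Finset ι) {f : ι → Space d → ℝ} {x : Space d} {g : ι → Space d}
    {l : ι → ℝ} (h : ∀ i ∈ s, HasLap (f i) x (g i) (l i)) :
    HasLap (fun y => ∑ i ∈ s, f i y) x (∑ i ∈ s, g i) (∑ i ∈ s, l i) := by
  classical
  induction s using Finset.induction_on with
  | empty => simpa using hasLap_const 0 x
  | insert i s hi ih =>
    have := (h i (Finset.mem_insert_self i s)).add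
      (ih fun j hj => h j (Finset.mem_insert_of_mem hj))
    exact this.congr (fun y => by rw [Finset.sum_insert hi]) (Finset.sum_insert hi).symm
      (Finset.sum_insert hi).symm

lemma hasLap_normSq_sub (c x : Space d) :
    HasLap (fun y : Space d => ‖y - c‖ ^ 2) x ((2 : ℝ) • (x - c)) (2 * d) := by
  set e := EuclideanSpace.basisFun (Fin d) ℝ
  have h1 : ∀ i ∈ Finset.univ, HasLap (fun y : Space d =>
      (inner ℝ (e i) y + -inner ℝ (e i) c) * (inner ℝ (e i) y + -inner ℝ (e i) c)) x
      (((2 : ℝ) * inner ℝ (e i) (x - c)) • e i) 2 := by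
    intro i _
    have h := (hasLap_inner (e i) x).add (hasLap_const (-inner ℝ (e i) c) x)
    refine (h.mul h).congr (fun _ => rfl) ?_ ?_
    · rw [inner_sub_right, add_zero]; module
    · simp [e.orthonormal.1 i]
  refine (HasLap.sum Finset.univ h1).congr (fun y => ?_) ?_ (by simp [mul_comm])
  · rw [← e.sum_sq_norm_inner_right]
    refine Finset.sum_congr rfl fun i _ => ?_
    rw [Real.norm_eq_abs, sq_abs, inner_sub_right]; ring
  · conv_rhs => rw [← e.sum_repr' (x - c), Finset.smul_sum]
    exact Finset.sum_congr rfl fun i _ => by rw [smul_smul]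

lemma HasLap.exists_lt_setAverage {f : Space d → ℝ} {x g : Space d} {l : ℝ} (h : HasLap f x g l)
    (hl : 0 < l) :
    ∃ ρ > 0, ∀ y ∈ ball x ρ, ∀ r, 0 < r → r < ρ → f y < ⨍ z in closedBall y r, f z :=
  exists_lt_setAverage_of_laplacian_pos h.1 (h.2.2 ▸ hl)

lemma HasLap.subMeanAt {f : Space d → ℝ} {x g : Space d} {l : ℝ} (h : HasLap f x g l)
    (hl : 0 < l) : SubMeanAt f x := by
  obtain ⟨ρ, hρ, h⟩ := h.exists_lt_setAverage hl
  filter_upwards [Ioo_mem_nhdsGT hρ] with r hr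
  exact (h x (mem_ball_self hρ) r hr.1 hr.2).le

lemma HasLap.hasFDerivAt {f : Space d → ℝ} {x g : Space d} {l : ℝ} (h : HasLap f x g l) :
    HasFDerivAt f (innerSL ℝ g : Space d →L[ℝ] ℝ) x := by
  have := (h.1.differentiableAt (n := 2) (by norm_num)).hasFDerivAt
  refine this.congr_fderiv ?_
  ext v
  exact h.2.1 v

/-- Only a strictly positive Laplacian gives `SubMeanAt` at this stage, since mean values of
harmonic functions are not yet available. A small quadratic supplies the strictness, and
`nonpos_of_subMeanAt_add_normSq` removes it again. -/
lemma HasLap.subMeanAt_add_normSq {f : Space d → ℝ} {x g : Space d} {l : ℝ} (hd : 0 < d)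
    (h : HasLap f x g l) (hl : 0 ≤ l) {ε : ℝ} (hε : 0 < ε) (c : Space d) (b : ℝ) :
    SubMeanAt (fun y => f y + (ε * ‖y - c‖ ^ 2 + b)) x :=
  have hd' : (0 : ℝ) < d := by exact_mod_cast hd
  (h.add (((hasLap_normSq_sub c x).const_mul ε).add (hasLap_const b x))).subMeanAt (by positivity)

/-! ### Harmonic polynomials -/

/-- Maximum principle for functions that are sub-mean-value up to small quadratic perturbations. -/
theorem nonpos_of_subMeanAt_add_normSq (hd : 0 < d) {D : Set (Space d)} (hD : IsOpen D)
    (hb : Bornology.IsBounded D) {f : Space d → ℝ} (hf : UpperSemicontinuousOn f (closure D))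
    (c : Space d)
    (hs : ∀ ε > 0, ∀ b, ∀ x ∈ D, 0 < f x + (ε * ‖x - c‖ ^ 2 + b) →
      SubMeanAt (fun y => f y + (ε * ‖y - c‖ ^ 2 + b)) x)
    (hfr : ∀ x ∈ frontier D, f x ≤ 0) : ∀ x ∈ closure D, f x ≤ 0 := by
  obtain ⟨R, hR⟩ := hb.subset_closedBall c
  intro x hx
  have hcl : closure D ⊆ closedBall c R := closure_minimal hR isClosed_closedBall
  have hq : ∀ y ∈ closure D, ‖y - c‖ ^ 2 ≤ R ^ 2 := fun y hy => by
    have := hcl hy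
    rw [mem_closedBall, dist_eq_norm] at this
    exact pow_le_pow_left₀ (norm_nonneg _) this 2
  -- The perturbation is shifted by `-(ε R²)` so as to be non-positive on the closure of `D`. The
  -- price at `x` is at most `ε R²`, and `ε` is arbitrary.
  have key : ∀ ε > 0, f x ≤ ε * R ^ 2 := by
    intro ε hε
    have := nonpos_of_subMeanAt hd hD hb
      (f := fun y => f y + (ε * ‖y - c‖ ^ 2 + -(ε * R ^ 2)))
      (hf.add ((Continuous.upperSemicontinuous (by fun_prop)).upperSemicontinuousOn _))
      (hs ε hε _) (fun y hy => by
        have h1 := hfr y hy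
        have h2 := hq y (frontier_subset_closure hy)
        nlinarith) x hx
    have h0 : 0 ≤ ε * ‖x - c‖ ^ 2 := by positivity
    linarith
  by_contra! hpos
  have := key (f x / (2 * (R ^ 2 + 1))) (by positivity)
  have h3 : f x / (2 * (R ^ 2 + 1)) * R ^ 2 ≤ f x / 2 := by
    rw [div_mul_eq_mul_div, div_le_div_iff₀ (by positivity) (by positivity)]
    nlinarith [sq_nonneg R]
  linarith

/-- The polynomial function attached to a polynomial in the coordinates. -/
noncomputable def polyFun (p : MvPolynomial (Fin d) ℝ) : Space d → ℝ :=
  fun x => MvPolynomial.eval (fun i => x i) p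

lemma hasFDerivAt_polyFun (p : MvPolynomial (Fin d) ℝ) (x : Space d) :
    HasFDerivAt (polyFun p) (∑ i, polyFun (MvPolynomial.pderiv i p) x •
      (EuclideanSpace.proj i : Space d →L[ℝ] ℝ)) x := by
  classical
  induction p using MvPolynomial.induction_on with
  | C a =>
    have h0 : polyFun (MvPolynomial.C a : MvPolynomial (Fin d) ℝ) = fun _ => a := by
      ext x; simp [polyFun]
    rw [h0]
    simpa [polyFun] using hasFDerivAt_const (𝕜 := ℝ) a x
  | add p q hp hq =>
    have h0 : polyFun (p + q) = polyFun p + polyFun q := by ext x; simp [polyFun]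
    rw [h0]
    refine (hp.add hq).congr_fderiv ?_
    simp only [polyFun, map_add]
    rw [← Finset.sum_add_distrib]
    exact Finset.sum_congr rfl fun i _ => by rw [add_smul]
  | mul_X p j hp =>
    have h1 : HasFDerivAt (fun y : Space d => y j) (EuclideanSpace.proj j : Space d →L[ℝ] ℝ) x :=
      (EuclideanSpace.proj j : Space d →L[ℝ] ℝ).hasFDerivAt
    have h0 : polyFun (p * MvPolynomial.X j) = polyFun p * fun y => y j := by
      ext x; simp [polyFun]
    rw [h0]
    refine (hp.mul h1).congr_fderiv ?_
    simp only [polyFun, map_mul, MvPolynomial.eval_X, MvPolynomial.pderiv_mul,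
      map_add, MvPolynomial.pderiv_X]
    simp_rw [add_smul]
    rw [Finset.sum_add_distrib, add_comm, Finset.smul_sum]
    congr 1
    · refine Finset.sum_congr rfl fun i _ => ?_
      rw [smul_smul, mul_comm]
    · rw [Finset.sum_eq_single j]
      · simp
      · intro i _ hi
        rw [Pi.single_eq_of_ne hi.symm]; simp
      · simp

lemma contDiff_polyFun (p : MvPolynomial (Fin d) ℝ) : ContDiff ℝ 2 (polyFun p) := by
  induction p using MvPolynomial.induction_on with
  | C a =>
    have : polyFun (MvPolynomial.C a : MvPolynomial (Fin d) ℝ) = fun _ => a := by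
      ext x; simp [polyFun]
    rw [this]; exact contDiff_const
  | add p q hp hq =>
    have : polyFun (p + q) = fun x => polyFun p x + polyFun q x := by ext x; simp [polyFun]
    rw [this]; exact hp.add hq
  | mul_X p j hp =>
    have : polyFun (p * MvPolynomial.X j) = fun x => polyFun p x * x j := by ext x; simp [polyFun]
    rw [this]; exact hp.mul (EuclideanSpace.proj j : Space d →L[ℝ] ℝ).contDiff

lemma continuous_polyFun (p : MvPolynomial (Fin d) ℝ) : Continuous (polyFun p) :=
  (contDiff_polyFun p).continuous

/-- The Laplacian on polynomials. -/
noncomputable def polyLaplacian (d : ℕ) : MvPolynomial (Fin d) ℝ →ₗ[ℝ] MvPolynomial (Fin d) ℝ :=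
  ∑ i, (MvPolynomial.pderiv i).toLinearMap ∘ₗ (MvPolynomial.pderiv i).toLinearMap

lemma polyLaplacian_apply (p : MvPolynomial (Fin d) ℝ) :
    polyLaplacian d p = ∑ i, MvPolynomial.pderiv i (MvPolynomial.pderiv i p) := by
  simp [polyLaplacian, LinearMap.sum_apply]

open Laplacian in
lemma laplacian_polyFun (p : MvPolynomial (Fin d) ℝ) (x : Space d) :
    Δ (polyFun p) x = polyFun (polyLaplacian d p) x := by
  rw [laplacian_eq_sum_fderiv, polyLaplacian_apply]
  have h0 : ∀ (q : MvPolynomial (Fin d) ℝ) (y : Space d) i,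
      fderiv ℝ (polyFun q) y (EuclideanSpace.basisFun (Fin d) ℝ i) =
        polyFun (MvPolynomial.pderiv i q) y := by
    intro q y i
    rw [(hasFDerivAt_polyFun q y).fderiv]
    simp [sum_apply]
  have : polyFun (∑ i, MvPolynomial.pderiv i (MvPolynomial.pderiv i p)) x =
      ∑ i, polyFun (MvPolynomial.pderiv i (MvPolynomial.pderiv i p)) x := by
    simp [polyFun]
  rw [this]
  refine Finset.sum_congr rfl fun i _ => ?_
  rw [← h0 (MvPolynomial.pderiv i p) x i]
  rw [show polyFun (MvPolynomial.pderiv i p) = fun y => fderiv ℝ (polyFun p) y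
    (EuclideanSpace.basisFun (Fin d) ℝ i) from funext fun y => (h0 p y i).symm]
  have h3 : DifferentiableAt ℝ (fderiv ℝ (polyFun p)) x :=
    ((contDiff_polyFun p).fderiv_right (m := 1) (by norm_num)).differentiable (by norm_num) x
  rw [fderiv_clm_apply h3 (by fun_prop)]
  simp

lemma totalDegree_pderiv_le (p : MvPolynomial (Fin d) ℝ) (i : Fin d) :
    (MvPolynomial.pderiv i p).totalDegree ≤ p.totalDegree - 1 := by
  refine Finset.sup_le fun m hm => ?_
  rw [MvPolynomial.mem_support_iff, MvPolynomial.coeff_pderiv] at hm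
  have h1 : MvPolynomial.coeff (m + Finsupp.single i 1) p ≠ 0 := by
    intro h; rw [h] at hm; simp at hm
  have h2 := MvPolynomial.le_totalDegree (MvPolynomial.mem_support_iff.2 h1)
  rw [Finsupp.sum_add_index' (by simp) (by simp)] at h2
  simp only [Finsupp.sum_single_index] at h2
  omega

lemma totalDegree_polyLaplacian_le (p : MvPolynomial (Fin d) ℝ) :
    (polyLaplacian d p).totalDegree ≤ p.totalDegree - 2 := by
  rw [polyLaplacian_apply]
  refine (MvPolynomial.totalDegree_finsetSum _ _).trans (Finset.sup_le fun i _ => ?_)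
  have h1 := totalDegree_pderiv_le (MvPolynomial.pderiv i p) i
  have h2 := totalDegree_pderiv_le p i
  omega

/-- The ball contains a product of open intervals, and a polynomial vanishing on a product of
infinite sets is zero. -/
lemma polyFun_eq_zero_of_ball {p : MvPolynomial (Fin d) ℝ} {c : Space d} {ρ : ℝ} (hρ : 0 < ρ)
    (h : ∀ x ∈ ball c ρ, polyFun p x = 0) : p = 0 := by
  have hopen : IsOpen ((WithLp.toLp 2 : (Fin d → ℝ) → Space d) ⁻¹' ball c ρ) :=
    isOpen_ball.preimage (PiLp.continuous_toLp 2 _)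
  obtain ⟨ε, hε, hsub⟩ := Metric.isOpen_iff.1 hopen (fun i => c i)
    (show WithLp.toLp 2 (fun i => c i) ∈ ball c ρ from mem_ball_self hρ)
  refine MvPolynomial.funext_set (fun i => Ioo (c i - ε) (c i + ε))
    (fun i => Ioo_infinite (by linarith)) fun x hx => ?_
  rw [map_zero]
  refine h (WithLp.toLp 2 x) (hsub ?_)
  rw [mem_ball, dist_pi_lt_iff hε]
  intro i
  have := hx i (mem_univ i)
  rw [Real.dist_eq, abs_sub_lt_iff]
  constructor <;> linarith [this.1, this.2]

/-- The polynomial `ρ² - |x - c|²`. -/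
noncomputable def ballPoly (c : Space d) (ρ : ℝ) : MvPolynomial (Fin d) ℝ :=
  MvPolynomial.C (ρ ^ 2) - ∑ i, (MvPolynomial.X i - MvPolynomial.C (c i)) ^ 2

lemma polyFun_ballPoly (c x : Space d) (ρ : ℝ) :
    polyFun (ballPoly c ρ) x = ρ ^ 2 - ‖x - c‖ ^ 2 := by
  simp [polyFun, ballPoly, EuclideanSpace.norm_sq_eq]

lemma totalDegree_ballPoly_le (c : Space d) (ρ : ℝ) : (ballPoly c ρ).totalDegree ≤ 2 := by
  refine (MvPolynomial.totalDegree_sub _ _).trans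
    (max_le ((MvPolynomial.totalDegree_C _).trans_le (by norm_num)) ?_)
  refine (MvPolynomial.totalDegree_finsetSum _ _).trans (Finset.sup_le fun i _ => ?_)
  refine (MvPolynomial.totalDegree_pow _ _).trans ?_
  have : (MvPolynomial.X i - MvPolynomial.C (c i) : MvPolynomial (Fin d) ℝ).totalDegree ≤ 1 :=
    (MvPolynomial.totalDegree_sub _ _).trans (by simp)
  omega

/-- The maximum principle for `p` and `-p`. It yields uniqueness in `exists_harmonic_polynomial` and
the Cauchy property in `exists_polyApprox`. -/
lemma abs_polyFun_le (hd : 0 < d) {p : MvPolynomial (Fin d) ℝ} (hp : polyLaplacian d p = 0)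
    {c : Space d} {ρ M : ℝ} (hρ : 0 < ρ) (h : ∀ x ∈ sphere c ρ, |polyFun p x| ≤ M) :
    ∀ x ∈ closedBall c ρ, |polyFun p x| ≤ M := by
  have hΔ : ∀ x, Laplacian.laplacian (polyFun p) x = 0 := fun x => by
    rw [laplacian_polyFun, hp]; simp [polyFun]
  have hfr : frontier (ball c ρ) = sphere c ρ := frontier_ball c hρ.ne'
  have aux : ∀ s : ℝ, s = 1 ∨ s = -1 → ∀ x ∈ closedBall c ρ, s * polyFun p x - M ≤ 0 := by
    intro s hs x hx
    rw [← closure_ball c hρ.ne'] at hx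
    refine nonpos_of_subMeanAt_add_normSq hd isOpen_ball isBounded_ball
      (f := fun y => s * polyFun p y - M)
      ((Continuous.upperSemicontinuous
        (by have := continuous_polyFun p; fun_prop)).upperSemicontinuousOn _) c ?_ ?_ x hx
    · intro ε hε b y _ _
      have h1 : HasLap (polyFun p) y (gradient (polyFun p) y) 0 :=
        ⟨(contDiff_polyFun p).contDiffAt, fun v => by rw [gradient, InnerProductSpace.toDual_symm_apply],
          hΔ y⟩
      have := ((h1.const_mul s)).subMeanAt_add_normSq hd (by simp) hε c (b - M)
      refine this.congr (Eventually.of_forall fun z => ?_)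
      simp only; ring
    · rw [hfr]
      intro y hy
      have := h y hy
      rcases hs with rfl | rfl
      · linarith [le_abs_self (polyFun p y)]
      · linarith [neg_abs_le (polyFun p y)]
  intro x hx
  rw [abs_le]
  constructor
  · linarith [aux (-1) (Or.inr rfl) x hx]
  · linarith [aux 1 (Or.inl rfl) x hx]

/-- Polynomial boundary values on a sphere extend to harmonic polynomials. -/
theorem exists_harmonic_polynomial (hd : 0 < d) (p : MvPolynomial (Fin d) ℝ) (c : Space d) {ρ : ℝ}
    (hρ : 0 < ρ) : ∃ q : MvPolynomial (Fin d) ℝ, polyLaplacian d q = 0 ∧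
      ∀ x ∈ sphere c ρ, polyFun q x = polyFun p x := by
  set n := p.totalDegree with hn
  set V := MvPolynomial.restrictTotalDegree (Fin d) ℝ n with hV
  have hmem : ∀ q ∈ V, polyLaplacian d (ballPoly c ρ * q) ∈ V := by
    intro q hq
    rw [hV, MvPolynomial.mem_restrictTotalDegree] at hq ⊢
    have h1 := totalDegree_polyLaplacian_le (ballPoly c ρ * q)
    have h2 := MvPolynomial.totalDegree_mul (ballPoly c ρ) q
    have h3 := totalDegree_ballPoly_le c ρ
    omega
  -- Subtracting a multiple of ρ² - |x - c|² from `p` leaves the values on the sphere unchanged, so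
  -- it suffices to solve Δ((ρ² - |x - c|²) q) = Δp. The degree count makes the left side an
  -- endomorphism of a finite-dimensional space, and the maximum principle makes it injective, hence
  -- surjective.
  let Φ : V →ₗ[ℝ] V :=
    ((polyLaplacian d ∘ₗ LinearMap.mulLeft ℝ (ballPoly c ρ)) ∘ₗ V.subtype).codRestrict V
      fun q => hmem q q.2
  have hinj : Function.Injective Φ := by
    rw [← LinearMap.ker_eq_bot, LinearMap.ker_eq_bot']
    intro q hq
    have h1 : polyLaplacian d (ballPoly c ρ * q) = 0 := congrArg Subtype.val hq
    have h2 : ∀ x ∈ ball c ρ, polyFun (q : MvPolynomial (Fin d) ℝ) x = 0 := by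
      intro x hx
      have h3 := abs_polyFun_le hd h1 hρ (M := 0) (fun y hy => by
        have : polyFun (ballPoly c ρ * (q : MvPolynomial (Fin d) ℝ)) y =
          polyFun (ballPoly c ρ) y * polyFun (q : MvPolynomial (Fin d) ℝ) y := by
          simp [polyFun]
        rw [mem_sphere, dist_eq_norm] at hy
        rw [this, polyFun_ballPoly, hy]; simp) x (ball_subset_closedBall hx)
      have h4 : polyFun (ballPoly c ρ * (q : MvPolynomial (Fin d) ℝ)) x =
          polyFun (ballPoly c ρ) x * polyFun (q : MvPolynomial (Fin d) ℝ) x := by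
        simp [polyFun]
      rw [h4, polyFun_ballPoly] at h3
      have h5 : (ρ ^ 2 - ‖x - c‖ ^ 2) * polyFun (q : MvPolynomial (Fin d) ℝ) x = 0 :=
        abs_nonpos_iff.1 h3
      rcases mul_eq_zero.1 h5 with h6 | h6
      · rw [mem_ball, dist_eq_norm] at hx
        nlinarith [norm_nonneg (x - c)]
      · exact h6
    exact Subtype.ext (polyFun_eq_zero_of_ball hρ h2)
  have hsurj := LinearMap.injective_iff_surjective.1 hinj
  have hLp : polyLaplacian d p ∈ V := by
    rw [hV, MvPolynomial.mem_restrictTotalDegree]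
    have := totalDegree_polyLaplacian_le p
    omega
  obtain ⟨q, hq⟩ := hsurj ⟨_, hLp⟩
  have hq' : polyLaplacian d (ballPoly c ρ * q) = polyLaplacian d p := congrArg Subtype.val hq
  refine ⟨p - ballPoly c ρ * q, by rw [map_sub, hq', sub_self], fun x hx => ?_⟩
  have h4 : polyFun (p - ballPoly c ρ * (q : MvPolynomial (Fin d) ℝ)) x =
      polyFun p x - polyFun (ballPoly c ρ) x * polyFun (q : MvPolynomial (Fin d) ℝ) x := by
    simp [polyFun]
  rw [mem_sphere, dist_eq_norm] at hx
  rw [h4, polyFun_ballPoly, hx]; simp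

/-- Polynomials are dense in the continuous functions on a compact set. -/
theorem exists_polynomial_near {K : Set (Space d)} (hK : IsCompact K) {g : Space d → ℝ}
    (hg : ContinuousOn g K) {ε : ℝ} (hε : 0 < ε) :
    ∃ p : MvPolynomial (Fin d) ℝ, ∀ x ∈ K, |polyFun p x - g x| < ε := by
  have := isCompact_iff_compactSpace.1 hK
  let coord : Fin d → C(K, ℝ) := fun i =>
    ⟨fun x => (x : Space d) i, by fun_prop⟩
  let A : Subalgebra ℝ C(K, ℝ) := (MvPolynomial.aeval coord).range
  have heval : ∀ (p : MvPolynomial (Fin d) ℝ) (x : K),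
      MvPolynomial.aeval coord p x = polyFun p x := by
    intro p x
    induction p using MvPolynomial.induction_on with
    | C a => simp [polyFun]
    | add p q hp hq => simp only [polyFun, map_add, ContinuousMap.add_apply] at *; rw [hp, hq]
    | mul_X p j hp =>
      simp only [polyFun, map_mul, ContinuousMap.mul_apply, MvPolynomial.aeval_X,
        MvPolynomial.eval_X] at *
      rw [hp]; rfl
  have hsep : A.SeparatesPoints := by
    intro x y hxy
    have : ∃ i, (x : Space d) i ≠ (y : Space d) i := by
      by_contra! h
      exact hxy (Subtype.ext (by ext i; exact h i))
    obtain ⟨i, hi⟩ := this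
    refine ⟨coord i, ⟨coord i, ⟨MvPolynomial.X i, by simp⟩, rfl⟩, hi⟩
  obtain ⟨⟨f, p, hp⟩, hf⟩ :=
    ContinuousMap.exists_mem_subalgebra_near_continuous_of_separatesPoints A hsep
      (fun x : K => g x) hg.domRestrict ε hε
  refine ⟨p, fun x hx => ?_⟩
  have := hf ⟨x, hx⟩
  rw [← Real.norm_eq_abs, ← heval p ⟨x, hx⟩]
  have hp' : MvPolynomial.aeval coord p = f := hp
  rw [hp']
  exact this

/-! ### Averages over the orthogonal group -/

/-- The orthogonal group of `ℝ^d`. -/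
noncomputable abbrev Rot (d : ℕ) := unitary (Space d →L[ℝ] Space d)

instance continuousStar_clm : ContinuousStar (Space d →L[ℝ] Space d) :=
  ⟨(star_isometry (E := Space d →L[ℝ] Space d)).continuous⟩

instance compactSpace_rot : CompactSpace (Rot d) := by
  refine isCompact_iff_compactSpace.1
    (?_ : IsCompact ((unitary (Space d →L[ℝ] Space d) : Submonoid _) : Set (Space d →L[ℝ] Space d)))
  refine Metric.isCompact_of_isClosed_isBounded isClosed_unitary ?_
  refine (isBounded_closedBall (x := (0 : Space d →L[ℝ] Space d)) (r := 1)).subset fun u hu => ?_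
  rw [mem_closedBall_zero_iff]
  refine ContinuousLinearMap.opNorm_le_bound _ zero_le_one fun x => ?_
  have := (Unitary.linearIsometryEquiv ⟨u, hu⟩).norm_map x
  rw [one_mul]
  exact this.le

noncomputable instance measurableSpace_rot : MeasurableSpace (Rot d) := borel _

instance borelSpace_rot : BorelSpace (Rot d) := ⟨rfl⟩

/-- The Haar probability measure of the orthogonal group. -/
noncomputable def rotMeasure (d : ℕ) : Measure (Rot d) := Measure.haarMeasure ⊤

instance isProbabilityMeasure_rotMeasure : IsProbabilityMeasure (rotMeasure d) :=
  ⟨by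
    have := Measure.haarMeasure_self (K₀ := (⊤ : TopologicalSpace.PositiveCompacts (Rot d)))
    simpa [rotMeasure] using this⟩

instance isMulLeftInvariant_rotMeasure : (rotMeasure d).IsMulLeftInvariant := by
  unfold rotMeasure; infer_instance

/-- The action of the inverse of a rotation. -/
noncomputable def rotInv (R : Rot d) (x : Space d) : Space d :=
  (Unitary.linearIsometryEquiv R⁻¹) x

lemma rotInv_eq (R : Rot d) (x : Space d) :
    rotInv R x = ((R⁻¹ : Rot d) : Space d →L[ℝ] Space d) x := rfl

lemma continuous_rotInv : Continuous fun p : Rot d × Space d => rotInv p.1 p.2 := by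
  simp only [rotInv_eq]
  have h1 : Continuous fun p : Rot d × Space d => ((p.1⁻¹ : Rot d) : Space d →L[ℝ] Space d) :=
    continuous_subtype_val.comp (continuous_inv.comp continuous_fst)
  exact h1.clm_apply continuous_snd

lemma continuous_rotInv_left (x : Space d) : Continuous fun R : Rot d => rotInv R x :=
  Continuous.comp (g := fun p : Rot d × Space d => rotInv p.1 p.2) (f := fun R => (R, x))
    continuous_rotInv (by fun_prop)

lemma continuous_rotInv_swap : Continuous fun p : Space d × Rot d => rotInv p.2 p.1 :=
  Continuous.comp (g := fun p : Rot d × Space d => rotInv p.1 p.2) (f := Prod.swap)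
    continuous_rotInv continuous_swap

lemma norm_rotInv (R : Rot d) (x : Space d) : ‖rotInv R x‖ = ‖x‖ :=
  (Unitary.linearIsometryEquiv R⁻¹).norm_map x

lemma rotInv_zero (R : Rot d) : rotInv R 0 = 0 := map_zero (Unitary.linearIsometryEquiv R⁻¹)

/-- The average of `f` over all rotations. -/
noncomputable def rotAvg (f : Space d → ℝ) (x : Space d) : ℝ := ∫ R, f (rotInv R x) ∂(rotMeasure d)

lemma rotAvg_zero (f : Space d → ℝ) : rotAvg f 0 = f 0 := by simp [rotAvg, rotInv_zero]

lemma integrable_rot {f : Space d → ℝ} (hf : Continuous f) (x : Space d) :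
    Integrable (fun R => f (rotInv R x)) (rotMeasure d) := by
  have : Continuous fun R : Rot d => f (rotInv R x) :=
    hf.comp (continuous_rotInv_left x)
  rw [← integrableOn_univ]
  exact this.continuousOn.integrableOn_compact isCompact_univ

lemma continuous_rotAvg {f : Space d → ℝ} (hf : Continuous f) : Continuous (rotAvg f) := by
  have h : Continuous (Function.uncurry fun (x : Space d) (R : Rot d) => f (rotInv R x)) :=
    hf.comp continuous_rotInv_swap
  have := continuous_parametric_integral_of_continuous (μ := rotMeasure d) h isCompact_univ
  rw [Measure.restrict_univ] at this
  exact this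

/-- A reflection `S` carries `x` to `y`. Since rotations act through their inverses, the
substitution of `S * R` for `R` turns `y` into `x`, and left invariance of the Haar measure is
exactly what is needed. -/
lemma rotAvg_eq_of_norm_eq (f : Space d → ℝ) {x y : Space d} (h : ‖x‖ = ‖y‖) :
    rotAvg f x = rotAvg f y := by
  set S : Rot d := Unitary.linearIsometryEquiv.symm (ℝ ∙ (x - y))ᗮ.reflection with hS
  have hSx : ((S : Rot d) : Space d →L[ℝ] Space d) x = y := by
    have h1 : Unitary.linearIsometryEquiv S x = y := by
      rw [hS, MulEquiv.apply_symm_apply]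
      exact Submodule.reflection_sub h
    exact h1
  unfold rotAvg
  rw [← integral_mul_left_eq_self (fun R => f (rotInv R y)) S]
  refine integral_congr_ae (Eventually.of_forall fun R => ?_)
  simp only [rotInv_eq, mul_inv_rev]
  congr 1
  rw [← hSx]
  have h2 : ((R⁻¹ * S⁻¹ : Rot d) : Space d →L[ℝ] Space d) ((S : Space d →L[ℝ] Space d) x) =
      ((R⁻¹ * S⁻¹ * S : Rot d) : Space d →L[ℝ] Space d) x := rfl
  rw [h2, inv_mul_cancel_right]

/-- Fubini. The weight is 1 for averages over balls and a radial bump for mollification. -/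
lemma setIntegral_mul_rotAvg {f φ : Space d → ℝ} (hf : Continuous f) (hφ : Continuous φ)
    (y : Space d) (r : ℝ) :
    ∫ z in closedBall y r, φ z * rotAvg f z =
      ∫ R, (∫ z in closedBall y r, φ z * f (rotInv R z)) ∂(rotMeasure d) := by
  simp_rw [rotAvg, ← integral_const_mul]
  rw [integral_integral_swap]
  have hc : Continuous (Function.uncurry fun (z : Space d) (R : Rot d) => φ z * f (rotInv R z)) :=
    (hφ.comp continuous_fst).mul (hf.comp continuous_rotInv_swap)
  rw [← Measure.restrict_univ (μ := rotMeasure d), Measure.prod_restrict]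
  exact hc.continuousOn.integrableOn_compact ((isCompact_closedBall y r).prod isCompact_univ)

lemma setIntegral_closedBall_rot (R : Rot d) (f : Space d → ℝ) (y : Space d) (r : ℝ) :
    ∫ z in closedBall y r, f (rotInv R z) = ∫ z in closedBall (rotInv R y) r, f z := by
  set L := Unitary.linearIsometryEquiv R⁻¹
  have := L.measurePreserving.setIntegral_preimage_emb
    L.toHomeomorph.measurableEmbedding f (closedBall (L y) r)
  change _ = ∫ z in closedBall (L y) r, f z
  rw [← this]
  congr 2
  ext h
  simp

lemma setAverage_closedBall_rotAvg {f : Space d → ℝ} (hf : Continuous f) (y : Space d) (r : ℝ) :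
    ⨍ z in closedBall y r, rotAvg f z =
      ∫ R, (⨍ z in closedBall (rotInv R y) r, f z) ∂(rotMeasure d) := by
  have h := setIntegral_mul_rotAvg hf (continuous_const (y := (1 : ℝ))) y r
  simp only [one_mul] at h
  simp only [setAverage_eq, smul_eq_mul]
  rw [h, ← integral_const_mul]
  refine integral_congr_ae (Eventually.of_forall fun R => ?_)
  simp only
  rw [setIntegral_closedBall_rot, measureReal_def, measureReal_def,
    Measure.addHaar_closedBall_center, Measure.addHaar_closedBall_center volume (rotInv R y)]

lemma setAverage_closedBall_zero_rotAvg {f : Space d → ℝ} (hf : Continuous f) (r : ℝ) :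
    ⨍ z in closedBall 0 r, rotAvg f z = ⨍ z in closedBall 0 r, f z := by
  rw [setAverage_closedBall_rotAvg hf]
  simp [rotInv_zero]

/-! ### The mean value property of harmonic polynomials -/

lemma hasLap_polyFun {p : MvPolynomial (Fin d) ℝ} (hp : polyLaplacian d p = 0) (x : Space d) :
    HasLap (polyFun p) x (gradient (polyFun p) x) 0 :=
  ⟨(contDiff_polyFun p).contDiffAt,
    fun v => by rw [gradient, InnerProductSpace.toDual_symm_apply],
    by rw [laplacian_polyFun, hp]; simp [polyFun]⟩

lemma HasLap.comp_const_add {f : Space d → ℝ} {c x g : Space d} {l : ℝ}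
    (h : HasLap f (c + x) g l) : HasLap (fun y => f (c + y)) x g l := by
  have h1 : ∀ y, fderiv ℝ (fun y => f (c + y)) y = fderiv ℝ f (c + y) := fun y =>
    fderiv_comp_add_left c
  refine ⟨h.1.comp x (by fun_prop), fun v => by rw [h1, h.2.1], ?_⟩
  rw [← h.2.2, laplacian_eq_sum_fderiv, laplacian_eq_sum_fderiv,
    show fderiv ℝ (fun y => f (c + y)) = fun y => fderiv ℝ f (c + y) from funext h1,
    fderiv_comp_add_left c]

/-- Ball averages commute with rotational averages. One radius must work for all rotates of `x` at
once, and it comes from compactness of the sphere through `x`. -/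
lemma subMeanAt_rotAvg {f : Space d → ℝ} (hf : Continuous f) (x : Space d)
    (h : ∀ y, ‖y‖ = ‖x‖ →
      ∃ ρ > 0, ∀ z ∈ ball y ρ, ∀ r, 0 < r → r < ρ → f z ≤ ⨍ w in closedBall z r, f w) :
    SubMeanAt (rotAvg f) x := by
  choose! ρ hρ hf' using h
  obtain ⟨t, ht, hcov⟩ := (isCompact_sphere (0 : Space d) ‖x‖).elim_nhds_subcover
    (fun y => ball y (ρ y)) fun y hy => ball_mem_nhds y (hρ y (by simpa using hy))
  have hev : ∀ᶠ r in 𝓝[>] (0 : ℝ), ∀ y ∈ t, r < ρ y :=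
    (Finset.eventually_all t).2 fun y hy =>
      mem_of_superset (Ioo_mem_nhdsGT (hρ y (by simpa using ht y hy))) fun r hr => hr.2
  filter_upwards [hev, self_mem_nhdsWithin] with r hr hr0
  rw [setAverage_closedBall_rotAvg hf]
  have hpt : ∀ R : Rot d, f (rotInv R x) ≤ ⨍ w in closedBall (rotInv R x) r, f w := by
    intro R
    obtain ⟨y, hy, hxy⟩ := mem_iUnion₂.1 (hcov (show rotInv R x ∈ sphere 0 ‖x‖ by
      simp [norm_rotInv]))
    exact hf' y (by simpa using ht y hy) _ hxy r hr0 (hr y hy)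
  refine integral_mono (integrable_rot hf x) ?_ hpt
  have hc : Continuous fun R : Rot d => ⨍ w in closedBall (rotInv R x) r, f w := by
    have h1 : ∀ y : Space d, ⨍ w in closedBall y r, f w =
        ((volume : Measure (Space d)).real (closedBall (0 : Space d) r))⁻¹ *
          ∫ h in closedBall (0 : Space d) r, f (y + h) := by
      intro y
      rw [setAverage_eq, setIntegral_closedBall_eq, measureReal_def, measureReal_def,
        Measure.addHaar_closedBall_center, smul_eq_mul]
    simp_rw [h1]
    refine continuous_const.mul ?_
    have h2 : Continuous fun y : Space d => ∫ h in closedBall (0 : Space d) r, f (y + h) :=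
      continuous_parametric_integral_of_continuous
        (f := fun (y h : Space d) => f (y + h)) (by fun_prop) (isCompact_closedBall 0 r)
    exact h2.comp (continuous_rotInv_left x)
  rw [← integrableOn_univ]
  exact hc.continuousOn.integrableOn_compact isCompact_univ

/-- The rotational average is constant on the sphere through `x` and obeys the maximum principle
with both signs, so its value at the centre equals its value on that sphere. This is the spherical
mean value property without surface measure. -/
lemma rotAvg_polyFun (hd : 0 < d) {p : MvPolynomial (Fin d) ℝ} (hp : polyLaplacian d p = 0)
    (c x : Space d) : rotAvg (fun y => polyFun p (c + y)) x = polyFun p c := by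
  set k : Space d → ℝ := fun y => polyFun p (c + y) with hk
  have hkc : Continuous k := (continuous_polyFun p).comp (by fun_prop)
  rcases eq_or_ne x 0 with rfl | hx
  · rw [rotAvg_zero]; simp [hk]
  have hx' : 0 < ‖x‖ := norm_pos_iff.2 hx
  have key : ∀ s : ℝ, ∀ y ∈ closedBall (0 : Space d) ‖x‖, s * (rotAvg k y - rotAvg k x) ≤ 0 := by
    intro s y hy
    rw [← closure_ball 0 hx'.ne'] at hy
    refine nonpos_of_subMeanAt_add_normSq hd isOpen_ball isBounded_ball
      (f := fun y => s * (rotAvg k y - rotAvg k x)) ((Continuous.upperSemicontinuous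
        (by have := continuous_rotAvg hkc; fun_prop)).upperSemicontinuousOn _) 0 ?_ ?_ y hy
    · intro ε hε b z _ _
      have hkl : ∀ w, HasLap (fun y => s * k y + (ε * ‖y - 0‖ ^ 2 + (b - s * rotAvg k x))) w
          (s • gradient (polyFun p) (c + w) + (ε • ((2:ℝ) • (w - 0)) + 0)) (s * 0 + (ε * (2 * d) + 0)) :=
        fun w => (((hasLap_polyFun hp (c + w)).comp_const_add).const_mul s).add
          (((hasLap_normSq_sub 0 w).const_mul ε).add (hasLap_const _ w))
      have hd' : (0 : ℝ) < d := by exact_mod_cast hd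
      have hcc : Continuous fun y => s * k y + (ε * ‖y - 0‖ ^ 2 + (b - s * rotAvg k x)) := by
        fun_prop
      have := subMeanAt_rotAvg hcc z fun w _ => by
        obtain ⟨ρ, hρ, h⟩ := (hkl w).exists_lt_setAverage (by rw [mul_zero]; positivity)
        exact ⟨ρ, hρ, fun z hz r h1 h2 => (h z hz r h1 h2).le⟩
      refine this.congr (Eventually.of_forall fun w => ?_)
      simp only [rotAvg, sub_zero, norm_rotInv]
      rw [integral_add ((integrable_rot hkc w).const_mul s) (integrable_const _),
        integral_const_mul, integral_const]
      simp
      ring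
    · intro z hz
      rw [frontier_ball _ hx'.ne', mem_sphere_zero_iff_norm] at hz
      rw [rotAvg_eq_of_norm_eq k hz]; simp
  have h1 := key 1 0 (by simp)
  have h2 := key (-1) 0 (by simp)
  rw [rotAvg_zero] at h1 h2
  have : k 0 = polyFun p c := by simp [hk]
  linarith

lemma setAverage_closedBall_translate (f : Space d → ℝ) (c : Space d) (r : ℝ) :
    ⨍ y in closedBall c r, f y = ⨍ y in closedBall 0 r, f (c + y) := by
  rw [setAverage_eq, setAverage_eq, setIntegral_closedBall_eq, measureReal_def, measureReal_def,
    Measure.addHaar_closedBall_center]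

theorem setAverage_polyFun (hd : 0 < d) {p : MvPolynomial (Fin d) ℝ} (hp : polyLaplacian d p = 0)
    (c : Space d) {r : ℝ} (hr : 0 < r) : ⨍ y in closedBall c r, polyFun p y = polyFun p c := by
  have hkc : Continuous fun y => polyFun p (c + y) := (continuous_polyFun p).comp (by fun_prop)
  rw [setAverage_closedBall_translate, ← setAverage_closedBall_zero_rotAvg hkc]
  simp_rw [rotAvg_polyFun hd hp]
  exact setAverage_closedBall_const _ hr _

/-! ### From small balls to all balls -/

lemma exists_continuous_eqOn {K : Set (Space d)} (hK : IsClosed K) {f : Space d → ℝ}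
    (hf : ContinuousOn f K) : ∃ g : Space d → ℝ, Continuous g ∧ EqOn g f K := by
  obtain ⟨g, hg⟩ := ContinuousMap.exists_restrict_eq hK ⟨K.domRestrict f, hf.domRestrict⟩
  refine ⟨g, g.continuous, fun x hx => ?_⟩
  have := DFunLike.congr_fun hg ⟨x, hx⟩
  exact this

lemma eventually_integrableOn_of_continuous {f : Space d → ℝ} (hf : Continuous f) (x : Space d) :
    ∀ᶠ r in 𝓝[>] (0 : ℝ), IntegrableOn f (closedBall x r) :=
  Eventually.of_forall fun _ => hf.continuousOn.integrableOn_closedBall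

lemma SubMeanAt.comp_const_add {f : Space d → ℝ} {c x : Space d} (h : SubMeanAt f (c + x)) :
    SubMeanAt (fun y => f (c + y)) x := by
  filter_upwards [h] with r hr
  refine hr.trans_eq ?_
  rw [setAverage_closedBall_translate, setAverage_closedBall_translate _ x]
  simp only [add_assoc]

/-- For each `z`, a harmonic polynomial `q` within ε/2 of `f` on the sphere through `z` satisfies `f
0 ≤ q 0 + ε/2` by the maximum principle, while `q 0` is the rotational average of `q` at `z`. Hence
`f 0 ≤ rotAvg f z` for every `z` in the ball, and integrating over `z` gives the claim. -/
lemma le_setAverage_of_subMeanAt_zero (hd : 0 < d) {f : Space d → ℝ} (hf : Continuous f) {r : ℝ}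
    (hr : 0 < r) (hs : ∀ x ∈ ball 0 r, SubMeanAt f x) : f 0 ≤ ⨍ y in closedBall 0 r, f y := by
  rw [← setAverage_closedBall_zero_rotAvg hf]
  rw [← setAverage_closedBall_const 0 hr (f 0)]
  refine setAverage_closedBall_mono continuousOn_const.integrableOn_closedBall
    (continuous_rotAvg hf).continuousOn.integrableOn_closedBall fun z hz => ?_
  rcases eq_or_ne z 0 with rfl | hz0
  · rw [rotAvg_zero]
  have hzn : 0 < ‖z‖ := norm_pos_iff.2 hz0
  rw [mem_closedBall_zero_iff] at hz
  refine le_of_forall_pos_le_add fun ε hε => ?_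
  obtain ⟨p, hp⟩ := exists_polynomial_near (isCompact_sphere (0 : Space d) ‖z‖) hf.continuousOn
    (half_pos hε)
  obtain ⟨q, hq, hqp⟩ := exists_harmonic_polynomial hd p 0 hzn
  have hqf : ∀ x ∈ sphere (0 : Space d) ‖z‖, |polyFun q x - f x| < ε / 2 := fun x hx => by
    rw [hqp x hx]; exact hp x hx
  have h1 : f 0 - polyFun q 0 - ε / 2 ≤ 0 := by
    refine nonpos_of_subMeanAt_add_normSq hd isOpen_ball isBounded_ball
      (f := fun y => f y - polyFun q y - ε / 2) ((Continuous.upperSemicontinuous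
        (by have := continuous_polyFun q; fun_prop)).upperSemicontinuousOn _) 0 ?_ ?_ 0
      (subset_closure (mem_ball_self hzn))
    · intro ε' hε' b x hx _
      have h2 : SubMeanAt (fun y => (-1) * polyFun q y + (ε' * ‖y - 0‖ ^ 2 + (b - ε / 2))) x :=
        ((hasLap_polyFun hq x).const_mul (-1)).subMeanAt_add_normSq hd (by simp) hε' 0 _
      have hcq := continuous_polyFun q
      refine ((hs x (ball_subset_ball hz hx)).add h2 (eventually_integrableOn_of_continuous hf x)
        (eventually_integrableOn_of_continuous (by fun_prop) x)).congr
        (Eventually.of_forall fun y => ?_)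
      simp only; ring
    · intro x hx
      rw [frontier_ball _ hzn.ne'] at hx
      linarith [(abs_lt.1 (hqf x hx)).1]
  have h2 : polyFun q 0 - ε / 2 ≤ rotAvg f z := by
    have h3 := rotAvg_polyFun hd hq 0 z
    simp only [zero_add] at h3
    rw [← h3]
    have h4 : rotAvg (polyFun q) z - ε / 2 =
        ∫ R, (polyFun q (rotInv R z) - ε / 2) ∂(rotMeasure d) := by
      rw [integral_sub (integrable_rot (continuous_polyFun q) z) (integrable_const _)]
      simp [rotAvg]
    rw [h4]
    refine integral_mono ((integrable_rot (continuous_polyFun q) z).sub (integrable_const _))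
      (integrable_rot hf z) fun R => ?_
    have := (abs_lt.1 (hqf (rotInv R z) (by simp [norm_rotInv]))).2
    simp only
    linarith
  linarith

/-- A continuous function with the sub-mean-value property on small balls has it on all balls. -/
theorem le_setAverage_of_subMeanAt (hd : 0 < d) {f : Space d → ℝ} {c : Space d} {r : ℝ}
    (hr : 0 < r) (hf : ContinuousOn f (closedBall c r)) (hs : ∀ x ∈ ball c r, SubMeanAt f x) :
    f c ≤ ⨍ y in closedBall c r, f y := by
  obtain ⟨g, hg, hgf⟩ := exists_continuous_eqOn isClosed_closedBall hf
  rw [← hgf (mem_closedBall_self hr.le), ← setAverage_closedBall_congr hgf,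
    setAverage_closedBall_translate]
  have := le_setAverage_of_subMeanAt_zero hd (f := fun y => g (c + y)) (by fun_prop) hr
    fun x hx => SubMeanAt.comp_const_add ?_
  · simpa using this
  · have hcx : c + x ∈ ball c r := by simpa using hx
    refine (hs _ hcx).congr ?_
    filter_upwards [isOpen_ball.mem_nhds hcx] with y hy
    exact (hgf (ball_subset_closedBall hy)).symm

theorem subharmonicIn_of_subMeanAt (hd : 0 < d) {A : Set (Space d)} {f : Space d → ℝ}
    (hf : ContinuousOn f A) (hs : ∀ x ∈ A, SubMeanAt f x) : SubharmonicIn A f :=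
  ⟨hf, fun _ _ hr hB => le_setAverage_of_subMeanAt hd hr (hf.mono hB)
    fun y hy => hs y (hB (ball_subset_closedBall hy))⟩

lemma SubharmonicIn.subMeanAt {A : Set (Space d)} {f : Space d → ℝ} (h : SubharmonicIn A f)
    {x : Space d} (hx : A ∈ 𝓝 x) : SubMeanAt f x := by
  filter_upwards [eventually_closedBall_subset hx, self_mem_nhdsWithin] with r hr hr0
  exact h.2 x r hr0 hr

lemma superharmonicIn_iff_neg {A : Set (Space d)} {f : Space d → ℝ} :
    SuperharmonicIn A f ↔ SubharmonicIn A (fun y => -f y) := by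
  unfold SuperharmonicIn SubharmonicIn
  simp only [setAverage_closedBall_neg, neg_le_neg_iff]
  refine and_congr_left fun _ => ⟨fun h => h.neg, fun h => ?_⟩
  exact h.neg.congr fun x _ => (neg_neg (f x)).symm

theorem superharmonicIn_of_subMeanAt_neg (hd : 0 < d) {A : Set (Space d)} {f : Space d → ℝ}
    (hf : ContinuousOn f A) (hs : ∀ x ∈ A, SubMeanAt (fun y => -f y) x) : SuperharmonicIn A f :=
  superharmonicIn_iff_neg.2 (subharmonicIn_of_subMeanAt hd hf.neg hs)

lemma SuperharmonicIn.subMeanAt_neg {A : Set (Space d)} {f : Space d → ℝ}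
    (h : SuperharmonicIn A f) {x : Space d} (hx : A ∈ 𝓝 x) : SubMeanAt (fun y => -f y) x :=
  (superharmonicIn_iff_neg.1 h).subMeanAt hx

/-! ### Solutions of the Dirichlet problem on balls -/

/-- `h` is a uniform limit of harmonic polynomials on a closed ball. -/
def PolyApprox (c : Space d) (ρ : ℝ) (h : Space d → ℝ) : Prop :=
  ∀ ε > 0, ∃ p : MvPolynomial (Fin d) ℝ, polyLaplacian d p = 0 ∧
    ∀ x ∈ closedBall c ρ, |polyFun p x - h x| < ε

/-- The Dirichlet problem on a ball without a Poisson kernel: the boundary data are approximated by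
polynomials, these are extended by harmonic polynomials, and the maximum principle carries uniform
convergence from the sphere into the ball. -/
theorem exists_polyApprox (hd : 0 < d) {g : Space d → ℝ} {c : Space d} {ρ : ℝ} (hρ : 0 < ρ)
    (hg : ContinuousOn g (sphere c ρ)) :
    ∃ h : Space d → ℝ, PolyApprox c ρ h ∧ EqOn h g (sphere c ρ) := by
  have hex : ∀ n : ℕ, ∃ q : MvPolynomial (Fin d) ℝ, polyLaplacian d q = 0 ∧
      ∀ x ∈ sphere c ρ, |polyFun q x - g x| < 1 / (n + 1 : ℝ) := by
    intro n
    obtain ⟨p, hp⟩ := exists_polynomial_near (isCompact_sphere c ρ) hg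
      (show (0 : ℝ) < 1 / (n + 1 : ℝ) by positivity)
    obtain ⟨q, hq, hqp⟩ := exists_harmonic_polynomial hd p c hρ
    exact ⟨q, hq, fun x hx => by rw [hqp x hx]; exact hp x hx⟩
  choose q hq hqg using hex
  have hdist : ∀ m n, m ≤ n → ∀ x ∈ closedBall c ρ,
      |polyFun (q n) x - polyFun (q m) x| ≤ 2 * (1 / (m + 1 : ℝ)) := by
    intro m n hmn x hx
    have h0 : polyLaplacian d (q n - q m) = 0 := by rw [map_sub, hq, hq, sub_zero]
    have h1 : ∀ y, polyFun (q n - q m) y = polyFun (q n) y - polyFun (q m) y := fun y => by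
      simp [polyFun]
    rw [← h1]
    refine abs_polyFun_le hd h0 hρ (fun y hy => ?_) x hx
    rw [h1]
    have h2 := hqg n y hy
    have h3 := hqg m y hy
    have h4 : 1 / (n + 1 : ℝ) ≤ 1 / (m + 1 : ℝ) := by gcongr
    rw [abs_lt] at h2 h3
    rw [abs_le]
    constructor <;> linarith
  have hto : Tendsto (fun n : ℕ => 2 * (1 / (n + 1 : ℝ))) atTop (𝓝 0) := by
    simpa using (tendsto_one_div_add_atTop_nhds_zero_nat (𝕜 := ℝ)).const_mul 2
  have hlim : ∀ x ∈ closedBall c ρ, ∃ l, Tendsto (fun n => polyFun (q n) x) atTop (𝓝 l) := by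
    intro x hx
    refine cauchySeq_tendsto_of_complete (cauchySeq_of_le_tendsto_0
      (fun n : ℕ => 2 * (2 * (1 / (n + 1 : ℝ)))) (fun n m N hn hm => ?_) ?_)
    · rw [Real.dist_eq]
      have h1 := abs_le.1 (hdist N n hn x hx)
      have h2 := abs_le.1 (hdist N m hm x hx)
      rw [abs_le]; constructor <;> linarith
    · simpa using hto.const_mul 2
  choose! h hh using hlim
  have hbd : ∀ m : ℕ, ∀ x ∈ closedBall c ρ, |h x - polyFun (q m) x| ≤ 2 * (1 / (m + 1 : ℝ)) := by
    intro m x hx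
    refine le_of_tendsto (((hh x hx).sub_const _).abs) ?_
    filter_upwards [eventually_ge_atTop m] with n hn using hdist m n hn x hx
  refine ⟨h, fun ε hε => ?_, fun x hx => ?_⟩
  · obtain ⟨m, hm⟩ := (hto.eventually_lt_const hε).exists
    exact ⟨q m, hq m, fun x hx => by rw [abs_sub_comm]; exact (hbd m x hx).trans_lt hm⟩
  · refine tendsto_nhds_unique (hh x (sphere_subset_closedBall hx)) ?_
    rw [tendsto_iff_dist_tendsto_zero]
    refine squeeze_zero (fun _ => dist_nonneg) (fun n => ?_)
      (tendsto_one_div_add_atTop_nhds_zero_nat (𝕜 := ℝ))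
    rw [Real.dist_eq]
    exact (hqg n x hx).le

lemma PolyApprox.continuousOn {c : Space d} {ρ : ℝ} {h : Space d → ℝ} (H : PolyApprox c ρ h) :
    ContinuousOn h (closedBall c ρ) := by
  refine continuousOn_of_uniform_approx_of_continuousOn fun u hu => ?_
  obtain ⟨ε, hε, hsub⟩ := Metric.mem_uniformity_dist.1 hu
  obtain ⟨p, -, hp⟩ := H ε hε
  refine ⟨polyFun p, (continuous_polyFun p).continuousOn, fun y hy => hsub ?_⟩
  rw [dist_comm, Real.dist_eq]
  exact hp y hy

lemma PolyApprox.neg {c : Space d} {ρ : ℝ} {h : Space d → ℝ} (H : PolyApprox c ρ h) :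
    PolyApprox c ρ (fun x => -h x) := by
  intro ε hε
  obtain ⟨p, hp, hph⟩ := H ε hε
  refine ⟨-p, by rw [map_neg, hp, neg_zero], fun x hx => ?_⟩
  have : polyFun (-p) x - -h x = -(polyFun p x - h x) := by simp [polyFun]; ring
  rw [this, abs_neg]
  exact hph x hx

theorem PolyApprox.setAverage (hd : 0 < d) {c : Space d} {ρ : ℝ} {h : Space d → ℝ}
    (H : PolyApprox c ρ h) {x : Space d} {r : ℝ} (hr : 0 < r)
    (hsub : closedBall x r ⊆ closedBall c ρ) : ⨍ y in closedBall x r, h y = h x := by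
  have hint := (H.continuousOn.mono hsub).integrableOn_closedBall
  refine eq_of_forall_dist_le fun ε hε => ?_
  obtain ⟨p, hp, hph⟩ := H (ε / 2) (half_pos hε)
  have hpi := (continuous_polyFun p).continuousOn.integrableOn_closedBall (x := x) (r := r)
  have h1 := setAverage_polyFun hd hp x hr
  have h2 := abs_lt.1 (hph x (hsub (mem_closedBall_self hr.le)))
  have hc : ∀ b : ℝ, IntegrableOn (fun _ : Space d => b) (closedBall x r) := fun b =>
    continuousOn_const.integrableOn_closedBall
  have h3 : ⨍ y in closedBall x r, h y ≤ polyFun p x + ε / 2 := by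
    rw [← h1, ← setAverage_closedBall_const x hr (ε / 2), ← setAverage_closedBall_add hpi (hc _)]
    refine setAverage_closedBall_mono hint (hpi.add (hc _)) fun y hy => ?_
    linarith [(abs_lt.1 (hph y (hsub hy))).1]
  have h4 : polyFun p x + -(ε / 2) ≤ ⨍ y in closedBall x r, h y := by
    rw [← h1, ← setAverage_closedBall_const x hr (-(ε / 2)),
      ← setAverage_closedBall_add hpi (hc _)]
    refine setAverage_closedBall_mono (hpi.add (hc _)) hint fun y hy => ?_
    linarith [(abs_lt.1 (hph y (hsub hy))).2]
  rw [Real.dist_eq, abs_le]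
  constructor <;> linarith

lemma PolyApprox.subMeanAt (hd : 0 < d) {c : Space d} {ρ : ℝ} {h : Space d → ℝ}
    (H : PolyApprox c ρ h) {x : Space d} (hx : x ∈ ball c ρ) : SubMeanAt h x := by
  filter_upwards [eventually_closedBall_subset (isOpen_ball.mem_nhds hx), self_mem_nhdsWithin]
    with r hr hr0
  exact (H.setAverage hd hr0 (hr.trans ball_subset_closedBall)).ge

/-! ### Smoothness by radial mollification, and the passage between C² and mean value notions. -/

/-- A smooth radial bump function. -/
noncomputable def radialBump (d : ℕ) (δ : ℝ) (y : Space d) : ℝ :=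
  Real.smoothTransition (1 - ‖y‖ ^ 2 / δ ^ 2)

lemma radialBump_nonneg (δ : ℝ) (y : Space d) : 0 ≤ radialBump d δ y :=
  Real.smoothTransition.nonneg _

lemma contDiff_radialBump (δ : ℝ) : ContDiff ℝ 2 (radialBump d δ) :=
  Real.smoothTransition.contDiff.comp (contDiff_const.sub ((contDiff_norm_sq ℝ).div_const _))

lemma radialBump_eq_zero {δ : ℝ} (hδ : 0 < δ) {y : Space d} (hy : y ∉ closedBall (0 : Space d) δ) :
    radialBump d δ y = 0 := by
  refine Real.smoothTransition.zero_of_nonpos ?_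
  rw [mem_closedBall_zero_iff, not_le] at hy
  rw [sub_nonpos, one_le_div (by positivity)]
  gcongr

lemma hasCompactSupport_radialBump {δ : ℝ} (hδ : 0 < δ) : HasCompactSupport (radialBump d δ) :=
  HasCompactSupport.intro (isCompact_closedBall 0 δ) fun _ hy => radialBump_eq_zero hδ hy

lemma setIntegral_radialBump_pos {δ : ℝ} (hδ : 0 < δ) :
    0 < ∫ y in closedBall (0 : Space d) δ, radialBump d δ y := by
  have hc : Continuous (radialBump d δ) := (contDiff_radialBump δ).continuous
  rw [integral_pos_iff_support_of_nonneg (fun y => radialBump_nonneg δ y)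
    hc.continuousOn.integrableOn_closedBall]
  have h1 : ball (0 : Space d) δ ⊆ Function.support (radialBump d δ) := fun y hy => by
    rw [mem_ball_zero_iff] at hy
    refine (Real.smoothTransition.pos_of_pos ?_).ne'
    rw [sub_pos, div_lt_one (by positivity)]
    gcongr
  have h2 := measure_mono (μ := volume.restrict (closedBall (0 : Space d) δ)) h1
  refine lt_of_lt_of_le ?_ h2
  rw [Measure.restrict_apply measurableSet_ball, inter_eq_left.2 ball_subset_closedBall]
  exact measure_ball_pos _ _ hδ

lemma rotInv_neg (R : Rot d) (x : Space d) : rotInv R (-x) = -rotInv R x :=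
  map_neg (Unitary.linearIsometryEquiv R⁻¹) x

/-- Because the weight is radial, `p (x - ·)` may be replaced by its rotational average, which is
the constant `p x`. -/
lemma setIntegral_radialBump_mul (hd : 0 < d) {p : MvPolynomial (Fin d) ℝ}
    (hp : polyLaplacian d p = 0) (x : Space d) (δ : ℝ) :
    ∫ y in closedBall (0 : Space d) δ, radialBump d δ y * polyFun p (x - y) =
      (∫ y in closedBall (0 : Space d) δ, radialBump d δ y) * polyFun p x := by
  have hc : Continuous fun y => polyFun p (x - y) := (continuous_polyFun p).comp (by fun_prop)
  have hrot : ∀ y, rotAvg (fun y => polyFun p (x - y)) y = polyFun p x := by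
    intro y
    rw [← rotAvg_polyFun hd hp x (-y)]
    simp only [rotAvg, rotInv_neg, sub_eq_add_neg]
  have h := setIntegral_mul_rotAvg hc (contDiff_radialBump (d := d) δ).continuous 0 δ
  simp only [hrot] at h
  rw [integral_mul_const] at h
  rw [h]
  have h2 : ∀ R : Rot d, ∫ z in closedBall (0 : Space d) δ,
      radialBump d δ z * polyFun p (x - rotInv R z) =
      ∫ z in closedBall (0 : Space d) δ, radialBump d δ z * polyFun p (x - z) := by
    intro R
    have h3 := setIntegral_closedBall_rot R (fun z => radialBump d δ z * polyFun p (x - z)) 0 δ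
    rw [rotInv_zero] at h3
    rw [← h3]
    simp only [radialBump, norm_rotInv]
  simp only [h2]
  simp

lemma PolyApprox.setIntegral_radialBump_mul (hd : 0 < d) {c : Space d} {ρ : ℝ} {h : Space d → ℝ}
    (H : PolyApprox c ρ h) {g : Space d → ℝ} (hg : Continuous g) (hgh : EqOn g h (closedBall c ρ))
    {x : Space d} {δ : ℝ} (hsub : closedBall x δ ⊆ closedBall c ρ) (hδ : 0 < δ) :
    ∫ y in closedBall (0 : Space d) δ, radialBump d δ y * g (x - y) =
      (∫ y in closedBall (0 : Space d) δ, radialBump d δ y) * h x := by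
  set J := ∫ y in closedBall (0 : Space d) δ, radialBump d δ y with hJ
  have hJ0 : 0 < J := setIntegral_radialBump_pos hδ
  have hbc : Continuous (radialBump d δ) := (contDiff_radialBump δ).continuous
  refine eq_of_forall_dist_le fun ε hε => ?_
  obtain ⟨p, hp, hph⟩ := H (ε / (2 * J)) (by positivity)
  have h1 := Droplet.setIntegral_radialBump_mul hd hp x δ
  have hpc := continuous_polyFun p
  have hi1 : IntegrableOn (fun y => radialBump d δ y * g (x - y)) (closedBall 0 δ) :=
    (hbc.mul (hg.comp (by fun_prop))).continuousOn.integrableOn_closedBall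
  have hi2 : IntegrableOn (fun y => radialBump d δ y * polyFun p (x - y)) (closedBall 0 δ) :=
    (hbc.mul (hpc.comp (by fun_prop))).continuousOn.integrableOn_closedBall
  have h2 : |∫ y in closedBall (0 : Space d) δ,
      (radialBump d δ y * g (x - y) - radialBump d δ y * polyFun p (x - y))| ≤ ε / 2 := by
    have h3 : ∫ y in closedBall (0 : Space d) δ, radialBump d δ y * (ε / (2 * J)) = ε / 2 := by
      rw [integral_mul_const]
      field_simp
      ring
    rw [← h3, ← Real.norm_eq_abs]
    refine norm_integral_le_of_norm_le
      ((hbc.mul continuous_const).continuousOn.integrableOn_closedBall) ?_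
    refine (ae_restrict_iff' measurableSet_closedBall).2 (Eventually.of_forall fun y hy => ?_)
    have hxy : x - y ∈ closedBall x δ := by
      rw [mem_closedBall_zero_iff] at hy
      simpa [mem_closedBall, dist_eq_norm] using hy
    rw [← mul_sub, norm_mul, Real.norm_eq_abs, Real.norm_eq_abs,
      abs_of_nonneg (radialBump_nonneg δ y), hgh (hsub hxy),
      abs_sub_comm]
    exact mul_le_mul_of_nonneg_left (hph _ (hsub hxy)).le (radialBump_nonneg δ y)
  rw [integral_sub hi1 hi2, h1] at h2
  have h4 : |J * polyFun p x - J * h x| ≤ ε / 2 := by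
    rw [← mul_sub, abs_mul, abs_of_pos hJ0]
    have := (hph x (hsub (mem_closedBall_self hδ.le))).le
    calc J * |polyFun p x - h x| ≤ J * (ε / (2 * J)) := by gcongr
      _ = ε / 2 := by field_simp
  rw [Real.dist_eq]
  rw [abs_le] at h2 h4 ⊢
  constructor <;> linarith

lemma _root_.ContDiffAt.hasLap {f : Space d → ℝ} {x : Space d} (h : ContDiffAt ℝ 2 f x) :
    HasLap f x (gradient f x) (Laplacian.laplacian f x) :=
  ⟨h, fun v => by rw [gradient, InnerProductSpace.toDual_symm_apply], rfl⟩

open InnerProductSpace in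
-- A non-zero Laplacian, multiplied by 1 or -1 to be positive, would make the mean value inequality
-- strict on small balls.
theorem harmonicOnNhd_of_setAverage {f : Space d → ℝ} {A : Set (Space d)} (hA : IsOpen A)
    (hf : ∀ x ∈ A, ContDiffAt ℝ 2 f x)
    (hm : ∀ x ∈ A, ∀ᶠ r in 𝓝[>] (0 : ℝ), ⨍ y in closedBall x r, f y = f x) :
    HarmonicOnNhd f A := by
  intro x hx
  refine ⟨hf x hx, ?_⟩
  filter_upwards [hA.mem_nhds hx] with y hy
  have aux : ∀ s : ℝ, ¬ 0 < Laplacian.laplacian (fun y => s * f y) y := by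
    intro s hs
    obtain ⟨ρ, hρ, h⟩ := exists_lt_setAverage_of_laplacian_pos
      (contDiffAt_const.mul (hf y hy)) hs
    obtain ⟨r, hr, hr2, hr3⟩ := ((hm y hy).and (Ioo_mem_nhdsGT hρ)).exists
    have h1 := h y (mem_ball_self hρ) r hr2 hr3
    rw [setAverage_closedBall_const_mul, hr] at h1
    exact lt_irrefl _ h1
  have hl : ∀ s : ℝ, Laplacian.laplacian (fun y => s * f y) y = s * Laplacian.laplacian f y :=
    fun s => (((hf y hy).hasLap).const_mul s).2.2
  have h1 := aux 1
  have h2 := aux (-1)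
  rw [hl] at h1 h2
  simp only [Pi.zero_apply]
  linarith

open InnerProductSpace in
-- Near each point `h` equals a normalized radial mollification of a continuous extension of itself,
-- so it is of class C². The mean value property, inherited from the polynomials, then forces the
-- Laplacian to vanish.
theorem PolyApprox.harmonicOnNhd (hd : 0 < d) {c : Space d} {ρ : ℝ} {h : Space d → ℝ}
    (H : PolyApprox c ρ h) : HarmonicOnNhd h (ball c ρ) := by
  refine harmonicOnNhd_of_setAverage isOpen_ball (fun x hx => ?_) fun x hx => ?_
  · obtain ⟨g, hg, hgh⟩ := exists_continuous_eqOn isClosed_closedBall H.continuousOn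
    obtain ⟨ε, hε, hεs⟩ := Metric.isOpen_iff.1 isOpen_ball x hx
    set δ := ε / 3 with hδ
    have hδ0 : 0 < δ := by positivity
    have hsm : ContDiff ℝ 2 (MeasureTheory.convolution (radialBump d δ) g
        (ContinuousLinearMap.lsmul ℝ ℝ) volume) :=
      (hasCompactSupport_radialBump hδ0).contDiff_convolution_left _ (contDiff_radialBump δ)
        hg.locallyIntegrable
    set J := ∫ y in closedBall (0 : Space d) δ, radialBump d δ y with hJ
    have hJ0 : 0 < J := setIntegral_radialBump_pos hδ0
    have heq : h =ᶠ[𝓝 x] fun z => J⁻¹ * (MeasureTheory.convolution (radialBump d δ) g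
        (ContinuousLinearMap.lsmul ℝ ℝ) volume) z := by
      filter_upwards [ball_mem_nhds x hδ0] with z hz
      have hzs : closedBall z δ ⊆ closedBall c ρ := by
        refine Subset.trans (fun w hw => ?_) (hεs.trans ball_subset_closedBall)
        rw [mem_closedBall] at hw
        rw [mem_ball] at hz ⊢
        have := dist_triangle w z x
        linarith
      have h1 := H.setIntegral_radialBump_mul hd hg hgh hzs hδ0
      have h2 : (MeasureTheory.convolution (radialBump d δ) g
          (ContinuousLinearMap.lsmul ℝ ℝ) volume) z =
          ∫ y in closedBall (0 : Space d) δ, radialBump d δ y * g (z - y) := by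
        rw [setIntegral_eq_integral_of_forall_compl_eq_zero]
        · simp [MeasureTheory.convolution]
        · intro y hy
          rw [radialBump_eq_zero hδ0 hy, zero_mul]
      rw [h2, h1, ← hJ, inv_mul_cancel_left₀ hJ0.ne']
    exact (contDiffAt_const.mul hsm.contDiffAt).congr_of_eventuallyEq heq
  · filter_upwards [eventually_closedBall_subset (isOpen_ball.mem_nhds hx), self_mem_nhdsWithin]
      with r hr hr0
    exact H.setAverage hd hr0 (hr.trans ball_subset_closedBall)

open InnerProductSpace in
lemma _root_.InnerProductSpace.HarmonicAt.hasLap {f : Space d → ℝ} {x : Space d}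
    (h : HarmonicAt f x) : HasLap f x (gradient f x) 0 :=
  ⟨h.1, fun v => by rw [gradient, InnerProductSpace.toDual_symm_apply], h.2.eq_of_nhds⟩

open InnerProductSpace in
lemma HasLap.le_setAverage (hd : 0 < d) {f : Space d → ℝ} {x : Space d} {r : ℝ} (hr : 0 < r)
    (hf : ContinuousOn f (closedBall x r))
    (h : ∀ y ∈ ball x r, ∃ g l, HasLap f y g l ∧ 0 ≤ l) : f x ≤ ⨍ y in closedBall x r, f y := by
  refine le_of_forall_pos_le_add fun ε hε => ?_
  -- The quadratic κ|y - x|² makes the Laplacian strictly positive and is at most `ε` on the ball.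
  set κ := ε / r ^ 2 with hκ
  have hκ0 : 0 < κ := by positivity
  have hcont : ContinuousOn (fun y => κ * ‖y - x‖ ^ 2 + 0) (closedBall x r) := by fun_prop
  have h1 := le_setAverage_of_subMeanAt hd (f := fun y => f y + (κ * ‖y - x‖ ^ 2 + 0)) hr
    (hf.add hcont) fun y hy => by
      obtain ⟨g, l, hg, hl⟩ := h y hy
      exact hg.subMeanAt_add_normSq hd hl hκ0 x 0
  rw [setAverage_closedBall_add hf.integrableOn_closedBall hcont.integrableOn_closedBall] at h1
  have h2 : ⨍ y in closedBall x r, (κ * ‖y - x‖ ^ 2 + 0) ≤ ε := by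
    rw [← setAverage_closedBall_const x hr ε]
    refine setAverage_closedBall_mono hcont.integrableOn_closedBall
      continuousOn_const.integrableOn_closedBall fun y hy => ?_
    rw [add_zero]
    rw [mem_closedBall, dist_eq_norm] at hy
    calc κ * ‖y - x‖ ^ 2 ≤ κ * r ^ 2 := by gcongr
      _ = ε := by rw [hκ]; field_simp
  simp only [sub_self, norm_zero] at h1
  linarith [h1]

open InnerProductSpace in
lemma _root_.InnerProductSpace.HarmonicAt.neg' {f : Space d → ℝ} {x : Space d}
    (h : HarmonicAt f x) : HasLap (fun y => -f y) x (-gradient f x) 0 :=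
  (h.hasLap.const_mul (-1)).congr (fun y => by ring) (by simp) (by simp)

open InnerProductSpace in
theorem subharmonicIn_of_harmonicOnNhd (hd : 0 < d) {A : Set (Space d)} {f : Space d → ℝ}
    (h : HarmonicOnNhd f A) : SubharmonicIn A f :=
  ⟨h.continuousOn, fun _ _ hr hB => HasLap.le_setAverage hd hr (h.continuousOn.mono hB)
    fun y hy => ⟨_, _, (h y (hB (ball_subset_closedBall hy))).hasLap, le_refl _⟩⟩

open InnerProductSpace in
theorem superharmonicIn_of_harmonicOnNhd (hd : 0 < d) {A : Set (Space d)} {f : Space d → ℝ}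
    (h : HarmonicOnNhd f A) : SuperharmonicIn A f :=
  superharmonicIn_iff_neg.2
    ⟨h.continuousOn.neg, fun _ _ hr hB => HasLap.le_setAverage hd hr (h.continuousOn.neg.mono hB)
      fun y hy => ⟨_, _, (h y (hB (ball_subset_closedBall hy))).neg', le_refl _⟩⟩

/-- Comparison of a function with the sub-mean-value property with a Dirichlet solution. -/
theorem PolyApprox.le_of_subMeanAt (hd : 0 < d) {c : Space d} {ρ : ℝ} (hρ : 0 < ρ)
    {h f : Space d → ℝ} (H : PolyApprox c ρ h) (hf : ContinuousOn f (closedBall c ρ))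
    (hs : ∀ x ∈ ball c ρ, h x < f x → SubMeanAt f x) (hfr : ∀ x ∈ sphere c ρ, f x ≤ h x) :
    ∀ x ∈ closedBall c ρ, f x ≤ h x := by
  intro x hx
  rw [← closure_ball c hρ.ne'] at hx
  have := nonpos_of_subMeanAt hd isOpen_ball isBounded_ball (f := fun x => f x + -h x)
    (by rw [closure_ball c hρ.ne']; exact (hf.add H.continuousOn.neg).upperSemicontinuousOn)
    (fun y hy hpos => (hs y hy (by linarith)).add (H.neg.subMeanAt hd hy)
      (eventually_integrableOn_closedBall (closedBall_mem_nhds_of_mem hy) hf)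
      (eventually_integrableOn_closedBall (closedBall_mem_nhds_of_mem hy) H.neg.continuousOn))
    (fun y hy => by
      rw [frontier_ball c hρ.ne'] at hy
      linarith [hfr y hy]) x hx
  linarith

theorem PolyApprox.ge_of_subMeanAt_neg (hd : 0 < d) {c : Space d} {ρ : ℝ} (hρ : 0 < ρ)
    {h f : Space d → ℝ} (H : PolyApprox c ρ h) (hf : ContinuousOn f (closedBall c ρ))
    (hs : ∀ x ∈ ball c ρ, f x < h x → SubMeanAt (fun y => -f y) x)
    (hfr : ∀ x ∈ sphere c ρ, h x ≤ f x) : ∀ x ∈ closedBall c ρ, h x ≤ f x := by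
  intro x hx
  have := H.neg.le_of_subMeanAt hd hρ (f := fun y => -f y) hf.neg
    (fun y hy hlt => hs y hy (by linarith)) (fun y hy => by linarith [hfr y hy]) x hx
  linarith

/-! ### Radial barriers -/

/-- The radial function `|x - P|^{-2d}`. -/
noncomputable def radialBarrier (P x : Space d) : ℝ := (‖x - P‖ ^ 2) ^ (-(d : ℤ))

/-- The exponent -2d takes the place of the fundamental solution. It is strictly subharmonic off `P`
in every dimension d ≥ 1, so neither the logarithmic case d = 2 nor the case d = 1 is special. -/
lemma exists_hasLap_radialBarrier (hd : 0 < d) {P x : Space d} (hx : x ≠ P) :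
    ∃ l > 0, HasLap (radialBarrier P) x
      ((-(2 * d * (‖x - P‖ ^ 2) ^ (-(d : ℤ) - 1))) • (x - P)) l := by
  have hd' : (0 : ℝ) < d := by exact_mod_cast hd
  have hs : 0 < ‖x - P‖ ^ 2 := by
    have := norm_pos_iff.2 (sub_ne_zero.2 hx); positivity
  set s := ‖x - P‖ ^ 2 with hsdef
  have h := (hasLap_normSq_sub P x).comp (q := fun s => s ^ (-(d : ℤ)))
    (q' := fun s => ((-(d : ℤ) : ℤ) : ℝ) * s ^ (-(d : ℤ) - 1))
    (q'' := ((-(d : ℤ) : ℤ) : ℝ) * (((-(d : ℤ) - 1 : ℤ) : ℝ) * s ^ (-(d : ℤ) - 1 - 1)))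
    (by
      filter_upwards [lt_mem_nhds hs] with y hy
      exact hasDerivAt_zpow _ _ (Or.inl hy.ne'))
    ((hasDerivAt_zpow _ _ (Or.inl hs.ne')).const_mul _)
    (by
      simp only [zpow_neg, zpow_natCast]
      exact (contDiffAt_id.pow d).inv (pow_ne_zero d hs.ne'))
  refine ⟨(2 * d ^ 2 + 4 * d) * s ^ (-(d : ℤ) - 1), by positivity,
    h.congr (fun _ => rfl) ?_ ?_⟩
  · rw [smul_smul, ← hsdef]
    congr 1
    push_cast; ring
  · have e1 : s ^ (-(d : ℤ) - 1 - 1) = s ^ (-(d : ℤ) - 1) / s := by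
      rw [zpow_sub_one₀ hs.ne' (-(d : ℤ) - 1)]; rfl
    have e2 : ‖(2 : ℝ) • (x - P)‖ ^ 2 = 4 * s := by
      rw [norm_smul, mul_pow, hsdef]; norm_num
    rw [← hsdef, e1, e2]
    push_cast
    field_simp
    ring

lemma radialBarrier_eq {P x : Space d} {r : ℝ} (h : ‖x - P‖ = r) :
    radialBarrier P x = (r ^ 2) ^ (-(d : ℤ)) := by rw [radialBarrier, h]

lemma continuousOn_radialBarrier (P : Space d) : ContinuousOn (radialBarrier P) {P}ᶜ := by
  intro x hx
  have hx' : x ≠ P := hx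
  have : ‖x - P‖ ^ 2 ≠ 0 := by
    have := norm_pos_iff.2 (sub_ne_zero.2 hx'); positivity
  unfold radialBarrier
  have hc : ContinuousAt (fun x => ‖x - P‖ ^ 2) x := by fun_prop
  exact (hc.zpow₀ _ (Or.inl this)).continuousWithinAt

/-- Bernoulli's inequality for negative powers. -/
lemma le_zpow_neg_sub_one (n : ℕ) {s : ℝ} (hs : 0 < s) (hs1 : s ≤ 1) :
    n * (1 - s) ≤ s ^ (-(n : ℤ)) - 1 := by
  have h1 : 1 ≤ s⁻¹ := (one_le_inv₀ hs).2 hs1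
  have h2 := one_add_mul_le_pow (a := s⁻¹ - 1) (by linarith) n
  have h3 : s ^ (-(n : ℤ)) = s⁻¹ ^ n := by simp
  have h4 : 1 - s ≤ s⁻¹ - 1 := by
    have : s * s⁻¹ = 1 := mul_inv_cancel₀ hs.ne'
    nlinarith [sq_nonneg (s - 1)]
  have h5 : (n : ℝ) * (1 - s) ≤ n * (s⁻¹ - 1) := by gcongr
  rw [h3]
  have h6 : 1 + (s⁻¹ - 1) = s⁻¹ := by ring
  rw [h6] at h2
  linarith

/-- The constant of the Hopf lemma on annuli with ratio `k` of the radii. -/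
noncomputable def hopfConst (d : ℕ) (k : ℝ) : ℝ := d / ((k ^ 2) ^ d - 1)

lemma hopfConst_pos (hd : 0 < d) {k : ℝ} (hk : 1 < k) : 0 < hopfConst d k := by
  have hd' : (0 : ℝ) < d := by exact_mod_cast hd
  have : 1 < (k ^ 2) ^ d := one_lt_pow₀ (by nlinarith) hd.ne'
  exact div_pos hd' (by linarith)

/-- Quantitative Hopf lemma. -/
theorem hopf_lower_bound (hd : 0 < d) {f : Space d → ℝ} {P : Space d} {σ ρ m : ℝ} (hσ : 0 < σ)
    (hρ : σ < ρ) (hm : 0 ≤ m) (hf : LowerSemicontinuousOn f (closedBall P ρ))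
    (hi : IntegrableOn f (closedBall P ρ)) (h0 : ∀ x ∈ sphere P ρ, 0 ≤ f x)
    (hfm : ∀ x ∈ sphere P σ, m ≤ f x)
    (hs : ∀ x ∈ ball P ρ, σ < ‖x - P‖ → SubMeanAt (fun y => -f y) x) :
    ∀ x ∈ closedBall P ρ, σ ≤ ‖x - P‖ →
      m * hopfConst d (ρ / σ) * (1 - ‖x - P‖ ^ 2 / ρ ^ 2) ≤ f x := by
  have hρ0 : 0 < ρ := hσ.trans hρ
  have hd' : (0 : ℝ) < d := by exact_mod_cast hd
  set Kσ := (σ ^ 2) ^ (-(d : ℤ)) with hKσ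
  set Kρ := (ρ ^ 2) ^ (-(d : ℤ)) with hKρ
  have hKρ0 : 0 < Kρ := by positivity
  have hratio : Kσ = Kρ * ((ρ / σ) ^ 2) ^ d := by
    rw [hKσ, hKρ, zpow_neg, zpow_neg, zpow_natCast, zpow_natCast, div_pow, div_pow]
    field_simp
  have hk1 : 1 < ((ρ / σ) ^ 2) ^ d :=
    one_lt_pow₀ (one_lt_pow₀ ((one_lt_div hσ).2 hρ) (by norm_num)) hd.ne'
  have hKK : 0 < Kσ - Kρ := by rw [hratio]; nlinarith
  set D : Set (Space d) := ball P ρ \ closedBall P σ with hD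
  have hDo : IsOpen D := isOpen_ball.sdiff isClosed_closedBall
  have hDcl : closure D ⊆ {x | σ ≤ ‖x - P‖} ∩ closedBall P ρ := by
    refine closure_minimal (fun x hx => ⟨?_, ball_subset_closedBall hx.1⟩)
      (((isClosed_le continuous_const (by fun_prop))).inter isClosed_closedBall)
    have := hx.2
    rw [mem_closedBall, dist_eq_norm, not_le] at this
    exact this.le
  have hne : ∀ x ∈ closure D, x ≠ P := by
    rintro x hx rfl
    have h : σ ≤ ‖x - x‖ := (hDcl hx).1
    rw [sub_self, norm_zero] at h
    linarith
  -- Normalization: the barrier equals `m` on the inner sphere and 0 on the outer one.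
  set A := m / (Kσ - Kρ) with hA
  have hA0 : 0 ≤ A := by positivity
  have hmain : ∀ x ∈ closure D, (A * (radialBarrier P x - Kρ)) + -f x ≤ 0 := by
    refine nonpos_of_subMeanAt_add_normSq hd hDo (isBounded_ball.subset sdiff_subset) ?_ P ?_ ?_
    · have h1 : ContinuousOn (fun x => A * (radialBarrier P x - Kρ)) (closure D) :=
        continuousOn_const.mul (((continuousOn_radialBarrier P).mono
          fun x hx => hne x hx).sub continuousOn_const)
      have h2 : UpperSemicontinuousOn (fun x => -f x) (closure D) :=
        (hf.neg).mono fun x hx => (hDcl hx).2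
      exact h1.upperSemicontinuousOn.add h2
    · intro ε hε b x hx _
      obtain ⟨l, hl, hlap⟩ := exists_hasLap_radialBarrier hd (hne x (subset_closure hx))
      have h1 := ((hlap.add (hasLap_const (-Kρ) x)).const_mul A).subMeanAt_add_normSq hd
        (by positivity) hε P b
      have hx2 := hx.2
      rw [mem_closedBall, dist_eq_norm, not_le] at hx2
      have h2 := hs x hx.1 hx2
      have hDn : D ∈ 𝓝 x := hDo.mem_nhds hx
      have hc1 : ContinuousOn (fun y => A * (radialBarrier P y + -Kρ) + (ε * ‖y - P‖ ^ 2 + b)) D :=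
        (continuousOn_const.mul (((continuousOn_radialBarrier P).mono
          fun x hx => hne x (subset_closure hx)).add continuousOn_const)).add (by fun_prop)
      refine (h1.add h2 (eventually_integrableOn_closedBall hDn hc1) ?_).congr
        (Eventually.of_forall fun y => by ring)
      filter_upwards [eventually_closedBall_subset (isOpen_ball.mem_nhds hx.1)] with r hr
      exact (hi.mono_set (hr.trans ball_subset_closedBall)).neg
    · intro x hx
      have hx1 := hDcl hx.1
      have hx2 : x ∉ D := by rw [← hDo.interior_eq]; exact hx.2
      have hx1' : σ ≤ ‖x - P‖ := hx1.1
      rcases hx1'.eq_or_lt with h | h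
      · have h3 := hfm x (mem_sphere_iff_norm.2 h.symm)
        rw [radialBarrier_eq h.symm, ← hKσ, hA, div_mul_cancel₀ _ hKK.ne']
        linarith
      · have h3 : ‖x - P‖ = ρ := by
          by_contra hcon
          refine hx2 ⟨?_, ?_⟩
          · rw [mem_ball, dist_eq_norm]
            exact lt_of_le_of_ne (by simpa [dist_eq_norm] using hx1.2) hcon
          · rw [mem_closedBall, dist_eq_norm, not_le]; exact h
        rw [radialBarrier_eq h3, ← hKρ, sub_self, mul_zero, zero_add]
        linarith [h0 x (mem_sphere_iff_norm.2 h3)]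
  intro x hx hσx
  have hxP : ‖x - P‖ ≤ ρ := by simpa [dist_eq_norm] using hx
  have hxpos : 0 < ‖x - P‖ := hσ.trans_le hσx
  have hlow : A * (radialBarrier P x - Kρ) ≤ f x := by
    rcases hσx.eq_or_lt with h | h
    · have h3 := hfm x (mem_sphere_iff_norm.2 h.symm)
      rw [radialBarrier_eq h.symm, ← hKσ, hA, div_mul_cancel₀ _ hKK.ne']
      exact h3
    · rcases hxP.eq_or_lt with h' | h'
      · rw [radialBarrier_eq h', ← hKρ, sub_self, mul_zero]
        exact h0 x (mem_sphere_iff_norm.2 h')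
      · have := hmain x (subset_closure ⟨by rwa [mem_ball, dist_eq_norm], by
          rw [mem_closedBall, dist_eq_norm, not_le]; exact h⟩)
        linarith
  refine le_trans ?_ hlow
  have hs1 : ‖x - P‖ ^ 2 / ρ ^ 2 ≤ 1 := by
    rw [div_le_one (by positivity)]; gcongr
  -- Bernoulli's inequality replaces the negative power by the quadratic profile 1 - |x - P|²/ρ²,
  -- whose gradient on the outer sphere is easy to read off. The remaining factor is `hopfConst`.
  have hb := le_zpow_neg_sub_one d (s := ‖x - P‖ ^ 2 / ρ ^ 2) (by positivity) hs1
  have e1 : radialBarrier P x - Kρ = Kρ * ((‖x - P‖ ^ 2 / ρ ^ 2) ^ (-(d : ℤ)) - 1) := by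
    rw [radialBarrier, hKρ, div_zpow]
    have : (ρ ^ 2) ^ (-(d : ℤ)) ≠ 0 := by positivity
    field_simp
  have e2 : A * Kρ = m / (((ρ / σ) ^ 2) ^ d - 1) := by
    rw [hA, hratio]
    have : ((ρ / σ) ^ 2) ^ d - 1 ≠ 0 := by linarith
    have h2 : Kρ * ((ρ / σ) ^ 2) ^ d - Kρ ≠ 0 := by rw [← hratio]; exact hKK.ne'
    field_simp
  rw [e1, ← mul_assoc, e2, hopfConst, mul_div_assoc', div_mul_eq_mul_div, div_mul_eq_mul_div,
    mul_assoc]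
  have : 0 < ((ρ / σ) ^ 2) ^ d - 1 := by linarith
  gcongr

/-- Comparison of averages of a non-negative function over nested balls. -/
lemma setAverage_closedBall_ge_of_subset {f : Space d → ℝ} {x y : Space d} {s r : ℝ} (hs : 0 < s)
    (hr : 0 < r) (hsub : closedBall x s ⊆ closedBall y r) (hi : IntegrableOn f (closedBall y r))
    (h0 : ∀ z ∈ closedBall y r, 0 ≤ f z) :
    (s / r) ^ d * ⨍ z in closedBall x s, f z ≤ ⨍ z in closedBall y r, f z := by
  have hvol : ∀ (z : Space d) (t : ℝ), 0 < t → (volume : Measure (Space d)).real (closedBall z t) =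
      t ^ d * (volume : Measure (Space d)).real (ball 0 1) := by
    intro z t ht
    rw [measureReal_def, Measure.addHaar_closedBall _ _ ht.le, ENNReal.toReal_mul,
      ENNReal.toReal_ofReal (by positivity), finrank_euclideanSpace_fin, measureReal_def]
  have hω : 0 < (volume : Measure (Space d)).real (ball (0 : Space d) 1) :=
    ENNReal.toReal_pos (measure_ball_pos _ _ one_pos).ne' measure_ball_lt_top.ne
  have h1 : ∫ z in closedBall x s, f z ≤ ∫ z in closedBall y r, f z :=
    setIntegral_mono_set hi ((ae_restrict_iff' measurableSet_closedBall).2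
      (Eventually.of_forall h0)) hsub.eventuallyLE
  simp only [setAverage_eq, smul_eq_mul, hvol x s hs, hvol y r hr]
  rw [div_pow, ← mul_assoc]
  have e : s ^ d / r ^ d * (s ^ d * (volume : Measure (Space d)).real (ball 0 1))⁻¹ =
      (r ^ d * (volume : Measure (Space d)).real (ball 0 1))⁻¹ := by
    field_simp
  rw [e]
  gcongr

/-- Weak Harnack inequality for non-negative functions with the super-mean-value property. -/
lemma SuperharmonicIn.harnack {A : Set (Space d)} {f : Space d → ℝ} (hf : SuperharmonicIn A f)
    {x y : Space d} {r : ℝ} (hr : 0 < r) (hxy : dist y x ≤ r) (hsub : closedBall y (2 * r) ⊆ A)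
    (h0 : ∀ z ∈ closedBall y (2 * r), 0 ≤ f z) :
    (1 / 2) ^ d * ⨍ z in closedBall x r, f z ≤ f y := by
  have h1 := setAverage_closedBall_ge_of_subset hr (by positivity : 0 < 2 * r)
    (closedBall_subset_closedBall' (by rw [dist_comm]; linarith) :
      closedBall x r ⊆ closedBall y (2 * r))
    (hf.1.mono hsub).integrableOn_closedBall h0
  have h2 : r / (2 * r) = 1 / 2 := by field_simp
  rw [h2] at h1
  exact h1.trans (hf.2 y (2 * r) (by positivity) hsub)

/-! ### Local description of wet regions and free boundaries -/

lemma eventually_mem_closure {U : Set (Space d)} (hU : IsOpen U) {x : Space d} (hx : x ∈ U) :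
    ∀ᶠ y in 𝓝 x, y ∈ closure U :=
  mem_of_superset (hU.mem_nhds hx) subset_closure

lemma mem_closure_wet_iff {U : Set (Space d)} (hU : IsOpen U) {x : Space d} (hx : x ∈ U)
    {v : Space d → ℝ} : x ∈ closure (wet U v) ↔ ∃ᶠ y in 𝓝 x, 0 < v y := by
  rw [mem_closure_iff_frequently]
  refine ⟨fun h => h.mono fun y hy => hy.2, fun h => ?_⟩
  exact (h.and_eventually (eventually_mem_closure hU hx)).mono fun y hy => ⟨hy.2, hy.1⟩

lemma mem_interior_wet_iff {U : Set (Space d)} (hU : IsOpen U) {x : Space d} (hx : x ∈ U)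
    {v : Space d → ℝ} : x ∈ interior (wet U v) ↔ ∀ᶠ y in 𝓝 x, 0 < v y := by
  rw [mem_interior_iff_mem_nhds]
  refine ⟨fun h => mem_of_superset h fun y hy => hy.2, fun h => ?_⟩
  filter_upwards [h, eventually_mem_closure hU hx] with y h1 h2 using ⟨h2, h1⟩

lemma mem_freeBoundary_iff_frequently {U : Set (Space d)} (hU : IsOpen U) {x : Space d}
    {v : Space d → ℝ} : x ∈ freeBoundary U v ↔
      x ∈ U ∧ (∃ᶠ y in 𝓝 x, 0 < v y) ∧ ¬ ∀ᶠ y in 𝓝 x, 0 < v y := by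
  constructor
  · rintro ⟨⟨h1, h2⟩, hx⟩
    exact ⟨hx, (mem_closure_wet_iff hU hx).1 h1, fun h => h2 ((mem_interior_wet_iff hU hx).2 h)⟩
  · rintro ⟨hx, h1, h2⟩
    exact ⟨⟨(mem_closure_wet_iff hU hx).2 h1, fun h => h2 ((mem_interior_wet_iff hU hx).1 h)⟩, hx⟩

lemma mem_freeBoundary_congr {U : Set (Space d)} (hU : IsOpen U) {x : Space d}
    {v v' : Space d → ℝ} (h : v =ᶠ[𝓝 x] v') : x ∈ freeBoundary U v ↔ x ∈ freeBoundary U v' := by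
  have h' : ∀ᶠ y in 𝓝 x, (0 < v y ↔ 0 < v' y) := h.mono fun y hy => by rw [hy]
  rw [mem_freeBoundary_iff_frequently hU, mem_freeBoundary_iff_frequently hU,
    frequently_congr h', eventually_congr h']

lemma IsState.continuousAt {U : Set (Space d)} (hU : IsOpen U) {v : Space d → ℝ}
    (hv : IsState U v) {x : Space d} (hx : x ∈ U) : ContinuousAt v x :=
  hv.continuousOn.continuousAt (eventually_mem_closure hU hx)

lemma IsState.isOpen_wet_inter {U : Set (Space d)} (hU : IsOpen U) {v : Space d → ℝ}
    (hv : IsState U v) : IsOpen (wet U v ∩ U) := by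
  rw [isOpen_iff_mem_nhds]
  rintro x ⟨hx, hxU⟩
  filter_upwards [(hv.continuousAt hU hxU).eventually (lt_mem_nhds hx.2), hU.mem_nhds hxU]
    with y h1 h2
  exact ⟨⟨subset_closure h2, h1⟩, h2⟩

lemma IsState.mem_freeBoundary_iff {U : Set (Space d)} (hU : IsOpen U) {v : Space d → ℝ}
    (hv : IsState U v) {x : Space d} : x ∈ freeBoundary U v ↔
      x ∈ U ∧ v x = 0 ∧ ∃ᶠ y in 𝓝 x, 0 < v y := by
  rw [mem_freeBoundary_iff_frequently hU]
  refine and_congr_right fun hx => ?_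
  have h0 := hv.nonneg x (subset_closure hx)
  refine ⟨fun h => ⟨?_, h.1⟩, fun h => ⟨h.2, fun h2 => h2.self_of_nhds.ne' h.1⟩⟩
  by_contra hne
  exact h.2 ((hv.continuousAt hU hx).eventually (lt_mem_nhds (lt_of_le_of_ne h0 (Ne.symm hne))))

/-- Lowering the function shrinks both its values and the set on which the inequality is tested. As
`superDiff` compares with 0 rather than with the value at the point, no equality `v x = v' x` is
needed. -/
lemma superDiff_subset_of_le {U : Set (Space d)} (hU : IsOpen U) {x : Space d} (hx : x ∈ U)
    {v v' : Space d → ℝ} (h : ∀ᶠ y in 𝓝 x, v' y ≤ v y) : superDiff U v x ⊆ superDiff U v' x := by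
  intro p hp ε hε
  have h1 := eventually_nhdsWithin_iff.1 (hp ε hε)
  rw [eventually_nhdsWithin_iff]
  filter_upwards [h1, h, h.eventually_nhds, hU.mem_nhds hx] with y hy1 hy2 hy3 hyU hy4
  refine hy2.trans (hy1 ?_)
  rw [mem_closure_wet_iff hU hyU] at hy4 ⊢
  exact (hy4.and_eventually hy3).mono fun z hz => hz.1.trans_le hz.2

lemma subDiff_subset_of_le {x : Space d} {v v' : Space d → ℝ} (h : ∀ᶠ y in 𝓝 x, v' y ≤ v y) :
    subDiff v' x ⊆ subDiff v x := by
  intro p hp ε hε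
  filter_upwards [hp ε hε, h] with y h1 h2 using h1.trans h2

lemma _root_.HasFDerivAt.eventually_abs_sub_le {φ : Space d → ℝ} {x g : Space d}
    (h : HasFDerivAt φ (innerSL ℝ g : Space d →L[ℝ] ℝ) x) {ε : ℝ} (hε : 0 < ε) :
    ∀ᶠ y in 𝓝 x, |φ y - φ x - inner ℝ g (y - x)| ≤ ε * ‖y - x‖ :=
  (h.isLittleO.def hε).mono fun _ hy => hy

lemma mem_subDiff_of_touch {φ v : Space d → ℝ} {x g : Space d}
    (h : HasFDerivAt φ (innerSL ℝ g : Space d →L[ℝ] ℝ) x) (hφ : φ x = 0)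
    (hle : ∀ᶠ y in 𝓝 x, φ y ≤ v y) : g ∈ subDiff v x := by
  intro ε hε
  filter_upwards [h.eventually_abs_sub_le hε, hle] with y h1 h2
  have := (abs_le.1 h1).1
  linarith

lemma tendsto_add_smul_nhdsGT (x p : Space d) :
    Tendsto (fun t : ℝ => x + t • p) (𝓝[>] 0) (𝓝 x) := by
  have : Tendsto (fun t : ℝ => x + t • p) (𝓝 0) (𝓝 (x + (0 : ℝ) • p)) :=
    (by fun_prop : Continuous fun t : ℝ => x + t • p).tendsto 0
  rw [zero_smul, add_zero] at this
  exact this.mono_left nhdsWithin_le_nhds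

/-- The subdifferential inequality is tested along the ray from `x` in the direction `p`. -/
lemma norm_le_of_mem_subDiff {f : Space d → ℝ} {x p : Space d} {k : ℝ} (hp : p ∈ subDiff f x)
    (hk : ∀ ε > 0, ∀ᶠ y in 𝓝 x, f y ≤ (k + ε) * ‖y - x‖) (hk0 : 0 ≤ k) : ‖p‖ ≤ k := by
  rcases eq_or_ne p 0 with rfl | hp0
  · simpa using hk0
  have hpn : 0 < ‖p‖ := norm_pos_iff.2 hp0
  refine le_of_forall_pos_le_add fun ε hε => ?_
  have h1 := (hp (ε / 2) (half_pos hε)).and (hk (ε / 2) (half_pos hε))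
  obtain ⟨t, ⟨h2, h3⟩, ht⟩ :=
    (((tendsto_add_smul_nhdsGT x p).eventually h1).and self_mem_nhdsWithin).exists
  have ht0 : (0 : ℝ) < t := ht
  rw [add_sub_cancel_left, real_inner_smul_right, real_inner_self_eq_norm_sq, norm_smul,
    Real.norm_of_nonneg ht0.le] at h2
  rw [add_sub_cancel_left, norm_smul, Real.norm_of_nonneg ht0.le] at h3
  have h4 : (t * ‖p‖) * ‖p‖ ≤ (t * ‖p‖) * (k + ε) := by nlinarith
  exact le_of_mul_le_mul_left h4 (by positivity)

/-- The ray from `x` in the direction `g` enters {φ > 0} and therefore the wet region of `v`, where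
the superdifferential inequality is available. Comparing the two expansions along this ray bounds
`‖g‖`. -/
lemma le_norm_of_mem_superDiff {U : Set (Space d)} (hU : IsOpen U) {v φ : Space d → ℝ}
    {x p g : Space d} (hx : x ∈ U) (hp : p ∈ superDiff U v x)
    (h : HasFDerivAt φ (innerSL ℝ g : Space d →L[ℝ] ℝ) x) (hφ : φ x = 0)
    (hle : ∀ᶠ y in 𝓝 x, φ y ≤ v y) : ‖g‖ ≤ ‖p‖ := by
  rcases eq_or_ne g 0 with rfl | hg0
  · simp
  have hgn : 0 < ‖g‖ := norm_pos_iff.2 hg0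
  refine le_of_forall_pos_le_add fun ε' hε' => ?_
  set ε := min (ε' / 2) (‖g‖ / 2) with hε
  have hε0 : 0 < ε := by positivity
  have h1 := ((eventually_nhdsWithin_iff.1 (hp ε hε0)).and (h.eventually_abs_sub_le hε0)).and
    (hle.and (hU.mem_nhds hx))
  obtain ⟨t, ⟨⟨h2, h3⟩, h4, h5⟩, ht⟩ :=
    (((tendsto_add_smul_nhdsGT x g).eventually h1).and self_mem_nhdsWithin).exists
  have ht0 : (0 : ℝ) < t := ht
  rw [add_sub_cancel_left, real_inner_smul_right, real_inner_self_eq_norm_sq, norm_smul,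
    Real.norm_of_nonneg ht0.le, hφ, sub_zero] at h3
  rw [add_sub_cancel_left, real_inner_smul_right, norm_smul, Real.norm_of_nonneg ht0.le] at h2
  have h6 := (abs_le.1 h3).1
  have hε1 : ε ≤ ‖g‖ / 2 := min_le_right _ _
  have hε2 : ε ≤ ε' / 2 := min_le_left _ _
  have htg : 0 < t * ‖g‖ := by positivity
  have h7 : 0 < φ (x + t • g) := by nlinarith
  have h8 := h2 (subset_closure ⟨subset_closure h5, h7.trans_le h4⟩)
  have h9 := real_inner_le_norm p g
  have h10 : (t * ‖g‖) * ‖g‖ ≤ (t * ‖g‖) * (‖p‖ + ε') := by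
    have := mul_le_mul_of_nonneg_left h9 ht0.le
    nlinarith
  exact le_of_mul_le_mul_left h10 htg

lemma mem_superDiff_of_touch {U : Set (Space d)} {φ v : Space d → ℝ} {x g : Space d}
    (h : HasFDerivAt φ (innerSL ℝ g : Space d →L[ℝ] ℝ) x) (hφ : φ x = 0)
    (hle : ∀ᶠ y in 𝓝[closure (wet U v)] x, v y ≤ φ y) : g ∈ superDiff U v x := by
  intro ε hε
  filter_upwards [nhdsWithin_le_nhds (h.eventually_abs_sub_le hε), hle] with y h1 h2
  have := (abs_le.1 h1).2
  linarith

/-! ### Gluing -/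

lemma IsState.integrable_near {U : Set (Space d)} (hU : IsOpen U) {v : Space d → ℝ}
    (hv : IsState U v) {x : Space d} (hx : x ∈ U) :
    ∀ᶠ r in 𝓝[>] (0 : ℝ), IntegrableOn v (closedBall x r) :=
  eventually_integrableOn_closedBall (eventually_mem_closure hU hx) hv.continuousOn

lemma eventually_integrableOn_neg {v : Space d → ℝ} {x : Space d}
    (h : ∀ᶠ r in 𝓝[>] (0 : ℝ), IntegrableOn v (closedBall x r)) :
    ∀ᶠ r in 𝓝[>] (0 : ℝ), IntegrableOn (fun y => -v y) (closedBall x r) :=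
  h.mono fun _ hr => hr.neg

lemma IsSupersolution.of_local (hd : 0 < d) {U : Set (Space d)} {μp : ℝ} {v : Space d → ℝ}
    (hs : IsState U v) (hm : ∀ x ∈ U, 0 < v x → SubMeanAt (fun y => -v y) x)
    (hl : ∀ x ∈ freeBoundary U v, ∀ p ∈ subDiff v x, ‖p‖ ^ 2 ≤ 1 + μp) :
    IsSupersolution U μp v :=
  ⟨hs, superharmonicIn_of_subMeanAt_neg hd
    (hs.continuousOn.mono (inter_subset_right.trans subset_closure)) fun x hx => hm x hx.2 hx.1.2,
    hl⟩

lemma IsSubsolution.of_local (hd : 0 < d) {U : Set (Space d)} {μm : ℝ} {v : Space d → ℝ}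
    (hs : IsState U v) (hm : ∀ x ∈ U, 0 < v x → SubMeanAt v x)
    (hl : ∀ x ∈ freeBoundary U v, ∀ p ∈ superDiff U v x, 1 - μm ≤ ‖p‖ ^ 2) :
    IsSubsolution U μm v :=
  ⟨hs, subharmonicIn_of_subMeanAt hd
    (hs.continuousOn.mono (inter_subset_right.trans subset_closure)) fun x hx => hm x hx.2 hx.1.2,
    hl⟩

lemma IsSupersolution.subMeanAt_neg {U : Set (Space d)} (hU : IsOpen U) {μp : ℝ}
    {v : Space d → ℝ} (hv : IsSupersolution U μp v) {x : Space d} (hx : x ∈ U) (h : 0 < v x) :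
    SubMeanAt (fun y => -v y) x :=
  hv.superharmonic.subMeanAt_neg
    ((hv.state.isOpen_wet_inter hU).mem_nhds ⟨⟨subset_closure hx, h⟩, hx⟩)

lemma IsSubsolution.subMeanAt {U : Set (Space d)} (hU : IsOpen U) {μm : ℝ}
    {v : Space d → ℝ} (hv : IsSubsolution U μm v) {x : Space d} (hx : x ∈ U) (h : 0 < v x) :
    SubMeanAt v x :=
  hv.subharmonic.subMeanAt
    ((hv.state.isOpen_wet_inter hU).mem_nhds ⟨⟨subset_closure hx, h⟩, hx⟩)

open scoped Classical in
/-- The function that equals `w` in a set and `v` outside. -/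
noncomputable def glue (B : Set (Space d)) (w v : Space d → ℝ) (x : Space d) : ℝ :=
  if x ∈ B then w x else v x

lemma glue_of_mem {B : Set (Space d)} {w v : Space d → ℝ} {x : Space d} (h : x ∈ B) :
    glue B w v x = w x := if_pos h

lemma glue_of_notMem {B : Set (Space d)} {w v : Space d → ℝ} {x : Space d} (h : x ∉ B) :
    glue B w v x = v x := if_neg h

lemma glue_eventuallyEq {B : Set (Space d)} (hB : IsOpen B) {w v : Space d → ℝ} {x : Space d}
    (h : x ∈ B) : glue B w v =ᶠ[𝓝 x] w := by
  filter_upwards [hB.mem_nhds h] with y hy using glue_of_mem hy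

lemma glue_ball_eventuallyEq {x₀ : Space d} {r : ℝ} {w v : Space d → ℝ}
    (h : ∀ x ∈ sphere x₀ r, ∀ᶠ y in 𝓝 x, w y = v y) {x : Space d} (hx : x ∉ ball x₀ r) :
    glue (ball x₀ r) w v =ᶠ[𝓝 x] v := by
  by_cases hs : x ∈ sphere x₀ r
  · filter_upwards [h x hs] with y hy
    by_cases hy' : y ∈ ball x₀ r
    · rw [glue_of_mem hy', hy]
    · rw [glue_of_notMem hy']
  · have : x ∈ (closedBall x₀ r)ᶜ := by
      rw [mem_compl_iff, ← ball_union_sphere]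
      exact fun h => h.elim hx hs
    filter_upwards [isClosed_closedBall.isOpen_compl.mem_nhds this] with y hy
    exact glue_of_notMem fun h => hy (ball_subset_closedBall h)

lemma isState_glue {U : Set (Space d)} {x₀ : Space d} {r : ℝ} {w v : Space d → ℝ}
    (hv : IsState U v) (hw : ∀ x ∈ ball x₀ r, ContinuousAt w x) (hw0 : ∀ x ∈ ball x₀ r, 0 ≤ w x)
    (h : ∀ x ∈ sphere x₀ r, ∀ᶠ y in 𝓝 x, w y = v y) : IsState U (glue (ball x₀ r) w v) := by
  refine ⟨fun x hx => ?_, fun x hx => ?_⟩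
  · by_cases hB : x ∈ ball x₀ r
    · exact ((hw x hB).congr (glue_eventuallyEq isOpen_ball hB).symm).continuousWithinAt
    · have := glue_ball_eventuallyEq h hB
      exact (hv.continuousOn x hx).congr_of_eventuallyEq (this.filter_mono nhdsWithin_le_nhds)
        this.eq_of_nhds
  · by_cases hB : x ∈ ball x₀ r
    · rw [glue_of_mem hB]; exact hw0 x hB
    · rw [glue_of_notMem hB]; exact hv.nonneg x hx

/-- Minima of supersolutions are supersolutions. At a free boundary point inside the ball there are
three cases. If φ < 0, the glued function vanishes nearby, so this cannot occur. If φ = 0, a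
subdifferential is at most |∇φ|. If φ > 0, then v vanishes and lies above the glued function. The
strict inequality on the sphere is needed only on the closure of the wet region, as elsewhere v
vanishes nearby and the minimum is v automatically. -/
theorem IsSupersolution.glue_min (hd : 0 < d) {U : Set (Space d)} (hU : IsOpen U) {μp : ℝ}
    {v φ : Space d → ℝ} (hv : IsSupersolution U μp v) {x₀ : Space d} {r : ℝ}
    (hB : closedBall x₀ r ⊆ U) (hφ : Continuous φ)
    (h1 : ∀ x ∈ sphere x₀ r, x ∈ closure (wet U v) → v x < φ x)
    (h2 : ∀ x ∈ ball x₀ r, 0 < φ x → SubMeanAt (fun y => -φ y) x)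
    (h3 : ∀ x ∈ ball x₀ r, φ x = 0 →
      ∃ g, HasFDerivAt φ (innerSL ℝ g : Space d →L[ℝ] ℝ) x ∧ ‖g‖ ^ 2 ≤ 1 + μp) :
    IsSupersolution U μp (glue (ball x₀ r) (fun y => min (v y) (max (φ y) 0)) v) := by
  have hev : ∀ x ∈ sphere x₀ r, ∀ᶠ y in 𝓝 x, min (v y) (max (φ y) 0) = v y := by
    intro x hx
    have hxU := hB (sphere_subset_closedBall hx)
    by_cases hw : x ∈ closure (wet U v)
    · have := (hv.state.continuousAt hU hxU).eventually_lt hφ.continuousAt (h1 x hx hw)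
      filter_upwards [this] with y hy
      exact min_eq_left (hy.le.trans (le_max_left _ _))
    · rw [mem_closure_wet_iff hU hxU, not_frequently] at hw
      filter_upwards [hw] with y hy
      exact min_eq_left ((not_lt.1 hy).trans (le_max_right _ _))
  have hBU : ∀ x ∈ ball x₀ r, x ∈ U := fun x hx => hB (ball_subset_closedBall hx)
  have hst : IsState U (glue (ball x₀ r) (fun y => min (v y) (max (φ y) 0)) v) :=
    isState_glue hv.state
      (fun x hx => (hv.state.continuousAt hU (hBU x hx)).min
        (hφ.continuousAt.max continuousAt_const))
      (fun x hx => le_min (hv.state.nonneg x (subset_closure (hBU x hx))) (le_max_right _ _)) hev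
  set v' := glue (ball x₀ r) (fun y => min (v y) (max (φ y) 0)) v with hv'
  have hle : ∀ y, v' y ≤ v y := fun y => by
    by_cases hy : y ∈ ball x₀ r
    · rw [hv', glue_of_mem hy]; exact min_le_left _ _
    · rw [hv', glue_of_notMem hy]
  have hci := fun {x : Space d} (hx : x ∈ U) => hst.integrable_near hU hx
  refine IsSupersolution.of_local hd hst (fun x hx hpos => ?_) fun x hx p hp => ?_
  · by_cases hxB : x ∈ ball x₀ r
    · have hx1 : v' x = min (v x) (max (φ x) 0) := glue_of_mem hxB
      have hvpos : 0 < v x := hpos.trans_le (hle x)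
      have hφpos : 0 < φ x := by
        rw [hx1] at hpos
        by_contra hcon
        rw [max_eq_right (not_lt.1 hcon)] at hpos
        exact absurd hpos (not_lt.2 (min_le_right _ _))
      rw [max_eq_left hφpos.le] at hx1
      rcases min_cases (v x) (φ x) with ⟨h, -⟩ | ⟨h, -⟩
      · exact (hv.subMeanAt_neg hU hx hvpos).of_le (by rw [hx1, h])
          (Eventually.of_forall fun y => neg_le_neg (hle y))
          (eventually_integrableOn_neg (hv.state.integrable_near hU hx))
          (eventually_integrableOn_neg (hci hx))
      · refine (h2 x hxB hφpos).of_le (by rw [hx1, h]) ?_ (eventually_integrableOn_neg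
          (eventually_integrableOn_of_continuous hφ x)) (eventually_integrableOn_neg (hci hx))
        filter_upwards [isOpen_ball.mem_nhds hxB, hφ.continuousAt.eventually (lt_mem_nhds hφpos)]
          with y hy hy2
        rw [hv', glue_of_mem hy, max_eq_left (le_of_lt hy2)]
        exact neg_le_neg (min_le_right _ _)
    · have he := glue_ball_eventuallyEq hev hxB
      refine (hv.subMeanAt_neg hU hx (hpos.trans_le (hle x))).congr ?_
      filter_upwards [he] with y hy
      rw [hv', hy]
  · by_cases hxB : x ∈ ball x₀ r
    · rw [hst.mem_freeBoundary_iff hU] at hx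
      obtain ⟨hxU, hx0, hfr⟩ := hx
      have hx1 : v' x = min (v x) (max (φ x) 0) := glue_of_mem hxB
      rcases lt_trichotomy (φ x) 0 with h | h | h
      · exfalso
        refine hfr ?_
        filter_upwards [isOpen_ball.mem_nhds hxB, hφ.continuousAt.eventually (gt_mem_nhds h)]
          with y hy hy2
        rw [not_lt, hv', glue_of_mem hy]
        exact (min_le_right _ _).trans (max_le (le_of_lt hy2) (le_refl 0))
      · obtain ⟨g, hg, hg2⟩ := h3 x hxB h
        have hpg : ‖p‖ ≤ ‖g‖ := by
          refine norm_le_of_mem_subDiff hp (fun ε hε => ?_) (norm_nonneg g)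
          filter_upwards [isOpen_ball.mem_nhds hxB, hg.eventually_abs_sub_le hε] with y hy hy2
          rw [hv', glue_of_mem hy]
          refine (min_le_right _ _).trans (max_le ?_ (by positivity))
          have h4 := (abs_le.1 hy2).2
          have h5 := real_inner_le_norm g (y - x)
          rw [h] at h4
          linarith
        exact le_trans (by gcongr) hg2
      · have hvx : v x = 0 := by
          rw [hx1, max_eq_left h.le] at hx0
          rcases min_cases (v x) (φ x) with ⟨h4, -⟩ | ⟨h4, -⟩
          · rwa [h4] at hx0
          · rw [h4] at hx0; exact absurd hx0 h.ne'
        refine hv.slope_le x ((hv.state.mem_freeBoundary_iff hU).2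
          ⟨hxU, hvx, hfr.mono fun y hy => hy.trans_le (hle y)⟩) p ?_
        exact subDiff_subset_of_le (Eventually.of_forall hle) hp
    · have he := glue_ball_eventuallyEq hev hxB
      refine hv.slope_le x ((mem_freeBoundary_congr hU he).1 hx) p ?_
      exact subDiff_subset_of_le (Eventually.of_forall hle) hp

/-- The dual of `IsSupersolution.glue_min`. No positive part of φ is taken because v ≥ 0 already,
and for the same reason φ < 0 on the sphere is as good as φ < v. -/
theorem IsSubsolution.glue_max (hd : 0 < d) {U : Set (Space d)} (hU : IsOpen U) {μm : ℝ}
    {v φ : Space d → ℝ} (hv : IsSubsolution U μm v) {x₀ : Space d} {r : ℝ}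
    (hB : closedBall x₀ r ⊆ U) (hφ : Continuous φ)
    (h1 : ∀ x ∈ sphere x₀ r, φ x < v x ∨ φ x < 0)
    (h2 : ∀ x ∈ ball x₀ r, 0 < φ x → SubMeanAt φ x)
    (h3 : ∀ x ∈ ball x₀ r, φ x = 0 →
      ∃ g, HasFDerivAt φ (innerSL ℝ g : Space d →L[ℝ] ℝ) x ∧ 1 - μm ≤ ‖g‖ ^ 2) :
    IsSubsolution U μm (glue (ball x₀ r) (fun y => max (v y) (φ y)) v) := by
  have hev : ∀ x ∈ sphere x₀ r, ∀ᶠ y in 𝓝 x, max (v y) (φ y) = v y := by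
    intro x hx
    have hxU := hB (sphere_subset_closedBall hx)
    rcases h1 x hx with h | h
    · filter_upwards [hφ.continuousAt.eventually_lt (hv.state.continuousAt hU hxU) h] with y hy
      exact max_eq_left hy.le
    · filter_upwards [hφ.continuousAt.eventually (gt_mem_nhds h), eventually_mem_closure hU hxU]
        with y hy hyU
      exact max_eq_left ((le_of_lt hy).trans (hv.state.nonneg y hyU))
  have hBU : ∀ x ∈ ball x₀ r, x ∈ U := fun x hx => hB (ball_subset_closedBall hx)
  have hst : IsState U (glue (ball x₀ r) (fun y => max (v y) (φ y)) v) :=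
    isState_glue hv.state
      (fun x hx => (hv.state.continuousAt hU (hBU x hx)).max hφ.continuousAt)
      (fun x hx => (hv.state.nonneg x (subset_closure (hBU x hx))).trans (le_max_left _ _)) hev
  set v' := glue (ball x₀ r) (fun y => max (v y) (φ y)) v with hv'
  have hle : ∀ y, v y ≤ v' y := fun y => by
    by_cases hy : y ∈ ball x₀ r
    · rw [hv', glue_of_mem hy]; exact le_max_left _ _
    · rw [hv', glue_of_notMem hy]
  have hle2 : ∀ x ∈ ball x₀ r, ∀ᶠ y in 𝓝 x, φ y ≤ v' y := fun x hx => by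
    filter_upwards [isOpen_ball.mem_nhds hx] with y hy
    rw [hv', glue_of_mem hy]; exact le_max_right _ _
  have hci := fun {x : Space d} (hx : x ∈ U) => hst.integrable_near hU hx
  refine IsSubsolution.of_local hd hst (fun x hx hpos => ?_) fun x hx p hp => ?_
  · by_cases hxB : x ∈ ball x₀ r
    · have hx1 : v' x = max (v x) (φ x) := glue_of_mem hxB
      rcases max_cases (v x) (φ x) with ⟨h, -⟩ | ⟨h, -⟩
      · rw [h] at hx1
        exact (hv.subMeanAt hU hx (hx1 ▸ hpos)).of_le hx1.symm (Eventually.of_forall hle)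
          (hv.state.integrable_near hU hx) (hci hx)
      · rw [h] at hx1
        exact (h2 x hxB (hx1 ▸ hpos)).of_le hx1.symm (hle2 x hxB)
          (eventually_integrableOn_of_continuous hφ x) (hci hx)
    · have he := glue_ball_eventuallyEq hev hxB
      exact (hv.subMeanAt hU hx (he.eq_of_nhds ▸ hpos)).congr he.symm
  · by_cases hxB : x ∈ ball x₀ r
    · have hxf := hx
      rw [hst.mem_freeBoundary_iff hU] at hx
      obtain ⟨hxU, hx0, hfr⟩ := hx
      have hx1 : v' x = max (v x) (φ x) := glue_of_mem hxB
      have hφx : φ x ≤ 0 := by rw [← hx0, hx1]; exact le_max_right _ _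
      rcases hφx.lt_or_eq with h | h
      · have he : v' =ᶠ[𝓝 x] v := by
          filter_upwards [isOpen_ball.mem_nhds hxB, hφ.continuousAt.eventually (gt_mem_nhds h)]
            with y hy hy2
          rw [hv', glue_of_mem hy]
          exact max_eq_left ((le_of_lt hy2).trans
            (hv.state.nonneg y (subset_closure (hBU y hy))))
        exact hv.slope_ge x ((mem_freeBoundary_congr hU he).1 hxf) p
          (superDiff_subset_of_le hU hxU (he.mono fun y hy => hy.ge) hp)
      · obtain ⟨g, hg, hg2⟩ := h3 x hxB h
        have := le_norm_of_mem_superDiff hU hxU hp hg h (hle2 x hxB)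
        exact hg2.trans (by gcongr)
    · have he := glue_ball_eventuallyEq hev hxB
      exact hv.slope_ge x ((mem_freeBoundary_congr hU he).1 hx) p
        (superDiff_subset_of_le hU hx.2 (he.mono fun y hy => hy.ge) hp)

lemma frontier_notMem_ball {U : Set (Space d)} (hU : IsOpen U) {x₀ : Space d} {r : ℝ}
    (hB : closedBall x₀ r ⊆ U) {x : Space d} (hx : x ∈ frontier U) : x ∉ ball x₀ r := fun h => by
  rw [hU.frontier_eq] at hx
  exact hx.2 (hB (ball_subset_closedBall h))

/-- A minimal supersolution lies below barriers in balls where the obstacle vanishes. -/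
theorem IsMinimalSupersolution.le_barrier (hd : 0 < d) {U : Set (Space d)} (hU : IsOpen U)
    {μp f : ℝ} {o v φ : Space d → ℝ} (hv : IsMinimalSupersolution U μp f o v)
    {x₀ : Space d} {r : ℝ} (hB : closedBall x₀ r ⊆ U) (ho : ∀ x ∈ ball x₀ r, o x ≤ 0)
    (hφ : Continuous φ) (h1 : ∀ x ∈ sphere x₀ r, x ∈ closure (wet U v) → v x < φ x)
    (h2 : ∀ x ∈ ball x₀ r, 0 < φ x → SubMeanAt (fun y => -φ y) x)
    (h3 : ∀ x ∈ ball x₀ r, φ x = 0 →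
      ∃ g, HasFDerivAt φ (innerSL ℝ g : Space d →L[ℝ] ℝ) x ∧ ‖g‖ ^ 2 ≤ 1 + μp) :
    ∀ x ∈ ball x₀ r, v x ≤ max (φ x) 0 := by
  intro x hx
  have hxU : x ∈ closure U := subset_closure (hB (ball_subset_closedBall hx))
  have := hv.2 _ ⟨hv.1.1.glue_min hd hU hB hφ h1 h2 h3, fun y hy => ?_, fun y hy => ?_⟩ x hxU
  · rw [glue_of_mem hx] at this
    exact this.trans (min_le_right _ _)
  · rw [glue_of_notMem (frontier_notMem_ball hU hB hy)]; exact hv.1.2.1 y hy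
  · by_cases hyB : y ∈ ball x₀ r
    · rw [glue_of_mem hyB]
      exact le_min (hv.1.2.2 y hy) ((ho y hyB).trans (le_max_right _ _))
    · rw [glue_of_notMem hyB]; exact hv.1.2.2 y hy

/-- A maximal subsolution lies above barriers in balls where the barrier is below the obstacle. -/
theorem IsMaximalSubsolution.barrier_le (hd : 0 < d) {U : Set (Space d)} (hU : IsOpen U)
    {μm f : ℝ} {o v φ : Space d → ℝ} (hv : IsMaximalSubsolution U μm f o v)
    {x₀ : Space d} {r : ℝ} (hB : closedBall x₀ r ⊆ U) (ho : ∀ x ∈ ball x₀ r, φ x ≤ o x)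
    (hφ : Continuous φ) (h1 : ∀ x ∈ sphere x₀ r, φ x < v x ∨ φ x < 0)
    (h2 : ∀ x ∈ ball x₀ r, 0 < φ x → SubMeanAt φ x)
    (h3 : ∀ x ∈ ball x₀ r, φ x = 0 →
      ∃ g, HasFDerivAt φ (innerSL ℝ g : Space d →L[ℝ] ℝ) x ∧ 1 - μm ≤ ‖g‖ ^ 2) :
    ∀ x ∈ ball x₀ r, φ x ≤ v x := by
  intro x hx
  have hxU : x ∈ closure U := subset_closure (hB (ball_subset_closedBall hx))
  have := hv.2 _ ⟨hv.1.1.glue_max hd hU hB hφ h1 h2 h3, fun y hy => ?_, fun y hy => ?_⟩ x hxU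
  · rw [glue_of_mem hx] at this
    exact (le_max_right _ _).trans this
  · rw [glue_of_notMem (frontier_notMem_ball hU hB hy)]; exact hv.1.2.1 y hy
  · by_cases hyB : y ∈ ball x₀ r
    · rw [glue_of_mem hyB]
      exact max_le (hv.1.2.2 y hy) (ho y hyB)
    · rw [glue_of_notMem hyB]; exact hv.1.2.2 y hy

/-! ### Minimal supersolutions vanish where they are small -/

/-- Opening a dry ball of radius ρ/2 is allowed because a radial superharmonic function vanishing on
its boundary with slope 1, which is admissible since 1 ≤ 1 + μ₊, has already grown beyond ρ/(8d) at
radius ρ. -/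
theorem IsMinimalSupersolution.eq_zero_of_small (hd : 0 < d) {U : Set (Space d)} (hU : IsOpen U)
    {μp f : ℝ} (hμ : 0 ≤ μp) {o v : Space d → ℝ} (hv : IsMinimalSupersolution U μp f o v)
    {x : Space d} {ρ : ℝ} (hρ : 0 < ρ) (hB : closedBall x ρ ⊆ U) (ho : ∀ y ∈ ball x ρ, o y ≤ 0)
    (hs : ∀ y ∈ sphere x ρ, v y ≤ ρ / (8 * d)) : ∀ y ∈ ball x (ρ / 2), v y = 0 := by
  have hd' : (0 : ℝ) < d := by exact_mod_cast hd
  set h := ρ / 2 with hh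
  have hh0 : 0 < h := by positivity
  set Kh := (h ^ 2) ^ (-(d : ℤ)) with hKh
  -- Chosen so that the gradient of `φ` has norm exactly 1 on the sphere of radius `h`.
  set A := h * (h ^ 2) ^ d / (2 * d) with hA
  have hA0 : 0 < A := by positivity
  -- Truncation near the centre keeps `φ` continuous. It only affects the region where `φ` is
  -- negative.
  set N : Space d → ℝ := fun y => max (‖y - x‖ ^ 2) ((h / 2) ^ 2) with hN
  have hN0 : ∀ y, 0 < N y := fun y => lt_of_lt_of_le (by positivity) (le_max_right _ _)
  have hNc : Continuous N := by fun_prop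
  set φ : Space d → ℝ := fun y => A * (Kh - N y ^ (-(d : ℤ))) with hφdef
  have hφ : Continuous φ :=
    continuous_const.mul (continuous_const.sub (hNc.zpow₀ _ fun y => Or.inl (hN0 y).ne'))
  have hinv : ∀ s : ℝ, s ^ (-(d : ℤ)) = (s ^ d)⁻¹ := fun s => by rw [zpow_neg, zpow_natCast]
  have hanti : ∀ s t : ℝ, 0 < s → s ≤ t → t ^ (-(d : ℤ)) ≤ s ^ (-(d : ℤ)) := fun s t hs hst => by
    rw [hinv, hinv]; gcongr
  have hneg : ∀ y, ‖y - x‖ ≤ h → φ y ≤ 0 := fun y hy => by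
    refine mul_nonpos_of_nonneg_of_nonpos hA0.le (sub_nonpos.2 (hanti _ _ (hN0 y) (max_le ?_ ?_)))
    · gcongr
    · gcongr; linarith
  have hlocal : ∀ y, h ≤ ‖y - x‖ → φ =ᶠ[𝓝 y] fun z => A * (Kh - radialBarrier x z) := by
    intro y hy
    have hc : Continuous fun z : Space d => ‖z - x‖ := by fun_prop
    filter_upwards [hc.continuousAt.eventually (lt_mem_nhds (show h / 2 < ‖y - x‖ by linarith))]
      with z hz
    have : N z = ‖z - x‖ ^ 2 := max_eq_left (by gcongr)
    simp only [hφdef, this, radialBarrier]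
  have hlap : ∀ y, h ≤ ‖y - x‖ → ∃ l < 0, HasLap (fun z => A * (Kh - radialBarrier x z)) y
      (A • ((2 * d * (‖y - x‖ ^ 2) ^ (-(d : ℤ) - 1)) • (y - x))) l := by
    intro y hy
    have hyx : y ≠ x := by
      rintro rfl
      rw [sub_self, norm_zero] at hy; linarith
    obtain ⟨l, hl, H⟩ := exists_hasLap_radialBarrier hd hyx
    refine ⟨A * (0 + -1 * l), by nlinarith, ?_⟩
    exact (((hasLap_const Kh y).add (H.const_mul (-1))).const_mul A).congr (fun z => by ring)
      (by rw [zero_add, smul_smul (-1 : ℝ)]; congr 2; ring) rfl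
  intro y hy
  have key := hv.le_barrier (φ := φ) hd hU hB ho hφ (fun y hy _ => ?_) (fun y hy hpos => ?_)
    (fun y hy h0 => ?_) y (ball_subset_ball (by linarith) hy)
  · rw [mem_ball, dist_eq_norm] at hy
    rw [max_eq_right (hneg y hy.le)] at key
    exact le_antisymm key (hv.1.1.state.nonneg y
      (subset_closure (hB (closedBall_subset_closedBall (by linarith)
        (mem_closedBall_iff_norm.2 hy.le)))))
  · have hyn : ‖y - x‖ = ρ := mem_sphere_iff_norm.1 hy
    have e1 : φ y = A * (Kh - (ρ ^ 2) ^ (-(d : ℤ))) := by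
      rw [(hlocal y (by linarith)).eq_of_nhds, radialBarrier_eq hyn]
    have e2 : (ρ ^ 2) ^ (-(d : ℤ)) = Kh * (4 ^ d)⁻¹ := by
      rw [hKh, hinv, hinv, ← mul_inv, ← mul_pow, hh]; congr 2; ring
    have e3 : A * Kh = h / (2 * d) := by
      rw [hA, hKh, hinv]; field_simp
    have e4 : (4 ^ d : ℝ)⁻¹ ≤ 1 / 4 := by
      rw [inv_le_comm₀ (by positivity) (by norm_num)]
      have := pow_le_pow_right₀ (show (1 : ℝ) ≤ 4 by norm_num) (show 1 ≤ d from hd)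
      norm_num at this ⊢
      exact this
    refine (hs y hy).trans_lt ?_
    rw [e1, e2, show A * (Kh - Kh * (4 ^ d)⁻¹) = (A * Kh) * (1 - (4 ^ d)⁻¹) by ring, e3]
    have e5 : ρ / (8 * d) = h / (2 * d) * (1 / 2) := by rw [hh]; field_simp; ring
    rw [e5]
    gcongr
    linarith
  · have hyh : h ≤ ‖y - x‖ := by
      by_contra hcon
      exact absurd hpos (not_lt.2 (hneg y (not_le.1 hcon).le))
    obtain ⟨l, hl, H⟩ := hlap y hyh
    refine ((H.const_mul (-1)).subMeanAt (by linarith)).congr ?_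
    filter_upwards [hlocal y hyh] with z hz
    rw [hz]; ring
  · have hyh : ‖y - x‖ = h := by
      by_contra hcon
      rcases lt_or_gt_of_ne hcon with h1 | h1
      · have h2 : max (‖y - x‖ ^ 2) ((h / 2) ^ 2) < h ^ 2 :=
          max_lt (by gcongr) (by gcongr; linarith)
        have h3 : Kh < N y ^ (-(d : ℤ)) := by
          rw [hKh, hinv, hinv]
          exact inv_strictAnti₀ (pow_pos (hN0 y) d) (pow_lt_pow_left₀ h2 (hN0 y).le hd.ne')
        have : φ y < 0 := mul_neg_of_pos_of_neg hA0 (sub_neg.2 h3)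
        exact this.ne h0
      · have h2 : h ^ 2 < N y := lt_of_lt_of_le (by gcongr) (le_max_left _ _)
        have h3 : N y ^ (-(d : ℤ)) < Kh := by
          rw [hKh, hinv, hinv]
          exact inv_strictAnti₀ (by positivity) (pow_lt_pow_left₀ h2 (by positivity) hd.ne')
        have : 0 < φ y := mul_pos hA0 (sub_pos.2 h3)
        exact this.ne' h0
    obtain ⟨l, hl, H⟩ := hlap y hyh.ge
    refine ⟨_, H.hasFDerivAt.congr_of_eventuallyEq (hlocal y hyh.ge), ?_⟩
    have e : A * (2 * d * (h ^ 2) ^ (-(d : ℤ) - 1)) * h = 1 := by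
      rw [hA, zpow_sub_one₀ (by positivity), hinv]; field_simp
    rw [smul_smul, norm_smul, hyh, Real.norm_of_nonneg (by positivity), e]
    linarith

/-! ### Quadratic barriers -/

/-- The quadratic function `q X_e + a |X|² - b X_e² + τ` with `X = y - x₀`. -/
noncomputable def quadBarrier (e x₀ : Space d) (q a b τ : ℝ) (y : Space d) : ℝ :=
  q * inner ℝ e (y - x₀) + a * ‖y - x₀‖ ^ 2 - b * inner ℝ e (y - x₀) ^ 2 + τ

lemma continuous_quadBarrier (e x₀ : Space d) (q a b τ : ℝ) :
    Continuous (quadBarrier e x₀ q a b τ) := by unfold quadBarrier; fun_prop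

lemma hasLap_quadBarrier {e : Space d} (he : ‖e‖ = 1) (x₀ : Space d) (q a b τ : ℝ) (y : Space d) :
    HasLap (quadBarrier e x₀ q a b τ) y
      (q • e + ((2 * a) • (y - x₀) - (2 * b * inner ℝ e (y - x₀)) • e)) (2 * d * a - 2 * b) := by
  have h1 : HasLap (fun y => inner ℝ e y + -inner ℝ e x₀) y e 0 :=
    ((hasLap_inner e y).add (hasLap_const (-inner ℝ e x₀) y)).congr (fun _ => rfl) (by simp)
      (by simp)
  have h2 := (((h1.const_mul q).add ((hasLap_normSq_sub x₀ y).const_mul a)).add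
    ((h1.mul h1).const_mul (-b))).add (hasLap_const τ y)
  refine h2.congr (fun z => ?_) ?_ ?_
  · simp only [quadBarrier, inner_sub_right]; ring
  · simp only [inner_sub_right]; module
  · rw [real_inner_self_eq_norm_sq, he]; ring

lemma norm_quadBarrier_correction_le {e : Space d} (he : ‖e‖ = 1) {X : Space d} {a b r : ℝ}
    (hX : ‖X‖ ≤ r) :
    ‖(2 * a) • X - (2 * b * inner ℝ e X) • e‖ ≤ 2 * |a| * r + 2 * |b| * r := by
  have h1 : |inner ℝ e X| ≤ r := (abs_real_inner_le_norm e X).trans (by rw [he, one_mul]; exact hX)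
  refine (norm_sub_le _ _).trans ?_
  rw [norm_smul, norm_smul, he, mul_one, Real.norm_eq_abs, Real.norm_eq_abs, abs_mul, abs_mul,
    abs_mul, abs_two]
  gcongr

/-! ### Families of obstacle solutions near a point -/

/-- The filter `𝓕 ×ˢ 𝓝 x` encodes half-relaxed limits, joint in the index and in space. Compactness
makes the index uniform over `K`. -/
lemma eventually_forall_of_compact {ι : Type*} {𝓕 : Filter ι} {K : Set (Space d)}
    (hK : IsCompact K) {P : ι → Space d → Prop}
    (h : ∀ x ∈ K, ∀ᶠ z in 𝓕 ×ˢ 𝓝 x, P z.1 z.2) : ∀ᶠ i in 𝓕, ∀ x ∈ K, P i x := by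
  have h' : ∀ x ∈ K, ∃ N ∈ 𝓝 x, ∀ᶠ i in 𝓕, ∀ y ∈ N, P i y := by
    intro x hx
    obtain ⟨pa, ha, pb, hb, hab⟩ := eventually_prod_iff.1 (h x hx)
    exact ⟨{y | pb y}, hb, ha.mono fun i hi y hy => hab hi hy⟩
  choose! N hN hP using h'
  obtain ⟨t, ht, hcov⟩ := hK.elim_nhds_subcover N hN
  filter_upwards [(Finset.eventually_all t).2 fun x hx => hP x (ht x hx)] with i hi x hx
  obtain ⟨y, hy, hxy⟩ := mem_iUnion₂.1 (hcov hx)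
  exact hi y hy x hxy

lemma eventually_prod_nhds {ι : Type*} {𝓕 : Filter ι} {x : Space d} {P : ι → Space d → Prop}
    (h : ∀ᶠ z in 𝓕 ×ˢ 𝓝 x, P z.1 z.2) : ∀ᶠ z in 𝓕 ×ˢ 𝓝 x, ∀ᶠ y in 𝓝 z.2, P z.1 y := by
  obtain ⟨pa, ha, pb, hb, hab⟩ := eventually_prod_iff.1 h
  refine eventually_prod_iff.2 ⟨pa, ha, _, eventually_eventually_nhds.2 hb, fun {i} hi {y} hy => ?_⟩
  exact hy.mono fun z hz => hab hi hz

lemma eventually_prod_of_ball {ι : Type*} {𝓕 : Filter ι} {x : Space d} {P : ι → Space d → Prop}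
    {ρ : ℝ} (hρ : 0 < ρ) (h : ∀ᶠ i in 𝓕, ∀ y ∈ ball x ρ, P i y) :
    ∀ᶠ z in 𝓕 ×ˢ 𝓝 x, P z.1 z.2 :=
  eventually_prod_iff.2 ⟨_, h, _, ball_mem_nhds x hρ, fun hi _ hy => hi _ hy⟩

theorem eventually_eq_zero_of_small (hd : 0 < d) {U : Set (Space d)} (hU : IsOpen U) {μp : ℝ}
    (hμ : 0 ≤ μp) {ι : Type*} {𝓕 : Filter ι} {o v : ι → Space d → ℝ} {f : ι → ℝ}
    (hv : ∀ᶠ i in 𝓕, IsMinimalSupersolution U μp (f i) (o i) (v i)) {w : Space d → ℝ}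
    {x : Space d} {ρ : ℝ} (hρ : 0 < ρ) (hB : closedBall x ρ ⊆ U)
    (ho : ∀ᶠ i in 𝓕, ∀ y ∈ ball x ρ, o i y ≤ 0)
    (hw : ∀ y ∈ closedBall x ρ, ∀ c, w y < c → ∀ᶠ z in 𝓕 ×ˢ 𝓝 y, v z.1 z.2 < c)
    (hs : ∀ y ∈ closedBall x ρ, w y < ρ / (8 * d)) : ∀ᶠ z in 𝓕 ×ˢ 𝓝 x, v z.1 z.2 = 0 := by
  have h1 := eventually_forall_of_compact (P := fun i y => v i y < ρ / (8 * d))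
    (isCompact_sphere x ρ) fun y hy => hw y (sphere_subset_closedBall hy) _ (hs y (sphere_subset_closedBall hy))
  refine eventually_prod_of_ball (P := fun i y => v i y = 0) (half_pos hρ) ?_
  filter_upwards [hv, ho, h1] with i hi1 hi2 hi3
  exact hi1.eq_zero_of_small hd hU hμ hρ hB hi2 fun y hy => (hi3 y hy).le

/-- A strictly superharmonic barrier above a function with a small superdifferential. -/
theorem exists_barrier_of_superDiff (hd : 0 < d) {U : Set (Space d)} {w : Space d → ℝ}
    {x₀ p : Space d} {ρ₀ Q : ℝ} (hρ₀ : 0 < ρ₀) (hw0 : ∀ y ∈ closedBall x₀ ρ₀, 0 ≤ w y)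
    (hp : p ∈ superDiff U w x₀) (hp0 : p ≠ 0) (hpq : ‖p‖ < Q) :
    ∃ r, 0 < r ∧ r < ρ₀ ∧ ∃ φ : Space d → ℝ, Continuous φ ∧ φ x₀ < 0 ∧
      (∀ y ∈ sphere x₀ r, y ∈ closure (wet U w) → w y < φ y) ∧
      ∀ y ∈ closedBall x₀ r, ∃ g l, HasLap φ y g l ∧ l < 0 ∧ ‖g‖ < Q := by
  have hd' : (0 : ℝ) < d := by exact_mod_cast hd
  have hnear : ∀ ε > 0, ∃ r > 0, r < ρ₀ ∧ ∀ y ∈ closedBall x₀ r, y ∈ closure (wet U w) →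
      w y ≤ inner ℝ p (y - x₀) + ε * ‖y - x₀‖ := by
    intro ε hε
    obtain ⟨r, hr, hsub⟩ := nhds_basis_closedBall.mem_iff.1 (eventually_nhdsWithin_iff.1 (hp ε hε))
    refine ⟨min r (ρ₀ / 2), by positivity, (min_le_right _ _).trans_lt (by linarith),
      fun y hy hy2 => hsub (closedBall_subset_closedBall (min_le_left _ _) hy) hy2⟩
  set P := ‖p‖ with hP
  have hP0 : 0 < P := norm_pos_iff.2 hp0
  set e := P⁻¹ • p with he
  have he1 : ‖e‖ = 1 := by
    rw [he, norm_smul, norm_inv, norm_norm, inv_mul_cancel₀ hP0.ne']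
  have hpe : ∀ X : Space d, inner ℝ p X = P * inner ℝ e X := fun X => by
    rw [he, real_inner_smul_left, mul_inv_cancel_left₀ hP0.ne']
  set η := (Q - P) / 8 with hη
  have hη0 : 0 < η := by have := sub_pos.2 hpq; positivity
  -- With this ratio the Laplacian of the barrier is (2dK - 2η)/r = -2K/r, while its gradient stays
  -- within 3η + 2K + 2η ≤ 7η of P, below Q = P + 8η.
  set K := η / (d + 1) with hK
  have hK0 : 0 < K := by positivity
  have hKη : (d + 1) * K = η := by rw [hK]; field_simp
  have hKle : K ≤ η := by nlinarith
  -- The first bound makes the error negligible against the term K r gained on the sphere. The last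
  -- turns P(-s) ≤ ε r into 16 η (-s) ≤ K r.
  set ε := min (K / 4) (min P (P * K / (16 * η))) with hε
  have hε0 : 0 < ε := by positivity
  have hε1 : ε ≤ K / 4 := min_le_left _ _
  have hε2 : ε ≤ P := (min_le_right _ _).trans (min_le_left _ _)
  have hε3 : ε * (16 * η) ≤ P * K := by
    have : ε ≤ P * K / (16 * η) := (min_le_right _ _).trans (min_le_right _ _)
    rwa [le_div_iff₀ (by positivity)] at this
  obtain ⟨r, hr, hr2, hrw⟩ := hnear ε hε0
  set φ := quadBarrier e x₀ (P + 3 * η) (K / r) (η / r) (-(K * r / 4)) with hφ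
  have hφc : Continuous φ := continuous_quadBarrier _ _ _ _ _ _
  have hsph : ∀ y ∈ sphere x₀ r, y ∈ closure (wet U w) → w y < φ y := by
    intro y hy hcl
    have h1 := hrw y (sphere_subset_closedBall hy) hcl
    have h0 := hw0 y (closedBall_subset_closedBall hr2.le (sphere_subset_closedBall hy))
    rw [mem_sphere_iff_norm] at hy
    rw [hpe, hy] at h1
    set s := inner ℝ e (y - x₀) with hs
    have hsr : |s| ≤ r := (abs_real_inner_le_norm e (y - x₀)).trans_eq (by rw [he1, hy, one_mul])
    have hφy : φ y = (P + 3 * η) * s + K * r - η * (s ^ 2 / r) - K * r / 4 := by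
      rw [hφ, quadBarrier, hy, ← hs]; field_simp; ring
    rw [hφy]
    have hKr : 0 < K * r := by positivity
    have hεr : ε * r ≤ K * r / 4 := by nlinarith
    rcases le_or_gt 0 s with h | h
    · have h2 : s ^ 2 / r ≤ s := by
        rw [div_le_iff₀ hr, sq]; exact mul_le_mul_of_nonneg_left (le_of_abs_le hsr) h
      nlinarith [mul_le_mul_of_nonneg_left h2 hη0.le, mul_nonneg hη0.le h]
    · rw [abs_of_neg h] at hsr
      have h2 : s ^ 2 / r ≤ -s := by
        rw [div_le_iff₀ hr]; nlinarith
      -- Non-negativity of `w` confines the closure of its wet region to almost the half-space s ≥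
      -- 0, so `s` can only be slightly negative here and the extra tilt 3η costs little.
      have h3 : P * (-s) ≤ ε * r := by linarith
      have h4 : 16 * η * (-s) ≤ K * r := by
        have : P * (16 * η * (-s)) ≤ P * (K * r) := by nlinarith
        exact le_of_mul_le_mul_left this hP0
      nlinarith [mul_le_mul_of_nonneg_left h2 hη0.le]
  have hφx₀ : φ x₀ < 0 := by
    have : φ x₀ = -(K * r / 4) := by simp [hφ, quadBarrier]
    rw [this, neg_lt_zero]; positivity
  refine ⟨r, hr, hr2, φ, hφc, hφx₀, hsph, fun y hy => ⟨_, _,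
    hasLap_quadBarrier he1 x₀ (P + 3 * η) (K / r) (η / r) (-(K * r / 4)) y, ?_, ?_⟩⟩
  · have : 2 * d * (K / r) - 2 * (η / r) = -(2 * K / r) := by
      rw [← hKη]; field_simp; ring
    rw [this, neg_lt_zero]; positivity
  · have hyr : ‖y - x₀‖ ≤ r := by rwa [mem_closedBall, dist_eq_norm] at hy
    have h1 := norm_quadBarrier_correction_le he1 (a := K / r) (b := η / r) hyr
    rw [abs_of_pos (by positivity), abs_of_pos (by positivity)] at h1
    have h2 : 2 * (K / r) * r + 2 * (η / r) * r = 2 * K + 2 * η := by field_simp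
    have h3 := norm_add_le ((P + 3 * η) • e)
      ((2 * (K / r)) • (y - x₀) - (2 * (η / r) * inner ℝ e (y - x₀)) • e)
    rw [norm_smul, he1, mul_one, Real.norm_of_nonneg (by positivity)] at h3
    have : Q = P + 8 * η := by rw [hη]; ring
    linarith

/-- If the slope of the upper relaxed limit is less than that for advancing, then the limit of
minimal supersolutions above dry obstacles is dry. -/
theorem eventually_eq_zero_of_superDiff (hd : 0 < d) {U : Set (Space d)} (hU : IsOpen U) {μp : ℝ}
    (hμ : 0 ≤ μp) {ι : Type*} {𝓕 : Filter ι} {o v : ι → Space d → ℝ} {f : ι → ℝ}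
    (hv : ∀ᶠ i in 𝓕, IsMinimalSupersolution U μp (f i) (o i) (v i)) {w : Space d → ℝ}
    {x₀ : Space d} {ρ₀ : ℝ} (hρ₀ : 0 < ρ₀) (hB : closedBall x₀ ρ₀ ⊆ U)
    (ho : ∀ᶠ i in 𝓕, ∀ y ∈ ball x₀ ρ₀, o i y ≤ 0) (hw0 : ∀ y ∈ closedBall x₀ ρ₀, 0 ≤ w y)
    (hw : ∀ y ∈ closedBall x₀ ρ₀, ∀ c, w y < c → ∀ᶠ z in 𝓕 ×ˢ 𝓝 y, v z.1 z.2 < c)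
    {p : Space d} (hp : p ∈ superDiff U w x₀) (hpq : ‖p‖ ^ 2 < 1 + μp) :
    ∀ᶠ z in 𝓕 ×ˢ 𝓝 x₀, v z.1 z.2 = 0 := by
  have hd' : (0 : ℝ) < d := by exact_mod_cast hd
  have small : ∀ x ρ, 0 < ρ → closedBall x ρ ⊆ ball x₀ ρ₀ →
      (∀ y ∈ closedBall x ρ, w y < ρ / (8 * d)) → ∀ᶠ z in 𝓕 ×ˢ 𝓝 x, v z.1 z.2 = 0 := by
    intro x ρ hρ hsub hs
    have hsub' := hsub.trans ball_subset_closedBall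
    exact eventually_eq_zero_of_small hd hU hμ hv hρ (hsub'.trans hB)
      (ho.mono fun i hi y hy => hi y (hsub (ball_subset_closedBall hy)))
      (fun y hy => hw y (hsub' hy)) hs
  -- The superdifferential says nothing off the closure of the wet region of `w`. There the
  -- smallness theorem makes the members of the family vanish, not merely tend to 0.
  have dry : ∀ x ∈ ball x₀ ρ₀, x ∉ closure (wet U w) → ∀ᶠ z in 𝓕 ×ˢ 𝓝 x, v z.1 z.2 = 0 := by
    intro x hx hcl
    rw [mem_closure_wet_iff hU (hB (ball_subset_closedBall hx)), not_frequently] at hcl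
    obtain ⟨ρ, hρ, hsub⟩ := nhds_basis_closedBall.mem_iff.1
      (inter_mem (isOpen_ball.mem_nhds hx) hcl)
    refine small x ρ hρ (fun y hy => (hsub hy).1) fun y hy => ?_
    have h1 : ¬ 0 < w y := (hsub hy).2
    exact (not_lt.1 h1).trans_lt (by positivity)
  have hnear : ∀ ε > 0, ∃ r > 0, r < ρ₀ ∧ ∀ y ∈ closedBall x₀ r, y ∈ closure (wet U w) →
      w y ≤ inner ℝ p (y - x₀) + ε * ‖y - x₀‖ := by
    intro ε hε
    obtain ⟨r, hr, hsub⟩ := nhds_basis_closedBall.mem_iff.1 (eventually_nhdsWithin_iff.1 (hp ε hε))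
    refine ⟨min r (ρ₀ / 2), by positivity, (min_le_right _ _).trans_lt (by linarith),
      fun y hy hy2 => hsub (closedBall_subset_closedBall (min_le_left _ _) hy) hy2⟩
  -- For p = 0 there is no direction in which to tilt a barrier, but then w is o(|x - x₀|) and falls
  -- below the threshold of the smallness theorem directly.
  rcases eq_or_ne p 0 with rfl | hp0
  · obtain ⟨r, hr, hr2, hrw⟩ := hnear (1 / (16 * d)) (by positivity)
    refine small x₀ r hr (closedBall_subset_ball hr2) fun y hy => ?_
    by_cases hcl : y ∈ closure (wet U w)
    · have h1 := hrw y hy hcl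
      rw [mem_closedBall, dist_eq_norm] at hy
      rw [inner_zero_left, zero_add] at h1
      calc w y ≤ 1 / (16 * d) * ‖y - x₀‖ := h1
        _ ≤ 1 / (16 * d) * r := by gcongr
        _ < r / (8 * d) := by
          rw [div_mul_eq_mul_div, one_mul]
          exact div_lt_div_of_pos_left hr (by positivity) (by linarith)
    · have h1 : ¬ 0 < w y := fun h => hcl (subset_closure
        ⟨subset_closure (hB (closedBall_subset_closedBall hr2.le hy)), h⟩)
      exact (not_lt.1 h1).trans_lt (by positivity)
  obtain ⟨r, hr, hr2, φ, hφc, hφx₀, hsph, hlap⟩ :=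
    exists_barrier_of_superDiff hd hρ₀ hw0 hp hp0 (Real.lt_sqrt_of_sq_lt hpq)
  have hev : ∀ᶠ i in 𝓕, ∀ y ∈ sphere x₀ r, y ∈ closure (wet U (v i)) → v i y < φ y := by
    refine eventually_forall_of_compact
      (P := fun i y => y ∈ closure (wet U (v i)) → v i y < φ y) (isCompact_sphere x₀ r)
      fun y hy => ?_
    have hyB : y ∈ ball x₀ ρ₀ := closedBall_subset_ball hr2 (sphere_subset_closedBall hy)
    by_cases hcl : y ∈ closure (wet U w)
    · obtain ⟨c, hc1, hc2⟩ := exists_between (hsph y hy hcl)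
      filter_upwards [hw y (ball_subset_closedBall hyB) c hc1,
        (hφc.continuousAt.eventually (lt_mem_nhds hc2)).prod_inr 𝓕] with z h1 h2 _
      exact h1.trans h2
    · filter_upwards [eventually_prod_nhds (P := fun i y => v i y = 0) (dry y hyB hcl),
        (isOpen_ball.eventually_mem hyB).prod_inr 𝓕] with z h1 h2 h3
      rw [mem_closure_wet_iff hU (hB (ball_subset_closedBall h2))] at h3
      obtain ⟨y', hy1, hy2⟩ := (h3.and_eventually h1).exists
      exact absurd hy2 hy1.ne'
  obtain ⟨ρ, hρ, hρs⟩ := Metric.eventually_nhds_iff_ball.1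
    ((hφc.continuousAt.eventually (gt_mem_nhds hφx₀)).and (ball_mem_nhds x₀ hr))
  refine eventually_prod_of_ball (P := fun i y => v i y = 0) hρ ?_
  filter_upwards [hv, ho, hev] with i hi1 hi2 hi3 y hy
  have hrB : closedBall x₀ r ⊆ closedBall x₀ ρ₀ := closedBall_subset_closedBall hr2.le
  have key := hi1.le_barrier hd hU (hrB.trans hB)
    (fun y hy => hi2 y (ball_subset_ball hr2.le hy)) hφc hi3 (fun y _ _ => ?_) (fun y hy _ => ?_)
    y (hρs y hy).2
  · rw [max_eq_right (le_of_lt (hρs y hy).1)] at key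
    exact le_antisymm key (hi1.1.1.state.nonneg y
      (subset_closure (hB (hrB (ball_subset_closedBall (hρs y hy).2)))))
  · obtain ⟨g, l, h1, hl, -⟩ := hlap y (ball_subset_closedBall ‹_›)
    exact ((h1.const_mul (-1)).subMeanAt (by linarith)).congr
      (Eventually.of_forall fun z => neg_one_mul _)
  · obtain ⟨g, l, h1, -, hg⟩ := hlap y (ball_subset_closedBall hy)
    refine ⟨g, h1.hasFDerivAt, ?_⟩
    calc _ ≤ √(1 + μp) ^ 2 := by gcongr
      _ = 1 + μp := Real.sq_sqrt (by linarith)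

/-- If the slope of the lower relaxed limit is greater than that for receding, then the limit of
maximal subsolutions below wet obstacles is wet. -/
theorem eventually_le_of_subDiff (hd : 0 < d) {U : Set (Space d)} (hU : IsOpen U) {μm : ℝ}
    (hμ : 0 ≤ 1 - μm) {ι : Type*} {𝓕 : Filter ι} {o v : ι → Space d → ℝ} {f : ι → ℝ}
    (hv : ∀ᶠ i in 𝓕, IsMaximalSubsolution U μm (f i) (o i) (v i)) {w : Space d → ℝ}
    {x₀ : Space d} {ρ₀ m₀ : ℝ} (hρ₀ : 0 < ρ₀) (hB : closedBall x₀ ρ₀ ⊆ U) (hm₀ : 0 < m₀)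
    (ho : ∀ᶠ i in 𝓕, ∀ y ∈ ball x₀ ρ₀, m₀ ≤ o i y)
    (hw : ∀ y ∈ closedBall x₀ ρ₀, ∀ c, c < w y → ∀ᶠ z in 𝓕 ×ˢ 𝓝 y, c < v z.1 z.2)
    {p : Space d} (hp : p ∈ subDiff w x₀) (hpq : 1 - μm < ‖p‖ ^ 2) :
    ∃ m > 0, ∀ᶠ z in 𝓕 ×ˢ 𝓝 x₀, m ≤ v z.1 z.2 := by
  have hd' : (0 : ℝ) < d := by exact_mod_cast hd
  set P := ‖p‖ with hP
  have hPq : √(1 - μm) < P := (Real.sqrt_lt' (by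
    by_contra hcon
    have : P = 0 := le_antisymm (not_lt.1 hcon) (norm_nonneg p)
    rw [this] at hpq; linarith)).2 hpq
  have hP0 : 0 < P := (Real.sqrt_nonneg _).trans_lt hPq
  set e := P⁻¹ • p with he
  have he1 : ‖e‖ = 1 := by
    rw [he, norm_smul, norm_inv, norm_norm, inv_mul_cancel₀ hP0.ne']
  have hpe : ∀ X : Space d, inner ℝ p X = P * inner ℝ e X := fun X => by
    rw [he, real_inner_smul_left, mul_inv_cancel_left₀ hP0.ne']
  -- The barrier has slope P - 3η up to a correction of 2K + 2η ≤ 4η, so its gradient stays above P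
  -- - 8η = √(1 - μ₋).
  set η := (P - √(1 - μm)) / 8 with hη
  have hη0 : 0 < η := by have := sub_pos.2 hPq; positivity
  have hηP : 8 * η ≤ P := by have := Real.sqrt_nonneg (1 - μm); rw [hη]; linarith
  set K := η / (d + 1) with hK
  have hK0 : 0 < K := by positivity
  have hKη : (d + 1) * K = η := by rw [hK]; field_simp
  have hKle : K ≤ η := by nlinarith
  obtain ⟨r₁, hr₁, hsub⟩ := nhds_basis_closedBall.mem_iff.1 (hp (K / 4) (by positivity))
  -- The bound r ≤ m₀/P keeps the barrier, which is at most P r on the ball, below the obstacle.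
  set r := min r₁ (min (ρ₀ / 2) (m₀ / P)) with hrdef
  have hr : 0 < r := by positivity
  have hr2 : r < ρ₀ :=
    ((min_le_right _ _).trans (min_le_left _ _)).trans_lt (half_lt_self hρ₀)
  have hr3 : P * r ≤ m₀ := by
    have : r ≤ m₀ / P := (min_le_right _ _).trans (min_le_right _ _)
    rwa [le_div_iff₀ hP0, mul_comm] at this
  have hrw : ∀ y ∈ closedBall x₀ r, inner ℝ p (y - x₀) - K / 4 * ‖y - x₀‖ ≤ w y :=
    fun y hy => hsub (closedBall_subset_closedBall (min_le_left _ _) hy)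
  have hrB : closedBall x₀ r ⊆ closedBall x₀ ρ₀ := closedBall_subset_closedBall hr2.le
  set φ := quadBarrier e x₀ (P - 3 * η) (-(K / r)) (-(η / r)) (K * r / 4) with hφ
  have hφc : Continuous φ := continuous_quadBarrier _ _ _ _ _ _
  have hsr : ∀ y ∈ closedBall x₀ r, |inner ℝ e (y - x₀)| ≤ r := fun y hy =>
    (abs_real_inner_le_norm e (y - x₀)).trans (by
      rw [he1, one_mul]; exact mem_closedBall_iff_norm.1 hy)
  have hKr : 0 < K * r := by positivity
  have hsph : ∀ y ∈ sphere x₀ r, φ y < w y ∨ φ y < 0 := by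
    intro y hy
    have h1 := hrw y (sphere_subset_closedBall hy)
    have hsr := hsr y (sphere_subset_closedBall hy)
    rw [mem_sphere_iff_norm] at hy
    rw [hpe, hy] at h1
    set s := inner ℝ e (y - x₀) with hs
    have hφy : φ y = (P - 3 * η) * s - K * r + η * (s ^ 2 / r) + K * r / 4 := by
      rw [hφ, quadBarrier, hy, ← hs]; field_simp; ring
    rw [hφy]
    rcases le_or_gt 0 s with h | h
    · left
      have h2 : s ^ 2 / r ≤ s := by
        rw [div_le_iff₀ hr, sq]; exact mul_le_mul_of_nonneg_left (le_of_abs_le hsr) h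
      nlinarith [mul_le_mul_of_nonneg_left h2 hη0.le, mul_nonneg hη0.le h]
    · right
      rw [abs_of_neg h] at hsr
      have h2 : s ^ 2 / r ≤ -s := by
        rw [div_le_iff₀ hr]; nlinarith
      nlinarith [mul_le_mul_of_nonneg_left h2 hη0.le]
  have hev : ∀ᶠ i in 𝓕, ∀ y ∈ sphere x₀ r, φ y < v i y ∨ φ y < 0 := by
    refine eventually_forall_of_compact
      (P := fun i y => φ y < v i y ∨ φ y < 0) (isCompact_sphere x₀ r) fun y hy => ?_
    rcases hsph y hy with h | h
    · obtain ⟨c, hc1, hc2⟩ := exists_between h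
      filter_upwards [hw y (hrB (sphere_subset_closedBall hy)) c hc2,
        (hφc.continuousAt.eventually (gt_mem_nhds hc1)).prod_inr 𝓕] with z h1 h2
      exact Or.inl (lt_trans h2 h1)
    · filter_upwards [(hφc.continuousAt.eventually (gt_mem_nhds h)).prod_inr 𝓕] with z h1
      exact Or.inr h1
  have hφx₀ : K * r / 8 < φ x₀ := by
    have : φ x₀ = K * r / 4 := by simp [hφ, quadBarrier]
    rw [this]; linarith
  obtain ⟨ρ, hρ, hρs⟩ := Metric.eventually_nhds_iff_ball.1
    ((hφc.continuousAt.eventually (lt_mem_nhds hφx₀)).and (ball_mem_nhds x₀ hr))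
  refine ⟨K * r / 8, by positivity,
    eventually_prod_of_ball (P := fun i y => K * r / 8 ≤ v i y) hρ ?_⟩
  filter_upwards [hv, ho, hev] with i hi1 hi2 hi3 y hy
  have key := hi1.barrier_le hd hU (hrB.trans hB) (fun y hy => ?_) hφc hi3 (fun y _ _ => ?_)
    (fun y hy _ => ?_) y (hρs y hy).2
  · exact (le_of_lt (hρs y hy).1).trans key
  · refine le_trans ?_ (hi2 y (ball_subset_ball hr2.le hy))
    have hy' := ball_subset_closedBall hy
    have h1 := hsr y hy'
    set s := inner ℝ e (y - x₀) with hs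
    have h2 : s ^ 2 / r ≤ r := by
      rw [div_le_iff₀ hr, ← sq, ← sq_abs]; gcongr
    have h3 : φ y ≤ (P - 3 * η) * s + η * (s ^ 2 / r) + K * r / 4 := by
      have h5 : φ y = (P - 3 * η) * s - K / r * ‖y - x₀‖ ^ 2 + η * (s ^ 2 / r) + K * r / 4 := by
        rw [hφ, quadBarrier, ← hs]; ring
      have : 0 ≤ K / r * ‖y - x₀‖ ^ 2 := by positivity
      linarith
    have h4 : (P - 3 * η) * s ≤ (P - 3 * η) * r :=
      mul_le_mul_of_nonneg_left (le_of_abs_le h1) (by linarith)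
    nlinarith [mul_le_mul_of_nonneg_left h2 hη0.le, mul_pos hη0 hr]
  · refine (hasLap_quadBarrier he1 x₀ (P - 3 * η) (-(K / r)) (-(η / r)) (K * r / 4) y).subMeanAt ?_
    have : 2 * d * (-(K / r)) - 2 * (-(η / r)) = 2 * K / r := by
      rw [← hKη]; field_simp; ring
    rw [this]; positivity
  · refine ⟨_,
      (hasLap_quadBarrier he1 x₀ (P - 3 * η) (-(K / r)) (-(η / r)) (K * r / 4) y).hasFDerivAt, ?_⟩
    have hyr : ‖y - x₀‖ ≤ r := by rw [mem_ball, dist_eq_norm] at hy; exact hy.le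
    have h1 := norm_quadBarrier_correction_le he1 (a := -(K / r)) (b := -(η / r)) hyr
    rw [abs_neg, abs_neg, abs_of_pos (by positivity), abs_of_pos (by positivity)] at h1
    have h2 : 2 * (K / r) * r + 2 * (η / r) * r = 2 * K + 2 * η := by field_simp
    have h3 := norm_sub_le_norm_add ((P - 3 * η) • e)
      ((2 * -(K / r)) • (y - x₀) - (2 * -(η / r) * inner ℝ e (y - x₀)) • e)
    rw [norm_smul, he1, mul_one, Real.norm_of_nonneg (by linarith)] at h3
    have h4 : √(1 - μm) ≤ ‖(P - 3 * η) • e +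
        ((2 * -(K / r)) • (y - x₀) - (2 * -(η / r) * inner ℝ e (y - x₀)) • e)‖ := by
      have : √(1 - μm) = P - 8 * η := by rw [hη]; ring
      linarith
    calc 1 - μm = √(1 - μm) ^ 2 := (Real.sq_sqrt hμ).symm
      _ ≤ _ := by gcongr

/-! ### Stability of obstacle solutions -/

lemma isState_glue_of_eqOn {U : Set (Space d)} {x₀ : Space d} {r : ℝ} {h v : Space d → ℝ}
    (hv : IsState U v) (hh : ContinuousOn h (closedBall x₀ r)) (h0 : ∀ x ∈ ball x₀ r, 0 ≤ h x)
    (heq : EqOn h v (sphere x₀ r)) : IsState U (glue (ball x₀ r) h v) := by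
  refine ⟨?_, fun x hx => ?_⟩
  · have h1 : ContinuousOn (glue (ball x₀ r) h v) (closedBall x₀ r) := by
      refine hh.congr fun x hx => ?_
      by_cases hB : x ∈ ball x₀ r
      · exact glue_of_mem hB
      · rw [glue_of_notMem hB]
        rw [← ball_union_sphere] at hx
        exact (heq (hx.resolve_left hB)).symm
    have h2 : ContinuousOn (glue (ball x₀ r) h v) (closure U ∩ (ball x₀ r)ᶜ) :=
      (hv.continuousOn.mono inter_subset_left).congr fun x hx => glue_of_notMem hx.2
    refine (h1.union_of_isClosed h2 isClosed_closedBall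
      (isClosed_closure.inter isOpen_ball.isClosed_compl)).mono fun x hx => ?_
    by_cases hB : x ∈ ball x₀ r
    · exact Or.inl (ball_subset_closedBall hB)
    · exact Or.inr ⟨hx, hB⟩
  · by_cases hB : x ∈ ball x₀ r
    · rw [glue_of_mem hB]; exact h0 x hB
    · rw [glue_of_notMem hB]; exact hv.nonneg x hx

lemma glue_eventuallyEq_of_notMem_closedBall {x₀ x : Space d} {r : ℝ} {w v : Space d → ℝ}
    (hx : x ∉ closedBall x₀ r) : glue (ball x₀ r) w v =ᶠ[𝓝 x] v := by
  filter_upwards [isClosed_closedBall.isOpen_compl.mem_nhds hx] with y hy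
  exact glue_of_notMem fun h => hy (ball_subset_closedBall h)

lemma glue_eq_of_eqOn {x₀ x : Space d} {r : ℝ} {h v : Space d → ℝ} (heq : EqOn h v (sphere x₀ r))
    (hx : x ∈ closedBall x₀ r) : glue (ball x₀ r) h v x = h x := by
  by_cases hB : x ∈ ball x₀ r
  · exact glue_of_mem hB
  · rw [glue_of_notMem hB]
    rw [← ball_union_sphere] at hx
    exact (heq (hx.resolve_left hB)).symm

lemma PolyApprox.const_le (hd : 0 < d) {c : Space d} {ρ : ℝ} (hρ : 0 < ρ)
    {h : Space d → ℝ} (H : PolyApprox c ρ h) {m : ℝ} (hm : ∀ x ∈ sphere c ρ, m ≤ h x) :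
    ∀ x ∈ closedBall c ρ, m ≤ h x :=
  H.le_of_subMeanAt hd hρ (f := fun _ => m) continuousOn_const
    (fun x _ _ => subMeanAt_const m x) hm

/-- Replacing a supersolution in a ball of its wet region by a harmonic function. -/
theorem IsSupersolution.glue_harmonic (hd : 0 < d) {U : Set (Space d)} (hU : IsOpen U) {μp : ℝ}
    {v h : Space d → ℝ} (hv : IsSupersolution U μp v) {x₀ : Space d} {r : ℝ} (hr : 0 < r)
    (hB : closedBall x₀ r ⊆ wet U v ∩ U) (H : PolyApprox x₀ r h) (heq : EqOn h v (sphere x₀ r)) :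
    (∀ x ∈ closedBall x₀ r, 0 < h x ∧ h x ≤ v x) ∧
      IsSupersolution U μp (glue (ball x₀ r) h v) := by
  have hBU : closedBall x₀ r ⊆ U := fun x hx => (hB hx).2
  have hvc : ContinuousOn v (closedBall x₀ r) :=
    hv.state.continuousOn.mono (hBU.trans subset_closure)
  obtain ⟨y₀, hy₀, hmin⟩ := (isCompact_closedBall x₀ r).exists_isMinOn
    ⟨x₀, mem_closedBall_self hr.le⟩ hvc
  have hm : 0 < v y₀ := (hB hy₀).1.2
  have hpos : ∀ x ∈ closedBall x₀ r, 0 < h x := fun x hx => hm.trans_le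
    (H.const_le hd hr (fun y hy => (hmin (sphere_subset_closedBall hy)).trans_eq (heq hy).symm) x hx)
  have hhv : ∀ x ∈ closedBall x₀ r, h x ≤ v x := H.ge_of_subMeanAt_neg hd hr hvc
    (fun x hx _ => hv.subMeanAt_neg hU (hBU (ball_subset_closedBall hx))
      (hB (ball_subset_closedBall hx)).1.2) fun x hx => (heq hx).le
  have hst : IsState U (glue (ball x₀ r) h v) := isState_glue_of_eqOn hv.state H.continuousOn
    (fun x hx => (hpos x (ball_subset_closedBall hx)).le) heq
  have hle : ∀ x, glue (ball x₀ r) h v x ≤ v x := fun x => by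
    by_cases hx : x ∈ ball x₀ r
    · rw [glue_of_mem hx]; exact hhv x (ball_subset_closedBall hx)
    · rw [glue_of_notMem hx]
  refine ⟨fun x hx => ⟨hpos x hx, hhv x hx⟩, IsSupersolution.of_local hd hst (fun x hx h0 => ?_)
    fun x hx p hp => ?_⟩
  · by_cases hxB : x ∈ ball x₀ r
    · refine (H.neg.subMeanAt hd hxB).congr ?_
      filter_upwards [glue_eventuallyEq (w := h) (v := v) isOpen_ball hxB] with y hy
      rw [hy]
    · exact (hv.subMeanAt_neg hU hx (by rwa [glue_of_notMem hxB] at h0)).of_le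
        (by rw [glue_of_notMem hxB]) (Eventually.of_forall fun y => neg_le_neg (hle y))
        (eventually_integrableOn_neg (hv.state.integrable_near hU hx))
        (eventually_integrableOn_neg (hst.integrable_near hU hx))
  · have hxB : x ∉ closedBall x₀ r := fun hxB => by
      have h1 := ((hst.mem_freeBoundary_iff hU).1 hx).2.1
      rw [glue_eq_of_eqOn heq hxB] at h1
      exact (hpos x hxB).ne' h1
    have he := glue_eventuallyEq_of_notMem_closedBall (w := h) (v := v) hxB
    exact hv.slope_le x ((mem_freeBoundary_congr hU he).1 hx) p
      (subDiff_subset_of_le (Eventually.of_forall hle) hp)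

/-- Replacing a subsolution in a ball by a harmonic function. -/
theorem IsSubsolution.glue_harmonic (hd : 0 < d) {U : Set (Space d)} (hU : IsOpen U) {μm : ℝ}
    {v h : Space d → ℝ} (hv : IsSubsolution U μm v) {x₀ : Space d} {r : ℝ} (hr : 0 < r)
    (hB : closedBall x₀ r ⊆ U) (H : PolyApprox x₀ r h) (heq : EqOn h v (sphere x₀ r))
    (hpos : ∀ x ∈ ball x₀ r, 0 < h x)
    (hsl : ∀ x ∈ sphere x₀ r, v x = 0 → ∀ p ∈ superDiff U (glue (ball x₀ r) h v) x,
      1 - μm ≤ ‖p‖ ^ 2) :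
    (∀ x ∈ closedBall x₀ r, v x ≤ h x) ∧ IsSubsolution U μm (glue (ball x₀ r) h v) := by
  have hvc : ContinuousOn v (closedBall x₀ r) :=
    hv.state.continuousOn.mono (hB.trans subset_closure)
  have hhv : ∀ x ∈ closedBall x₀ r, v x ≤ h x := H.le_of_subMeanAt hd hr hvc
    (fun x hx hlt => hv.subMeanAt hU (hB (ball_subset_closedBall hx)) ((hpos x hx).trans hlt))
    fun x hx => (heq hx).ge
  have hst : IsState U (glue (ball x₀ r) h v) := isState_glue_of_eqOn hv.state H.continuousOn
    (fun x hx => (hpos x hx).le) heq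
  have hle : ∀ x, v x ≤ glue (ball x₀ r) h v x := fun x => by
    by_cases hx : x ∈ ball x₀ r
    · rw [glue_of_mem hx]; exact hhv x (ball_subset_closedBall hx)
    · rw [glue_of_notMem hx]
  refine ⟨hhv, IsSubsolution.of_local hd hst (fun x hx h0 => ?_) fun x hx p hp => ?_⟩
  · by_cases hxB : x ∈ ball x₀ r
    · exact (H.subMeanAt hd hxB).congr (glue_eventuallyEq isOpen_ball hxB).symm
    · exact (hv.subMeanAt hU hx (by rwa [glue_of_notMem hxB] at h0)).of_le
        (by rw [glue_of_notMem hxB]) (Eventually.of_forall hle)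
        (hv.state.integrable_near hU hx) (hst.integrable_near hU hx)
  · by_cases hxB : x ∈ closedBall x₀ r
    · have h1 := ((hst.mem_freeBoundary_iff hU).1 hx).2.1
      rw [glue_eq_of_eqOn heq hxB] at h1
      rw [← ball_union_sphere] at hxB
      rcases hxB with hxB | hxB
      · exact absurd h1 (hpos x hxB).ne'
      · exact hsl x hxB (by rw [← heq hxB, h1]) p hp
    · have he := glue_eventuallyEq_of_notMem_closedBall (w := h) (v := v) hxB
      exact hv.slope_ge x ((mem_freeBoundary_congr hU he).1 hx) p
        (superDiff_subset_of_le hU hx.2 (Eventually.of_forall hle) hp)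

lemma IsStable.isSubsolution (hd : 0 < d) {U : Set (Space d)} {μm μp : ℝ} {v : Space d → ℝ}
    (hv : IsStable U μm μp v) : IsSubsolution U μm v :=
  ⟨hv.state, subharmonicIn_of_harmonicOnNhd hd hv.harmonic, hv.slope_ge⟩

lemma IsStable.isSupersolution (hd : 0 < d) {U : Set (Space d)} {μm μp : ℝ} {v : Space d → ℝ}
    (hv : IsStable U μm μp v) : IsSupersolution U μp v :=
  ⟨hv.state, superharmonicIn_of_harmonicOnNhd hd hv.harmonic, hv.slope_le⟩

lemma PolyApprox.harmonicAt_of_eqOn (hd : 0 < d) {v h : Space d → ℝ} {x : Space d} {r : ℝ}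
    (hr : 0 < r) (H : PolyApprox x r h) (heq : ∀ y ∈ ball x r, h y = v y) :
    InnerProductSpace.HarmonicAt v x := by
  refine (InnerProductSpace.harmonicAt_congr_nhds ?_).1 (H.harmonicOnNhd hd x (mem_ball_self hr))
  filter_upwards [ball_mem_nhds x hr] with y hy using heq y hy

/-- The harmonic replacement in a ball of the wet region is a smaller supersolution. It stays above
the obstacle because the obstacle is a subsolution with smaller boundary values, so minimality
forces equality. -/
theorem IsMinimalSupersolution.harmonicOnNhd (hd : 0 < d) {U : Set (Space d)} (hU : IsOpen U)
    {μm μp f : ℝ} {o v : Space d → ℝ} (hv : IsMinimalSupersolution U μp f o v)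
    (ho : IsSubsolution U μm o) : InnerProductSpace.HarmonicOnNhd v (wet U v ∩ U) := by
  intro x hx
  obtain ⟨r, hr, hB⟩ := nhds_basis_closedBall.mem_iff.1
    ((hv.1.1.state.isOpen_wet_inter hU).mem_nhds hx)
  have hBU : closedBall x r ⊆ U := fun y hy => (hB hy).2
  have hBc : closedBall x r ⊆ closure U := hBU.trans subset_closure
  obtain ⟨h, H, heq⟩ := exists_polyApprox hd hr
    (hv.1.1.state.continuousOn.mono (sphere_subset_closedBall.trans hBc))
  obtain ⟨h1, h2⟩ := hv.1.1.glue_harmonic hd hU hr hB H heq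
  have hoh : ∀ y ∈ closedBall x r, o y ≤ h y := H.le_of_subMeanAt hd hr
    (ho.state.continuousOn.mono hBc)
    (fun y hy hlt => ho.subMeanAt hU (hBU (ball_subset_closedBall hy))
      ((h1 y (ball_subset_closedBall hy)).1.trans hlt))
    fun y hy => (hv.1.2.2 y (hBc (sphere_subset_closedBall hy))).trans_eq (heq hy).symm
  refine H.harmonicAt_of_eqOn hd hr fun y hy => le_antisymm (h1 y (ball_subset_closedBall hy)).2 ?_
  have := hv.2 _ ⟨h2, fun z hz => ?_, fun z hz => ?_⟩ y (hBc (ball_subset_closedBall hy))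
  · rwa [glue_of_mem hy] at this
  · rw [glue_of_notMem (frontier_notMem_ball hU hBU hz)]; exact hv.1.2.1 z hz
  · by_cases hzB : z ∈ ball x r
    · rw [glue_of_mem hzB]; exact hoh z (ball_subset_closedBall hzB)
    · rw [glue_of_notMem hzB]; exact hv.1.2.2 z hz

/-- The replacement stays below `o` because `o` is superharmonic where it is positive. The ball may
reach across the free boundary of `v`: it is enough that the replacement is positive inside and
steep where `v` vanishes on the sphere. For balls inside the wet region of `v` the steepness
condition is void; the general form is what excludes hollow sets. -/
theorem IsMaximalSubsolution.le_of_glue_harmonic (hd : 0 < d) {U : Set (Space d)} (hU : IsOpen U)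
    {μm μp f : ℝ} {o v h : Space d → ℝ} (hv : IsMaximalSubsolution U μm f o v)
    (ho : IsSupersolution U μp o) {x₀ : Space d} {r : ℝ} (hr : 0 < r)
    (hB : closedBall x₀ r ⊆ U) (hBo : ∀ y ∈ ball x₀ r, 0 < o y) (H : PolyApprox x₀ r h)
    (heq : EqOn h v (sphere x₀ r)) (hpos : ∀ x ∈ ball x₀ r, 0 < h x)
    (hsl : ∀ x ∈ sphere x₀ r, v x = 0 → ∀ p ∈ superDiff U (glue (ball x₀ r) h v) x,
      1 - μm ≤ ‖p‖ ^ 2) :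
    ∀ x ∈ ball x₀ r, h x = v x := by
  have hBc : closedBall x₀ r ⊆ closure U := hB.trans subset_closure
  obtain ⟨h1, h2⟩ := hv.1.1.glue_harmonic hd hU hr hB H heq hpos hsl
  have hho : ∀ y ∈ closedBall x₀ r, h y ≤ o y := H.ge_of_subMeanAt_neg hd hr
    (ho.state.continuousOn.mono hBc)
    (fun y hy _ => ho.subMeanAt_neg hU (hB (ball_subset_closedBall hy)) (hBo y hy))
    fun y hy => (heq hy).trans_le (hv.1.2.2 y (hBc (sphere_subset_closedBall hy)))
  intro y hy
  refine le_antisymm ?_ (h1 y (ball_subset_closedBall hy))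
  have := hv.2 _ ⟨h2, fun z hz => ?_, fun z hz => ?_⟩ y (hBc (ball_subset_closedBall hy))
  · rwa [glue_of_mem hy] at this
  · rw [glue_of_notMem (frontier_notMem_ball hU hB hz)]; exact hv.1.2.1 z hz
  · by_cases hzB : z ∈ ball x₀ r
    · rw [glue_of_mem hzB]; exact hho z (ball_subset_closedBall hzB)
    · rw [glue_of_notMem hzB]; exact hv.1.2.2 z hz

theorem IsMaximalSubsolution.harmonicOnNhd (hd : 0 < d) {U : Set (Space d)} (hU : IsOpen U)
    {μm μp f : ℝ} {o v : Space d → ℝ} (hv : IsMaximalSubsolution U μm f o v)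
    (ho : IsSupersolution U μp o) : InnerProductSpace.HarmonicOnNhd v (wet U v ∩ U) := by
  intro x hx
  obtain ⟨r, hr, hB⟩ := nhds_basis_closedBall.mem_iff.1
    ((hv.1.1.state.isOpen_wet_inter hU).mem_nhds hx)
  have hBU : closedBall x r ⊆ U := fun y hy => (hB hy).2
  have hBc : closedBall x r ⊆ closure U := hBU.trans subset_closure
  have hvc := hv.1.1.state.continuousOn.mono hBc
  obtain ⟨h, H, heq⟩ := exists_polyApprox hd hr (hvc.mono sphere_subset_closedBall)
  obtain ⟨y₀, hy₀, hmin⟩ := (isCompact_closedBall x r).exists_isMinOn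
    ⟨x, mem_closedBall_self hr.le⟩ hvc
  have hpos : ∀ y ∈ closedBall x r, 0 < h y := fun y hy => ((hB hy₀).1.2 : 0 < v y₀).trans_le
    (H.const_le hd hr (fun y hy => (hmin (sphere_subset_closedBall hy)).trans_eq (heq hy).symm) y hy)
  refine H.harmonicAt_of_eqOn hd hr (hv.le_of_glue_harmonic hd hU ho hr hBU (fun y hy => ?_) H heq
    (fun y hy => hpos y (ball_subset_closedBall hy)) fun y hy h0 => ?_)
  · have hy' := ball_subset_closedBall hy
    exact (hB hy').1.2.trans_le (hv.1.2.2 y (hBc hy'))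
  · exact absurd h0 (hB (sphere_subset_closedBall hy)).1.2.ne'

lemma eventually_of_eventually_pure_prod {x : Space d} {P : Unit → Space d → Prop}
    (h : ∀ᶠ z in (pure () : Filter Unit) ×ˢ 𝓝 x, P z.1 z.2) : ∀ᶠ y in 𝓝 x, P () y := by
  have := h.curry
  rwa [eventually_pure] at this

/-- At a free boundary point of `v` the obstacle vanishes. If it is wet arbitrarily close by, its
own lower slope bound is inherited through o ≤ v. Otherwise the obstacle is dry nearby, and a slope
below 1 - μ₋ < 1 + μ₊ would let the barrier dry out `v`. -/
theorem IsMinimalSupersolution.isStable (hd : 0 < d) {U : Set (Space d)} (hU : IsOpen U)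
    {μm μp f : ℝ} (hμm : 0 ≤ μm) (hμp : 0 ≤ μp) {o v : Space d → ℝ}
    (hv : IsMinimalSupersolution U μp f o v) (ho : IsStable U μm μp o) : IsStable U μm μp v := by
  refine ⟨hv.1.1.state, hv.harmonicOnNhd hd hU (ho.isSubsolution hd), fun x hx p hp => ?_,
    hv.1.1.slope_le⟩
  obtain ⟨hxU, hx0, hfr⟩ := (hv.1.1.state.mem_freeBoundary_iff hU).1 hx
  by_cases hcl : ∃ᶠ y in 𝓝 x, 0 < o y
  · have hox : o x = 0 := le_antisymm ((hv.1.2.2 x (subset_closure hxU)).trans_eq hx0)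
      (ho.state.nonneg x (subset_closure hxU))
    refine ho.slope_ge x ((ho.state.mem_freeBoundary_iff hU).2 ⟨hxU, hox, hcl⟩) p
      (superDiff_subset_of_le hU hxU ?_ hp)
    filter_upwards [eventually_mem_closure hU hxU] with y hy using hv.1.2.2 y hy
  · rw [not_frequently] at hcl
    obtain ⟨ρ, hρ, hsub⟩ := nhds_basis_closedBall.mem_iff.1 (inter_mem (hU.mem_nhds hxU) hcl)
    by_contra hcon
    -- The theorem on families is used for the constant family over `Unit` along `pure ()`, with `v`
    -- itself as relaxed limit.
    have := eventually_eq_zero_of_superDiff hd hU hμp (𝓕 := pure ()) (v := fun _ : Unit => v)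
      (o := fun _ => o) (f := fun _ => f) (w := v) (x₀ := x) (p := p)
      (Eventually.of_forall fun _ => hv) hρ (fun y hy => (hsub hy).1)
      (Eventually.of_forall fun _ y hy => not_lt.1 (hsub (ball_subset_closedBall hy)).2)
      (fun y hy => hv.1.1.state.nonneg y (subset_closure (hsub hy).1))
      (fun y hy c hc => ((hv.1.1.state.continuousAt hU (hsub hy).1).eventually
        (gt_mem_nhds hc)).prod_inr _) hp (by linarith)
    have h2 := eventually_of_eventually_pure_prod (P := fun _ y => v y = 0) this
    obtain ⟨y, hy1, hy2⟩ := (hfr.and_eventually h2).exists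
    exact hy1.ne' hy2

/-- If the obstacle vanishes at the point, its upper slope bound is inherited through v ≤ o. If it
is positive there, too steep a subdifferential would make `v` positive at its own free boundary
point. -/
theorem IsMaximalSubsolution.isStable (hd : 0 < d) {U : Set (Space d)} (hU : IsOpen U)
    {μm μp f : ℝ} (hμm : 0 ≤ μm) (hμm1 : μm ≤ 1) (hμp : 0 ≤ μp) {o v : Space d → ℝ}
    (hv : IsMaximalSubsolution U μm f o v) (ho : IsStable U μm μp o) : IsStable U μm μp v := by
  refine ⟨hv.1.1.state, hv.harmonicOnNhd hd hU (ho.isSupersolution hd), hv.1.1.slope_ge,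
    fun x hx p hp => ?_⟩
  obtain ⟨hxU, hx0, hfr⟩ := (hv.1.1.state.mem_freeBoundary_iff hU).1 hx
  have hle : ∀ᶠ y in 𝓝 x, v y ≤ o y := by
    filter_upwards [eventually_mem_closure hU hxU] with y hy using hv.1.2.2 y hy
  rcases (ho.state.nonneg x (subset_closure hxU)).eq_or_lt with h0 | h0
  · refine ho.slope_le x ((ho.state.mem_freeBoundary_iff hU).2 ⟨hxU, h0.symm, ?_⟩) p
      (subDiff_subset_of_le hle hp)
    exact (hfr.and_eventually hle).mono fun y hy => hy.1.trans_le hy.2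
  · obtain ⟨ρ, hρ, hsub⟩ := nhds_basis_closedBall.mem_iff.1 (inter_mem (hU.mem_nhds hxU)
      ((ho.state.continuousAt hU hxU).eventually (lt_mem_nhds (half_lt_self h0))))
    by_contra hcon
    obtain ⟨m, hm, this⟩ := eventually_le_of_subDiff hd hU (sub_nonneg.2 hμm1) (𝓕 := pure ())
      (v := fun _ : Unit => v) (o := fun _ => o) (f := fun _ => f) (w := v) (x₀ := x) (p := p)
      (Eventually.of_forall fun _ => hv) hρ (fun y hy => (hsub hy).1) (half_pos h0)
      (Eventually.of_forall fun _ y hy => (hsub (ball_subset_closedBall hy)).2.out.le)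
      (fun y hy c hc => ((hv.1.1.state.continuousAt hU (hsub hy).1).eventually
        (lt_mem_nhds hc)).prod_inr _) hp (by linarith)
    have h2 := eventually_of_eventually_pure_prod (P := fun _ y => m ≤ v y) this
    rw [← hx0] at hm
    exact absurd h2.self_of_nhds (not_le.2 hm)

/-- Truncation at `M` preserves supersolutions, because near the free boundary v < M and nothing
changes there. The truncation is a competitor. -/
theorem IsMinimalSupersolution.le_const (hd : 0 < d) {U : Set (Space d)} (hU : IsOpen U)
    {μp f M : ℝ} (hM : 0 < M) {o v : Space d → ℝ} (hv : IsMinimalSupersolution U μp f o v)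
    (hf : f ≤ M) (ho : ∀ x ∈ closure U, o x ≤ M) : ∀ x ∈ closure U, v x ≤ M := by
  have hs := hv.1.1.state
  have hst : IsState U (fun y => min (v y) M) :=
    ⟨fun x hx => Filter.Tendsto.min (hs.continuousOn x hx) tendsto_const_nhds, fun x hx => le_min (hs.nonneg x hx) hM.le⟩
  have hsup : IsSupersolution U μp (fun y => min (v y) M) := by
    refine IsSupersolution.of_local hd hst (fun x hx hpos => ?_) fun x hx p hp => ?_
    · rcases min_cases (v x) M with ⟨h, -⟩ | ⟨h, -⟩
      · exact (hv.1.1.subMeanAt_neg hU hx (lt_of_lt_of_le hpos (min_le_left _ _))).of_le (by rw [h])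
          (Eventually.of_forall fun y => neg_le_neg (min_le_left _ _))
          (eventually_integrableOn_neg (hs.integrable_near hU hx))
          (eventually_integrableOn_neg (hst.integrable_near hU hx))
      · exact (subMeanAt_const (-M) x).of_le (by rw [h])
          (Eventually.of_forall fun y => neg_le_neg (min_le_right _ _))
          (eventually_integrableOn_of_continuous continuous_const x)
          (eventually_integrableOn_neg (hst.integrable_near hU hx))
    · obtain ⟨hxU, hx0, -⟩ := (hst.mem_freeBoundary_iff hU).1 hx
      have hvM : v x < M := by
        by_contra hcon
        rw [min_eq_right (not_lt.1 hcon)] at hx0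
        exact hM.ne' hx0
      have he : (fun y => min (v y) M) =ᶠ[𝓝 x] v := by
        filter_upwards [(hs.continuousAt hU hxU).eventually (gt_mem_nhds hvM)] with y hy
        exact min_eq_left (le_of_lt hy)
      exact hv.1.1.slope_le x ((mem_freeBoundary_congr hU he).1 hx) p
        (subDiff_subset_of_le (he.mono fun y hy => hy.le) hp)
  intro x hx
  refine (hv.2 _ ⟨hsup, fun y hy => ?_, fun y hy => le_min (hv.1.2.2 y hy) (ho y hy)⟩ x hx).trans
    (min_le_right _ _)
  rw [hv.1.2.1 y hy, min_eq_left hf]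

/-- Induction on the number of points of `Z` in (0, t): the step is applied from the last such point
to `t`, or from 0 if there is none. -/
lemma forcing_induction {T : ℝ} {Z : Set ℝ} (hZ : Z.Finite) {P : ℝ → Prop} (h0 : P 0)
    (step : ∀ s t : ℝ, 0 ≤ s → s < t → t ≤ T → Disjoint (Ioo s t) Z → P s → P t) :
    ∀ t ∈ Icc 0 T, P t := by
  have key : ∀ n : ℕ, ∀ t ∈ Icc 0 T, (Z ∩ Ioo 0 t).ncard = n → P t := by
    intro n
    induction n using Nat.strong_induction_on with
    | _ n ih =>
      intro t ht hn
      rcases ht.1.eq_or_lt with rfl | ht0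
      · exact h0
      have hfin : (Z ∩ Ioo 0 t).Finite := hZ.inter_of_left _
      rcases (Z ∩ Ioo 0 t).eq_empty_or_nonempty with he | hne
      · exact step 0 t le_rfl ht0 ht.2 (by
          rw [disjoint_iff_inter_eq_empty, inter_comm]; exact he) h0
      · obtain ⟨z, hz, hmax⟩ := exists_max_image _ id hfin hne
        have hz1 : 0 < z := hz.2.1
        have hz2 : z < t := hz.2.2
        refine step z t hz1.le hz2 ht.2 ?_ (ih _ ?_ z ⟨hz1.le, hz2.le.trans ht.2⟩ rfl)
        · rw [disjoint_left]
          intro y hy hyZ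
          have : y ≤ z := hmax y ⟨hyZ, hz1.trans hy.1, hy.2⟩
          exact absurd hy.1 (not_lt.2 this)
        · rw [← hn]
          refine ncard_lt_ncard ⟨fun y hy => ⟨hy.1, hy.2.1, hy.2.2.trans hz2⟩, fun hcon => ?_⟩ hfin
          exact lt_irrefl z (hcon hz).2.2
  exact fun t ht => key _ t ht rfl

theorem IsObstacleSolution.isStable_and_bounded (hd : 0 < d) {U : Set (Space d)} (hU : IsOpen U)
    {μm μp T : ℝ} (hμm : 0 ≤ μm) (hμm1 : μm ≤ 1) (hμp : 0 ≤ μp) {Z : Set ℝ} {F : ℝ → ℝ}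
    (hF : IsForcing T Z F) {u : ℝ → Space d → ℝ} (hu : IsObstacleSolution U μm μp T Z F u)
    (hb : BddAbove (u 0 '' closure U)) :
    ∃ M : ℝ, ∀ t ∈ Icc 0 T, IsStable U μm μp (u t) ∧ ∀ x ∈ closure U, u t x ≤ M := by
  obtain ⟨M₀, hM₀⟩ := hb
  obtain ⟨L, hL⟩ := hF.lipschitz
  obtain ⟨M₁, hM₁⟩ := isCompact_Icc.bddAbove_image hL.continuousOn
  set M := max (max M₀ M₁) 1 with hM
  have hM0 : 0 < M := one_pos.trans_le (le_max_right _ _)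
  refine ⟨M, forcing_induction hF.finite ⟨hu.initial, fun x hx => ?_⟩ ?_⟩
  · exact (hM₀ (mem_image_of_mem _ hx)).trans ((le_max_left _ _).trans (le_max_left _ _))
  · rintro s t hs hst ht hdis ⟨h1, h2⟩
    rcases hF.monotone_or_antitone s t hs hst ht hdis with hm | hm
    · have hmin := hu.increasing s t hs hst ht hdis hm
      refine ⟨hmin.isStable hd hU hμm hμp h1, hmin.le_const hd hU hM0 ?_ h2⟩
      exact (hM₁ (mem_image_of_mem _ ⟨hs.trans hst.le, ht⟩)).trans
        ((le_max_right _ _).trans (le_max_left _ _))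
    · have hmax := hu.decreasing s t hs hst ht hdis hm
      exact ⟨hmax.isStable hd hU hμm hμm1 hμp h1,
        fun x hx => (hmax.1.2.2 x hx).trans (h2 x hx)⟩

/-! ### Semicontinuous envelopes -/

/-- At points of the open set `U` the spatial constraint disappears; only the time interval remains
a constraint. -/
lemma nhdsWithin_prod_closure {U : Set (Space d)} (hU : IsOpen U) {T t : ℝ} {x : Space d}
    (hx : x ∈ U) : 𝓝[Icc 0 T ×ˢ closure U] (t, x) = 𝓝[Icc 0 T] t ×ˢ 𝓝 x := by
  rw [nhdsWithin_prod_eq, (nhdsWithin_eq_nhds (s := closure U)).2 (eventually_mem_closure hU hx)]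

/-- `u` takes values in `[0, M]`. -/
def BoundedBy (U : Set (Space d)) (T M : ℝ) (u : ℝ → Space d → ℝ) : Prop :=
  ∀ t ∈ Icc 0 T, ∀ x ∈ closure U, 0 ≤ u t x ∧ u t x ≤ M

lemma BoundedBy.eventually {U : Set (Space d)} {T M : ℝ} {u : ℝ → Space d → ℝ}
    (h : BoundedBy U T M u) (z : ℝ × Space d) :
    ∀ᶠ z in 𝓝[Icc 0 T ×ˢ closure U] z, 0 ≤ u z.1 z.2 ∧ u z.1 z.2 ≤ M := by
  filter_upwards [self_mem_nhdsWithin] with z hz using h z.1 hz.1 z.2 hz.2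

lemma neBot_envelope {U : Set (Space d)} {T t : ℝ} {x : Space d} (ht : t ∈ Icc 0 T)
    (hx : x ∈ closure U) : (𝓝[Icc 0 T ×ˢ closure U] (t, x)).NeBot :=
  mem_closure_iff_nhdsWithin_neBot.1 (subset_closure ⟨ht, hx⟩)

lemma le_upperEnv {U : Set (Space d)} {T M : ℝ} {u : ℝ → Space d → ℝ} (h : BoundedBy U T M u)
    {t : ℝ} {x : Space d} (ht : t ∈ Icc 0 T) (hx : x ∈ closure U) :
    u t x ≤ upperEnv U T u t x := by
  by_contra! hlt
  have := eventually_lt_of_limsup_lt hlt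
    (isBoundedUnder_of_eventually_le ((h.eventually (t, x)).mono fun _ hz => hz.2))
  exact lt_irrefl _ (this.self_of_nhdsWithin ⟨ht, hx⟩)

lemma eventually_lt_of_upperEnv_lt {U : Set (Space d)} (hU : IsOpen U) {T M : ℝ}
    {u : ℝ → Space d → ℝ} (h : BoundedBy U T M u) {t c : ℝ} {x : Space d} (hx : x ∈ U)
    (hc : upperEnv U T u t x < c) : ∀ᶠ z in 𝓝[Icc 0 T] t ×ˢ 𝓝 x, u z.1 z.2 < c := by
  rw [← nhdsWithin_prod_closure hU hx]
  exact eventually_lt_of_limsup_lt hc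
    (isBoundedUnder_of_eventually_le ((h.eventually (t, x)).mono fun _ hz => hz.2))

lemma upperEnv_le {U : Set (Space d)} (hU : IsOpen U) {T M : ℝ} {u : ℝ → Space d → ℝ}
    (h : BoundedBy U T M u) {t c : ℝ} {x : Space d} (ht : t ∈ Icc 0 T) (hx : x ∈ U)
    (hc : ∀ᶠ z in 𝓝[Icc 0 T] t ×ˢ 𝓝 x, u z.1 z.2 ≤ c) : upperEnv U T u t x ≤ c := by
  have := neBot_envelope ht (subset_closure hx)
  rw [← nhdsWithin_prod_closure hU hx] at hc
  exact limsup_le_of_le (isBoundedUnder_of_eventually_ge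
    ((h.eventually (t, x)).mono fun _ hz => hz.1)).isCoboundedUnder_le hc

lemma eventually_lt_of_lt_lowerEnv {U : Set (Space d)} (hU : IsOpen U) {T M : ℝ}
    {u : ℝ → Space d → ℝ} (h : BoundedBy U T M u) {t c : ℝ} {x : Space d} (hx : x ∈ U)
    (hc : c < lowerEnv U T u t x) : ∀ᶠ z in 𝓝[Icc 0 T] t ×ˢ 𝓝 x, c < u z.1 z.2 := by
  rw [← nhdsWithin_prod_closure hU hx]
  exact eventually_lt_of_lt_liminf hc
    (isBoundedUnder_of_eventually_ge ((h.eventually (t, x)).mono fun _ hz => hz.1))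

lemma le_lowerEnv {U : Set (Space d)} (hU : IsOpen U) {T M : ℝ} {u : ℝ → Space d → ℝ}
    (h : BoundedBy U T M u) {t c : ℝ} {x : Space d} (ht : t ∈ Icc 0 T) (hx : x ∈ U)
    (hc : ∀ᶠ z in 𝓝[Icc 0 T] t ×ˢ 𝓝 x, c ≤ u z.1 z.2) : c ≤ lowerEnv U T u t x := by
  have := neBot_envelope ht (subset_closure hx)
  rw [← nhdsWithin_prod_closure hU hx] at hc
  exact le_liminf_of_le (isBoundedUnder_of_eventually_le
    ((h.eventually (t, x)).mono fun _ hz => hz.2)).isCoboundedUnder_ge hc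

lemma lowerEnv_le {U : Set (Space d)} {T M : ℝ} {u : ℝ → Space d → ℝ} (h : BoundedBy U T M u)
    {t : ℝ} {x : Space d} (ht : t ∈ Icc 0 T) (hx : x ∈ closure U) :
    lowerEnv U T u t x ≤ u t x := by
  by_contra! hlt
  have := eventually_lt_of_lt_liminf hlt
    (isBoundedUnder_of_eventually_ge ((h.eventually (t, x)).mono fun _ hz => hz.1))
  exact lt_irrefl _ (this.self_of_nhdsWithin ⟨ht, hx⟩)

/-! ### Local behaviour of obstacle solutions in time -/

lemma exists_left_disjoint {Z : Set ℝ} (hZ : Z.Finite) {t l : ℝ} (hl : l < t) :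
    ∃ s, l ≤ s ∧ s < t ∧ Disjoint (Ioo s t) Z := by
  have h1 : (Z \ {t})ᶜ ∈ 𝓝 t := (hZ.subset sdiff_subset).isClosed.isOpen_compl.mem_nhds
    fun h => h.2 rfl
  obtain ⟨s, hs, hsub⟩ := (mem_nhdsLE_iff_exists_Ioc_subset' hl).1 (mem_nhdsWithin_of_mem_nhds h1)
  refine ⟨max l s, le_max_left _ _, max_lt hl hs, disjoint_left.2 fun y hy hyZ => ?_⟩
  exact hsub ⟨(le_max_right _ _).trans_lt hy.1, hy.2.le⟩ ⟨hyZ, hy.2.ne⟩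

lemma exists_right_disjoint {Z : Set ℝ} (hZ : Z.Finite) {t r : ℝ} (hr : t < r) :
    ∃ s, t < s ∧ s ≤ r ∧ Disjoint (Ioo t s) Z := by
  have h1 : (Z \ {t})ᶜ ∈ 𝓝 t := (hZ.subset sdiff_subset).isClosed.isOpen_compl.mem_nhds
    fun h => h.2 rfl
  obtain ⟨s, hs, hsub⟩ := (mem_nhdsGE_iff_exists_Ico_subset' hr).1 (mem_nhdsWithin_of_mem_nhds h1)
  refine ⟨min r s, lt_min hr hs, min_le_left _ _, disjoint_left.2 fun y hy hyZ => ?_⟩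
  exact hsub ⟨hy.1.le, hy.2.trans_le (min_le_right _ _)⟩ ⟨hyZ, hy.1.ne'⟩

/-- On (s₀, s₁] the solution is either the minimal supersolution above the locally dry state u(s₀),
and the barrier theorem applies, or it lies below u(s₀) and stays dry. The time t₀ will be either
endpoint: s₁ for the past and s₀ for the future. -/
theorem IsObstacleSolution.eventually_eq_zero (hd : 0 < d) {U : Set (Space d)} (hU : IsOpen U)
    {μm μp T M : ℝ} (hμp : 0 ≤ μp) {Z : Set ℝ} {F : ℝ → ℝ} (hF : IsForcing T Z F)
    {u : ℝ → Space d → ℝ} (hu : IsObstacleSolution U μm μp T Z F u) (hM : BoundedBy U T M u)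
    {s₀ s₁ t₀ : ℝ} (hs₀ : 0 ≤ s₀) (hs : s₀ < s₁) (hs₁ : s₁ ≤ T) (hdis : Disjoint (Ioo s₀ s₁) Z)
    (ht₀ : t₀ ∈ Icc 0 T) {x₀ : Space d} {ρ₀ : ℝ} (hρ₀ : 0 < ρ₀) (hB : closedBall x₀ ρ₀ ⊆ U)
    (ho : ∀ y ∈ ball x₀ ρ₀, u s₀ y ≤ 0) {p : Space d} (hp : p ∈ superDiff U (upperEnv U T u t₀) x₀)
    (hpq : ‖p‖ ^ 2 < 1 + μp) : ∀ᶠ z in 𝓝[Ioc s₀ s₁] t₀ ×ˢ 𝓝 x₀, u z.1 z.2 = 0 := by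
  have hIoc : ∀ s ∈ Ioc s₀ s₁, s ∈ Icc 0 T := fun s hs => ⟨hs₀.trans hs.1.le, hs.2.trans hs₁⟩
  have hd' : ∀ s ∈ Ioc s₀ s₁, Disjoint (Ioo s₀ s) Z := fun s hs =>
    hdis.mono_left (Ioo_subset_Ioo_right hs.2)
  rcases hF.monotone_or_antitone s₀ s₁ hs₀ hs hs₁ hdis with hm | hm
  · refine eventually_eq_zero_of_superDiff hd hU hμp (f := F) (o := fun _ => u s₀)
      (w := upperEnv U T u t₀) ?_ hρ₀ hB (Eventually.of_forall fun _ => ho)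
      (fun y hy => ?_) (fun y hy c hc => ?_) hp hpq
    · filter_upwards [self_mem_nhdsWithin] with s hs'
      exact hu.increasing s₀ s hs₀ hs'.1 (hs'.2.trans hs₁) (hd' s hs')
        (hm.mono (Icc_subset_Icc_right hs'.2))
    · exact ((hM t₀ ht₀ y (subset_closure (hB hy))).1).trans
        (le_upperEnv hM ht₀ (subset_closure (hB hy)))
    · exact (eventually_lt_of_upperEnv_lt hU hM (hB hy) hc).filter_mono
        (prod_mono_left _ (nhdsWithin_mono _ hIoc))
  · refine eventually_prod_of_ball (P := fun s y => u s y = 0) hρ₀ ?_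
    filter_upwards [self_mem_nhdsWithin] with s hs' y hy
    have hyU : y ∈ closure U := subset_closure (hB (ball_subset_closedBall hy))
    have := (hu.decreasing s₀ s hs₀ hs'.1 (hs'.2.trans hs₁) (hd' s hs')
      (hm.mono (Icc_subset_Icc_right hs'.2))).1.2.2 y hyU
    exact le_antisymm (this.trans (ho y hy)) (hM s (hIoc s hs') y hyU).1

/-- The counterpart of `eventually_eq_zero` for a locally wet state u(s₀): preserved trivially when
F increases, and by the subsolution barrier when F decreases. -/
theorem IsObstacleSolution.eventually_ge (hd : 0 < d) {U : Set (Space d)} (hU : IsOpen U)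
    {μm μp T M : ℝ} (hμm : μm ≤ 1) {Z : Set ℝ} {F : ℝ → ℝ} (hF : IsForcing T Z F)
    {u : ℝ → Space d → ℝ} (hu : IsObstacleSolution U μm μp T Z F u) (hM : BoundedBy U T M u)
    {s₀ s₁ t₀ : ℝ} (hs₀ : 0 ≤ s₀) (hs : s₀ < s₁) (hs₁ : s₁ ≤ T) (hdis : Disjoint (Ioo s₀ s₁) Z)
    {x₀ : Space d} {ρ₀ m₀ : ℝ} (hρ₀ : 0 < ρ₀) (hB : closedBall x₀ ρ₀ ⊆ U)
    (hm₀ : 0 < m₀) (ho : ∀ y ∈ ball x₀ ρ₀, m₀ ≤ u s₀ y) {p : Space d}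
    (hp : p ∈ subDiff (lowerEnv U T u t₀) x₀) (hpq : 1 - μm < ‖p‖ ^ 2) :
    ∃ m > 0, ∀ᶠ z in 𝓝[Ioc s₀ s₁] t₀ ×ˢ 𝓝 x₀, m ≤ u z.1 z.2 := by
  have hIoc : ∀ s ∈ Ioc s₀ s₁, s ∈ Icc 0 T := fun s hs => ⟨hs₀.trans hs.1.le, hs.2.trans hs₁⟩
  have hd' : ∀ s ∈ Ioc s₀ s₁, Disjoint (Ioo s₀ s) Z := fun s hs =>
    hdis.mono_left (Ioo_subset_Ioo_right hs.2)
  rcases hF.monotone_or_antitone s₀ s₁ hs₀ hs hs₁ hdis with hm | hm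
  · refine ⟨m₀, hm₀, eventually_prod_of_ball (P := fun s y => m₀ ≤ u s y) hρ₀ ?_⟩
    filter_upwards [self_mem_nhdsWithin] with s hs' y hy
    exact (ho y hy).trans ((hu.increasing s₀ s hs₀ hs'.1 (hs'.2.trans hs₁) (hd' s hs')
      (hm.mono (Icc_subset_Icc_right hs'.2))).1.2.2 y
        (subset_closure (hB (ball_subset_closedBall hy))))
  · refine eventually_le_of_subDiff hd hU (sub_nonneg.2 hμm) (f := F) (o := fun _ => u s₀)
      (w := lowerEnv U T u t₀) ?_ hρ₀ hB hm₀ (Eventually.of_forall fun _ => ho)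
      (fun y hy c hc => ?_) hp hpq
    · filter_upwards [self_mem_nhdsWithin] with s hs'
      exact hu.decreasing s₀ s hs₀ hs'.1 (hs'.2.trans hs₁) (hd' s hs')
        (hm.mono (Icc_subset_Icc_right hs'.2))
    · exact (eventually_lt_of_lt_lowerEnv hU hM (hB hy) hc).filter_mono
        (prod_mono_left _ (nhdsWithin_mono _ hIoc))

lemma eventually_Icc_of_left {T s₀ t₀ : ℝ} (hs : s₀ < t₀) {x₀ : Space d}
    {P : ℝ → Space d → Prop} (hl : ∀ᶠ z in 𝓝[Ioc s₀ t₀] t₀ ×ˢ 𝓝 x₀, P z.1 z.2)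
    (hr : ∀ᶠ z in 𝓝[Ioc t₀ T] t₀ ×ˢ 𝓝 x₀, P z.1 z.2) :
    ∀ᶠ z in 𝓝[Icc 0 T] t₀ ×ˢ 𝓝 x₀, P z.1 z.2 := by
  have h1 : 𝓝[Icc 0 T] t₀ ≤ 𝓝[Ioc s₀ t₀] t₀ ⊔ 𝓝[Ioc t₀ T] t₀ := by
    rw [← nhdsWithin_union]
    refine nhdsWithin_le_iff.2 ?_
    filter_upwards [self_mem_nhdsWithin, mem_nhdsWithin_of_mem_nhds (lt_mem_nhds hs)] with s h1 h2
    rcases le_or_gt s t₀ with h | h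
    · exact Or.inl ⟨h2, h⟩
    · exact Or.inr ⟨h, h1.2⟩
  refine Eventually.filter_mono (prod_mono_left _ h1) ?_
  rw [Filter.sup_prod]
  exact eventually_sup.2 ⟨hl, hr⟩

lemma eventually_right {Z : Set ℝ} (hZ : Z.Finite) {T t₀ : ℝ} (ht₀ : t₀ ≤ T) {x₀ : Space d}
    {P : ℝ → Space d → Prop} (h : ∀ s₁, t₀ < s₁ → s₁ ≤ T → Disjoint (Ioo t₀ s₁) Z →
      ∀ᶠ z in 𝓝[Ioc t₀ s₁] t₀ ×ˢ 𝓝 x₀, P z.1 z.2) :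
    ∀ᶠ z in 𝓝[Ioc t₀ T] t₀ ×ˢ 𝓝 x₀, P z.1 z.2 := by
  rcases ht₀.eq_or_lt with rfl | hlt
  · simp
  obtain ⟨s₁, h1, h2, h3⟩ := exists_right_disjoint hZ hlt
  refine (h s₁ h1 h2 h3).filter_mono (prod_mono_left _ (nhdsWithin_le_iff.2 ?_))
  filter_upwards [self_mem_nhdsWithin, mem_nhdsWithin_of_mem_nhds (gt_mem_nhds h1)] with s h4 h5
  exact ⟨h4.1, h5.le⟩

lemma eventually_prod_self {ι : Type*} {𝓕 : Filter ι} {x : Space d} {P : ι → Space d → Prop}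
    (h : ∀ᶠ z in 𝓕 ×ˢ 𝓝 x, P z.1 z.2) : ∀ᶠ y in 𝓝 x, ∀ᶠ z in 𝓕 ×ˢ 𝓝 y, P z.1 z.2 := by
  obtain ⟨pa, ha, pb, hb, hab⟩ := eventually_prod_iff.1 h
  filter_upwards [eventually_eventually_nhds.2 hb] with y hy
  exact eventually_prod_iff.2 ⟨pa, ha, pb, hy, hab⟩

lemma notMem_freeBoundary_upperEnv {U : Set (Space d)} (hU : IsOpen U) {T M : ℝ}
    {u : ℝ → Space d → ℝ} (hM : BoundedBy U T M u) {t₀ : ℝ} (ht₀ : t₀ ∈ Icc 0 T) {x₀ : Space d}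
    (h : ∀ᶠ z in 𝓝[Icc 0 T] t₀ ×ˢ 𝓝 x₀, u z.1 z.2 = 0) :
    x₀ ∉ freeBoundary U (upperEnv U T u t₀) := by
  intro hx
  rw [mem_freeBoundary_iff_frequently hU] at hx
  obtain ⟨y, hy1, hy2, hyU⟩ := (hx.2.1.and_eventually
    ((eventually_prod_self (P := fun s y => u s y = 0) h).and (hU.mem_nhds hx.1))).exists
  exact absurd hy1 (not_lt.2 (upperEnv_le hU hM ht₀ hyU (hy2.mono fun z hz => hz.le)))

lemma notMem_freeBoundary_lowerEnv {U : Set (Space d)} (hU : IsOpen U) {T M : ℝ}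
    {u : ℝ → Space d → ℝ} (hM : BoundedBy U T M u) {t₀ m : ℝ} (ht₀ : t₀ ∈ Icc 0 T) (hm : 0 < m)
    {x₀ : Space d} (h : ∀ᶠ z in 𝓝[Icc 0 T] t₀ ×ˢ 𝓝 x₀, m ≤ u z.1 z.2) :
    x₀ ∉ freeBoundary U (lowerEnv U T u t₀) := by
  intro hx
  rw [mem_freeBoundary_iff_frequently hU] at hx
  refine hx.2.2 ?_
  filter_upwards [eventually_prod_self (P := fun s y => m ≤ u s y) h, hU.mem_nhds hx.1]
    with y hy hyU
  exact hm.trans_le (le_lowerEnv hU hM ht₀ hyU hy)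

lemma eventually_of_nhdsWithin_self {𝓕 : Filter ℝ} {t₀ : ℝ} (h𝓕 : pure t₀ ≤ 𝓕) {x₀ : Space d}
    {P : ℝ → Space d → Prop} (h : ∀ᶠ z in 𝓕 ×ˢ 𝓝 x₀, P z.1 z.2) : ∀ᶠ y in 𝓝 x₀, P t₀ y := by
  have := (h.filter_mono (prod_mono_left _ h𝓕)).curry
  rwa [eventually_pure] at this

/-- The cone condition is used at a single time s₀ < t₀ beyond the last point of `Z`, where it
provides a dry ball as obstacle. Too small a slope then makes `u` vanish in a full space-time
neighbourhood of (t₀, x₀). -/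
theorem IsObstacleSolution.advancing (hd : 0 < d) {U : Set (Space d)} (hU : IsOpen U)
    {μm μp T M : ℝ} (hμp : 0 ≤ μp) {Z : Set ℝ} {F : ℝ → ℝ} (hF : IsForcing T Z F)
    {u : ℝ → Space d → ℝ} (hu : IsObstacleSolution U μm μp T Z F u) (hM : BoundedBy U T M u)
    {t₀ : ℝ} (ht₀ : t₀ ∈ Icc 0 T) {x₀ : Space d} (hx₀ : x₀ ∈ freeBoundary U (upperEnv U T u t₀))
    (hV : PositiveVelocity (fun t => wet U (upperEnv U T u t)) t₀ x₀) {p : Space d}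
    (hp : p ∈ superDiff U (upperEnv U T u t₀) x₀) : 1 + μp ≤ ‖p‖ ^ 2 := by
  by_contra! hpq
  obtain ⟨c, hc, r₀, hr₀, hr₀t, hcone⟩ := hV
  obtain ⟨s₀, h1, h2, h3⟩ := exists_left_disjoint hF.finite (sub_lt_self t₀ hr₀)
  have hs₀ : 0 ≤ s₀ := (sub_nonneg.2 hr₀t).trans h1
  obtain ⟨ρ, hρ, hρU⟩ := nhds_basis_closedBall.mem_iff.1 (hU.mem_nhds hx₀.2)
  have hleft : ∀ᶠ z in 𝓝[Ioc s₀ t₀] t₀ ×ˢ 𝓝 x₀, u z.1 z.2 = 0 := by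
    refine hu.eventually_eq_zero hd hU hμp hF hM hs₀ h2 ht₀.2 h3 ht₀
      (ρ₀ := min ρ (c * (t₀ - s₀))) (lt_min hρ (mul_pos hc (sub_pos.2 h2)))
      ((closedBall_subset_closedBall (min_le_left _ _)).trans hρU) (fun y hy => ?_) hp hpq
    have hy' := ball_subset_closedBall hy
    have hyU : y ∈ closure U :=
      subset_closure (hρU (closedBall_subset_closedBall (min_le_left _ _) hy'))
    have hnot := hcone s₀ ⟨h1, h2⟩ (closedBall_subset_closedBall (min_le_right _ _) hy')
    have h4 : upperEnv U T u s₀ y ≤ 0 := not_lt.1 fun h => hnot ⟨hyU, h⟩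
    exact (le_upperEnv hM ⟨hs₀, h2.le.trans ht₀.2⟩ hyU).trans h4
  -- The left neighbourhood contains t₀ itself, so u(t₀) is dry near x₀ and can serve as obstacle
  -- for the times after t₀, even if t₀ lies in `Z`.
  have hself : ∀ᶠ y in 𝓝 x₀, u t₀ y = 0 := eventually_of_nhdsWithin_self
    (P := fun s y => u s y = 0) (pure_le_nhdsWithin (show t₀ ∈ Ioc s₀ t₀ from ⟨h2, le_refl t₀⟩)) hleft
  obtain ⟨ρ', hρ', hsub⟩ := nhds_basis_closedBall.mem_iff.1
    (inter_mem (hU.mem_nhds hx₀.2) hself)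
  refine notMem_freeBoundary_upperEnv hU hM ht₀ (eventually_Icc_of_left
    (P := fun s y => u s y = 0) h2 hleft (eventually_right (P := fun s y => u s y = 0) hF.finite
      ht₀.2 fun s₁ h4 h5 h6 => ?_)) hx₀
  exact hu.eventually_eq_zero hd hU hμp hF hM ht₀.1 h4 h5 h6 ht₀ hρ' (fun y hy => (hsub hy).1)
    (fun y hy => (hsub (ball_subset_closedBall hy)).2.out.le) hp hpq

/-- The argument of `advancing` with wet obstacles. Positivity on the closed ball at time s₀ becomes
a uniform bound by compactness, and a uniform bound is what survives in the lower envelope. -/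
theorem IsObstacleSolution.receding (hd : 0 < d) {U : Set (Space d)} (hU : IsOpen U)
    {μm μp T M : ℝ} (hμm : μm ≤ 1) {Z : Set ℝ} {F : ℝ → ℝ} (hF : IsForcing T Z F)
    {u : ℝ → Space d → ℝ} (hu : IsObstacleSolution U μm μp T Z F u) (hM : BoundedBy U T M u)
    {t₀ : ℝ} (ht₀ : t₀ ∈ Icc 0 T) {x₀ : Space d} (hx₀ : x₀ ∈ freeBoundary U (lowerEnv U T u t₀))
    (hV : NegativeVelocity (fun t => wet U (lowerEnv U T u t)) t₀ x₀) {p : Space d}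
    (hp : p ∈ subDiff (lowerEnv U T u t₀) x₀) : ‖p‖ ^ 2 ≤ 1 - μm := by
  by_contra! hpq
  obtain ⟨c, hc, r₀, hr₀, hr₀t, hcone⟩ := hV
  obtain ⟨s₀, h1, h2, h3⟩ := exists_left_disjoint hF.finite (sub_lt_self t₀ hr₀)
  have hs₀ : 0 ≤ s₀ := (sub_nonneg.2 hr₀t).trans h1
  have hs₀T : s₀ ∈ Icc 0 T := ⟨hs₀, h2.le.trans ht₀.2⟩
  obtain ⟨ρ, hρ, hρU⟩ := nhds_basis_closedBall.mem_iff.1 (hU.mem_nhds hx₀.2)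
  have hleft : ∃ m > 0, ∀ᶠ z in 𝓝[Ioc s₀ t₀] t₀ ×ˢ 𝓝 x₀, m ≤ u z.1 z.2 := by
    set ρ₀ := min ρ (c * (t₀ - s₀)) with hρ₀
    have hρ₀0 : 0 < ρ₀ := lt_min hρ (mul_pos hc (sub_pos.2 h2))
    have hB : closedBall x₀ ρ₀ ⊆ U := (closedBall_subset_closedBall (min_le_left _ _)).trans hρU
    obtain ⟨y₀, hy₀, hmin⟩ := (isCompact_closedBall x₀ ρ₀).exists_isMinOn
      ⟨x₀, mem_closedBall_self hρ₀0.le⟩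
      ((hu.state s₀ hs₀T).continuousOn.mono (hB.trans subset_closure))
    have hpos : 0 < u s₀ y₀ := by
      have h4 : y₀ ∈ wet U (lowerEnv U T u s₀) :=
        hcone s₀ ⟨h1, h2⟩ (closedBall_subset_closedBall (min_le_right _ _) hy₀)
      exact h4.2.trans_le (lowerEnv_le hM hs₀T h4.1)
    exact hu.eventually_ge hd hU hμm hF hM hs₀ h2 ht₀.2 h3 hρ₀0 hB hpos
      (fun y hy => hmin (ball_subset_closedBall hy)) hp hpq
  obtain ⟨m, hm, hleft⟩ := hleft
  have hself : ∀ᶠ y in 𝓝 x₀, m ≤ u t₀ y := eventually_of_nhdsWithin_self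
    (P := fun s y => m ≤ u s y) (pure_le_nhdsWithin (show t₀ ∈ Ioc s₀ t₀ from ⟨h2, le_refl t₀⟩)) hleft
  obtain ⟨ρ', hρ', hsub⟩ := nhds_basis_closedBall.mem_iff.1
    (inter_mem (hU.mem_nhds hx₀.2) hself)
  have hright : ∃ m' > 0, ∀ᶠ z in 𝓝[Ioc t₀ T] t₀ ×ˢ 𝓝 x₀, m' ≤ u z.1 z.2 := by
    rcases ht₀.2.eq_or_lt with rfl | hlt
    · exact ⟨1, one_pos, by simp⟩
    obtain ⟨s₁, h4, h5, h6⟩ := exists_right_disjoint hF.finite hlt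
    obtain ⟨m', hm', hev⟩ := hu.eventually_ge hd hU hμm hF hM ht₀.1 h4 h5 h6 hρ'
      (fun y hy => (hsub hy).1) hm (fun y hy => (hsub (ball_subset_closedBall hy)).2) hp hpq
    refine ⟨m', hm', hev.filter_mono (prod_mono_left _ (nhdsWithin_le_iff.2 ?_))⟩
    filter_upwards [self_mem_nhdsWithin, mem_nhdsWithin_of_mem_nhds (gt_mem_nhds h4)] with s h7 h8
    exact ⟨h7.1, h8.le⟩
  obtain ⟨m', hm', hright⟩ := hright
  refine notMem_freeBoundary_lowerEnv hU hM ht₀ (lt_min hm hm') (eventually_Icc_of_left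
    (P := fun s y => min m m' ≤ u s y) h2 (hleft.mono fun z hz => (min_le_left _ _).trans hz)
    (hright.mono fun z hz => (min_le_right _ _).trans hz)) hx₀

/-! ### Growth, Harnack inequality and non-degeneracy -/

lemma IsSubsolution.subMeanAt_of_mem {U : Set (Space d)} (hU : IsOpen U) {μm : ℝ}
    {v : Space d → ℝ} (hv : IsSubsolution U μm v) {x : Space d} (hx : x ∈ U) : SubMeanAt v x := by
  rcases (hv.state.nonneg x (subset_closure hx)).eq_or_lt with h | h
  · filter_upwards [eventually_closedBall_subset (eventually_mem_closure hU hx),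
      self_mem_nhdsWithin] with r hr hr0
    rw [← h, ← setAverage_closedBall_const x hr0 0]
    exact setAverage_closedBall_mono continuousOn_const.integrableOn_closedBall
      (hv.state.continuousOn.mono hr).integrableOn_closedBall fun y hy => by
        exact hv.state.nonneg y (hr hy)
  · exact hv.subMeanAt hU hx h

lemma IsSubsolution.le_setAverage (hd : 0 < d) {U : Set (Space d)} (hU : IsOpen U) {μm : ℝ}
    {v : Space d → ℝ} (hv : IsSubsolution U μm v) {x : Space d} {r : ℝ} (hr : 0 < r)
    (hB : closedBall x r ⊆ U) : v x ≤ ⨍ y in closedBall x r, v y :=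
  le_setAverage_of_subMeanAt hd hr (hv.state.continuousOn.mono (hB.trans subset_closure))
    fun _ hy => hv.subMeanAt_of_mem hU (hB (ball_subset_closedBall hy))

lemma IsStable.setAverage_eq (hd : 0 < d) {U : Set (Space d)} {μm μp : ℝ}
    {v : Space d → ℝ} (hv : IsStable U μm μp v) {x : Space d} {r : ℝ} (hr : 0 < r)
    (hB : closedBall x r ⊆ wet U v ∩ U) : ⨍ y in closedBall x r, v y = v x :=
  le_antisymm ((superharmonicIn_of_harmonicOnNhd hd hv.harmonic).2 x r hr hB)
    ((subharmonicIn_of_harmonicOnNhd hd hv.harmonic).2 x r hr hB)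

/-- Harnack inequality. -/
lemma IsStable.harnack (hd : 0 < d) {U : Set (Space d)} {μm μp : ℝ}
    {v : Space d → ℝ} (hv : IsStable U μm μp v) {x y : Space d} {r : ℝ} (hr : 0 < r)
    (hxy : dist y x ≤ r) (hB : closedBall y (2 * r) ⊆ wet U v ∩ U) :
    (1 / 2) ^ d * v x ≤ v y := by
  have h1 := (superharmonicIn_of_harmonicOnNhd hd hv.harmonic).harnack hr hxy hB
    fun z hz => (hB hz).1.2.le
  rwa [hv.setAverage_eq hd hr ((closedBall_subset_closedBall' (by
    rw [dist_comm]; linarith)).trans hB)] at h1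

lemma hasFDerivAt_one_sub_normSq (P : Space d) (k ρ : ℝ) (z : Space d) :
    HasFDerivAt (fun y => k * (1 - ‖y - P‖ ^ 2 / ρ ^ 2))
      (innerSL ℝ ((-(2 * k / ρ ^ 2)) • (z - P)) : Space d →L[ℝ] ℝ) z := by
  have h := (((hasLap_normSq_sub P z).const_mul (-(k / ρ ^ 2))).add (hasLap_const k z)).congr
    (f' := fun y => k * (1 - ‖y - P‖ ^ 2 / ρ ^ 2)) (fun y => by ring)
    (g' := (-(2 * k / ρ ^ 2)) • (z - P)) (by rw [smul_smul, add_zero]; congr 1; ring) rfl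
  exact h.hasFDerivAt

lemma norm_hopf_gradient {P z : Space d} {k ρ : ℝ} (hk : 0 ≤ k) (hρ : 0 < ρ)
    (hz : ‖z - P‖ = ρ) : ‖(-(2 * k / ρ ^ 2)) • (z - P)‖ = 2 * k / ρ := by
  rw [norm_smul, hz, norm_neg, Real.norm_of_nonneg (by positivity)]
  field_simp

/-- The constant of linear growth away from the free boundary. -/
noncomputable def growthConst (d : ℕ) (μp : ℝ) : ℝ := 2 ^ d * √(1 + μp) / (2 * hopfConst d 4)

lemma growthConst_nonneg (hd : 0 < d) (μp : ℝ) : 0 ≤ growthConst d μp := by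
  have := hopfConst_pos hd (k := 4) (by norm_num)
  unfold growthConst; positivity

/-- The nearest zero z₀ of `v` is a free boundary point on the largest wet ball around `x`. Harnack
bounds `v` below by a multiple of `v x` on a quarter of that ball, the Hopf lemma turns this into a
subdifferential of size comparable to v(x)/ρ at z₀, and the slope there is at most √(1 + μ₊). -/
theorem IsStable.le_growthConst_mul (hd : 0 < d) {U : Set (Space d)} (hU : IsOpen U) {μm μp : ℝ}
    {v : Space d → ℝ} (hv : IsStable U μm μp v) {x z : Space d} (hz : v z = 0)
    (hB : closedBall x (dist z x) ⊆ U) : v x ≤ growthConst d μp * dist z x := by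
  have hBc := hB.trans subset_closure
  have hvc := hv.state.continuousOn.mono hBc
  have hKc : IsCompact (closedBall x (dist z x) ∩ v ⁻¹' {0}) :=
    (isCompact_closedBall _ _).of_isClosed_subset
      (hvc.preimage_isClosed_of_isClosed isClosed_closedBall isClosed_singleton) inter_subset_left
  obtain ⟨z₀, ⟨hz₀, hvz₀⟩, hmin⟩ := hKc.exists_isMinOn
    ⟨z, mem_closedBall.2 (le_refl _), hz⟩ (show Continuous fun y => dist y x by fun_prop).continuousOn
  have hvz₀' : v z₀ = 0 := hvz₀
  set ρ := dist z₀ x with hρ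
  have hρle : ρ ≤ dist z x := hz₀
  have hgc := growthConst_nonneg hd μp
  refine le_trans ?_ (mul_le_mul_of_nonneg_left hρle hgc)
  rcases (dist_nonneg : 0 ≤ dist z₀ x).eq_or_lt with h0 | hρ0
  · rw [eq_comm, dist_eq_zero] at h0
    rw [← h0, hvz₀']; positivity
  have hnn : ∀ y ∈ closedBall x ρ, 0 ≤ v y := fun y hy =>
    hv.state.nonneg y (hBc (closedBall_subset_closedBall hρle hy))
  have hρU : closedBall x ρ ⊆ U := (closedBall_subset_closedBall hρle).trans hB
  have hwet : ball x ρ ⊆ wet U v ∩ U := by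
    intro y hy
    have hyU := hρU (ball_subset_closedBall hy)
    refine ⟨⟨subset_closure hyU, lt_of_le_of_ne (hnn y (ball_subset_closedBall hy)) ?_⟩, hyU⟩
    intro h
    have h1 : ρ ≤ dist y x := hmin ⟨mem_closedBall.2 (hy.out.le.trans hρle), h.symm⟩
    exact absurd hy (not_lt.2 h1)
  set cH := hopfConst d 4 with hcH
  have hcH0 : 0 < cH := hopfConst_pos hd (by norm_num)
  set m := (1 / 2) ^ d * v x with hm
  have hm0 : 0 ≤ m := mul_nonneg (by positivity) (hnn x (mem_closedBall_self hρ0.le))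
  have hhopf := hopf_lower_bound hd (f := v) (P := x) (σ := ρ / 4) (ρ := ρ) (m := m) (by positivity)
    (by linarith) hm0 (hvc.mono (closedBall_subset_closedBall hρle)).lowerSemicontinuousOn
    (hvc.mono (closedBall_subset_closedBall hρle)).integrableOn_closedBall
    (fun y hy => hnn y (sphere_subset_closedBall hy))
    (fun y hy => hv.harnack hd (r := ρ / 4) (by positivity) (le_of_eq hy)
      ((closedBall_subset_ball' (by rw [mem_sphere.1 hy]; linarith)).trans hwet))
    (fun y hy _ => (superharmonicIn_of_harmonicOnNhd hd hv.harmonic).subMeanAt_neg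
      ((hv.state.isOpen_wet_inter hU).mem_nhds (hwet hy)))
  have hρne : ρ ≠ 0 := hρ0.ne'
  rw [show ρ / (ρ / 4) = 4 by rw [div_div_eq_mul_div, mul_comm, mul_div_assoc, div_self hρne, mul_one], ← hcH] at hhopf
  have hz₀U : z₀ ∈ U := hB hz₀
  have hz₀n : ‖z₀ - x‖ = ρ := by rw [hρ, dist_eq_norm]
  have hfb : z₀ ∈ freeBoundary U v := by
    refine (hv.state.mem_freeBoundary_iff hU).2 ⟨hz₀U, hvz₀', ?_⟩
    rw [← mem_closure_wet_iff hU hz₀U]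
    have h1 : z₀ ∈ closure (ball x ρ) := by
      rw [closure_ball x hρ0.ne']; exact mem_closedBall.2 (le_refl _)
    exact closure_mono (fun y hy => (hwet hy).1) h1
  have hsub := hv.slope_le z₀ hfb _ (mem_subDiff_of_touch
    (hasFDerivAt_one_sub_normSq x (m * cH) ρ z₀) (by
      show m * cH * (1 - ‖z₀ - x‖ ^ 2 / ρ ^ 2) = 0
      rw [hz₀n, div_self (pow_ne_zero 2 hρne), sub_self, mul_zero]) (by
      have hc : Continuous fun y : Space d => ‖y - x‖ := by fun_prop
      filter_upwards [hU.mem_nhds hz₀U, hc.continuousAt.eventually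
        (lt_mem_nhds (show ρ / 4 < ‖z₀ - x‖ by rw [hz₀n]; linarith))] with y hyU hy4
      by_cases hyB : y ∈ closedBall x ρ
      · exact hhopf y hyB (le_of_lt hy4)
      · refine le_trans (mul_nonpos_of_nonneg_of_nonpos (by positivity) ?_)
          (hv.state.nonneg y (subset_closure hyU))
        rw [mem_closedBall, dist_eq_norm, not_le] at hyB
        rw [sub_nonpos, one_le_div (by positivity)]
        gcongr))
  rw [norm_hopf_gradient (by positivity) hρ0 hz₀n] at hsub
  have h1 : 2 * (m * cH) / ρ ≤ √(1 + μp) := Real.le_sqrt_of_sq_le hsub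
  rw [div_le_iff₀ hρ0] at h1
  have h2 : v x = 2 ^ d * m := by
    rw [hm, ← mul_assoc, ← mul_pow]; norm_num
  rw [h2, growthConst, ← hcH, div_mul_eq_mul_div, le_div_iff₀ (by positivity)]
  have : (0 : ℝ) < 2 ^ d := by positivity
  nlinarith

lemma _root_.IsPreconnected.exists_mem_frontier {X : Type*} [TopologicalSpace X] {s A : Set X}
    (hs : IsPreconnected s) (h1 : (s ∩ A).Nonempty) (h2 : (s ∩ Aᶜ).Nonempty) :
    ∃ q ∈ s, q ∈ frontier A := by
  by_contra! hcon
  obtain ⟨x, hx, hxA⟩ := h1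
  obtain ⟨y, hy, hyA⟩ := h2
  obtain ⟨z, -, hz1, hz2⟩ := hs (interior A) (closure A)ᶜ isOpen_interior
    isClosed_closure.isOpen_compl
    (fun z hz => or_iff_not_imp_left.2 fun h h' => hcon z hz ⟨h', h⟩)
    ⟨x, hx, by_contra fun h => hcon x hx ⟨subset_closure hxA, h⟩⟩
    ⟨y, hy, fun h => hcon y hy ⟨h, fun h' => hyA (interior_subset h')⟩⟩
  exact hz2 (subset_closure (interior_subset hz1))

lemma forall_pos_or_forall_eq_zero {U : Set (Space d)} {v : Space d → ℝ}
    (hv : IsState U v) {x : Space d} {r : ℝ} (hB : ball x r ⊆ U)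
    (hf : ∀ y ∈ ball x r, y ∉ freeBoundary U v) :
    (∀ y ∈ ball x r, 0 < v y) ∨ ∀ y ∈ ball x r, v y = 0 := by
  by_contra! hcon
  obtain ⟨⟨y, hy, hy0⟩, z, hz, hz0⟩ := hcon
  have hzc := subset_closure (hB hz)
  have hpre : IsPreconnected (ball x r) := (convex_ball x r).isPreconnected
  obtain ⟨q, hq, hqf⟩ := hpre.exists_mem_frontier (A := wet U v)
    ⟨z, hz, hzc, lt_of_le_of_ne (hv.nonneg z hzc) (Ne.symm hz0)⟩
    ⟨y, hy, fun h => absurd h.2 (not_lt.2 hy0)⟩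
  exact hf q hq ⟨hqf, hB hq⟩

/-- Non-degeneracy of a single profile. -/
def Nondegenerate (U : Set (Space d)) (c r₀ : ℝ) (v : Space d → ℝ) : Prop :=
  ∀ x ∈ freeBoundary U v, ∀ r : ℝ, 0 < r → r ≤ r₀ → ball x r ⊆ U → c * r ≤ sSup (v '' ball x r)

lemma Nondegenerate.notMem_freeBoundary {U : Set (Space d)} {c r₀ : ℝ} (hc : 0 < c)
    {v : Space d → ℝ} (hn : Nondegenerate U c r₀ v) {x : Space d} {r : ℝ} (hr : 0 < r)
    (hr₀ : r ≤ r₀) (hB : ball x (2 * r) ⊆ U) (hs : ∀ y ∈ ball x (2 * r), v y ≤ c / 2 * r) :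
    ∀ y ∈ ball x r, y ∉ freeBoundary U v := by
  intro y hy hyf
  have hsub : ball y r ⊆ ball x (2 * r) := ball_subset_ball' (by
    have : dist y x < r := hy
    linarith)
  have h1 := hn y hyf r hr hr₀ (hsub.trans hB)
  have h2 : sSup (v '' ball y r) ≤ c / 2 * r := by
    refine csSup_le ((nonempty_ball.2 hr).image _) ?_
    rintro _ ⟨z, hz, rfl⟩
    exact hs z (hsub hz)
  nlinarith

/-! ### Decreasing sequences of maximal subsolutions -/

/-- A decreasing sequence of maximal subsolutions below a common obstacle that are uniformly
non-degenerate and stay above a state that is positive on the boundary. -/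
structure IsRecedingSequence (U : Set (Space d)) (μm μp c r₀ : ℝ) (o l : Space d → ℝ)
    (v : ℕ → Space d → ℝ) (f : ℕ → ℝ) : Prop where
  obstacle : IsStable U μm μp o
  stable : ∀ n, IsStable U μm μp (v n)
  maximal : ∀ n, IsMaximalSubsolution U μm (f n) o (v n)
  antitone : ∀ m n, m ≤ n → ∀ x ∈ closure U, v n x ≤ v m x
  nondegenerate : ∀ n, Nondegenerate U c r₀ (v n)
  lower : IsState U l
  lower_le : ∀ n, ∀ x ∈ closure U, l x ≤ v n x
  lower_pos : ∀ x ∈ frontier U, 0 < l x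

/-- The pointwise infimum of a sequence. -/
noncomputable def infSeq (v : ℕ → Space d → ℝ) (x : Space d) : ℝ := ⨅ n, v n x

namespace IsRecedingSequence

variable {U : Set (Space d)} {μm μp c r₀ : ℝ} {o l : Space d → ℝ} {v : ℕ → Space d → ℝ}
  {f : ℕ → ℝ}

lemma nonneg (H : IsRecedingSequence U μm μp c r₀ o l v f) (n : ℕ) {x : Space d}
    (hx : x ∈ closure U) : 0 ≤ v n x := (H.stable n).state.nonneg x hx

lemma bddBelow (H : IsRecedingSequence U μm μp c r₀ o l v f) {x : Space d}
    (hx : x ∈ closure U) : BddBelow (range fun n => v n x) :=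
  ⟨0, by rintro _ ⟨n, rfl⟩; exact H.nonneg n hx⟩

lemma infSeq_le (H : IsRecedingSequence U μm μp c r₀ o l v f) (n : ℕ) {x : Space d}
    (hx : x ∈ closure U) : infSeq v x ≤ v n x := ciInf_le (H.bddBelow hx) n

lemma infSeq_nonneg (H : IsRecedingSequence U μm μp c r₀ o l v f) {x : Space d}
    (hx : x ∈ closure U) : 0 ≤ infSeq v x := le_ciInf fun n => H.nonneg n hx

lemma lower_le_infSeq (H : IsRecedingSequence U μm μp c r₀ o l v f) {x : Space d}
    (hx : x ∈ closure U) : l x ≤ infSeq v x := le_ciInf fun n => H.lower_le n x hx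

lemma le_infSeq {b : ℝ} {x : Space d} (h : ∀ n, b ≤ v n x) : b ≤ infSeq v x := le_ciInf h

lemma tendsto (H : IsRecedingSequence U μm μp c r₀ o l v f) {x : Space d} (hx : x ∈ closure U) :
    Tendsto (fun n => v n x) atTop (𝓝 (infSeq v x)) :=
  tendsto_atTop_ciInf (fun _ _ hmn => H.antitone _ _ hmn x hx) (H.bddBelow hx)

/-- Dini's argument: for a decreasing sequence of continuous functions the pointwise infimum is
already the upper half-relaxed limit. -/
lemma eventually_lt (H : IsRecedingSequence U μm μp c r₀ o l v f) (hU : IsOpen U) {x : Space d}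
    (hx : x ∈ U) {b : ℝ} (hb : infSeq v x < b) :
    ∀ᶠ z in atTop ×ˢ 𝓝 x, v z.1 z.2 < b := by
  obtain ⟨n, hn⟩ := exists_lt_of_ciInf_lt hb
  refine eventually_prod_iff.2 ⟨_, eventually_ge_atTop n, _,
    (((H.stable n).state.continuousAt hU hx).eventually (gt_mem_nhds hn)).and
      (eventually_mem_closure hU hx), fun {m} hm {y} hy => ?_⟩
  exact (H.antitone n m hm y hy.2).trans_lt hy.1

lemma eventually_forall_lt (H : IsRecedingSequence U μm μp c r₀ o l v f) (hU : IsOpen U)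
    {K : Set (Space d)} (hK : IsCompact K) (hKU : K ⊆ U) {b : ℝ}
    (hb : ∀ x ∈ K, infSeq v x < b) : ∀ᶠ n in atTop, ∀ x ∈ K, v n x < b :=
  eventually_forall_of_compact (P := fun n x => v n x < b) hK
    fun x hx => H.eventually_lt hU (hKU hx) (hb x hx)

lemma upperSemicontinuousOn (H : IsRecedingSequence U μm μp c r₀ o l v f) (hU : IsOpen U) :
    UpperSemicontinuousOn (infSeq v) U := by
  intro x hx b hb
  refine Filter.Eventually.filter_mono nhdsWithin_le_nhds ?_
  obtain ⟨pa, ha, pb, hb', hab⟩ := eventually_prod_iff.1 (H.eventually_lt hU hx hb)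
  obtain ⟨n, hn⟩ := ha.exists
  filter_upwards [hb', eventually_mem_closure hU hx] with y hy hyU
  exact (H.infSeq_le n hyU).trans_lt (hab hn hy)

lemma integrableOn (H : IsRecedingSequence U μm μp c r₀ o l v f) {x : Space d}
    {r : ℝ} (hB : closedBall x r ⊆ U) : IntegrableOn (infSeq v) (closedBall x r) := by
  have hBc := hB.trans subset_closure
  have hi : ∀ n, IntegrableOn (v n) (closedBall x r) := fun n =>
    ((H.stable n).state.continuousOn.mono hBc).integrableOn_closedBall
  have hae : ∀ᵐ y ∂volume.restrict (closedBall x r), y ∈ closedBall x r :=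
    ae_restrict_mem measurableSet_closedBall
  refine Integrable.mono (hi 0) (aestronglyMeasurable_of_tendsto_ae atTop
    (fun n => (hi n).aestronglyMeasurable) (hae.mono fun y hy => H.tendsto (hBc hy))) ?_
  filter_upwards [hae] with y hy
  rw [Real.norm_of_nonneg (H.infSeq_nonneg (hBc hy)), Real.norm_of_nonneg (H.nonneg 0 (hBc hy))]
  exact H.infSeq_le 0 (hBc hy)

/-- Monotone convergence. The infimum is only upper semicontinuous, so it is handled through its
averages rather than as a subsolution. -/
lemma le_setAverage (H : IsRecedingSequence U μm μp c r₀ o l v f) (hd : 0 < d) (hU : IsOpen U)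
    {x : Space d} {r : ℝ} (hr : 0 < r) (hB : closedBall x r ⊆ U) :
    infSeq v x ≤ ⨍ y in closedBall x r, infSeq v y := by
  have hBc := hB.trans subset_closure
  have hi : ∀ n, IntegrableOn (v n) (closedBall x r) := fun n =>
    ((H.stable n).state.continuousOn.mono hBc).integrableOn_closedBall
  have hae : ∀ᵐ y ∂volume.restrict (closedBall x r), y ∈ closedBall x r :=
    ae_restrict_mem measurableSet_closedBall
  have h1 := integral_tendsto_of_tendsto_of_antitone hi (H.integrableOn hB)
    (hae.mono fun y hy m n hmn => H.antitone m n hmn y (hBc hy))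
    (hae.mono fun y hy => H.tendsto (hBc hy))
  have h2 : Tendsto (fun n => ⨍ y in closedBall x r, v n y) atTop
      (𝓝 (⨍ y in closedBall x r, infSeq v y)) := by
    simp only [setAverage_eq, smul_eq_mul]
    exact h1.const_mul _
  refine ge_of_tendsto h2 (Eventually.of_forall fun n => ?_)
  exact (H.infSeq_le n (hBc (mem_closedBall_self hr.le))).trans
    (((H.stable n).isSubsolution hd).le_setAverage hd hU hr hB)

lemma subMeanAt (H : IsRecedingSequence U μm μp c r₀ o l v f) (hd : 0 < d) (hU : IsOpen U)
    {x : Space d} (hx : x ∈ U) : SubMeanAt (infSeq v) x := by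
  filter_upwards [eventually_closedBall_subset (hU.mem_nhds hx), self_mem_nhdsWithin]
    with r hr hr0
  exact H.le_setAverage hd hU hr0 hr

/-- If the limit vanishes near a point, then eventually the sequence has no free boundary there. -/
lemma eventually_pos_or_eq_zero (H : IsRecedingSequence U μm μp c r₀ o l v f) (hU : IsOpen U)
    (hc : 0 < c) {x : Space d} {r : ℝ} (hr : 0 < r) (hr₀ : r ≤ r₀)
    (hB : closedBall x (2 * r) ⊆ U) (hw : ∀ y ∈ closedBall x (2 * r), infSeq v y < c / 2 * r) :
    ∀ᶠ n in atTop, (∀ y ∈ ball x r, 0 < v n y) ∨ ∀ y ∈ ball x r, v n y = 0 := by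
  filter_upwards [H.eventually_forall_lt hU (isCompact_closedBall x (2 * r)) hB hw] with n hn
  have hB' : ball x r ⊆ ball x (2 * r) := ball_subset_ball (by linarith)
  exact forall_pos_or_forall_eq_zero (H.stable n).state
    (hB'.trans (ball_subset_closedBall.trans hB))
    ((H.nondegenerate n).notMem_freeBoundary hc hr hr₀ (ball_subset_closedBall.trans hB)
      fun y hy => (hn y (ball_subset_closedBall hy)).le)

/-- If all members are positive in a ball, then a zero of the limit spreads. -/
lemma infSeq_eq_zero_of_pos (H : IsRecedingSequence U μm μp c r₀ o l v f) (hd : 0 < d)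
    {z : Space d} {r : ℝ} (hr : 0 < r) (hB : closedBall z (2 * r) ⊆ U)
    (hpos : ∀ n, ∀ y ∈ closedBall z (2 * r), 0 < v n y) (hz : infSeq v z = 0) :
    ∀ x ∈ closedBall z r, infSeq v x = 0 := by
  intro x hx
  have hBc := hB.trans subset_closure
  have hxU : x ∈ closure U := hBc (closedBall_subset_closedBall (by linarith) hx)
  have hzU : z ∈ closure U := hBc (mem_closedBall_self (by positivity))
  refine le_antisymm ?_ (H.infSeq_nonneg hxU)
  have h1 : Tendsto (fun n => 2 ^ d * v n z) atTop (𝓝 (2 ^ d * infSeq v z)) :=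
    (H.tendsto hzU).const_mul _
  rw [hz, mul_zero] at h1
  refine ge_of_tendsto h1 (Eventually.of_forall fun n => (H.infSeq_le n hxU).trans ?_)
  have h2 := (H.stable n).harnack hd hr (x := x) (y := z) (by rw [dist_comm]; exact hx)
    fun y hy => ⟨⟨hBc hy, hpos n y hy⟩, hB hy⟩
  have h3 : (2 : ℝ) ^ d * ((1 / 2) ^ d * v n x) = v n x := by
    rw [← mul_assoc, ← mul_pow]; norm_num
  rw [← h3]
  gcongr

end IsRecedingSequence

/-! ### Steep harmonic functions above a hinge -/

/-- Write u = 1/R. The term √Q contributes at least (8 + 2n)(u - n); the logarithmic term costs at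
most 4u + 4u + 2n u, and the linear term in τ returns 2(8 + 2n) n. This bookkeeping dictates the
constant 8 + 2n. -/
lemma hinge_laplacian_pos {n s τ δ R : ℝ} (hn : 0 < n) (hτ : 0 ≤ τ) (hτ1 : 0 ≤ 1 - 2 * τ)
    (hR : 0 < R) (hRs : R ^ 2 = s ^ 2 + τ ^ 2 + δ ^ 2) :
    0 < (8 + 2 * n) * ((4 - 4 * τ - 2 * n * τ) / (2 * R) -
        4 * (s ^ 2 + τ ^ 2) * (1 - 2 * τ) / (4 * R ^ 3)) -
      τ * ((4 - 4 * τ - 2 * n * τ) / R ^ 2 - 4 * (s ^ 2 + τ ^ 2) * (1 - 2 * τ) / R ^ 4) -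
      2 * (-2 * s ^ 2 + 2 * τ * (1 - 2 * τ)) / R ^ 2 + n * (2 * Real.log R) +
      2 * (8 + 2 * n) * n := by
  have hlog := Real.one_sub_inv_le_log_of_pos hR
  set u := R⁻¹ with hu
  have hu0 : 0 < u := by positivity
  set A := (s ^ 2 + τ ^ 2) * u ^ 2 with hA
  have hRu : R * u = 1 := mul_inv_cancel₀ hR.ne'
  have hA0 : 0 ≤ A := by positivity
  have hA1 : A ≤ 1 := by
    have h1 : s ^ 2 + τ ^ 2 ≤ R ^ 2 := by rw [hRs]; nlinarith [sq_nonneg δ]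
    calc A ≤ R ^ 2 * u ^ 2 := by rw [hA]; gcongr
      _ = 1 := by rw [← mul_pow, hRu, one_pow]
  have hτR : τ * u ≤ 1 := by
    have : τ ≤ R := abs_le_of_sq_le_sq' (by rw [hRs]; nlinarith [sq_nonneg δ, sq_nonneg s]) hR.le |>.2
    calc τ * u ≤ R * u := by gcongr
      _ = 1 := hRu
  have hs2 : 0 ≤ s ^ 2 * u ^ 2 := by positivity
  have e1 : (4 - 4 * τ - 2 * n * τ) / (2 * R) - 4 * (s ^ 2 + τ ^ 2) * (1 - 2 * τ) / (4 * R ^ 3) =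
      (2 - 2 * τ - n * τ) * u - A * (1 - 2 * τ) * u := by
    rw [hA, hu]; field_simp; ring
  have e2 : (4 - 4 * τ - 2 * n * τ) / R ^ 2 - 4 * (s ^ 2 + τ ^ 2) * (1 - 2 * τ) / R ^ 4 =
      (4 - 4 * τ - 2 * n * τ) * u ^ 2 - 4 * A * (1 - 2 * τ) * u ^ 2 := by
    rw [hA, hu]; field_simp
  have e3 : 2 * (-2 * s ^ 2 + 2 * τ * (1 - 2 * τ)) / R ^ 2 =
      -4 * (s ^ 2 * u ^ 2) + 4 * τ * (1 - 2 * τ) * u ^ 2 := by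
    rw [hu]; field_simp; ring
  rw [e1, e2, e3]
  have f1 : (1 - n * τ) * u ≤ (2 - 2 * τ - n * τ) * u - A * (1 - 2 * τ) * u := by
    have : 0 ≤ (1 - A) * ((1 - 2 * τ) * u) := by
      refine mul_nonneg (by linarith) (by positivity)
    nlinarith
  have f2 : τ * ((4 - 4 * τ - 2 * n * τ) * u ^ 2 - 4 * A * (1 - 2 * τ) * u ^ 2) ≤ 4 * u := by
    have h1 : 0 ≤ τ * (A * (1 - 2 * τ)) * u ^ 2 := by positivity
    have h2 : 0 ≤ (4 + 2 * n) * τ ^ 2 * u ^ 2 := by positivity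
    have h3 : τ * u * u ≤ 1 * u := by gcongr
    nlinarith
  have f3 : 4 * τ * (1 - 2 * τ) * u ^ 2 ≤ 4 * u := by
    have h3 : τ * u * u ≤ 1 * u := by gcongr
    have h2 : 0 ≤ τ ^ 2 * u ^ 2 := by positivity
    nlinarith
  have f4 : n * (2 * (1 - u)) ≤ n * (2 * Real.log R) := by gcongr
  have f5 : (8 + 2 * n) * (u - n) ≤ (8 + 2 * n) * ((1 - n * τ) * u) := by
    have : n * (τ * u) ≤ n * 1 := by gcongr
    gcongr
    nlinarith
  have f6 := mul_le_mul_of_nonneg_left f1 (show 0 ≤ 8 + 2 * n by linarith)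
  have h7 : 0 ≤ n ^ 2 := sq_nonneg n
  linarith

/-- A strictly subharmonic function that vanishes steeply at a hinge. -/
noncomputable def hinge (n : ℝ) (δ s τ : ℝ) : ℝ :=
  (8 + 2 * n) * (√(s ^ 2 + τ ^ 2 + δ ^ 2) + s - 3 * δ) -
    τ * Real.log (s ^ 2 + τ ^ 2 + δ ^ 2) - 2 * (8 + 2 * n) * τ

/-- The hypotheses record the derivatives of s = e · (x - y)/r and τ = (1 - |x - y|²/r²)/2 with k =
1/r: height above the equator and approximate depth below the sphere. The term -τ log Q models the
logarithmically infinite normal derivative of a harmonic function with boundary values s⁺; δ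
regularizes the edge. -/
lemma exists_hasLap_hinge (hd : 0 < d) {δ k : ℝ} (hδ : 0 < δ) (hk : 0 < k) {s τ : Space d → ℝ}
    {x a b : Space d} (hs : HasLap s x a 0) (ht : HasLap τ x b (-(d * k ^ 2)))
    (haa : ‖a‖ ^ 2 = k ^ 2) (hab : inner ℝ a b = -(k ^ 2 * s x))
    (hbb : ‖b‖ ^ 2 = k ^ 2 * (1 - 2 * τ x)) (hτ : 0 ≤ τ x) :
    ∃ g, ∃ l > 0, HasLap (fun y => hinge d δ (s y) (τ y)) x g l := by
  have hQ : HasLap (fun y => s y ^ 2 + τ y ^ 2 + δ ^ 2) x ((2 * s x) • a + (2 * τ x) • b)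
      (k ^ 2 * (4 - 4 * τ x - 2 * d * τ x)) := by
    refine (((hs.mul hs).add (ht.mul ht)).add (hasLap_const (δ ^ 2) x)).congr (fun y => by ring)
      (by module) ?_
    rw [real_inner_self_eq_norm_sq, real_inner_self_eq_norm_sq, haa, hbb]
    ring
  set Q := s x ^ 2 + τ x ^ 2 + δ ^ 2 with hQdef
  set gQ := (2 * s x) • a + (2 * τ x) • b with hgQ
  have hQ0 : 0 < Q := by positivity
  have hgQn : ‖gQ‖ ^ 2 = k ^ 2 * (4 * (s x ^ 2 + τ x ^ 2) * (1 - 2 * τ x)) := by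
    rw [hgQ, norm_add_sq_real, norm_smul, norm_smul, mul_pow, mul_pow, haa, hbb,
      real_inner_smul_left, real_inner_smul_right, hab, Real.norm_eq_abs, Real.norm_eq_abs,
      sq_abs, sq_abs]
    ring
  have hbgQ : inner ℝ b gQ = k ^ 2 * (-2 * s x ^ 2 + 2 * τ x * (1 - 2 * τ x)) := by
    rw [hgQ, inner_add_right, real_inner_smul_right, real_inner_smul_right,
      real_inner_self_eq_norm_sq, hbb, real_inner_comm, hab]
    ring
  set R := √Q with hR
  have hR0 : 0 < R := Real.sqrt_pos.2 hQ0
  have hRQ : R ^ 2 = Q := Real.sq_sqrt hQ0.le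
  have hsqrt := hQ.comp (q := fun t => √t) (q' := fun t => 1 / (2 * √t))
    (q'' := -1 / (4 * R ^ 3))
    ((lt_mem_nhds hQ0).mono fun t ht => Real.hasDerivAt_sqrt (ne_of_gt ht))
    (by
      have h1 := ((Real.hasDerivAt_sqrt hQ0.ne').const_mul 2).inv (by positivity)
      simp only [one_div]
      refine h1.congr_deriv ?_
      rw [← hR]; field_simp; ring) (Real.contDiffAt_sqrt hQ0.ne')
  have hlog := hQ.comp (q := Real.log) (q' := fun t => t⁻¹) (q'' := -(Q ^ 2)⁻¹)
    ((lt_mem_nhds hQ0).mono fun t ht => Real.hasDerivAt_log (ne_of_gt ht))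
    (hasDerivAt_inv hQ0.ne') (Real.contDiffAt_log.2 hQ0.ne')
  have hK := ((hsqrt.add hs).add (hasLap_const (-(3 * δ)) x)).const_mul (8 + 2 * (d : ℝ))
  have hall := (hK.add ((ht.mul hlog).const_mul (-1))).add (ht.const_mul (-(2 * (8 + 2 * (d : ℝ)))))
  have hd' : (0 : ℝ) < d := by exact_mod_cast hd
  have h1τ : 0 ≤ 1 - 2 * τ x := by
    have h1 : 0 ≤ k ^ 2 * (1 - 2 * τ x) := by rw [← hbb]; positivity
    exact nonneg_of_mul_nonneg_right h1 (by positivity)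
  have hpos := hinge_laplacian_pos (s := s x) (δ := δ) hd' hτ h1τ hR0 hRQ
  refine ⟨_, _, mul_pos (pow_pos hk 2) hpos, hall.congr (fun y => by unfold hinge; ring) rfl ?_⟩
  rw [hgQn, real_inner_smul_right, hbgQ]
  have hlogR : Real.log Q = 2 * Real.log R := by rw [← hRQ, Real.log_pow]; norm_num
  rw [← hQdef, ← hR, hlogR, ← hRQ]
  field_simp
  ring

/-- On the sphere τ = 0 and the logarithm drops out, so the hinge lies below a multiple of (s - δ)⁺.
The shift -3δ in the definition serves this purpose. -/
lemma hinge_zero_le {n δ s : ℝ} (hn : 0 ≤ n) (hδ : 0 < δ) :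
    hinge n δ s 0 ≤ 2 * (8 + 2 * n) * max (s - δ) 0 := by
  have h1 : √(s ^ 2 + δ ^ 2) ≤ |s| + δ :=
    Real.sqrt_le_iff.2 ⟨by positivity, by nlinarith [sq_abs s, mul_nonneg (abs_nonneg s) hδ.le]⟩
  have h2 : |s| + s - 2 * δ ≤ 2 * max (s - δ) 0 := by
    rcases abs_cases s with ⟨h, _⟩ | ⟨h, _⟩
    · linarith [le_max_left (s - δ) 0]
    · linarith [le_max_right (s - δ) 0]
  have h3 : hinge n δ s 0 = (8 + 2 * n) * (√(s ^ 2 + δ ^ 2) + s - 3 * δ) := by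
    simp [hinge]
  rw [h3]
  have h4 : (8 + 2 * n) * (√(s ^ 2 + δ ^ 2) + s - 3 * δ) ≤ (8 + 2 * n) * (2 * max (s - δ) 0) := by
    gcongr; linarith
  linarith

/-- At depth comparable to δ near the equator the value exceeds δ by a factor of order log(1/δ). The
9 collects a loss 3 from the shift -3δ and 6 from the linear term with τ ≤ 3δ. -/
lemma le_hinge {n δ s τ : ℝ} (hn : 0 ≤ n) (hδ : 0 < δ) (hδ1 : 4 * δ ≤ 1) (hs : |s| ≤ 2 * δ)
    (hτ : δ / 2 ≤ τ) (hτ' : τ ≤ 3 * δ) :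
    δ * (-Real.log (4 * δ) - 9 * (8 + 2 * n)) ≤ hinge n δ s τ := by
  have hs2 : s ^ 2 ≤ (2 * δ) ^ 2 := sq_le_sq' (abs_le.1 hs).1 (abs_le.1 hs).2
  have hQ0 : 0 < s ^ 2 + τ ^ 2 + δ ^ 2 := by positivity
  have hQ : s ^ 2 + τ ^ 2 + δ ^ 2 ≤ (4 * δ) ^ 2 := by nlinarith
  have h1 : -s ≤ √(s ^ 2 + τ ^ 2 + δ ^ 2) :=
    Real.le_sqrt_of_sq_le (by nlinarith [sq_nonneg τ, sq_nonneg δ])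
  have h2 : Real.log (s ^ 2 + τ ^ 2 + δ ^ 2) ≤ 2 * Real.log (4 * δ) := by
    have := Real.log_le_log hQ0 hQ
    rwa [Real.log_pow] at this
  have h3 : Real.log (4 * δ) ≤ 0 := Real.log_nonpos (by positivity) hδ1
  have h4 : δ * -Real.log (4 * δ) ≤ τ * -Real.log (s ^ 2 + τ ^ 2 + δ ^ 2) := by
    calc δ * -Real.log (4 * δ) = δ / 2 * -(2 * Real.log (4 * δ)) := by ring
      _ ≤ τ * -(2 * Real.log (4 * δ)) := mul_le_mul_of_nonneg_right hτ (by linarith)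
      _ ≤ _ := mul_le_mul_of_nonneg_left (by linarith) (by linarith)
  have h5 : (8 + 2 * n) * (-(3 * δ)) ≤
      (8 + 2 * n) * (√(s ^ 2 + τ ^ 2 + δ ^ 2) + s - 3 * δ) := by
    gcongr; linarith
  have h6 : (8 + 2 * n) * τ ≤ (8 + 2 * n) * (3 * δ) := by gcongr
  unfold hinge
  linarith

/-- Lower bound for a harmonic function by a hinge. -/
theorem PolyApprox.hinge_le (hd : 0 < d) {y e : Space d} {r δ κ : ℝ} (hr : 0 < r) (hδ : 0 < δ)
    (hκ : 0 < κ) (he : ‖e‖ = 1) {h : Space d → ℝ} (H : PolyApprox y r h)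
    (h0 : ∀ x ∈ sphere y r, 0 ≤ h x)
    (hs : ∀ x ∈ sphere y r, κ * (inner ℝ e (x - y) - δ * r) ≤ h x) :
    ∀ x ∈ closedBall y r, κ * r / (2 * (8 + 2 * d)) *
      hinge d δ (r⁻¹ * inner ℝ e (x - y)) ((1 - ‖x - y‖ ^ 2 / r ^ 2) / 2) ≤ h x := by
  have hd' : (0 : ℝ) < d := by exact_mod_cast hd
  -- Normalized so that on the sphere the scaled hinge is at most κ (e · (x - y) - δ r)⁺.
  set A := κ * r / (2 * (8 + 2 * d)) with hA
  have hA0 : 0 < A := by positivity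
  refine H.le_of_subMeanAt hd hr ?_ (fun x hx _ => ?_) fun x hx => ?_
  · unfold hinge
    have h1 : Continuous fun x : Space d => r⁻¹ * inner ℝ e (x - y) := by fun_prop
    have h2 : Continuous fun x : Space d => (1 - ‖x - y‖ ^ 2 / r ^ 2) / 2 := by fun_prop
    have h3 : Continuous fun x : Space d => (r⁻¹ * inner ℝ e (x - y)) ^ 2 +
      ((1 - ‖x - y‖ ^ 2 / r ^ 2) / 2) ^ 2 + δ ^ 2 := by fun_prop
    exact (continuous_const.mul ((((continuous_const.mul (((Real.continuous_sqrt.comp h3).add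
      h1).sub continuous_const)).sub (h2.mul (h3.log fun x => by positivity)))).sub
        (continuous_const.mul h2))).continuousOn
  · have hs1 : HasLap (fun x => r⁻¹ * inner ℝ e (x - y)) x (r⁻¹ • e) 0 :=
      (((hasLap_inner e x).add (hasLap_const (-inner ℝ e y) x)).const_mul r⁻¹).congr
        (fun x => by rw [inner_sub_right]; ring) (by rw [add_zero]) (by ring)
    have ht1 : HasLap (fun x => (1 - ‖x - y‖ ^ 2 / r ^ 2) / 2) x (-(r⁻¹ ^ 2) • (x - y))
        (-(d * r⁻¹ ^ 2)) :=
      (((hasLap_normSq_sub y x).const_mul (-(r⁻¹ ^ 2) / 2)).add (hasLap_const (1 / 2) x)).congr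
        (fun x => by field_simp; ring) (by rw [add_zero, smul_smul]; congr 1; ring) (by ring)
    have hx' : ‖x - y‖ < r := by rw [← dist_eq_norm]; exact hx
    obtain ⟨g, l, hl, hlap⟩ := exists_hasLap_hinge hd hδ (inv_pos.2 hr) hs1 ht1
      (by rw [norm_smul, he, mul_one, Real.norm_eq_abs, sq_abs])
      (by rw [real_inner_smul_left, real_inner_smul_right]; ring)
      (by
        rw [norm_smul, mul_pow, Real.norm_eq_abs, sq_abs]
        field_simp; ring)
      (by
        have : ‖x - y‖ ^ 2 / r ^ 2 ≤ 1 := (div_le_one (by positivity)).2 (by gcongr)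
        linarith)
    exact (hlap.const_mul A).subMeanAt (by positivity)
  · have hx' : ‖x - y‖ = r := by rw [← dist_eq_norm]; exact hx
    rw [hx', div_self (by positivity), sub_self, zero_div]
    have h1 := hinge_zero_le (s := r⁻¹ * inner ℝ e (x - y)) hd'.le hδ
    calc A * hinge d δ (r⁻¹ * inner ℝ e (x - y)) 0
        ≤ A * (2 * (8 + 2 * d) * max (r⁻¹ * inner ℝ e (x - y) - δ) 0) := by gcongr
      _ = max (κ * (inner ℝ e (x - y) - δ * r)) 0 := by
          rw [← mul_assoc, mul_max_of_nonneg _ _ (by positivity), mul_zero]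
          congr 1
          rw [hA]; field_simp
      _ ≤ h x := max_le (hs x hx) (h0 x hx)

/-- A function that dominates a harmonic function above a hinge is steep at the zeros near the
equator. -/
theorem PolyApprox.le_norm_superDiff (hd : 0 < d) {y e : Space d} {r δ κ : ℝ} (hr : 0 < r)
    (hδ : 0 < δ) (hδ1 : 4 * δ ≤ 1) (hκ : 0 < κ) (he : ‖e‖ = 1) {h : Space d → ℝ}
    (H : PolyApprox y r h) (h0 : ∀ x ∈ sphere y r, 0 ≤ h x)
    (hs : ∀ x ∈ sphere y r, κ * (inner ℝ e (x - y) - δ * r) ≤ h x)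
    (hlog : 0 ≤ -Real.log (4 * δ) - 9 * (8 + 2 * d))
    {U : Set (Space d)} (hU : IsOpen U) {v : Space d → ℝ} {z p : Space d} (hz : z ∈ sphere y r)
    (hzU : z ∈ U) (hze : |inner ℝ e (z - y)| ≤ δ * r)
    (hv0 : ∀ᶠ x in 𝓝 z, 0 ≤ v x) (hvh : ∀ x ∈ closedBall y r, h x ≤ v x)
    (hp : p ∈ superDiff U v z) :
    κ / (2 * (8 + 2 * d)) * (-Real.log (4 * δ) - 9 * (8 + 2 * d)) * hopfConst d 2 ≤ ‖p‖ := by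
  set L := -Real.log (4 * δ) - 9 * (8 + 2 * (d : ℝ)) with hL
  have hd' : (0 : ℝ) < d := by exact_mod_cast hd
  have hzr : ‖z - y‖ = r := by rw [← dist_eq_norm]; exact hz
  -- The ball of radius 2δr around `P` is tangent to the sphere at `z` from inside. On the
  -- concentric sphere of radius δr, height and depth lie in the range of `le_hinge`, and the Hopf
  -- lemma carries the resulting bound to a slope at `z`.
  set P := y + (1 - 2 * δ) • (z - y) with hP
  have hPy : P - y = (1 - 2 * δ) • (z - y) := by rw [hP]; abel
  have hzP : z - P = (2 * δ) • (z - y) := by rw [hP]; module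
  have hPyn : ‖P - y‖ = (1 - 2 * δ) * r := by
    rw [hPy, norm_smul, hzr, Real.norm_of_nonneg (by linarith)]
  have hzPn : ‖z - P‖ = 2 * δ * r := by
    rw [hzP, norm_smul, hzr, Real.norm_of_nonneg (by positivity)]
  have hsub : closedBall P (2 * δ * r) ⊆ closedBall y r := closedBall_subset_closedBall' (by
    rw [dist_eq_norm, hPyn]; linarith)
  have hsub' : ball P (2 * δ * r) ⊆ ball y r := ball_subset_ball' (by
    rw [dist_eq_norm, hPyn]; linarith)
  have hnn : ∀ x ∈ closedBall y r, 0 ≤ h x := H.const_le hd hr h0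
  set m := κ * r / (2 * (8 + 2 * d)) * (δ * L) with hm
  have hm0 : 0 ≤ m := by positivity
  set cH := hopfConst d 2 with hcH
  have hcH0 : 0 < cH := hopfConst_pos hd (by norm_num)
  have hδr : 0 < δ * r := by positivity
  have hhopf := hopf_lower_bound hd (f := h) (P := P) (σ := δ * r) (ρ := 2 * δ * r) (m := m) hδr
    (by linarith) hm0 (H.continuousOn.mono hsub).lowerSemicontinuousOn
    (H.continuousOn.mono hsub).integrableOn_closedBall
    (fun x hx => hnn x (hsub (sphere_subset_closedBall hx)))
    (fun x hx => by
      have hxP : ‖x - P‖ = δ * r := by rw [← dist_eq_norm]; exact hx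
      have hxy : x - y = (x - P) + (P - y) := by abel
      refine le_trans ?_ (H.hinge_le hd hr hδ hκ he h0 hs x (hsub (mem_closedBall.2 (by
        rw [mem_sphere.1 hx]; linarith))))
      refine mul_le_mul_of_nonneg_left (le_hinge hd'.le hδ hδ1 ?_ ?_ ?_) (by positivity)
      · rw [abs_mul, abs_of_pos (inv_pos.2 hr), inv_mul_le_iff₀ hr, hxy, inner_add_right, hPy,
          real_inner_smul_right]
        have h1 : |inner ℝ e (x - P)| ≤ δ * r := by
          have := abs_real_inner_le_norm e (x - P)
          rwa [he, one_mul, hxP] at this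
        have h2 : |(1 - 2 * δ) * inner ℝ e (z - y)| ≤ 1 * (δ * r) := by
          rw [abs_mul]
          gcongr
          rw [abs_le]; constructor <;> linarith
        have h3 := abs_add_le (inner ℝ e (x - P)) ((1 - 2 * δ) * inner ℝ e (z - y))
        linarith
      · have h1 : ‖x - y‖ ≤ (1 - δ) * r := by
          rw [hxy]
          calc _ ≤ _ := norm_add_le _ _
            _ = _ := by rw [hxP, hPyn]; ring
        have h2 : ‖x - y‖ ^ 2 / r ^ 2 ≤ (1 - δ) ^ 2 := by
          rw [div_le_iff₀ (by positivity), ← mul_pow]; gcongr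
        nlinarith
      · have h1 : (1 - 3 * δ) * r ≤ ‖x - y‖ := by
          have h2 := norm_sub_norm_le (P - y) (P - x)
          rw [show P - y - (P - x) = x - y by abel, hPyn, norm_sub_rev, hxP] at h2
          linarith
        have h2 : (1 - 3 * δ) ^ 2 ≤ ‖x - y‖ ^ 2 / r ^ 2 := by
          rw [le_div_iff₀ (by positivity), ← mul_pow]
          have : 0 ≤ (1 - 3 * δ) * r := mul_nonneg (by linarith) hr.le
          gcongr
        nlinarith)
    (fun x hx _ => H.neg.subMeanAt hd (hsub' hx))
  have hρne : 2 * δ * r ≠ 0 := by positivity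
  rw [show 2 * δ * r / (δ * r) = 2 by field_simp, ← hcH] at hhopf
  have h1 := le_norm_of_mem_superDiff hU hzU hp
    (hasFDerivAt_one_sub_normSq P (m * cH) (2 * δ * r) z) (by
      show m * cH * (1 - ‖z - P‖ ^ 2 / (2 * δ * r) ^ 2) = 0
      rw [hzPn, div_self (pow_ne_zero 2 hρne), sub_self, mul_zero]) (by
      have hc : Continuous fun y : Space d => ‖y - P‖ := by fun_prop
      filter_upwards [hv0, hc.continuousAt.eventually
        (lt_mem_nhds (show δ * r < ‖z - P‖ by rw [hzPn]; linarith))] with x hx0 hx1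
      by_cases hxB : x ∈ closedBall P (2 * δ * r)
      · exact (hhopf x hxB (le_of_lt hx1)).trans (hvh x (hsub hxB))
      · refine le_trans (mul_nonpos_of_nonneg_of_nonpos (by positivity) ?_) hx0
        rw [mem_closedBall, dist_eq_norm, not_le] at hxB
        rw [sub_nonpos, one_le_div (by positivity)]
        gcongr)
  rw [norm_hopf_gradient (by positivity) (by positivity) hzPn] at h1
  refine le_trans (le_of_eq ?_) h1
  rw [hm]; field_simp

/-- A strong minimum principle in three moves: averages over nested balls make the centre positive,
Harnack spreads this to a quarter of the ball, and the Hopf bound covers the rest. -/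
lemma PolyApprox.pos (hd : 0 < d) {y : Space d} {r : ℝ} (hr : 0 < r) {h : Space d → ℝ}
    (H : PolyApprox y r h) (h0 : ∀ x ∈ sphere y r, 0 ≤ h x)
    (hex : ∃ x ∈ sphere y r, 0 < h x) : ∀ x ∈ ball y r, 0 < h x := by
  have hnn : ∀ x ∈ closedBall y r, 0 ≤ h x := H.const_le hd hr h0
  obtain ⟨z, hz, hz0⟩ := hex
  have hy : 0 < h y := by
    have hzc : z ∈ closedBall y r := sphere_subset_closedBall hz
    have h1 : ∀ᶠ x in 𝓝[closedBall y r] z, h z / 2 < h x :=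
      (H.continuousOn z hzc).eventually (lt_mem_nhds (by linarith))
    obtain ⟨ε, hε, hεs⟩ := Metric.mem_nhdsWithin_iff.1 h1
    set t := min (ε / 2) r / 2 with ht
    have ht0 : 0 < t := by positivity
    have htr : 2 * t ≤ r := by rw [ht]; linarith [min_le_right (ε / 2) r]
    have htε : 4 * t ≤ ε := by rw [ht]; linarith [min_le_left (ε / 2) r]
    have hzr : ‖z - y‖ = r := by rw [← dist_eq_norm]; exact hz
    set x := y + (1 - t / r) • (z - y) with hx
    have hq : t / r ≤ 1 := (div_le_one hr).2 (by linarith)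
    have hqr : t / r * r = t := div_mul_cancel₀ t hr.ne'
    have hxy : dist x y = r - t := by
      rw [dist_eq_norm, show x - y = (1 - t / r) • (z - y) by rw [hx]; abel, norm_smul, hzr,
        Real.norm_of_nonneg (by linarith)]
      linarith
    have hxz : dist x z = t := by
      rw [dist_eq_norm, show x - z = (-(t / r)) • (z - y) by rw [hx]; module, norm_smul, hzr,
        norm_neg, Real.norm_of_nonneg (by positivity), hqr]
    have hsub : closedBall x t ⊆ closedBall y r := closedBall_subset_closedBall' (by linarith)
    have h2 := setAverage_closedBall_ge_of_subset ht0 hr hsub H.continuousOn.integrableOn_closedBall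
      hnn
    rw [H.setAverage hd hr subset_rfl, H.setAverage hd ht0 hsub] at h2
    have h3 : h z / 2 < h x := hεs ⟨mem_ball.2 (by linarith), hsub (mem_closedBall_self ht0.le)⟩
    exact lt_of_lt_of_le (mul_pos (by positivity) (by linarith)) h2
  have hharm := superharmonicIn_of_harmonicOnNhd hd (H.harmonicOnNhd hd)
  have hm : ∀ x ∈ closedBall y (r / 4), (1 / 2) ^ d * h y ≤ h x := by
    intro x hx
    have hsub : closedBall x (2 * (r / 4)) ⊆ ball y r := closedBall_subset_ball' (by
      have := mem_closedBall.1 hx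
      linarith)
    have := hharm.harnack (x := y) (y := x) (r := r / 4) (by positivity) hx hsub fun z hz =>
      hnn z (ball_subset_closedBall (hsub hz))
    rwa [H.setAverage hd (by positivity) (closedBall_subset_closedBall (by linarith))] at this
  intro x hx
  have hm0 : 0 < (1 / 2) ^ d * h y := by positivity
  rcases le_total (dist x y) (r / 4) with hxr | hxr
  · exact hm0.trans_le (hm x hxr)
  have h1 := hopf_lower_bound hd (f := h) (P := y) (σ := r / 4) (ρ := r) (by positivity)
    (by linarith) hm0.le H.continuousOn.lowerSemicontinuousOn
    H.continuousOn.integrableOn_closedBall h0 (fun z hz => hm z (sphere_subset_closedBall hz))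
    (fun z hz _ => H.neg.subMeanAt hd hz) x (ball_subset_closedBall hx)
    (by rwa [← dist_eq_norm])
  refine lt_of_lt_of_le (mul_pos (mul_pos hm0 (hopfConst_pos hd ?_)) ?_) h1
  · rw [one_lt_div (by positivity)]; linarith
  · rw [sub_pos, div_lt_one (by positivity), ← dist_eq_norm]
    have : dist x y < r := hx
    gcongr

/-! ### The radial profile outside a ball -/

/-- A radial function that is superharmonic off `c`, vanishes on `sphere c a` and grows outwards. -/
noncomputable def shell (c : Space d) (a : ℝ) (x : Space d) : ℝ :=
  1 - (a ^ 2) ^ d * radialBarrier c x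

lemma shell_eq (c : Space d) (a : ℝ) (x : Space d) :
    shell c a x = 1 - (a ^ 2 / ‖x - c‖ ^ 2) ^ d := by
  rw [shell, radialBarrier, zpow_neg, zpow_natCast, div_pow, div_eq_mul_inv]

lemma continuousOn_shell (c : Space d) (a : ℝ) : ContinuousOn (shell c a) {c}ᶜ :=
  continuousOn_const.sub (continuousOn_const.mul (continuousOn_radialBarrier c))

lemma one_sub_le_shell (hd : 0 < d) {c x : Space d} {a : ℝ} (ha : 0 < a) (hx : a ≤ ‖x - c‖) :
    1 - a ^ 2 / ‖x - c‖ ^ 2 ≤ shell c a x := by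
  rw [shell_eq]
  have h1 : a ^ 2 / ‖x - c‖ ^ 2 ≤ 1 := (div_le_one (by have := ha.trans_le hx; positivity)).2
    (by gcongr)
  linarith [pow_le_of_le_one (by positivity) h1 hd.ne']

/-- Together with `shell_le` this says that `shell` is comparable to the distance from the sphere,
with the explicit constants used below. -/
lemma le_shell (hd : 0 < d) {c x : Space d} {a : ℝ} (ha : 0 < a) (hx : a ≤ ‖x - c‖)
    (hx2 : ‖x - c‖ ≤ 2 * a) : (‖x - c‖ - a) / (2 * a) ≤ shell c a x := by
  refine le_trans ?_ (one_sub_le_shell hd ha hx)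
  set t := ‖x - c‖
  have ht : 0 < t := ha.trans_le hx
  rw [one_sub_div (by positivity), div_le_div_iff₀ (by positivity) (by positivity)]
  have h1 : 0 ≤ (t - a) * (2 * a - t) := mul_nonneg (by linarith) (by linarith)
  nlinarith [mul_nonneg (sub_nonneg.2 hx) (mul_nonneg ht.le (sub_nonneg.2 hx2)),
    mul_nonneg (sub_nonneg.2 hx) (mul_nonneg ha.le ha.le)]

lemma shell_le {c x : Space d} {a : ℝ} (ha : 0 < a) (hx : a ≤ ‖x - c‖) :
    shell c a x ≤ 2 * d * (‖x - c‖ - a) / a := by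
  rw [shell_eq]
  set t := ‖x - c‖
  have ht : 0 < t := ha.trans_le hx
  have h0 : 0 ≤ a ^ 2 / t ^ 2 := by positivity
  have h1 := one_add_mul_le_pow (a := a ^ 2 / t ^ 2 - 1) (by linarith) d
  rw [add_sub_cancel] at h1
  have h2 : 1 - a ^ 2 / t ^ 2 ≤ 2 * (t - a) / a := by
    rw [one_sub_div (by positivity), div_le_div_iff₀ (by positivity) (by positivity)]
    nlinarith [mul_nonneg (sub_nonneg.2 hx) (mul_nonneg ht.le (sub_nonneg.2 hx)),
      mul_nonneg (sub_nonneg.2 hx) (mul_nonneg ht.le ht.le),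
      mul_nonneg (sub_nonneg.2 hx) (mul_nonneg ha.le (sub_nonneg.2 hx))]
  have h3 : d * (1 - a ^ 2 / t ^ 2) ≤ d * (2 * (t - a) / a) := by gcongr
  have h4 : (d : ℝ) * (2 * (t - a) / a) = 2 * d * (t - a) / a := by ring
  linarith

lemma shell_nonneg (hd : 0 < d) {c x : Space d} {a : ℝ} (ha : 0 < a) (hx : a ≤ ‖x - c‖) :
    0 ≤ shell c a x := by
  refine le_trans ?_ (one_sub_le_shell hd ha hx)
  rw [sub_nonneg]
  exact (div_le_one (by have := ha.trans_le hx; positivity)).2 (by gcongr)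

lemma subMeanAt_neg_shell (hd : 0 < d) {c x : Space d} (hx : x ≠ c) {a k : ℝ} (ha : 0 < a)
    (hk : 0 < k) : SubMeanAt (fun y => -(k * shell c a y)) x := by
  obtain ⟨l, hl, h⟩ := exists_hasLap_radialBarrier hd hx
  refine (((h.const_mul (k * (a ^ 2) ^ d)).add (hasLap_const (-k) x)).congr
    (fun y => by unfold shell; ring) rfl rfl).subMeanAt ?_
  positivity

lemma setAverage_shell_le (hd : 0 < d) {c x : Space d} {a ρ : ℝ} (ha : 0 < a) (hρ : 0 < ρ)
    (hc : c ∉ closedBall x ρ) : ⨍ y in closedBall x ρ, shell c a y ≤ shell c a x := by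
  have hne : ∀ y ∈ closedBall x ρ, y ≠ c := fun y hy h => hc (h ▸ hy)
  have h1 := HasLap.le_setAverage hd hρ ((continuousOn_radialBarrier c).mono hne)
    fun y hy => by
      obtain ⟨l, hl, h⟩ := exists_hasLap_radialBarrier hd (hne y (ball_subset_closedBall hy))
      exact ⟨_, _, h, hl.le⟩
  have hi := ((continuousOn_radialBarrier c).mono hne).integrableOn_closedBall
  have h2 : ⨍ y in closedBall x ρ, shell c a y =
      1 - (a ^ 2) ^ d * ⨍ y in closedBall x ρ, radialBarrier c y := by
    unfold shell
    rw [setAverage_closedBall_sub continuousOn_const.integrableOn_closedBall (hi.const_mul _),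
      setAverage_closedBall_const x hρ, setAverage_closedBall_const_mul]
  rw [h2, shell]
  gcongr

/-! ### The hollow set and balls touching its boundary from inside. -/

namespace IsRecedingSequence

variable {U : Set (Space d)} {μm μp c₀ r₀ : ℝ} {o l : Space d → ℝ} {v : ℕ → Space d → ℝ}
  {f : ℕ → ℝ}

/-- The interior of the zero set of the limit where no member of the sequence vanishes. -/
def hollow (U : Set (Space d)) (v : ℕ → Space d → ℝ) : Set (Space d) :=
  {x | x ∈ U ∧ (∀ᶠ y in 𝓝 x, infSeq v y = 0) ∧ ∀ n, 0 < v n x}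

/-- Where the limit vanishes, non-degeneracy leaves late members no free boundary, so positivity at
`x` spreads over a ball of fixed radius. Earlier members are larger. -/
lemma isOpen_hollow (H : IsRecedingSequence U μm μp c₀ r₀ o l v f) (hU : IsOpen U)
    (hc : 0 < c₀) (hr₀ : 0 < r₀) : IsOpen (hollow U v) := by
  rw [isOpen_iff_mem_nhds]
  rintro x ⟨hxU, hw, hpos⟩
  obtain ⟨ε, hε, hεs⟩ := Metric.mem_nhds_iff.1 (inter_mem (hU.mem_nhds hxU) hw)
  set r := min (ε / 3) r₀ with hr
  have hr0 : 0 < r := by positivity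
  have hB : closedBall x (2 * r) ⊆ ball x ε := closedBall_subset_ball (by
    linarith [min_le_left (ε / 3) r₀])
  have hev := H.eventually_pos_or_eq_zero hU hc hr0 (min_le_right _ _)
    (fun y hy => (hεs (hB hy)).1) (fun y hy => by
      have : infSeq v y = 0 := (hεs (hB hy)).2
      rw [this]; positivity)
  filter_upwards [hU.mem_nhds hxU, hw.eventually_nhds, ball_mem_nhds x hr0] with y hyU hyw hy
  refine ⟨hyU, hyw, fun n => ?_⟩
  obtain ⟨m, hm, hnm⟩ := (hev.and (eventually_ge_atTop n)).exists
  refine lt_of_lt_of_le ?_ (H.antitone n m hnm y (subset_closure hyU))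
  rcases hm with h | h
  · exact h y hy
  · exact absurd (h x (mem_ball_self hr0)) (hpos m).ne'

/-- Harnack at a point just inside the ball spreads the vanishing of the limit across the sphere to
a neighbourhood of `y`. -/
lemma mem_hollow_of_pos (H : IsRecedingSequence U μm μp c₀ r₀ o l v f) (hd : 0 < d)
    {y c : Space d} {a r : ℝ} (ha : 0 < a) (hy : ‖y - c‖ = a) (hwB : ∀ x ∈ ball c a, infSeq v x = 0)
    (hr : 0 < r) (hrU : ball y r ⊆ U) (hpos : ∀ n, ∀ x ∈ ball y r, 0 < v n x) : y ∈ hollow U v := by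
  set t := min (r / 8) a with ht
  have ht0 : 0 < t := by positivity
  have hta : t / a ≤ 1 := (div_le_one ha).2 (min_le_right _ _)
  have htr : t ≤ r / 8 := min_le_left _ _
  set z := c + (1 - t / a) • (y - c) with hz
  have hzy : dist z y = t := by
    rw [dist_eq_norm, show z - y = (-(t / a)) • (y - c) by rw [hz]; module, norm_smul, hy,
      norm_neg, Real.norm_of_nonneg (by positivity), div_mul_cancel₀ t ha.ne']
  have hzc : z ∈ ball c a := by
    rw [mem_ball, dist_eq_norm, show z - c = (1 - t / a) • (y - c) by rw [hz]; abel, norm_smul, hy,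
      Real.norm_of_nonneg (by linarith), sub_mul, div_mul_cancel₀ t ha.ne']
    linarith
  have hsub : closedBall z (2 * (r / 4)) ⊆ ball y r := closedBall_subset_ball' (by linarith)
  have h1 := H.infSeq_eq_zero_of_pos hd (by positivity : 0 < r / 4) (hsub.trans hrU)
    (fun n x hx => hpos n x (hsub hx)) (hwB z hzc)
  refine ⟨hrU (mem_ball_self hr), ?_, fun n => hpos n y (mem_ball_self hr)⟩
  filter_upwards [isOpen_ball.mem_nhds (mem_ball.2 (show dist y z < r / 4 by
    rw [dist_comm]; linarith))] with x hx
  exact h1 x (ball_subset_closedBall hx)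

/-- Non-degeneracy of the limit at a boundary point of the hollow set. -/
lemma exists_ge_infSeq (H : IsRecedingSequence U μm μp c₀ r₀ o l v f) (hd : 0 < d) (hU : IsOpen U)
    (hc : 0 < c₀) {y c : Space d} {a r : ℝ} (ha : 0 < a) (hy : ‖y - c‖ = a)
    (hB : ball c a ⊆ hollow U v) (hyD : y ∉ hollow U v) (hr : 0 < r) (hr₀ : r ≤ r₀)
    (hrU : closedBall y (2 * r) ⊆ U) : ∃ x ∈ closedBall y (2 * r), c₀ / 2 * r ≤ infSeq v x := by
  by_contra! hcon
  have hyc : y ∈ closure (ball c a) := by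
    rw [closure_ball c ha.ne', mem_closedBall, dist_eq_norm, hy]
  obtain ⟨q, hq, hqc⟩ := mem_closure_iff.1 hyc _ isOpen_ball (mem_ball_self hr)
  refine hyD (H.mem_hollow_of_pos hd ha hy (fun x hx => (hB hx).2.1.self_of_nhds) hr
    ((ball_subset_ball (by linarith)).trans (ball_subset_closedBall.trans hrU)) fun n x hx => ?_)
  obtain ⟨m, hm, hnm⟩ := ((H.eventually_pos_or_eq_zero hU hc hr hr₀ hrU hcon).and
    (eventually_ge_atTop n)).exists
  refine lt_of_lt_of_le ?_ (H.antitone n m hnm x (subset_closure (hrU (closedBall_subset_closedBall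
    (by linarith) (ball_subset_closedBall hx)))))
  rcases hm with h | h
  · exact h x hx
  · exact absurd (h q hq) ((hB hqc).2.2 m).ne'

lemma subMeanAt_infSeq_sub_shell (H : IsRecedingSequence U μm μp c₀ r₀ o l v f) (hd : 0 < d)
    (hU : IsOpen U) {c x : Space d} {a k : ℝ} (ha : 0 < a) (hk : 0 < k) (hx : x ∈ U) (hxc : x ≠ c) :
    SubMeanAt (fun y => infSeq v y + -(k * shell c a y)) x := by
  refine (H.subMeanAt hd hU hx).add (subMeanAt_neg_shell hd hxc ha hk) ?_ ?_
  · filter_upwards [eventually_closedBall_subset (hU.mem_nhds hx)] with r hr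
    exact H.integrableOn hr
  · filter_upwards [eventually_closedBall_subset (isOpen_compl_singleton.mem_nhds hxc)] with r hr
    exact (continuousOn_const.mul ((continuousOn_shell c a).mono hr)).neg.integrableOn_closedBall

/-- Comparison in the annulus between radii b and 2a, followed by b → a. Radii b < a are needed
because the limit is not known to vanish on the touching sphere itself. -/
lemma infSeq_le_shell (H : IsRecedingSequence U μm μp c₀ r₀ o l v f) (hd : 0 < d) (hU : IsOpen U)
    {c : Space d} {a M : ℝ} (ha : 0 < a) (hM : 0 < M) (hB : closedBall c (2 * a) ⊆ U)
    (hwB : ∀ x ∈ ball c a, infSeq v x = 0) (hwM : ∀ x ∈ closedBall c (2 * a), infSeq v x ≤ M)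
    {x : Space d} (hx : a ≤ ‖x - c‖) (hx2 : ‖x - c‖ < 2 * a) :
    infSeq v x ≤ 2 * M * shell c a x := by
  have key : ∀ b, 0 < b → b < a → infSeq v x ≤ 2 * M * shell c b x := by
    intro b hb hba
    have hn : Continuous fun x : Space d => ‖x - c‖ := by fun_prop
    set D := {x : Space d | b < ‖x - c‖} ∩ {x | ‖x - c‖ < 2 * a} with hD
    have hDo : IsOpen D := (isOpen_lt continuous_const hn).inter (isOpen_lt hn continuous_const)
    have hDc : closure D ⊆ {x | b ≤ ‖x - c‖} ∩ {x | ‖x - c‖ ≤ 2 * a} :=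
      closure_minimal (fun x hx => ⟨hx.1.out.le, hx.2.out.le⟩)
        ((isClosed_le continuous_const hn).inter (isClosed_le hn continuous_const))
    have hDU : closure D ⊆ closedBall c (2 * a) := fun x hx => by
      rw [mem_closedBall, dist_eq_norm]; exact (hDc hx).2
    have hDne : closure D ⊆ {c}ᶜ := fun x hx h => by
      have h1 : b ≤ ‖x - c‖ := (hDc hx).1
      have h2 : x = c := h
      rw [h2, sub_self, norm_zero] at h1
      linarith
    have h1 := nonpos_of_subMeanAt hd hDo ((isBounded_closedBall).subset (subset_closure.trans hDU))
      (f := fun x => infSeq v x + -(2 * M * shell c b x))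
      (((H.upperSemicontinuousOn hU).mono (hDU.trans hB)).add (continuousOn_const.mul
        ((continuousOn_shell c b).mono hDne)).neg.upperSemicontinuousOn)
      (fun y hy _ => H.subMeanAt_infSeq_sub_shell hd hU hb (by positivity)
        (hB (hDU (subset_closure hy))) (hDne (subset_closure hy)))
      (fun y hy => by
        have hyc := hDc hy.1
        have hyD : y ∉ D := fun h => hy.2 (hDo.interior_eq.symm ▸ h)
        have h3 : b ≤ ‖y - c‖ := hyc.1
        have hnn := shell_nonneg hd hb h3
        by_cases hya : ‖y - c‖ < a
        · rw [hwB y (by rwa [mem_ball, dist_eq_norm])]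
          have : 0 ≤ 2 * M * shell c b y := by positivity
          linarith
        · have h2 : 2 * a ≤ ‖y - c‖ := by
            by_contra! h
            exact hyD ⟨lt_of_lt_of_le hba (not_lt.1 hya), h⟩
          have h4 := one_sub_le_shell hd hb h3
          have h5 : b ^ 2 / ‖y - c‖ ^ 2 ≤ 1 / 2 := by
            rw [div_le_div_iff₀ (pow_pos (hb.trans_le h3) 2) (by norm_num)]
            nlinarith
          have h6 : 2 * M * (1 / 2) ≤ 2 * M * shell c b y := by gcongr; linarith
          linarith [hwM y (hDU hy.1)]) x (subset_closure ⟨lt_of_lt_of_le hba hx, hx2⟩)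
    linarith
  have hcont : ContinuousAt (fun b => 2 * M * shell c b x) a := by
    unfold shell; fun_prop
  refine ge_of_tendsto (hcont.tendsto.mono_left (nhdsWithin_le_nhds (s := Iio a))) ?_
  filter_upwards [Ioo_mem_nhdsLT ha] with b hb
  exact key b hb.1 hb.2

/-- The asymptotic slope of the limit at a boundary point touched from inside the hollow set. -/
theorem exists_slope (H : IsRecedingSequence U μm μp c₀ r₀ o l v f) (hd : 0 < d) (hU : IsOpen U)
    (hc : 0 < c₀) (hr₀ : 0 < r₀) {y c : Space d} {a : ℝ} (ha : 0 < a) (hy : ‖y - c‖ = a)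
    (hBU : closedBall c (3 * a) ⊆ U) (hB : ball c a ⊆ hollow U v) (hyD : y ∉ hollow U v) :
    ∃ α > 0, ∀ η, 0 < η → η < α → ∃ R > 0,
      (∀ x ∈ closedBall y R, a ≤ ‖x - c‖ → infSeq v x ≤ (α + η) * shell c a x) ∧
      ∀ ρ > 0, ∃ x ∈ closedBall y ρ, a ≤ ‖x - c‖ ∧ (α - η) * shell c a x < infSeq v x := by
  have hd' : (0 : ℝ) < d := by exact_mod_cast hd
  have hwB : ∀ x ∈ ball c a, infSeq v x = 0 := fun x hx => (hB hx).2.1.self_of_nhds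
  have hB2 : closedBall c (2 * a) ⊆ U := (closedBall_subset_closedBall (by linarith)).trans hBU
  obtain ⟨z, hz, hmax⟩ := UpperSemicontinuousOn.exists_isMaxOn
    ⟨c, mem_closedBall_self (by positivity)⟩ (isCompact_closedBall c (2 * a))
    ((H.upperSemicontinuousOn hU).mono hB2)
  set M := max (infSeq v z) 1 with hM
  have hM0 : 0 < M := lt_max_of_lt_right one_pos
  have hwM : ∀ x ∈ closedBall c (2 * a), infSeq v x ≤ M := fun x hx =>
    (hmax hx).trans (le_max_left _ _)
  -- Admissible slopes of a bound by the shell near `y`. Their infimum is the asymptotic slope: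
  -- above it some neighbourhood works, below it none does. Non-degeneracy makes it positive.
  set S := {α : ℝ | 0 ≤ α ∧ ∃ R > 0, ∀ x ∈ closedBall y R, a ≤ ‖x - c‖ →
    infSeq v x ≤ α * shell c a x} with hS
  have hSne : S.Nonempty := ⟨2 * M, by positivity, a / 2, by positivity, fun x hx hxa =>
    H.infSeq_le_shell hd hU ha hM0 hB2 hwB hwM hxa (by
      rw [mem_closedBall, dist_eq_norm] at hx
      have := norm_add_le (x - y) (y - c)
      rw [sub_add_sub_cancel, hy] at this
      linarith)⟩
  have hSb : BddBelow S := ⟨0, fun α hα => hα.1⟩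
  have hlt : ∀ β, sInf S < β → ∃ R > 0, ∀ x ∈ closedBall y R, a ≤ ‖x - c‖ →
      infSeq v x ≤ β * shell c a x := by
    intro β hβ
    obtain ⟨α, hα, hαβ⟩ := exists_lt_of_csInf_lt hSne hβ
    obtain ⟨-, R, hR, h⟩ := hα
    exact ⟨R, hR, fun x hx hxa => (h x hx hxa).trans (by
      have := shell_nonneg hd ha hxa; gcongr)⟩
  have hpos : 0 < sInf S := by
    by_contra! hcon
    -- With this slope the shell bound at distance 2r gives at most c₀ r/4, half of what
    -- non-degeneracy demands.
    obtain ⟨R, hR, h⟩ := hlt (c₀ * a / (16 * d)) (hcon.trans_lt (by positivity))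
    set r := min (min (R / 2) (a / 2)) r₀ with hr
    have hr0 : 0 < r := by positivity
    have hrR : r ≤ R / 2 := (min_le_left _ _).trans (min_le_left _ _)
    have hra : r ≤ a / 2 := (min_le_left _ _).trans (min_le_right _ _)
    obtain ⟨x, hx, hxw⟩ := H.exists_ge_infSeq hd hU hc ha hy hB hyD hr0 (min_le_right _ _)
      ((closedBall_subset_closedBall' (by rw [dist_eq_norm, hy]; linarith)).trans hBU)
    have hxpos : 0 < infSeq v x := lt_of_lt_of_le (by positivity) hxw
    have hxa : a ≤ ‖x - c‖ := by
      by_contra! h'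
      rw [hwB x (by rwa [mem_ball, dist_eq_norm])] at hxpos
      exact lt_irrefl _ hxpos
    have h1 := h x (closedBall_subset_closedBall (by linarith) hx) hxa
    have h2 := shell_le ha hxa
    have h3 : ‖x - c‖ - a ≤ 2 * r := by
      rw [mem_closedBall, dist_eq_norm] at hx
      have := norm_add_le (x - y) (y - c)
      rw [sub_add_sub_cancel, hy] at this
      linarith
    have h4 : c₀ * a / (16 * d) * shell c a x ≤ c₀ * a / (16 * d) * (2 * d * (2 * r) / a) := by
      gcongr
      exact h2.trans (by gcongr)
    have h5 : c₀ * a / (16 * d) * (2 * d * (2 * r) / a) = c₀ / 4 * r := by field_simp; ring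
    nlinarith
  refine ⟨sInf S, hpos, fun η hη hηα => ?_⟩
  obtain ⟨R, hR, h⟩ := hlt (sInf S + η) (by linarith)
  refine ⟨R, hR, h, fun ρ hρ => ?_⟩
  by_contra! hcon
  have : sInf S - η ∈ S := ⟨by linarith, ρ, hρ, hcon⟩
  linarith [csInf_le hSb this]

end IsRecedingSequence

/-- A zero of `v` in the ball would, by linear growth, keep the average below `growthConst` times
2s. So the ball is wet and the average is the value at the centre. This turns an averaged bound for
the infimum into a pointwise bound for each member. -/
lemma IsStable.le_of_le_setAverage (hd : 0 < d) {U : Set (Space d)} (hU : IsOpen U) {μm μp : ℝ}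
    {v : Space d → ℝ} (hv : IsStable U μm μp v) {x : Space d} {s A : ℝ} (hs : 0 < s)
    (hB : closedBall x (3 * s) ⊆ U) (hA : growthConst d μp * (2 * s) < A)
    (hAv : A ≤ ⨍ y in closedBall x s, v y) : A ≤ v x := by
  have hBs : closedBall x s ⊆ U := (closedBall_subset_closedBall (by linarith)).trans hB
  have hpos : ∀ z ∈ closedBall x s, v z ≠ 0 := by
    intro z hz h0
    have h1 : ⨍ y in closedBall x s, v y ≤ growthConst d μp * (2 * s) := by
      rw [← setAverage_closedBall_const x hs (growthConst d μp * (2 * s))]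
      refine setAverage_closedBall_mono
        (hv.state.continuousOn.mono (hBs.trans subset_closure)).integrableOn_closedBall
        continuousOn_const.integrableOn_closedBall fun y hy => ?_
      have hzy : dist z y ≤ 2 * s := by
        have := dist_triangle_right z y x
        rw [mem_closedBall] at hz hy
        linarith
      refine (hv.le_growthConst_mul hd hU h0 ((closedBall_subset_closedBall' ?_).trans hB)).trans
        (mul_le_mul_of_nonneg_left hzy (growthConst_nonneg hd μp))
      rw [mem_closedBall] at hy
      linarith
    linarith
  rwa [hv.setAverage_eq hd hs fun z hz => ⟨⟨subset_closure (hBs hz), lt_of_le_of_ne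
    (hv.state.nonneg z (subset_closure (hBs hz))) (hpos z hz).symm⟩, hBs hz⟩] at hAv

/-! ### Linear growth of all members away from a touching ball, and closedness of the hollow set. -/

namespace IsRecedingSequence

variable {U : Set (Space d)} {μm μp c₀ r₀ : ℝ} {o l : Space d → ℝ} {v : ℕ → Space d → ℝ}
  {f : ℕ → ℝ}

/-- The distance of the limit to the radial profile at a point controls its average distance
nearby. -/
lemma setAverage_shell_sub_le (H : IsRecedingSequence U μm μp c₀ r₀ o l v f) (hd : 0 < d)
    (hU : IsOpen U) {c x₁ xh P : Space d} {a k ρ σ s : ℝ} (ha : 0 < a) (hk : 0 < k) (hσ : 0 < σ)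
    (hσρ : σ < ρ) (hs : 0 < s) (hx₁ : a < ‖x₁ - c‖) (hx₁' : ‖x₁ - c‖ - a ≤ ρ - σ)
    (hP : P - c = ((a + ρ) / ‖x₁ - c‖) • (x₁ - c)) (hBU : closedBall P ρ ⊆ U)
    (hw : ∀ x ∈ closedBall P ρ, a ≤ ‖x - c‖ → infSeq v x ≤ k * shell c a x)
    (hsub : ∀ z ∈ sphere P σ, closedBall xh s ⊆ closedBall z (ρ - σ)) :
    0 ≤ ⨍ x in closedBall xh s, (k * shell c a x - infSeq v x) ∧
    (s / (ρ - σ)) ^ d * (⨍ x in closedBall xh s, (k * shell c a x - infSeq v x)) *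
      hopfConst d (ρ / σ) * ((‖x₁ - c‖ - a) / ρ) ≤ k * shell c a x₁ - infSeq v x₁ := by
  have : Nonempty (Fin d) := ⟨⟨0, hd⟩⟩
  set t := ‖x₁ - c‖ with ht
  have ht0 : 0 < t := ha.trans hx₁
  have hρ : 0 < ρ := hσ.trans hσρ
  -- The ball of radius ρ around `P` touches `sphere c a` from outside, and x₁ lies on the segment
  -- from the point of contact to `P`, at distance ‖x₁ - c‖ - a from the boundary of that ball.
  have hPn : ‖P - c‖ = a + ρ := by
    rw [hP, norm_smul, ← ht, Real.norm_of_nonneg (by positivity), div_mul_cancel₀ _ ht0.ne']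
  have hfar : ∀ x ∈ closedBall P ρ, a ≤ ‖x - c‖ := by
    intro x hx
    rw [mem_closedBall, dist_eq_norm, norm_sub_rev] at hx
    have := norm_add_le (P - x) (x - c)
    rw [sub_add_sub_cancel, hPn] at this
    linarith
  have hne : closedBall P ρ ⊆ {c}ᶜ := fun x hx h => by
    have h1 := hfar x hx
    have h2 : x = c := h
    rw [h2, sub_self, norm_zero] at h1
    linarith
  set F : Space d → ℝ := fun x => k * shell c a x - infSeq v x with hF
  have hshell : ContinuousOn (fun x => k * shell c a x) (closedBall P ρ) :=
    continuousOn_const.mul ((continuousOn_shell c a).mono hne)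
  have hFi : ∀ z τ, closedBall z τ ⊆ closedBall P ρ → IntegrableOn F (closedBall z τ) :=
    fun z τ h => (hshell.mono h).integrableOn_closedBall.sub (H.integrableOn (h.trans hBU))
  have hF0 : ∀ x ∈ closedBall P ρ, 0 ≤ F x := fun x hx => sub_nonneg.2 (hw x hx (hfar x hx))
  have hsub2 : ∀ z ∈ sphere P σ, closedBall z (ρ - σ) ⊆ closedBall P ρ := fun z hz =>
    closedBall_subset_closedBall' (by rw [mem_sphere.1 hz]; linarith)
  obtain ⟨z₀, hz₀⟩ : (sphere P σ).Nonempty := NormedSpace.sphere_nonempty.2 hσ.le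
  have hA0 : 0 ≤ ⨍ x in closedBall xh s, F x := by
    rw [← setAverage_closedBall_const xh hs 0]
    have h1 := (hsub z₀ hz₀).trans (hsub2 z₀ hz₀)
    exact setAverage_closedBall_mono continuousOn_const.integrableOn_closedBall (hFi _ _ h1)
      fun y hy => hF0 y (h1 hy)
  refine ⟨hA0, ?_⟩
  -- The defect `F` has the super-mean-value property, so its value at `z` dominates its average
  -- over a large ball, which contains the small ball around `xh`.
  have hmean : ∀ z ∈ sphere P σ, (s / (ρ - σ)) ^ d * (⨍ x in closedBall xh s, F x) ≤ F z := by
    intro z hz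
    have hρσ : 0 < ρ - σ := by linarith
    have h1 := hsub2 z hz
    refine (setAverage_closedBall_ge_of_subset hs hρσ (hsub z hz) (hFi _ _ h1)
      fun y hy => hF0 y (h1 hy)).trans ?_
    have h2 : ⨍ x in closedBall z (ρ - σ), F x = k * (⨍ x in closedBall z (ρ - σ), shell c a x) -
        ⨍ x in closedBall z (ρ - σ), infSeq v x := by
      rw [hF, setAverage_closedBall_sub (hshell.mono h1).integrableOn_closedBall
        (H.integrableOn (h1.trans hBU)), setAverage_closedBall_const_mul]
    rw [h2]
    have h3 := setAverage_shell_le hd ha hρσ fun h => hne (h1 h) rfl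
    have h4 := H.le_setAverage hd hU hρσ (h1.trans hBU)
    have h5 := mul_le_mul_of_nonneg_left h3 hk.le
    show _ ≤ k * shell c a z - infSeq v z
    linarith
  have hxP : ‖x₁ - P‖ = ρ - (t - a) := by
    have h1 : x₁ - P = (1 - (a + ρ) / t) • (x₁ - c) := by
      rw [sub_smul, one_smul, ← hP]; abel
    rw [h1, norm_smul, ← ht, Real.norm_of_nonpos, neg_mul, sub_mul, div_mul_cancel₀ _ ht0.ne']
    · ring
    · rw [sub_nonpos, one_le_div ht0]; linarith
  have hm0 : 0 ≤ (s / (ρ - σ)) ^ d * (⨍ x in closedBall xh s, F x) :=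
    mul_nonneg (pow_nonneg (div_nonneg hs.le (by linarith)) d) hA0
  have hcH := hopfConst_pos hd ((one_lt_div hσ).2 hσρ)
  have hlsc : LowerSemicontinuousOn F (closedBall P ρ) := by
    have := hshell.lowerSemicontinuousOn.add
      (((H.upperSemicontinuousOn hU).mono hBU).neg)
    have h2 : F = fun z => k * shell c a z + (-infSeq v) z := by
      funext z; simp [hF, sub_eq_add_neg]
    rw [h2]; exact this
  have hhopf := hopf_lower_bound hd (f := F) hσ hσρ hm0 hlsc (hFi _ _ subset_rfl)
    (fun x hx => hF0 x (sphere_subset_closedBall hx)) hmean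
    (fun x hx _ => by
      have hx' := ball_subset_closedBall hx
      have h1 := H.subMeanAt_infSeq_sub_shell hd hU ha hk (hBU hx') (hne hx')
      have h2 : (fun y => -F y) = fun y => infSeq v y + -(k * shell c a y) := by
        funext y; simp only [hF]; ring
      rw [h2]; exact h1) x₁
    (by rw [mem_closedBall, dist_eq_norm, hxP]; linarith) (by rw [hxP]; linarith)
  refine le_trans (mul_le_mul_of_nonneg_left ?_ (mul_nonneg hm0 hcH.le)) hhopf
  rw [hxP, one_sub_div (by positivity), div_le_div_iff₀ hρ (by positivity)]
  have h1 : 0 ≤ (t - a) * (ρ - (t - a)) * ρ :=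
    mul_nonneg (mul_nonneg (by linarith) (by linarith)) hρ.le
  nlinarith

/-- A large ball that touches the sphere `sphere c a` from outside near `y` and contains the part of a
small sphere around `y` that points away from `c`. -/
lemma exists_tangent_ball {y c e x₁ : Space d} {a r δ L : ℝ} (ha : 0 < a) (hr : 0 < r)
    (hδ : 0 < δ) (hδ1 : 4 * δ ≤ 1) (hL : L = 1 / δ) (he : ‖e‖ = 1) (hye : y - c = a • e)
    (hra : L * r ≤ a) (hx₁a : a ≤ ‖x₁ - c‖) (hx₁ : ‖x₁ - y‖ ≤ δ / 32 * r) :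
    ∃ P, P - c = ((a + L * r) / ‖x₁ - c‖) • (x₁ - c) ∧ dist P y ≤ δ / 8 * r + L * r ∧
      ∀ x ∈ sphere y r, δ * r ≤ inner ℝ e (x - y) → ∀ κ ≤ δ / 4, ∀ z ∈ sphere P (δ / 16 * r),
        closedBall x (κ * r) ⊆ closedBall z (L * r - δ / 16 * r) := by
  have hy : ‖y - c‖ = a := by rw [hye, norm_smul, he, mul_one, Real.norm_of_nonneg ha.le]
  have hLδ : L * δ = 1 := by rw [hL]; exact one_div_mul_cancel hδ.ne'
  have hL4 : 4 ≤ L := by rw [hL, le_div_iff₀ hδ]; linarith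
  have hLr : 4 * r ≤ L * r := by gcongr
  set t := ‖x₁ - c‖ with ht
  have ht0 : 0 < t := ha.trans_le hx₁a
  have hta : t - a ≤ δ / 32 * r := by
    have := norm_add_le (x₁ - y) (y - c)
    rw [sub_add_sub_cancel, hy] at this
    linarith
  set ν := t⁻¹ • (x₁ - c) with hν
  have hx₁ν : x₁ - c = t • ν := by rw [hν, smul_smul, mul_inv_cancel₀ ht0.ne', one_smul]
  have hνn : ‖ν‖ = 1 := by
    rw [hν, norm_smul, ← ht, norm_inv, Real.norm_of_nonneg ht0.le, inv_mul_cancel₀ ht0.ne']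
  have hνe : a * ‖ν - e‖ ≤ δ / 16 * r := by
    have h1 : a • (ν - e) = (x₁ - y) - (t - a) • ν := by
      have : x₁ - y = t • ν - a • e := by rw [← hx₁ν, ← hye]; abel
      rw [this]; module
    have h2 : ‖a • (ν - e)‖ ≤ ‖x₁ - y‖ + ‖(t - a) • ν‖ := h1 ▸ norm_sub_le _ _
    rw [norm_smul, norm_smul, hνn, Real.norm_of_nonneg ha.le, Real.norm_of_nonneg (by linarith)]
      at h2
    linarith
  set P := c + (a + L * r) • ν with hP
  have hPc : P - c = (a + L * r) • ν := by rw [hP]; abel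
  have hPy : ‖P - (y + (L * r) • e)‖ ≤ δ / 8 * r := by
    have h1 : P - (y + (L * r) • e) = (a + L * r) • (ν - e) := by
      have h2 : y = c + a • e := by rw [← hye]; abel
      rw [hP, h2]; module
    rw [h1, norm_smul, Real.norm_of_nonneg (by positivity)]
    calc (a + L * r) * ‖ν - e‖ ≤ (a + a) * ‖ν - e‖ := by gcongr
      _ ≤ δ / 8 * r := by linarith
  have hPy2 : dist P y ≤ δ / 8 * r + L * r := by
    rw [dist_eq_norm]
    have h1 := norm_add_le (P - (y + (L * r) • e)) ((L * r) • e)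
    rw [show P - (y + (L * r) • e) + (L * r) • e = P - y by abel, norm_smul, he, mul_one,
      Real.norm_of_nonneg (by positivity)] at h1
    linarith
  refine ⟨P, by rw [hPc, hν, smul_smul, div_eq_mul_inv], hPy2, fun x hx hSδ κ hκδ => ?_⟩
  have hxr : ‖x - y‖ = r := by rw [← dist_eq_norm]; exact hx
  set S := inner ℝ e (x - y) with hS
  -- With Lδ = 1 the condition e · (x - y) ≥ δ r lowers the squared distance to y + L r e from (L
  -- r)² + r² to at most (L r)² - r², leaving room δ r/2 inside the large ball.
  have hxP0 : ‖x - (y + (L * r) • e)‖ ≤ (L - δ / 2) * r := by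
    refine abs_le_of_sq_le_sq' ?_ (mul_nonneg (by linarith) hr.le) |>.2
    have h1 : x - (y + (L * r) • e) = (x - y) - (L * r) • e := by abel
    rw [h1, norm_sub_sq_real, norm_smul, he, hxr, real_inner_smul_right, real_inner_comm, ← hS,
      mul_one, Real.norm_of_nonneg (by positivity)]
    have h2 : L * r * (δ * r) ≤ L * r * S := by gcongr
    have h3 : L * r * (δ * r) = r ^ 2 := by
      calc L * r * (δ * r) = L * δ * r ^ 2 := by ring
        _ = r ^ 2 := by rw [hLδ, one_mul]
    have h4 : ((L - δ / 2) * r) ^ 2 = (L * r) ^ 2 - L * r * (δ * r) + (δ / 2 * r) ^ 2 := by ring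
    rw [h4, h3]
    nlinarith [sq_nonneg (δ / 2 * r)]
  intro z hz
  refine closedBall_subset_closedBall' ?_
  have h1 : dist x z ≤ ‖x - (y + (L * r) • e)‖ + ‖P - (y + (L * r) • e)‖ + δ / 16 * r := by
    have h2 := dist_triangle x (y + (L * r) • e) P
    have h3 := dist_triangle x P z
    rw [dist_comm P z, mem_sphere.1 hz] at h3
    rw [dist_comm (y + (L * r) • e) P, dist_eq_norm x (y + _), dist_eq_norm P] at h2
    linarith
  have h2 : κ * r ≤ δ / 4 * r := by gcongr
  linarith

/-- Linear growth of all members of the sequence in the directions pointing away from a ball that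
touches the boundary of the hollow set. -/
theorem exists_linear_growth (H : IsRecedingSequence U μm μp c₀ r₀ o l v f) (hd : 0 < d)
    (hU : IsOpen U) (hc : 0 < c₀) (hr₀ : 0 < r₀) {y c e : Space d} {a : ℝ} (ha : 0 < a)
    (he : ‖e‖ = 1) (hye : y - c = a • e) (hBU : closedBall c (3 * a) ⊆ U)
    (hB : ball c a ⊆ hollow U v) (hyD : y ∉ hollow U v) :
    ∃ κ > 0, ∀ δ, 0 < δ → 4 * δ ≤ 1 → ∃ r₁ > 0, ∀ r, 0 < r → r < r₁ → ∀ n, ∀ x ∈ sphere y r,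
      δ * r ≤ inner ℝ e (x - y) → κ * (inner ℝ e (x - y) - δ / 2 * r) ≤ v n x := by
  have hd' : (0 : ℝ) < d := by exact_mod_cast hd
  have hy : ‖y - c‖ = a := by rw [hye, norm_smul, he, mul_one, Real.norm_of_nonneg ha.le]
  obtain ⟨α, hα, hslope⟩ := H.exists_slope hd hU hc hr₀ ha hy hBU hB hyD
  set lam := α / (2 * a) with hlam
  have hlam0 : 0 < lam := by positivity
  refine ⟨lam, hlam0, fun δ hδ hδ1 => ?_⟩
  set G := growthConst d μp with hG
  have hG0 : 0 ≤ G := growthConst_nonneg hd μp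
  -- The relative radius of the averaging ball: small enough that `G * (2 * κ)` stays below the
  -- growth λδ/2 to be proved, as `le_of_le_setAverage` requires.
  set κ := min (δ / 4) (lam * δ / (8 * (G + 1))) with hκ
  have hκ0 : 0 < κ := by positivity
  have hκδ : κ ≤ δ / 4 := min_le_left _ _
  have hκG : G * (2 * κ) < lam * (δ / 2) := by
    have h1 : κ * (8 * (G + 1)) ≤ lam * δ := (le_div_iff₀ (by positivity)).1 (min_le_right _ _)
    linarith [mul_pos hlam0 hδ]
  set L := 1 / δ with hL
  have hLδ : L * δ = 1 := one_div_mul_cancel hδ.ne'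
  have hL4 : 4 ≤ L := by rw [hL, le_div_iff₀ hδ]; linarith
  set cH := hopfConst d (L / (δ / 16)) with hcH
  have hcH0 : 0 < cH := hopfConst_pos hd (by rw [one_lt_div (by positivity)]; linarith)
  set C := (L / κ) ^ d * (4 * d * L / (a * cH)) with hC
  have hC0 : 0 < C := by positivity
  -- The constant `C` is the factor by which a relative defect 2η at x₁ can be magnified into an
  -- average defect at `x`. This choice of η makes the latter at most λδ r/4.
  set η := min (α / 2) (lam * δ / (4 * C)) with hη
  have hη0 : 0 < η := by positivity
  have hηα : η < α := (min_le_left _ _).trans_lt (by linarith)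
  have hηC : C * η ≤ lam * (δ / 4) := by
    have h1 : η * (4 * C) ≤ lam * δ := (le_div_iff₀ (by positivity)).1 (min_le_right _ _)
    linarith
  obtain ⟨R, hR, hle, hex⟩ := hslope η hη0 hηα
  refine ⟨min (R / (2 * L + 1)) (a / (2 * L + 1)), by positivity, fun r hr hrr n x hx hSδ => ?_⟩
  have hrR : (2 * L + 1) * r < R := by
    have := hrr.trans_le (min_le_left _ _)
    rw [lt_div_iff₀ (by positivity)] at this
    linarith
  have hra : (2 * L + 1) * r < a := by
    have := hrr.trans_le (min_le_right _ _)
    rw [lt_div_iff₀ (by positivity)] at this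
    linarith
  have hLr : 4 * r ≤ L * r := by gcongr
  obtain ⟨x₁, hx₁, hx₁a, hx₁w⟩ := hex (δ / 32 * r) (by positivity)
  rw [mem_closedBall, dist_eq_norm] at hx₁
  set t := ‖x₁ - c‖ with ht
  have ht0 : 0 < t := ha.trans_le hx₁a
  have hδr : δ * r ≤ r / 4 := by linarith [mul_le_mul_of_nonneg_right hδ1 hr.le]
  have hδr0 : 0 < δ * r := by positivity
  have hta : t - a ≤ δ / 32 * r := by
    have := norm_add_le (x₁ - y) (y - c)
    rw [sub_add_sub_cancel, hy] at this
    linarith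
  have hsh := shell_le ha hx₁a
  have hta0 : a < t := by
    refine lt_of_le_of_ne hx₁a fun h => ?_
    have h1 := hle x₁ (mem_closedBall.2 (by rw [dist_eq_norm]; linarith)) hx₁a
    rw [← ht, ← h, sub_self, mul_zero, zero_div] at hsh
    linarith [mul_nonpos_of_nonneg_of_nonpos hη0.le hsh]
  obtain ⟨P, hPc, hPy2, hPsub⟩ := exists_tangent_ball ha hr hδ hδ1 hL he hye (by linarith) hx₁a hx₁
  have hPR : closedBall P (L * r) ⊆ closedBall y R := closedBall_subset_closedBall' (by linarith)
  have hyc : dist y c = a := by rw [dist_eq_norm, hy]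
  have hPU : closedBall P (L * r) ⊆ U := (closedBall_subset_closedBall' (by
    have := dist_triangle P y c
    linarith)).trans hBU
  have hxr : ‖x - y‖ = r := by rw [← dist_eq_norm]; exact hx
  set S := inner ℝ e (x - y) with hS
  have hsub := hPsub x hx hSδ κ hκδ
  have hσρ : δ / 16 * r < L * r := by linarith
  obtain ⟨hA0, hA⟩ := H.setAverage_shell_sub_le hd hU (x₁ := x₁) (xh := x) (P := P) (k := α + η)
    (ρ := L * r) (σ := δ / 16 * r) (s := κ * r) ha (by positivity) (by positivity) hσρ
    (by positivity) hta0 (by rw [← ht]; linarith) hPc hPU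
    (fun z hz hza => hle z (hPR hz) hza) hsub
  rw [← ht, show L * r / (δ / 16 * r) = L / (δ / 16) by field_simp, ← hcH] at hA
  set A := ⨍ x in closedBall x (κ * r), ((α + η) * shell c a x - infSeq v x) with hAdef
  -- At x₁ the limit is within 2η of the shell in slope, and the Hopf bound there is proportional to
  -- the same distance t - a as the shell. The distance cancels, so it does not matter how close x₁
  -- is to the sphere.
  have hAC : A ≤ C * η * r := by
    have hta0' : 0 < t - a := sub_pos.2 hta0
    have h1 : (κ / L) ^ d ≤ (κ * r / (L * r - δ / 16 * r)) ^ d := by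
      have : κ / L = κ * r / (L * r) := by field_simp
      rw [this]
      gcongr
      linarith
    have h2 : (κ / L) ^ d * A * cH * ((t - a) / (L * r)) ≤ 2 * η * (2 * d * (t - a) / a) := by
      calc _ ≤ (κ * r / (L * r - δ / 16 * r)) ^ d * A * cH * ((t - a) / (L * r)) := by gcongr
        _ ≤ _ := hA
        _ ≤ 2 * η * shell c a x₁ := by linarith
        _ ≤ _ := by gcongr
    have h3 : (κ / L) ^ d * (L / κ) ^ d = 1 := by
      rw [← mul_pow, div_mul_div_comm, mul_comm κ, div_self (by positivity), one_pow]
    have h4 : A = (L / κ) ^ d * (L * r / (cH * (t - a))) *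
        ((κ / L) ^ d * A * cH * ((t - a) / (L * r))) := by
      calc A = ((κ / L) ^ d * (L / κ) ^ d) * A := by rw [h3, one_mul]
        _ = _ := by field_simp
    rw [h4]
    calc _ ≤ (L / κ) ^ d * (L * r / (cH * (t - a))) * (2 * η * (2 * d * (t - a) / a)) := by gcongr
      _ = C * η * r := by rw [hC]; field_simp; ring
  have hκr : κ * r ≤ r / 4 := by linarith [mul_le_mul_of_nonneg_right hκδ hr.le]
  have hxsU : closedBall x (3 * (κ * r)) ⊆ U := (closedBall_subset_closedBall' (by
    have h1 := dist_triangle x y c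
    rw [mem_sphere] at hx
    linarith)).trans hBU
  have hxs1 : closedBall x (κ * r) ⊆ closedBall x (3 * (κ * r)) :=
    closedBall_subset_closedBall (by linarith [mul_pos hκ0 hr])
  have hge : ∀ z ∈ closedBall x (κ * r), a + (S - κ * r) ≤ ‖z - c‖ ∧ ‖z - c‖ ≤ 2 * a := by
    intro z hz
    rw [mem_closedBall, dist_eq_norm] at hz
    have e1 : z - c = (z - x) + (x - y) + (y - c) := by abel
    constructor
    · have h1 := real_inner_le_norm e (z - c)
      have h2 := abs_le.1 (abs_real_inner_le_norm e (z - x))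
      have h3 : inner ℝ e (y - c) = a := by
        rw [hye, real_inner_smul_right, real_inner_self_eq_norm_sq, he]; ring
      rw [he, one_mul] at h1 h2
      rw [e1, inner_add_right, inner_add_right, h3, ← hS, ← e1] at h1
      linarith [h2.1]
    · rw [e1]
      have h1 := norm_add_le (z - x + (x - y)) (y - c)
      have h2 := norm_add_le (z - x) (x - y)
      linarith
  have hSκ : 0 < S - κ * r := by
    have : κ * r ≤ δ / 4 * r := by gcongr
    linarith
  have hne : closedBall x (κ * r) ⊆ {c}ᶜ := fun z hz h => by
    have h1 := (hge z hz).1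
    have h2 : z = c := h
    rw [h2, sub_self, norm_zero] at h1
    linarith
  have hshi : IntegrableOn (fun z => shell c a z) (closedBall x (κ * r)) :=
    ((continuousOn_shell c a).mono hne).integrableOn_closedBall
  have hwi := H.integrableOn (hxs1.trans hxsU)
  have hshell : (S - κ * r) / (2 * a) ≤ ⨍ z in closedBall x (κ * r), shell c a z := by
    rw [← setAverage_closedBall_const x (mul_pos hκ0 hr) ((S - κ * r) / (2 * a))]
    refine setAverage_closedBall_mono continuousOn_const.integrableOn_closedBall hshi
      fun z hz => ?_
    obtain ⟨h1, h2⟩ := hge z hz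
    exact (div_le_div_of_nonneg_right (by linarith) (by positivity)).trans
      (le_shell hd ha (by linarith) h2)
  have hAeq : A = (α + η) * (⨍ z in closedBall x (κ * r), shell c a z) -
      ⨍ z in closedBall x (κ * r), infSeq v z := by
    rw [hAdef, setAverage_closedBall_sub (hshi.const_mul _) hwi, setAverage_closedBall_const_mul]
  have hwavg : lam * (S - δ / 2 * r) ≤ ⨍ z in closedBall x (κ * r), infSeq v z := by
    have h1 : α * ((S - κ * r) / (2 * a)) ≤
        (α + η) * ⨍ z in closedBall x (κ * r), shell c a z := by
      gcongr
      linarith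
    have h2 : α * ((S - κ * r) / (2 * a)) = lam * (S - κ * r) := by rw [hlam]; ring
    have h3 : lam * (κ * r) ≤ lam * (δ / 4 * r) := by gcongr
    have h4 : C * η * r ≤ lam * (δ / 4) * r := by gcongr
    linarith
  -- The average of the infimum bounds that of every `v n` from below, so the radius and the slope
  -- obtained do not depend on `n`.
  refine (H.stable n).le_of_le_setAverage hd hU (mul_pos hκ0 hr) hxsU ?_ (hwavg.trans ?_)
  · have h1 : G * (2 * κ) * r < lam * (δ / 2) * r := by gcongr
    have h2 : lam * (δ * r - δ / 2 * r) ≤ lam * (S - δ / 2 * r) := by gcongr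
    linarith
  · exact setAverage_closedBall_mono hwi
      ((H.stable n).state.continuousOn.mono ((hxs1.trans hxsU).trans
        subset_closure)).integrableOn_closedBall
      fun z hz => H.infSeq_le n (subset_closure (hxsU (hxs1 hz)))

/-- A ball of the hollow set that stays inside the wet region of the obstacle cannot touch the
boundary of the hollow set. -/
theorem mem_hollow_of_touch (H : IsRecedingSequence U μm μp c₀ r₀ o l v f) (hd : 0 < d)
    (hU : IsOpen U) (hμm : 0 ≤ μm) (hc : 0 < c₀) (hr₀ : 0 < r₀) {y c : Space d} {a : ℝ}
    (ha : 0 < a) (hy : ‖y - c‖ = a) (hBo : closedBall c (3 * a) ⊆ wet U o ∩ U)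
    (hB : ball c a ⊆ hollow U v) : y ∈ hollow U v := by
  by_contra hyD
  have hd' : (0 : ℝ) < d := by exact_mod_cast hd
  have hBU : closedBall c (3 * a) ⊆ U := fun x hx => (hBo hx).2
  set e := a⁻¹ • (y - c) with he'
  have he : ‖e‖ = 1 := by
    rw [he', norm_smul, hy, norm_inv, Real.norm_of_nonneg ha.le, inv_mul_cancel₀ ha.ne']
  have hye : y - c = a • e := by rw [he', smul_smul, mul_inv_cancel₀ ha.ne', one_smul]
  obtain ⟨κ, hκ, hgrow⟩ := H.exists_linear_growth hd hU hc hr₀ ha he hye hBU hB hyD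
  set K : ℝ := 8 + 2 * d with hK
  have hcH := hopfConst_pos hd (show (1 : ℝ) < 2 by norm_num)
  -- Chosen so that with 4δ = exp(-Y) the slope produced by the hinge is exactly 1, which suffices
  -- since 1 - μ₋ ≤ 1.
  set Y := 9 * K + 2 * K / (κ * hopfConst d 2) with hY
  set δ := Real.exp (-Y) / 4 with hδ
  have hδ0 : 0 < δ := by positivity
  have h4δ : 4 * δ = Real.exp (-Y) := by rw [hδ]; ring
  have hδ1 : 4 * δ ≤ 1 := by
    rw [h4δ, Real.exp_le_one_iff, neg_nonpos]; positivity
  have hlog : -Real.log (4 * δ) - 9 * K = 2 * K / (κ * hopfConst d 2) := by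
    rw [h4δ, Real.log_exp, hY]; ring
  obtain ⟨r₁, hr₁, hgr⟩ := hgrow δ hδ0 hδ1
  -- The bound r ≤ aδ beats the curvature of `ball c a`: points of the small sphere with e · (x - y)
  -- < -δ r lie inside that ball.
  set r := min (min (r₁ / 2) (a * δ)) a with hr
  have hr0 : 0 < r := by positivity
  have hrr₁ : r < r₁ := ((min_le_left _ _).trans (min_le_left _ _)).trans_lt (by linarith)
  have hraδ : r ≤ a * δ := (min_le_left _ _).trans (min_le_right _ _)
  have hra : r ≤ a := min_le_right _ _
  have hyr : closedBall y r ⊆ closedBall c (3 * a) := closedBall_subset_closedBall' (by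
    rw [dist_eq_norm, hy]; linarith)
  have hnn : ∀ n, ∀ x ∈ closedBall y r, 0 ≤ v n x := fun n x hx =>
    H.nonneg n (subset_closure (hBU (hyr hx)))
  have hlow : ∀ n, ∀ x ∈ sphere y r, κ * (inner ℝ e (x - y) - δ * r) ≤ v n x := by
    intro n x hx
    rcases le_total (δ * r) (inner ℝ e (x - y)) with h | h
    · refine le_trans ?_ (hgr r hr0 hrr₁ n x hx h)
      have : 0 < δ * r := by positivity
      gcongr
      linarith
    · exact (mul_nonpos_of_nonneg_of_nonpos hκ.le (by linarith)).trans
        (hnn n x (sphere_subset_closedBall hx))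
  have hposS : ∀ n, ∀ x ∈ sphere y r, δ * r ≤ inner ℝ e (x - y) → 0 < v n x := by
    intro n x hx h
    refine lt_of_lt_of_le (mul_pos hκ ?_) (hgr r hr0 hrr₁ n x hx h)
    have : 0 < δ * r := by positivity
    linarith
  refine hyD (H.mem_hollow_of_pos hd ha hy (fun x hx => (hB hx).2.1.self_of_nhds) hr0
    (ball_subset_closedBall.trans (hyr.trans hBU)) fun n => ?_)
  obtain ⟨h, Hh, heq⟩ := exists_polyApprox hd hr0 (((H.stable n).state.continuousOn.mono
    ((hyr.trans hBU).trans subset_closure)).mono sphere_subset_closedBall)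
  have h0 : ∀ x ∈ sphere y r, 0 ≤ h x := fun x hx =>
    (hnn n x (sphere_subset_closedBall hx)).trans_eq (heq hx).symm
  have hpos := Hh.pos hd hr0 h0 (by
    have hx : y + r • e ∈ sphere y r := by
      rw [mem_sphere, dist_eq_norm, add_sub_cancel_left, norm_smul, he, mul_one,
        Real.norm_of_nonneg hr0.le]
    refine ⟨y + r • e, hx, ?_⟩
    rw [heq hx]
    refine hposS n _ hx ?_
    rw [add_sub_cancel_left, real_inner_smul_right, real_inner_self_eq_norm_sq, he]
    nlinarith)
  have hagree := (H.maximal n).le_of_glue_harmonic hd hU (H.obstacle.isSupersolution hd) hr0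
    (hyr.trans hBU) (fun x hx => (hBo (hyr (ball_subset_closedBall hx))).1.2) Hh heq hpos
    -- Zeros of `v n` on the small sphere lie near the equator: above it linear growth gives
    -- positivity, and below it the points belong to the hollow set.
    (fun x hx hvx p hp => by
      have hxr : ‖x - y‖ = r := by rw [← dist_eq_norm]; exact hx
      have hS1 : inner ℝ e (x - y) ≤ δ * r := by
        by_contra! h'
        exact absurd hvx (hposS n x hx h'.le).ne'
      have hS2 : -(δ * r) ≤ inner ℝ e (x - y) := by
        by_contra! h'
        refine absurd hvx ((hB (?_ : x ∈ ball c a)).2.2 n).ne'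
        rw [mem_ball, dist_eq_norm]
        refine lt_of_pow_lt_pow_left₀ 2 ha.le ?_
        rw [show x - c = (x - y) + (y - c) by abel, norm_add_sq_real, hxr, hy, hye,
          real_inner_smul_right, real_inner_comm]
        have h1 : a * inner ℝ e (x - y) < a * -(δ * r) := by gcongr
        have h2 : r * r ≤ a * δ * r := by gcongr
        have h3 : 0 < a * δ * r := by positivity
        nlinarith
      have hxU : x ∈ U := hBU (hyr (sphere_subset_closedBall hx))
      have h1 := Hh.le_norm_superDiff hd hr0 hδ0 hδ1 hκ he h0
        (fun z hz => (hlow n z hz).trans_eq (heq hz).symm) (by rw [hlog]; positivity) hU hx hxU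
        (abs_le.2 ⟨hS2, hS1⟩) (by
          filter_upwards [hU.mem_nhds hxU] with z hz
          by_cases hzB : z ∈ ball y r
          · rw [glue_of_mem hzB]; exact (hpos z hzB).le
          · rw [glue_of_notMem hzB]; exact H.nonneg n (subset_closure hz)) (fun z hz => by
          by_cases hzB : z ∈ ball y r
          · rw [glue_of_mem hzB]
          · rw [glue_of_notMem hzB]
            refine (heq ?_).le
            exact le_antisymm (mem_closedBall.1 hz) (not_lt.1 hzB)) hp
      rw [hlog] at h1
      have h2 : ∀ K A : ℝ, 0 < K → 0 < A → κ / (2 * K) * (2 * K / (κ * A)) * A = 1 := by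
        intro K A hK hA
        field_simp
      rw [h2 K _ (by positivity) hcH] at h1
      nlinarith)
  exact fun x hx => (hpos x hx).trans_eq (hagree x hx)

/-- The hollow set is relatively closed in the wet region of the obstacle. -/
theorem mem_hollow_of_mem_closure (H : IsRecedingSequence U μm μp c₀ r₀ o l v f) (hd : 0 < d)
    (hU : IsOpen U) (hμm : 0 ≤ μm) (hc : 0 < c₀) (hr₀ : 0 < r₀) {y : Space d}
    (hy : y ∈ closure (hollow U v)) (hyo : y ∈ wet U o ∩ U) : y ∈ hollow U v := by
  by_contra hyD
  have hop := H.isOpen_hollow hU hc hr₀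
  obtain ⟨ε, hε, hεs⟩ := nhds_basis_closedBall.mem_iff.1
    ((H.obstacle.state.isOpen_wet_inter hU).mem_nhds hyo)
  obtain ⟨c, hcD, hyc⟩ := Metric.mem_closure_iff.1 hy (ε / 4) (by positivity)
  -- The largest hollow ball around a nearby hollow point `c` touches the complement at `z`, still
  -- well inside the wet region of `o`. The contradiction arises at `z`, not at `y`.
  obtain ⟨z, hzD, hz⟩ := hop.isClosed_compl.exists_infDist_eq_dist ⟨y, hyD⟩ c
  have hza : dist c z ≤ dist c y := hz ▸ infDist_le_dist_of_mem hyD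
  have ha : 0 < dist c z := dist_pos.2 fun h => hzD (h ▸ hcD)
  refine hzD (H.mem_hollow_of_touch hd hU hμm hc hr₀ (c := c) (a := dist c z) ha ?_ ?_ ?_)
  · rw [dist_comm, dist_eq_norm]
  · refine (closedBall_subset_closedBall' ?_).trans hεs
    rw [dist_comm c y] at hza ⊢
    rw [dist_comm] at hyc
    rw [dist_comm c y] at hyc
    linarith
  · intro x hx
    by_contra hxD
    have h1 := infDist_le_dist_of_mem (x := c) (s := (hollow U v)ᶜ) hxD
    rw [hz, dist_comm c x] at h1
    exact absurd hx (not_lt.2 h1)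

end IsRecedingSequence

/-! ### Emptiness of the hollow set and drying of the sequence. -/

namespace IsRecedingSequence

variable {U : Set (Space d)} {μm μp c₀ r₀ : ℝ} {o l : Space d → ℝ} {v : ℕ → Space d → ℝ}
  {f : ℕ → ℝ}

/-- The state `l` stays below the limit and is positive on the boundary of `U`, which keeps the
limit positive near that boundary. -/
lemma notMem_frontier_of_mem_closure_hollow (H : IsRecedingSequence U μm μp c₀ r₀ o l v f)
    {x : Space d} (hx : x ∈ closure (hollow U v)) : x ∉ frontier U := by
  intro hxf
  have h1 := (H.lower.continuousOn x hxf.1).eventually (lt_mem_nhds (H.lower_pos x hxf))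
  rw [eventually_nhdsWithin_iff] at h1
  obtain ⟨y, hy1, hy2⟩ := (mem_closure_iff_frequently.1 hx).and_eventually h1 |>.exists
  have hyU := subset_closure (s := U) hy1.1
  have h2 : infSeq v y = 0 := hy1.2.1.self_of_nhds
  linarith [hy2 hyU, H.lower_le_infSeq hyU]

/-- By relative closedness, `o` vanishes at the boundary points of the hollow set, so replacing `v
n` by `o` on it is continuous. The result is a subsolution: at such points it lies above `v n`,
which has a free boundary there. Maximality gives o ≤ v n on the hollow set for every n, so `o`
vanishes there together with the limit, although v n ≤ o is positive. -/
theorem hollow_eq_empty (H : IsRecedingSequence U μm μp c₀ r₀ o l v f) (hd : 0 < d)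
    (hU : IsOpen U) (hμm : 0 ≤ μm) (hc : 0 < c₀) (hr₀ : 0 < r₀) : hollow U v = ∅ := by
  rw [eq_empty_iff_forall_notMem]
  intro x₀ hx₀
  have hop := H.isOpen_hollow hU hc hr₀
  set D := hollow U v with hD
  have hvo : ∀ n, ∀ x ∈ closure U, v n x ≤ o x := fun n => (H.maximal n).1.2.2
  have hedge : ∀ x ∈ closure U, x ∉ D → x ∈ closure D → x ∈ U ∧ o x = 0 := by
    intro x hx hxD hxc
    have hxU : x ∈ U := by
      by_contra h
      exact H.notMem_frontier_of_mem_closure_hollow hxc (hU.frontier_eq ▸ ⟨hx, h⟩)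
    refine ⟨hxU, ?_⟩
    by_contra h
    exact hxD (H.mem_hollow_of_mem_closure hd hU hμm hc hr₀ hxc
      ⟨⟨hx, lt_of_le_of_ne (H.obstacle.state.nonneg x hx) (Ne.symm h)⟩, hxU⟩)
  have key : ∀ n, SubsolutionBelow U μm (f n) o (glue D o (v n)) := by
    intro n
    set v' := glue D o (v n) with hv'
    have hvn := (H.maximal n).1.1
    have hle : ∀ x ∈ closure U, v n x ≤ v' x := fun x hx => by
      by_cases h : x ∈ D
      · rw [hv', glue_of_mem h]; exact hvo n x hx
      · rw [hv', glue_of_notMem h]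
    have hle' : ∀ x ∈ closure U, v' x ≤ o x := fun x hx => by
      by_cases h : x ∈ D
      · rw [hv', glue_of_mem h]
      · rw [hv', glue_of_notMem h]; exact hvo n x hx
    have hout : ∀ x, x ∉ closure D → v' =ᶠ[𝓝 x] v n := fun x hx => by
      filter_upwards [isClosed_closure.isOpen_compl.mem_nhds hx] with y hy
      exact glue_of_notMem fun h => hy (subset_closure h)
    have hst : IsState U v' := by
      refine ⟨fun x hx => ?_, fun x hx => (H.nonneg n hx).trans (hle x hx)⟩
      by_cases hxD : x ∈ D
      · have he := glue_eventuallyEq (w := o) (v := v n) hop hxD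
        exact (H.obstacle.state.continuousOn x hx).congr_of_eventuallyEq
          (he.filter_mono nhdsWithin_le_nhds) he.eq_of_nhds
      by_cases hxc : x ∈ closure D
      · obtain ⟨hxU, hox⟩ := hedge x hx hxD hxc
        have hvx : v n x = 0 := le_antisymm ((hvo n x hx).trans hox.le) (H.nonneg n hx)
        have h1 : Tendsto (v n) (𝓝[closure U] x) (𝓝 0) := hvx ▸ hvn.state.continuousOn x hx
        have h2 : Tendsto o (𝓝[closure U] x) (𝓝 0) := hox ▸ H.obstacle.state.continuousOn x hx
        rw [ContinuousWithinAt, show v' x = 0 by rw [hv', glue_of_notMem hxD, hvx]]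
        exact tendsto_of_tendsto_of_tendsto_of_le_of_le' h1 h2
          (eventually_nhdsWithin_of_forall hle) (eventually_nhdsWithin_of_forall hle')
      · have he := hout x hxc
        exact (hvn.state.continuousOn x hx).congr_of_eventuallyEq
          (he.filter_mono nhdsWithin_le_nhds) he.eq_of_nhds
    refine ⟨IsSubsolution.of_local hd hst (fun x hx hpos => ?_) fun x hx p hp => ?_,
      fun x hx => ?_, hle'⟩
    · by_cases hxD : x ∈ D
      · have he := glue_eventuallyEq (w := o) (v := v n) hop hxD
        exact (((H.obstacle.isSubsolution hd).subMeanAt_of_mem hU hx).congr he.symm)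
      by_cases hxc : x ∈ closure D
      · have := hle' x (subset_closure hx)
        rw [(hedge x (subset_closure hx) hxD hxc).2] at this
        linarith
      · exact (hvn.subMeanAt_of_mem hU hx).congr (hout x hxc).symm
    · have hxU := hx.2
      by_cases hxD : x ∈ D
      · have he := glue_eventuallyEq (w := o) (v := v n) hop hxD
        exact H.obstacle.slope_ge x ((mem_freeBoundary_congr hU he).1 hx) p
          (superDiff_subset_of_le hU hxU (he.mono fun y hy => hy.ge) hp)
      by_cases hxc : x ∈ closure D
      · obtain ⟨-, hox⟩ := hedge x (subset_closure hxU) hxD hxc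
        refine hvn.slope_ge x ((hvn.state.mem_freeBoundary_iff hU).2 ⟨hxU, ?_, ?_⟩) p
          (superDiff_subset_of_le hU hxU ((eventually_mem_closure hU hxU).mono hle) hp)
        · exact le_antisymm ((hvo n x (subset_closure hxU)).trans hox.le)
            (H.nonneg n (subset_closure hxU))
        · exact (mem_closure_iff_frequently.1 hxc).mono fun y hy => hy.2.2 n
      · have he := hout x hxc
        exact hvn.slope_ge x ((mem_freeBoundary_congr hU he).1 hx) p
          (superDiff_subset_of_le hU hxU (he.mono fun y hy => hy.ge) hp)
    · rw [hv', glue_of_notMem fun h => H.notMem_frontier_of_mem_closure_hollow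
        (subset_closure h) hx]
      exact (H.maximal n).1.2.1 x hx
  have hxU : x₀ ∈ closure U := subset_closure hx₀.1
  have h1 : o x₀ ≤ infSeq v x₀ := le_infSeq fun n => by
    have := (H.maximal n).2 _ (key n) x₀ hxU
    rwa [glue_of_mem hx₀] at this
  have h2 : infSeq v x₀ = 0 := hx₀.2.1.self_of_nhds
  linarith [hx₀.2.2 0, hvo 0 x₀ hxU]

/-- Where the limit vanishes, the sequence vanishes eventually. -/
theorem eventually_eq_zero_of_notMem_closure (H : IsRecedingSequence U μm μp c₀ r₀ o l v f)
    (hd : 0 < d) (hU : IsOpen U) (hμm : 0 ≤ μm) (hc : 0 < c₀) (hr₀ : 0 < r₀) {x : Space d}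
    (hx : x ∈ U) (hxw : x ∉ closure (wet U (infSeq v))) :
    ∀ᶠ z in atTop ×ˢ 𝓝 x, v z.1 z.2 = 0 := by
  rw [mem_closure_wet_iff hU hx, not_frequently] at hxw
  have hw : ∀ᶠ y in 𝓝 x, infSeq v y = 0 := by
    filter_upwards [hxw, eventually_mem_closure hU hx] with y hy hyU
    exact le_antisymm (not_lt.1 hy) (H.infSeq_nonneg hyU)
  obtain ⟨ε, hε, hεs⟩ := Metric.mem_nhds_iff.1 (inter_mem (hU.mem_nhds hx) hw)
  set r := min (ε / 3) r₀ with hr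
  have hr0 : 0 < r := by positivity
  have hB : closedBall x (2 * r) ⊆ ball x ε := closedBall_subset_ball (by
    linarith [min_le_left (ε / 3) r₀])
  refine eventually_prod_of_ball (P := fun n y => v n y = 0) hr0 ?_
  -- Positivity at `x` for infinitely many indices means positivity for all, by monotonicity, and
  -- would make `x` hollow.
  have hnp : ∀ᶠ n in atTop, ¬ 0 < v n x := by
    by_contra h
    rw [not_eventually] at h
    simp only [not_not] at h
    refine (H.hollow_eq_empty hd hU hμm hc hr₀).subset
      (show x ∈ hollow U v from ⟨hx, hw, fun n => ?_⟩)
    obtain ⟨m, hm, hnm⟩ := (h.and_eventually (eventually_ge_atTop n)).exists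
    exact hm.trans_le (H.antitone n m hnm x (subset_closure hx))
  filter_upwards [H.eventually_pos_or_eq_zero hU hc hr0 (min_le_right _ _)
    (fun y hy => (hεs (hB hy)).1) (fun y hy => by
      have : infSeq v y = 0 := (hεs (hB hy)).2
      rw [this]; positivity), hnp] with n hn hn'
  exact hn.resolve_left fun h => hn' (h x (mem_ball_self hr0))

/-- If the superdifferential of the limit is too small, then the sequence vanishes eventually. -/
theorem eventually_eq_zero_of_superDiff (H : IsRecedingSequence U μm μp c₀ r₀ o l v f)
    (hd : 0 < d) (hU : IsOpen U) (hμm : 0 ≤ μm) (hc : 0 < c₀) (hr₀ : 0 < r₀) {x₀ p : Space d}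
    (hx₀ : x₀ ∈ U) (hp : p ∈ superDiff U (infSeq v) x₀) (hpq : ‖p‖ ^ 2 < 1 - μm) :
    ∀ᶠ z in atTop ×ˢ 𝓝 x₀, v z.1 z.2 = 0 := by
  by_cases hcl : x₀ ∈ closure (wet U (infSeq v))
  swap
  · exact H.eventually_eq_zero_of_notMem_closure hd hU hμm hc hr₀ hx₀ hcl
  obtain ⟨ρ₀, hρ₀, hρU⟩ := nhds_basis_closedBall.mem_iff.1 (hU.mem_nhds hx₀)
  have hw0 : infSeq v x₀ = 0 := by
    have h1 := (hp 1 one_pos).self_of_nhdsWithin hcl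
    rw [sub_self, inner_zero_right, norm_zero, mul_zero, add_zero] at h1
    exact le_antisymm h1 (H.infSeq_nonneg (subset_closure hx₀))
  rcases eq_or_ne p 0 with rfl | hp0
  -- For p = 0 the limit is o(|x - x₀|), so non-degeneracy leaves no free boundary of late members
  -- near x₀. As the limit is wet nearby, all members are positive there, and Harnack spreads the
  -- zero at x₀ to a whole ball: a contradiction.
  · exfalso
    obtain ⟨ε, hε, hεs⟩ := nhds_basis_closedBall.mem_iff.1
      (eventually_nhdsWithin_iff.1 (hp (c₀ / 8) (by positivity)))
    set r := min (min (ε / 2) (ρ₀ / 2)) r₀ with hr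
    have hr0 : 0 < r := by positivity
    have hr1 : r ≤ ε / 2 := (min_le_left _ _).trans (min_le_left _ _)
    have hr2 : r ≤ ρ₀ / 2 := (min_le_left _ _).trans (min_le_right _ _)
    have hrε : 2 * r ≤ ε := by linarith
    have hrρ : 2 * r ≤ ρ₀ := by linarith
    have hrU : closedBall x₀ (2 * r) ⊆ U := (closedBall_subset_closedBall hrρ).trans hρU
    have hsmall : ∀ y ∈ closedBall x₀ (2 * r), infSeq v y < c₀ / 2 * r := by
      intro y hy
      by_cases hyc : y ∈ closure (wet U (infSeq v))
      · have h1 : infSeq v y ≤ inner ℝ 0 (y - x₀) + c₀ / 8 * ‖y - x₀‖ :=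
          hεs (closedBall_subset_closedBall hrε hy) hyc
        rw [inner_zero_left, zero_add] at h1
        rw [mem_closedBall, dist_eq_norm] at hy
        calc infSeq v y ≤ c₀ / 8 * ‖y - x₀‖ := h1
          _ ≤ c₀ / 8 * (2 * r) := by gcongr
          _ < c₀ / 2 * r := by nlinarith
      · have h1 : ¬ 0 < infSeq v y := fun h =>
          hyc (subset_closure ⟨subset_closure (hrU hy), h⟩)
        exact (not_lt.1 h1).trans_lt (by positivity)
    have hnear : ∃ᶠ y in 𝓝 x₀, 0 < infSeq v y := (mem_closure_wet_iff hU hx₀).1 hcl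
    have hev := H.eventually_pos_or_eq_zero hU hc hr0 (min_le_right _ _) hrU hsmall
    have hpos : ∀ n, ∀ y ∈ ball x₀ r, 0 < v n y := by
      intro n y hy
      have hyU := subset_closure (hrU (closedBall_subset_closedBall (by linarith)
        (ball_subset_closedBall hy)))
      obtain ⟨m, hm, hnm⟩ := (hev.and (eventually_ge_atTop n)).exists
      refine lt_of_lt_of_le ?_ (H.antitone n m hnm y hyU)
      rcases hm with h | h
      · exact h y hy
      · obtain ⟨q, hq, hqB, hqU⟩ := (hnear.and_eventually
          ((isOpen_ball.eventually_mem (mem_ball_self hr0)).and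
            (eventually_mem_closure hU hx₀))).exists
        linarith [H.infSeq_le m hqU, h q hqB]
    have hz := H.infSeq_eq_zero_of_pos hd (z := x₀) (r := r / 4) (by positivity)
      ((closedBall_subset_closedBall (by linarith)).trans hrU)
      (fun n y hy => hpos n y (closedBall_subset_ball (by linarith) hy)) hw0
    obtain ⟨q, hq, hqB⟩ := (hnear.and_eventually
      (closedBall_mem_nhds x₀ (show 0 < r / 4 by positivity))).exists
    exact hq.ne' (hz q hqB)
  have hwnn : ∀ y ∈ closedBall x₀ ρ₀, 0 ≤ infSeq v y := fun y hy =>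
    H.infSeq_nonneg (subset_closure (hρU hy))
  obtain ⟨r, hr, hr2, φ, hφc, hφx₀, hsph, hlap⟩ :=
    exists_barrier_of_superDiff hd hρ₀ hwnn hp hp0 (Real.lt_sqrt_of_sq_lt hpq)
  have hrU : closedBall x₀ r ⊆ U := (closedBall_subset_closedBall hr2.le).trans hρU
  have hev : ∀ᶠ n in atTop, ∀ y ∈ sphere x₀ r, y ∈ closure (wet U (v n)) → v n y < φ y := by
    refine eventually_forall_of_compact
      (P := fun n y => y ∈ closure (wet U (v n)) → v n y < φ y) (isCompact_sphere x₀ r)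
      fun y hy => ?_
    have hyU : y ∈ U := hrU (sphere_subset_closedBall hy)
    by_cases hyc : y ∈ closure (wet U (infSeq v))
    · obtain ⟨c, hc1, hc2⟩ := exists_between (hsph y hy hyc)
      filter_upwards [H.eventually_lt hU hyU hc1,
        (hφc.continuousAt.eventually (lt_mem_nhds hc2)).prod_inr atTop] with z h1 h2 _
      exact h1.trans h2
    · filter_upwards [eventually_prod_nhds (P := fun n y => v n y = 0)
        (H.eventually_eq_zero_of_notMem_closure hd hU hμm hc hr₀ hyU hyc),
        (hU.eventually_mem hyU).prod_inr atTop] with z h1 h2 h3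
      rw [mem_closure_wet_iff hU h2] at h3
      obtain ⟨y', hy1, hy2⟩ := (h3.and_eventually h1).exists
      exact absurd hy2 hy1.ne'
  obtain ⟨ρ, hρ, hρs⟩ := Metric.eventually_nhds_iff_ball.1
    ((hφc.continuousAt.eventually (gt_mem_nhds hφx₀)).and (ball_mem_nhds x₀ hr))
  refine eventually_prod_of_ball (P := fun n y => v n y = 0) hρ ?_
  filter_upwards [hev] with n hn y hy
  have hvn := (H.maximal n).1.1
  obtain ⟨hφy, hyr⟩ := hρs y hy
  by_contra hvy
  have hyU := hrU (ball_subset_closedBall hyr)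
  have hvy0 : 0 < v n y := lt_of_le_of_ne (H.nonneg n (subset_closure hyU)) (Ne.symm hvy)
  set C := closedBall x₀ r ∩ closure (wet U (v n)) with hC
  have hCc : IsCompact C := (isCompact_closedBall x₀ r).inter_right isClosed_closure
  have hcont : ContinuousOn (fun x => v n x - φ x) C :=
    (hvn.state.continuousOn.mono (inter_subset_left.trans (hrU.trans subset_closure))).sub
      hφc.continuousOn
  -- A wet point where φ < 0 makes v n - φ positive somewhere, and on the small sphere it is
  -- negative. The maximum over the closed wet part is therefore attained inside, where both
  -- alternatives fail: at a dry point the gradient of φ is too small, at a wet one φ is strictly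
  -- superharmonic.
  have hyC : y ∈ C := ⟨ball_subset_closedBall hyr, subset_closure ⟨subset_closure hyU, hvy0⟩⟩
  obtain ⟨z, hzC, hmax⟩ := hCc.exists_isMaxOn ⟨y, hyC⟩ hcont
  have hz0 : 0 < v n z - φ z := lt_of_lt_of_le (show 0 < v n y - φ y by linarith) (hmax hyC)
  have hzr : z ∈ ball x₀ r := by
    by_contra h
    have := hn z (le_antisymm (mem_closedBall.1 hzC.1) (not_lt.1 h)) hzC.2
    linarith
  have hzU : z ∈ U := hrU hzC.1
  obtain ⟨g, l', hlapz, hl, hg⟩ := hlap z hzC.1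
  rcases (H.nonneg n (subset_closure hzU)).eq_or_lt with hz | hz
  · have hfb : z ∈ freeBoundary U (v n) := (hvn.state.mem_freeBoundary_iff hU).2
      ⟨hzU, hz.symm, (mem_closure_wet_iff hU hzU).1 hzC.2⟩
    have h1 := hvn.slope_ge z hfb g (mem_superDiff_of_touch (φ := fun x => φ x - φ z)
      (hlapz.hasFDerivAt.sub_const _) (sub_self _) (by
        filter_upwards [self_mem_nhdsWithin, nhdsWithin_le_nhds (isOpen_ball.mem_nhds hzr)]
          with x hx hxr
        have h2 : v n x - φ x ≤ v n z - φ z := hmax ⟨ball_subset_closedBall hxr, hx⟩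
        linarith))
    have h2 : ‖g‖ ^ 2 < √(1 - μm) ^ 2 := by gcongr
    rw [Real.sq_sqrt (by nlinarith [sq_nonneg ‖p‖])] at h2
    linarith
  · obtain ⟨ρ', hρ', havg⟩ := (hlapz.const_mul (-1)).exists_lt_setAverage (by linarith)
    have hnear : ∀ᶠ x in 𝓝 z, x ∈ ball x₀ r ∧ 0 < v n x :=
      (isOpen_ball.eventually_mem hzr).and
        ((hvn.state.continuousAt hU hzU).eventually (lt_mem_nhds hz))
    obtain ⟨s, hs⟩ := ((((hvn.subMeanAt hU hzU hz).and (eventually_closedBall_subset hnear)).and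
      (Ioo_mem_nhdsGT hρ'))).exists
    obtain ⟨⟨hs1, hs2⟩, hs3⟩ := hs
    have h1 := havg z (mem_ball_self hρ') s hs3.1 hs3.2
    have hsU : closedBall z s ⊆ U := fun x hx => hrU (ball_subset_closedBall (hs2 hx).1)
    have hi1 : IntegrableOn (v n) (closedBall z s) :=
      (hvn.state.continuousOn.mono (hsU.trans subset_closure)).integrableOn_closedBall
    have hi2 : IntegrableOn (fun x => -1 * φ x) (closedBall z s) :=
      (continuous_const.mul hφc).continuousOn.integrableOn_closedBall
    have h2 : ⨍ x in closedBall z s, (v n x + -1 * φ x) ≤ v n z - φ z := by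
      rw [← setAverage_closedBall_const z hs3.1 (v n z - φ z)]
      refine setAverage_closedBall_mono (hi1.add hi2)
        continuousOn_const.integrableOn_closedBall fun x hx => ?_
      have hxU := subset_closure (hsU hx)
      have h3 : v n x - φ x ≤ v n z - φ z := hmax ⟨ball_subset_closedBall (hs2 hx).1,
        subset_closure ⟨hxU, (hs2 hx).2⟩⟩
      linarith
    rw [setAverage_closedBall_add hi1 hi2] at h2
    linarith

end IsRecedingSequence

/-! ### The slope condition for the upper envelope -/

lemma eventually_Icc_zero {T : ℝ} {x₀ : Space d} {P : ℝ → Space d → Prop}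
    (h0 : ∀ᶠ y in 𝓝 x₀, P 0 y) (hr : ∀ᶠ z in 𝓝[Ioc 0 T] (0 : ℝ) ×ˢ 𝓝 x₀, P z.1 z.2) :
    ∀ᶠ z in 𝓝[Icc 0 T] (0 : ℝ) ×ˢ 𝓝 x₀, P z.1 z.2 := by
  have h1 : 𝓝[Icc 0 T] (0 : ℝ) ≤ pure 0 ⊔ 𝓝[Ioc 0 T] (0 : ℝ) := by
    rw [← nhdsWithin_singleton, ← nhdsWithin_union]
    refine nhdsWithin_mono _ fun s hs => ?_
    rcases hs.1.eq_or_lt with h | h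
    · exact Or.inl h.symm
    · exact Or.inr ⟨h, hs.2⟩
  refine Eventually.filter_mono (prod_mono_left _ h1) ?_
  rw [Filter.sup_prod]
  refine eventually_sup.2 ⟨?_, hr⟩
  exact eventually_prod_iff.2 ⟨fun s => s = 0, eventually_pure.2 rfl, _, h0,
    fun {s} hs {y} hy => by rw [show s = 0 from hs]; exact hy⟩

/-- Behaviour of an obstacle solution to the left of a time at which it is dry near a point. -/
theorem IsObstacleSolution.eventually_eq_zero_left (hd : 0 < d) {U : Set (Space d)}
    (hU : IsOpen U) {μm μp T M : ℝ} (hμm : 0 ≤ μm) {Z : Set ℝ} {F : ℝ → ℝ} (hF : IsForcing T Z F)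
    {u : ℝ → Space d → ℝ} (hu : IsObstacleSolution U μm μp T Z F u) (hM : BoundedBy U T M u)
    (hst : ∀ t ∈ Icc 0 T, IsStable U μm μp (u t)) (hnd : UniformlyNondegenerate U T u)
    {s₀ t₀ : ℝ} (hs₀ : 0 ≤ s₀) (hst₀ : s₀ < t₀) (ht₀ : t₀ ≤ T) (hdis : Disjoint (Ioo s₀ t₀) Z)
    {x₀ : Space d} (hx₀ : x₀ ∈ U) (h0 : ∀ᶠ y in 𝓝 x₀, u t₀ y = 0) {p : Space d}
    (hp : p ∈ superDiff U (upperEnv U T u t₀) x₀) (hpq : ‖p‖ ^ 2 < 1 - μm) :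
    ∀ᶠ z in 𝓝[Ioc s₀ t₀] t₀ ×ˢ 𝓝 x₀, u z.1 z.2 = 0 := by
  have ht₀' : t₀ ∈ Icc 0 T := ⟨hs₀.trans hst₀.le, ht₀⟩
  have hdis' : ∀ s t, s₀ ≤ s → t ≤ t₀ → Disjoint (Ioo s t) Z := fun s t hs ht =>
    hdis.mono_left (Ioo_subset_Ioo hs ht)
  have h1 := h0.and (eventually_mem_closure hU hx₀)
  obtain ⟨ρ, hρ, hρs⟩ := Metric.eventually_nhds_iff_ball.1 h1
  rcases hF.monotone_or_antitone s₀ t₀ hs₀ hst₀ ht₀ hdis with hm | hm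
  -- When F increases, earlier states lie below u(t₀), which is dry near x₀.
  · refine eventually_prod_of_ball (P := fun s y => u s y = 0) hρ ?_
    filter_upwards [self_mem_nhdsWithin] with s hs y hy
    obtain ⟨hy0, hyU⟩ := hρs y hy
    rcases hs.2.eq_or_lt with rfl | hlt
    · exact hy0
    have hs0 := hs₀.trans hs.1.le
    have h2 := (hu.increasing s t₀ hs0 hlt ht₀ (hdis' s t₀ hs.1.le le_rfl)
      (hm.mono (Icc_subset_Icc_left hs.1.le))).1.2.2 y hyU
    exact le_antisymm (h2.trans hy0.le) (hM s ⟨hs0, hlt.le.trans ht₀⟩ y hyU).1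
  · have hle : ∀ s t, s₀ ≤ s → s ≤ t → t ≤ t₀ → ∀ x ∈ closure U, u t x ≤ u s x := by
      intro s t hs hst' ht x hx
      rcases hst'.eq_or_lt with rfl | hlt
      · exact le_rfl
      · exact (hu.decreasing s t (hs₀.trans hs) hlt (ht.trans ht₀) (hdis' s t hs ht)
          (hm.mono (Icc_subset_Icc hs ht))).1.2.2 x hx
    -- When F decreases, the states at times increasing to t₀ form a receding sequence with obstacle
    -- u(s₀). The final state u(t₀), positive on the boundary of `U` since F is, serves as lower
    -- bound.
    obtain ⟨s, hmono, hs, hlim⟩ := exists_seq_strictMono_tendsto' hst₀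
    have hsT : ∀ n, s n ∈ Icc 0 T := fun n =>
      ⟨hs₀.trans (hs n).1.le, (hs n).2.le.trans ht₀⟩
    obtain ⟨c, hc, r₀, hr₀, hnd⟩ := hnd
    have H : IsRecedingSequence U μm μp c r₀ (u s₀) (u t₀) (fun n => u (s n))
        (fun n => F (s n)) :=
      { obstacle := hst s₀ ⟨hs₀, hst₀.le.trans ht₀⟩
        stable := fun n => hst (s n) (hsT n)
        maximal := fun n => hu.decreasing s₀ (s n) hs₀ (hs n).1 (hsT n).2
          (hdis' s₀ (s n) le_rfl (hs n).2.le) (hm.mono (Icc_subset_Icc_right (hs n).2.le))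
        antitone := fun m n hmn => hle (s m) (s n) (hs m).1.le (hmono.monotone hmn) (hs n).2.le
        nondegenerate := fun n => hnd (s n) (hsT n)
        lower := hu.state t₀ ht₀'
        lower_le := fun n => hle (s n) t₀ (hs n).1.le (hs n).2.le le_rfl
        lower_pos := fun x hx => by rw [hu.dirichlet t₀ ht₀' x hx]; exact hF.pos t₀ ht₀' }
    -- The infimum along the sequence lies below the envelope at t₀, so `p` is also a
    -- superdifferential of the infimum.
    have hw : ∀ᶠ y in 𝓝 x₀, infSeq (fun n => u (s n)) y ≤ upperEnv U T u t₀ y := by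
      filter_upwards [hU.mem_nhds hx₀] with y hy
      refine le_of_forall_gt_imp_ge_of_dense fun b hb => ?_
      have h2 := (eventually_lt_of_upperEnv_lt hU hM hy hb)
      have h3 : Tendsto (fun n => (s n, y)) atTop (𝓝[Icc 0 T] t₀ ×ˢ 𝓝 y) :=
        (tendsto_nhdsWithin_iff.2 ⟨hlim, Eventually.of_forall hsT⟩).prodMk tendsto_const_nhds
      obtain ⟨n, hn⟩ := (h3.eventually h2).exists
      exact (H.infSeq_le n (subset_closure hy)).trans hn.le
    have h2 := H.eventually_eq_zero_of_superDiff hd hU hμm hc hr₀ hx₀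
      (superDiff_subset_of_le hU hx₀ hw hp) hpq
    obtain ⟨pa, ha, pb, hb, hab⟩ := eventually_prod_iff.1 h2
    obtain ⟨n, hn⟩ := ha.exists
    obtain ⟨ρ', hρ', hρs'⟩ := Metric.eventually_nhds_iff_ball.1
      (hb.and (eventually_mem_closure hU hx₀))
    refine eventually_prod_of_ball (P := fun s y => u s y = 0) hρ' ?_
    -- One dry member suffices: by monotonicity all later states up to t₀ are dry on the same ball.
    filter_upwards [self_mem_nhdsWithin, mem_nhdsWithin_of_mem_nhds (lt_mem_nhds (hs n).2)]
      with t ht hnt y hy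
    obtain ⟨hy1, hyU⟩ := hρs' y hy
    have h3 : u (s n) y = 0 := hab hn hy1
    exact le_antisymm ((hle (s n) t (hs n).1.le (le_of_lt hnt) ht.2 y hyU).trans h3.le)
      (hM t ⟨hs₀.trans ht.1.le, ht.2.trans ht₀⟩ y hyU).1

/-- If u(t₀) is wet arbitrarily close to x₀, its own stability applies because u ≤ u^*. Otherwise
u(t₀) is dry near x₀. The barrier for advancing excludes wet points shortly afterwards since 1 - μ₋
< 1 + μ₊, and the receding sequences exclude them shortly before, so u^* would vanish near x₀. -/
theorem IsObstacleSolution.upper_slope (hd : 0 < d) {U : Set (Space d)} (hU : IsOpen U)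
    {μm μp T M : ℝ} (hμm : 0 ≤ μm) (hμp : 0 ≤ μp) {Z : Set ℝ} {F : ℝ → ℝ} (hF : IsForcing T Z F)
    {u : ℝ → Space d → ℝ} (hu : IsObstacleSolution U μm μp T Z F u) (hM : BoundedBy U T M u)
    (hst : ∀ t ∈ Icc 0 T, IsStable U μm μp (u t)) (hnd : UniformlyNondegenerate U T u)
    {t₀ : ℝ} (ht₀ : t₀ ∈ Icc 0 T) {x₀ : Space d} (hx₀ : x₀ ∈ freeBoundary U (upperEnv U T u t₀))
    {p : Space d} (hp : p ∈ superDiff U (upperEnv U T u t₀) x₀) : 1 - μm ≤ ‖p‖ ^ 2 := by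
  by_contra! hpq
  have hxU := hx₀.2
  have hxc := subset_closure (s := U) hxU
  have hle : ∀ᶠ y in 𝓝 x₀, u t₀ y ≤ upperEnv U T u t₀ y :=
    (eventually_mem_closure hU hxU).mono fun y hy => le_upperEnv hM ht₀ hy
  by_cases hfr : ∃ᶠ y in 𝓝 x₀, 0 < u t₀ y
  · have h1 := (hp 1 one_pos).self_of_nhdsWithin hx₀.1.1
    rw [sub_self, inner_zero_right, norm_zero, mul_zero, add_zero] at h1
    have h2 : u t₀ x₀ = 0 := le_antisymm ((le_upperEnv hM ht₀ hxc).trans h1) (hM t₀ ht₀ x₀ hxc).1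
    have h3 := (hst t₀ ht₀).slope_ge x₀
      (((hst t₀ ht₀).state.mem_freeBoundary_iff hU).2 ⟨hxU, h2, hfr⟩) p
      (superDiff_subset_of_le hU hxU hle hp)
    linarith
  have h0 : ∀ᶠ y in 𝓝 x₀, u t₀ y = 0 := by
    filter_upwards [not_frequently.1 hfr, eventually_mem_closure hU hxU] with y hy hyU
    exact le_antisymm (not_lt.1 hy) (hM t₀ ht₀ y hyU).1
  obtain ⟨ρ', hρ', hsub⟩ := nhds_basis_closedBall.mem_iff.1 (inter_mem (hU.mem_nhds hxU) h0)
  have hright : ∀ᶠ z in 𝓝[Ioc t₀ T] t₀ ×ˢ 𝓝 x₀, u z.1 z.2 = 0 :=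
    eventually_right (P := fun s y => u s y = 0) hF.finite ht₀.2 fun s₁ h4 h5 h6 =>
      hu.eventually_eq_zero hd hU hμp hF hM ht₀.1 h4 h5 h6 ht₀ hρ' (fun y hy => (hsub hy).1)
        (fun y hy => (hsub (ball_subset_closedBall hy)).2.out.le) hp (by linarith)
  refine notMem_freeBoundary_upperEnv hU hM ht₀ ?_ hx₀
  rcases ht₀.1.eq_or_lt with rfl | hpos
  · exact eventually_Icc_zero (P := fun s y => u s y = 0) h0 hright
  · obtain ⟨s₀, hs₀, hs, hdis⟩ := exists_left_disjoint hF.finite hpos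
    exact eventually_Icc_of_left (P := fun s y => u s y = 0) hs
      (hu.eventually_eq_zero_left hd hU hμm hF hM hst hnd hs₀ hs ht₀.2 hdis hxU h0 hp hpq) hright

/-! ### Dimension zero -/

lemma freeBoundary_eq_empty_of_dim_zero (U : Set (Space 0)) (v : Space 0 → ℝ) :
    freeBoundary U v = ∅ := by
  rw [freeBoundary, (isClopen_discrete (wet U v)).frontier_eq, empty_inter]

lemma eq_const_of_dim_zero (v : Space 0 → ℝ) : v = fun _ => v 0 :=
  funext fun x => by rw [Subsingleton.elim x 0]

lemma IsState.isStable_of_dim_zero {U : Set (Space 0)} {v : Space 0 → ℝ} (hv : IsState U v)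
    (μm μp : ℝ) : IsStable U μm μp v := by
  refine ⟨hv, fun x _ => ?_, fun x hx => ?_, fun x hx => ?_⟩
  · rw [eq_const_of_dim_zero v]
    exact ⟨contDiffAt_const, Eventually.of_forall fun y => (hasLap_const (v 0) y).2.2⟩
  · rw [freeBoundary_eq_empty_of_dim_zero] at hx; exact hx.elim
  · rw [freeBoundary_eq_empty_of_dim_zero] at hx; exact hx.elim

lemma IsState.isSupersolution_of_dim_zero {U : Set (Space 0)} {v : Space 0 → ℝ}
    (hv : IsState U v) (μp : ℝ) : IsSupersolution U μp v := by
  refine ⟨hv, ⟨(continuous_of_discreteTopology).continuousOn, fun x r hr _ => ?_⟩,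
    fun x hx => ?_⟩
  · rw [eq_const_of_dim_zero v]
    exact (setAverage_closedBall_const x hr (v 0)).le
  · rw [freeBoundary_eq_empty_of_dim_zero] at hx; exact hx.elim

/-- On a single point there is no boundary condition and every state is a supersolution, so u(s)
competes with u(t) when F increases, and u never exceeds its initial value. -/
theorem IsObstacleSolution.isStable_and_bounded_of_dim_zero {U : Set (Space 0)}
    {μm μp T : ℝ} {Z : Set ℝ} {F : ℝ → ℝ} (hF : IsForcing T Z F) {u : ℝ → Space 0 → ℝ}
    (hu : IsObstacleSolution U μm μp T Z F u) :
    ∃ M : ℝ, ∀ t ∈ Icc 0 T, IsStable U μm μp (u t) ∧ ∀ x ∈ closure U, u t x ≤ M := by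
  refine ⟨u 0 0, fun t ht => ⟨(hu.state t ht).isStable_of_dim_zero μm μp, ?_⟩⟩
  refine forcing_induction (P := fun t => ∀ x ∈ closure U, u t x ≤ u 0 0) hF.finite
    (fun x _ => by rw [Subsingleton.elim x 0]) (fun s t hs hst ht hdis h x hx => ?_) t ht
  refine le_trans ?_ (h x hx)
  rcases hF.monotone_or_antitone s t hs hst ht hdis with hm | hm
  · refine (hu.increasing s t hs hst ht hdis hm).2 (u s)
      ⟨(hu.state s ⟨hs, hst.le.trans ht⟩).isSupersolution_of_dim_zero μp, fun y hy => ?_,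
        fun y _ => le_rfl⟩ x hx
    rw [(isClopen_discrete U).frontier_eq] at hy
    exact hy.elim
  · exact (hu.decreasing s t hs hst ht hdis hm).1.2.2 x hx

end Droplet

theorem mainTheorem7 (d : ℕ) (U : Set (Droplet.Space d)) (hUo : IsOpen U) (hUc : IsConnected U)
    (hK : IsCompact Uᶜ) (μm μp : ℝ) (hμm : μm ∈ Set.Ioo (0 : ℝ) 1) (hμp : 0 < μp)
    (T : ℝ) (hT : 0 < T) (Z : Set ℝ) (F : ℝ → ℝ) (hF : Droplet.IsForcing T Z F)
    (u : ℝ → Droplet.Space d → ℝ)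
    (hu : Droplet.IsObstacleSolution U μm μp T Z F u)
    (hb : BddAbove (u 0 '' closure U))
    (hnd : Droplet.UniformlyNondegenerate U T u) :
    Droplet.SolvesLocalStability U μm μp T u ∧ Droplet.SolvesDynamicSlope U μm μp T u := by
  have hstb : ∃ M : ℝ, ∀ t ∈ Set.Icc 0 T, Droplet.IsStable U μm μp (u t) ∧
      ∀ x ∈ closure U, u t x ≤ M := by
    rcases d.eq_zero_or_pos with rfl | hd
    · exact hu.isStable_and_bounded_of_dim_zero hF
    · exact hu.isStable_and_bounded hd hUo hμm.1.le hμm.2.le hμp.le hF hb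
  obtain ⟨M, hM⟩ := hstb
  have hB : Droplet.BoundedBy U T M u := fun t ht x hx =>
    ⟨(hu.state t ht).nonneg x hx, (hM t ht).2 x hx⟩
  -- Free boundary points exist only in positive dimension, so dimension zero needs separate
  -- treatment only for (a).
  have hpos : ∀ v x, x ∈ Droplet.freeBoundary U v → 0 < d := fun v x hx => by
    rcases d.eq_zero_or_pos with rfl | hd
    · rw [Droplet.freeBoundary_eq_empty_of_dim_zero] at hx; exact hx.elim
    · exact hd
  refine ⟨⟨⟨M, fun t ht x hx => abs_le.2 ⟨?_, (hB t ht x hx).2⟩⟩, fun t ht => (hM t ht).1,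
    fun t ht x hx p hp => ?_⟩, ⟨fun t ht x hx hV p hp => ?_, fun t ht x hx hV p hp => ?_⟩⟩
  · linarith [(hB t ht x hx).1, (hB t ht x hx).2]
  · exact hu.upper_slope (hpos _ _ hx) hUo hμm.1.le hμp.le hF hB (fun t ht => (hM t ht).1) hnd
      ht hx hp
  · exact hu.advancing (hpos _ _ hx) hUo hμp.le hF hB ht hx hV hp
  · exact hu.receding (hpos _ _ hx) hUo hμm.2.le hF hB ht hx hV hp
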